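/- Let $K=\{K_n\}_{n\ge 1}$ be Stasheff's operad of associahedra in its symmetric version ($K(n)$ is the Fulton--MacPherson compactification of the space of $n$ distinct labelled points in the interval modulo translations and dilatations, there are no operations of arity $0$, $K(1)$ is a point, and composition is the insertion of infinitesimal configurations). Let $C=\{C_n\}_{n\ge 0}$ be the right $K$-module of cyclohedra ($C_n$ is the Fulton--MacPherson compactification of the space of $n$ distinct labelled points in the circle $\mathbb S^1$). Let $\mathcal C_1$ be the little intervals operad and let $\mathcal J_1$ be the right $\mathcal C_1$-module of little intervals in the circle: $\mathcal J_1(n)$ is the space of $n$-tuples of imbeddings $\alpha_1,\dots,\alpha_n:[0,1]\to\mathbb S^1$, each of the form $\exp\circ\tilde\alpha_i$ with $\tilde\alpha_i:[0,1]\to\mathbb R$ linear and increasing, such that the images of the interiors are mutually disjoint. For a topological space $X$ with a base point $b$, let $\Lambda X$ be the space of continuous maps $\mathbb S^1\to X$ and $\Omega X\subset\Lambda X$ the subspace of loops based at $b$. For an operad $P$, a right $P$-module $M$ and a $P$-algebra $U$ with structure maps $A_n:P(n)\times U^n\to U$, an $M$-trace over $U$ is a space $V$ with continuous $\Sigma_n$-equivariant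 maps $T_n:M(n)\times U^n\to V$ such that $T_{k+l-1}(m\circ_i p)=T_k(m)\circ_i A_l(p)$ for $m\in M(k)$, $p\in P(l)$, $1\le i\le k$. **Theorem.** There is a homomorphism of operads $\rho:K\to\mathcal C_1$ that is a weak homotopy equivalence in every arity $n\ge1$. For every such $\rho$ there is a homomorphism of right $K$-modules $\lambda:C\to\mathcal J_1$ (where $K$ acts on $\mathcal J_1$ through $\rho$) that is a weak homotopy equivalence in every arity $n\ge 0$ and has the following property for every pointed space $(X,b)$. The classical action $A$ of the little intervals makes $\Omega X$ a $\mathcal C_1$-algebra, hence, through $\rho$, a $K$-algebra (an $A_\infty$-space); the maps $T_n:\mathcal J_1(n)\times(\Omega X)^n\to\Lambda X$, where $T_n(\alpha_1,\dots,\alpha_n)(\phi_1,\dots,\phi_n)$ is $\phi_i\circ\alpha_i^{-1}$ on the image of $\alpha_i$ (each $\phi_i$ being regarded as a map on $[0,1]$) and $b$ elsewhere, make $\Lambda X$ a $\mathcal J_1$-trace over the $\mathcal C_1$-algebra $\Omega X$; and the composites $T_n(\lambda(-))$ make $\Lambda X$ a $C$-trace over the $K$-algebra $\Omega X$. -/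

import Mathlib

open Set Filter Topology

noncomputable section

namespace CycloLoop

/-! ### Index bookkeeping for partial compositions

In a partial composition `p ∘_i q` with `p` of arity `k`, `q` of arity `l` and result of arity
`n = k + l - 1` (recorded as `n + 1 = k + l`), the inputs `i, …, i + l - 1` (counted from `0`)
of the composite are those of `q`, and the other ones are the inputs of `p` different from `i`. -/

/-- The input `j` of `p ∘_i q` is one of the `l` inputs of `q`. -/
abbrev InBlock (i l j : ℕ) : Prop := i ≤ j ∧ j < i + l

/-- The input of `p` that the input `j` of `p ∘_i q` feeds into. -/
def outer {k l n : ℕ} (i : Fin k) (h : n + 1 = k + l) (j : Fin n) : Fin k :=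
  if h1 : (j : ℕ) < i then ⟨j, by omega⟩
  else if h2 : (j : ℕ) < i + l then i
  else ⟨j + 1 - l, by omega⟩

/-- The input of `q` corresponding to an input `j` of `p ∘_i q` that lies in the block. -/
def sub {i l j : ℕ} (h : InBlock i l j) : Fin l := ⟨j - i, by omega⟩

/-- The input of `p ∘_i q` corresponding to the input `b` of `q`. -/
def inner {k l n : ℕ} (i : Fin k) (h : n + 1 = k + l) (b : Fin l) : Fin n := ⟨i + b, by omega⟩

/-- The arguments of `f` in `(f ∘_i g)(u_1, …, u_{k+l-1}) =
f(u_1, …, u_{i-1}, g(u_i, …, u_{i+l-1}), u_{i+l}, …, u_{k+l-1})`. -/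
def plug {U : Type*} {k l n : ℕ} (i : Fin k) (h : n + 1 = k + l) (g : (Fin l → U) → U)
    (u : Fin n → U) (a : Fin k) : U :=
  if h1 : (a : ℕ) < i then u ⟨a, by omega⟩
  else if h2 : (a : ℕ) = i then g (fun b => u (inner i h b))
  else u ⟨a + l - 1, by omega⟩

/-! ### Topological operads, right modules, algebras, traces -/

/-- A (symmetric, unital) topological operad, presented by partial compositions. -/
structure TopOperad where
  /-- the space of operations of arity `n` -/
  obj : ℕ → Type
  [top : ∀ n, TopologicalSpace (obj n)]
  /-- the right action of the symmetric group -/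
  act : ∀ {n : ℕ}, obj n → Equiv.Perm (Fin n) → obj n
  /-- the operad unit -/
  unit : obj 1
  /-- the partial composition `p ∘_i q` -/
  comp : ∀ {k l n : ℕ} (_ : Fin k) (_ : n + 1 = k + l), obj k → obj l → obj n
  continuous_act : ∀ {n : ℕ} (σ : Equiv.Perm (Fin n)), Continuous fun p : obj n => act p σ
  continuous_comp : ∀ {k l n : ℕ} (i : Fin k) (h : n + 1 = k + l),
    Continuous fun x : obj k × obj l => comp i h x.1 x.2
  act_one : ∀ {n : ℕ} (p : obj n), act p 1 = p
  act_mul : ∀ {n : ℕ} (p : obj n) (σ τ : Equiv.Perm (Fin n)), act p (σ * τ) = act (act p σ) τ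
  comp_unit : ∀ {k : ℕ} (i : Fin k) (p : obj k), comp i rfl p unit = p
  unit_comp : ∀ {l : ℕ} (h : l + 1 = 1 + l) (q : obj l), comp 0 h unit q = q
  /-- sequential associativity `(p ∘_i q) ∘_{i+j} r = p ∘_i (q ∘_j r)` (indices from `0`) -/
  assoc_seq : ∀ {k l m n n₁ n₂ : ℕ} (i : Fin k) (j : Fin l) (i' : Fin n₁) (h₁ : n₁ + 1 = k + l)
    (h₂ : n + 1 = n₁ + m) (h₃ : n₂ + 1 = l + m) (h₄ : n + 1 = k + n₂), (i' : ℕ) = i + j →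
    ∀ (p : obj k) (q : obj l) (r : obj m),
      comp i' h₂ (comp i h₁ p q) r = comp i h₄ p (comp j h₃ q r)
  /-- parallel associativity `(p ∘_i q) ∘_{j+l-1} r = (p ∘_j r) ∘_i q` for `i < j` -/
  assoc_par : ∀ {k l m n n₁ n₂ : ℕ} (i j : Fin k) (j' : Fin n₁) (i' : Fin n₂)
    (h₁ : n₁ + 1 = k + l) (h₂ : n + 1 = n₁ + m) (h₃ : n₂ + 1 = k + m) (h₄ : n + 1 = n₂ + l),
    i < j → (j' : ℕ) + 1 = j + l → (i' : ℕ) = i →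
    ∀ (p : obj k) (q : obj l) (r : obj m),
      comp j' h₂ (comp i h₁ p q) r = comp i' h₄ (comp j h₃ p r) q
  /-- equivariance `pσ ∘_i qτ = (p ∘_{σ(i)} q)(σ ∘_i τ)`; the two conditions on `ω` say that
  `ω` is the block permutation `σ ∘_i τ` -/
  equivariant : ∀ {k l n : ℕ} (i : Fin k) (h : n + 1 = k + l) (σ : Equiv.Perm (Fin k))
    (τ : Equiv.Perm (Fin l)) (ω : Equiv.Perm (Fin n)),
    (∀ j, outer (σ i) h (ω j) = σ (outer i h j)) → (∀ b, ω (inner i h b) = inner (σ i) h (τ b)) →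
    ∀ (p : obj k) (q : obj l), comp i h (act p σ) (act q τ) = act (comp (σ i) h p q) ω

attribute [instance] TopOperad.top

/-- A right module over a topological operad. -/
structure RightModule (P : TopOperad) where
  /-- the space of elements of arity `n` -/
  obj : ℕ → Type
  [top : ∀ n, TopologicalSpace (obj n)]
  /-- the right action of the symmetric group -/
  act : ∀ {n : ℕ}, obj n → Equiv.Perm (Fin n) → obj n
  /-- the partial composition `m ∘_i p` -/
  comp : ∀ {k l n : ℕ} (_ : Fin k) (_ : n + 1 = k + l), obj k → P.obj l → obj n
  continuous_act : ∀ {n : ℕ} (σ : Equiv.Perm (Fin n)), Continuous fun p : obj n => act p σ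
  continuous_comp : ∀ {k l n : ℕ} (i : Fin k) (h : n + 1 = k + l),
    Continuous fun x : obj k × P.obj l => comp i h x.1 x.2
  act_one : ∀ {n : ℕ} (p : obj n), act p 1 = p
  act_mul : ∀ {n : ℕ} (p : obj n) (σ τ : Equiv.Perm (Fin n)), act p (σ * τ) = act (act p σ) τ
  comp_unit : ∀ {k : ℕ} (i : Fin k) (p : obj k), comp i rfl p P.unit = p
  assoc_seq : ∀ {k l m n n₁ n₂ : ℕ} (i : Fin k) (j : Fin l) (i' : Fin n₁) (h₁ : n₁ + 1 = k + l)
    (h₂ : n + 1 = n₁ + m) (h₃ : n₂ + 1 = l + m) (h₄ : n + 1 = k + n₂), (i' : ℕ) = i + j →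
    ∀ (p : obj k) (q : P.obj l) (r : P.obj m),
      comp i' h₂ (comp i h₁ p q) r = comp i h₄ p (P.comp j h₃ q r)
  assoc_par : ∀ {k l m n n₁ n₂ : ℕ} (i j : Fin k) (j' : Fin n₁) (i' : Fin n₂)
    (h₁ : n₁ + 1 = k + l) (h₂ : n + 1 = n₁ + m) (h₃ : n₂ + 1 = k + m) (h₄ : n + 1 = n₂ + l),
    i < j → (j' : ℕ) + 1 = j + l → (i' : ℕ) = i →
    ∀ (p : obj k) (q : P.obj l) (r : P.obj m),
      comp j' h₂ (comp i h₁ p q) r = comp i' h₄ (comp j h₃ p r) q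
  equivariant : ∀ {k l n : ℕ} (i : Fin k) (h : n + 1 = k + l) (σ : Equiv.Perm (Fin k))
    (τ : Equiv.Perm (Fin l)) (ω : Equiv.Perm (Fin n)),
    (∀ j, outer (σ i) h (ω j) = σ (outer i h j)) → (∀ b, ω (inner i h b) = inner (σ i) h (τ b)) →
    ∀ (p : obj k) (q : P.obj l), comp i h (act p σ) (P.act q τ) = act (comp (σ i) h p q) ω

attribute [instance] RightModule.top

/-- A homomorphism of topological operads. -/
structure OperadHom (P Q : TopOperad) where
  /-- the components -/
  map : ∀ {n : ℕ}, P.obj n → Q.obj n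
  continuous_map : ∀ n : ℕ, Continuous (map : P.obj n → Q.obj n)
  map_act : ∀ {n : ℕ} (p : P.obj n) (σ : Equiv.Perm (Fin n)), map (P.act p σ) = Q.act (map p) σ
  map_unit : map P.unit = Q.unit
  map_comp : ∀ {k l n : ℕ} (i : Fin k) (h : n + 1 = k + l) (p : P.obj k) (q : P.obj l),
    map (P.comp i h p q) = Q.comp i h (map p) (map q)

/-- A homomorphism from a right `P`-module `M` to a right `Q`-module `N`, the latter being regarded
as a right `P`-module through the operad homomorphism `ρ : P → Q`. -/
structure ModuleHom {P Q : TopOperad} (ρ : OperadHom P Q) (M : RightModule P)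
    (N : RightModule Q) where
  /-- the components -/
  map : ∀ {n : ℕ}, M.obj n → N.obj n
  continuous_map : ∀ n : ℕ, Continuous (map : M.obj n → N.obj n)
  map_act : ∀ {n : ℕ} (m : M.obj n) (σ : Equiv.Perm (Fin n)), map (M.act m σ) = N.act (map m) σ
  map_comp : ∀ {k l n : ℕ} (i : Fin k) (h : n + 1 = k + l) (m : M.obj k) (p : P.obj l),
    map (M.comp i h m p) = N.comp i h (map m) (ρ.map p)

/-- The structure of an algebra over the operad `P` on the space `U`: continuous, equivariant maps
`P(n) × U^n → U` compatible with the unit and the compositions. -/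
structure OperadAlgebra (P : TopOperad) (U : Type*) [TopologicalSpace U] where
  /-- the structure maps -/
  map : ∀ {n : ℕ}, P.obj n → (Fin n → U) → U
  continuous_map : ∀ n : ℕ, Continuous fun x : P.obj n × (Fin n → U) => map x.1 x.2
  map_act : ∀ {n : ℕ} (p : P.obj n) (σ : Equiv.Perm (Fin n)) (u : Fin n → U),
    map (P.act p σ) u = map p (fun a => u (σ⁻¹ a))
  map_unit : ∀ u : Fin 1 → U, map P.unit u = u 0
  map_comp : ∀ {k l n : ℕ} (i : Fin k) (h : n + 1 = k + l) (p : P.obj k) (q : P.obj l)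
    (u : Fin n → U), map (P.comp i h p q) u = map p (plug i h (map q) u)

/-- The `P`-algebra obtained from a `Q`-algebra by restriction along `ρ : P → Q`. -/
def OperadAlgebra.restrict {P Q : TopOperad} {U : Type*} [TopologicalSpace U]
    (A : OperadAlgebra Q U) (ρ : OperadHom P Q) : OperadAlgebra P U where
  map p u := A.map (ρ.map p) u
  continuous_map n :=
    (A.continuous_map n).comp (((ρ.continuous_map n).comp continuous_fst).prodMk continuous_snd)
  map_act p σ u := by rw [ρ.map_act, A.map_act]
  map_unit u := by rw [ρ.map_unit, A.map_unit]
  map_comp i h p q u := by rw [ρ.map_comp, A.map_comp]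

/-- The structure of an `M`-trace over the `P`-algebra `(U, A)` on the space `V`: continuous,
equivariant maps `M(n) × U^n → V` with `T(m ∘_i p) = T(m) ∘_i A(p)`. -/
structure Trace {P : TopOperad} (M : RightModule P) {U : Type*} [TopologicalSpace U]
    (A : OperadAlgebra P U) (V : Type*) [TopologicalSpace V] where
  /-- the structure maps -/
  map : ∀ {n : ℕ}, M.obj n → (Fin n → U) → V
  continuous_map : ∀ n : ℕ, Continuous fun x : M.obj n × (Fin n → U) => map x.1 x.2
  map_act : ∀ {n : ℕ} (m : M.obj n) (σ : Equiv.Perm (Fin n)) (u : Fin n → U),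
    map (M.act m σ) u = map m (fun a => u (σ⁻¹ a))
  map_comp : ∀ {k l n : ℕ} (i : Fin k) (h : n + 1 = k + l) (m : M.obj k) (p : P.obj l)
    (u : Fin n → U), map (M.comp i h m p) u = map m (plug i h (A.map p) u)

/-! ### Weak homotopy equivalences -/

/-- The map `π_n(X, x) → π_n(Y, f x)` induced by a continuous map. -/
def piMap {X Y : Type*} [TopologicalSpace X] [TopologicalSpace Y] (f : C(X, Y)) (n : ℕ) (x : X) :
    HomotopyGroup.Pi n X x → HomotopyGroup.Pi n Y (f x) :=
  Quotient.map' (fun γ => ⟨f.comp γ.1, fun y hy => congrArg f (γ.2 y hy)⟩)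
    (fun _ _ h => h.map fun H => H.compContinuousMap f)

/-- The map of sets of path components induced by a continuous map. -/
def pathComponentMap {X Y : Type*} [TopologicalSpace X] [TopologicalSpace Y] (f : C(X, Y)) :
    ZerothHomotopy X → ZerothHomotopy Y :=
  Quotient.map' f (fun _ _ h => h.map f.continuous)

/-- Weak homotopy equivalences: bijections on path components and, for every base point, on all
homotopy groups. -/
structure IsWeakHomotopyEquiv {X Y : Type*} [TopologicalSpace X] [TopologicalSpace Y]
    (f : X → Y) : Prop where
  continuous : Continuous f
  bijective_pathComponentMap : Function.Bijective (pathComponentMap ⟨f, continuous⟩)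
  bijective_piMap : ∀ (n : ℕ) (x : X), Function.Bijective (piMap ⟨f, continuous⟩ n x)


/-! ### Insertion of labelled families -/

lemma outer_spec {k l n : ℕ} (i : Fin k) (h : n + 1 = k + l) (j : Fin n) :
    ((j : ℕ) < i ∧ (outer i h j : ℕ) = j) ∨ (InBlock i l j ∧ (outer i h j : ℕ) = i) ∨
      ((i : ℕ) + l ≤ j ∧ (outer i h j : ℕ) + l = j + 1) := by
  unfold outer
  split_ifs with h1 h2
  · exact Or.inl ⟨h1, rfl⟩
  · exact Or.inr (Or.inl ⟨⟨by omega, h2⟩, rfl⟩)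
  · refine Or.inr (Or.inr ⟨by omega, ?_⟩)
    simp only
    omega

lemma outer_eq_iff {k l n : ℕ} (i : Fin k) (h : n + 1 = k + l) (j : Fin n) :
    outer i h j = i ↔ InBlock i l j := by
  have := outer_spec i h j
  rw [Fin.ext_iff]
  constructor <;> intro h' <;> simp only [InBlock] at * <;> omega

lemma eq_of_outer_eq {k l n : ℕ} (i : Fin k) (h : n + 1 = k + l) {a b : Fin n}
    (hab : outer i h a = outer i h b) (hne : ¬ (InBlock i l a ∧ InBlock i l b)) : a = b := by
  have h1 := outer_spec i h a
  have h2 := outer_spec i h b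
  rw [Fin.ext_iff] at hab ⊢
  simp only [InBlock] at *
  omega

lemma block_perm {k l n : ℕ} {i : Fin k} {h : n + 1 = k + l} {σ : Equiv.Perm (Fin k)}
    {ω : Equiv.Perm (Fin n)} (h1 : ∀ j, outer (σ i) h (ω j) = σ (outer i h j)) (x : Fin n) :
    InBlock (σ i) l (ω x) ↔ InBlock i l x := by
  rw [← outer_eq_iff (σ i) h, ← outer_eq_iff i h, h1, σ.injective.eq_iff]

lemma sub_perm {k l n : ℕ} {i : Fin k} {h : n + 1 = k + l} {σ : Equiv.Perm (Fin k)}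
    {τ : Equiv.Perm (Fin l)} {ω : Equiv.Perm (Fin n)}
    (h2 : ∀ b, ω (inner i h b) = inner (σ i) h (τ b)) {x : Fin n}
    (hx : InBlock i l x) (hx' : InBlock (σ i) l (ω x)) : sub hx' = τ (sub hx) := by
  have e : x = inner i h (sub hx) := by
    rw [Fin.ext_iff]; simp only [inner, sub, InBlock] at *; omega
  have := h2 (sub hx)
  rw [← e, Fin.ext_iff] at this
  rw [Fin.ext_iff]
  simp only [inner, sub] at *
  omega

/-- Insertion of a binary family on `Fin l` into one on `Fin k`. -/
def ins2 {E : Type*} {k l n : ℕ} (i : Fin k) (h : n + 1 = k + l) (P : Fin k → Fin k → E)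
    (Q : Fin l → Fin l → E) (x y : Fin n) : E :=
  if hb : InBlock i l x ∧ InBlock i l y then Q (sub hb.1) (sub hb.2)
  else P (outer i h x) (outer i h y)

/-- Insertion of a ternary family on `Fin l` into one on `Fin k`. -/
def ins3 {E : Type*} {k l n : ℕ} (i : Fin k) (h : n + 1 = k + l) (P : Fin k → Fin k → Fin k → E)
    (Q : Fin l → Fin l → Fin l → E) (x y z : Fin n) : E :=
  if hb : InBlock i l x ∧ InBlock i l y ∧ InBlock i l z then
    Q (sub hb.1) (sub hb.2.1) (sub hb.2.2)
  else P (outer i h x) (outer i h y) (outer i h z)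

lemma continuous_ins2 {E : Type*} [TopologicalSpace E] {k l n : ℕ} (i : Fin k)
    (h : n + 1 = k + l) :
    Continuous fun x : (Fin k → Fin k → E) × (Fin l → Fin l → E) =>
      (ins2 i h x.1 x.2 : Fin n → Fin n → E) := by
  refine continuous_pi fun a => continuous_pi fun b => ?_
  unfold ins2
  split_ifs <;> fun_prop

lemma continuous_ins3 {E : Type*} [TopologicalSpace E] {k l n : ℕ} (i : Fin k)
    (h : n + 1 = k + l) :
    Continuous fun x : (Fin k → Fin k → Fin k → E) × (Fin l → Fin l → Fin l → E) =>
      (ins3 i h x.1 x.2 : Fin n → Fin n → Fin n → E) := by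
  refine continuous_pi fun a => continuous_pi fun b => continuous_pi fun c => ?_
  unfold ins3
  split_ifs <;> fun_prop

section laws
variable {k l m n n₁ n₂ : ℕ}

lemma seq_outer {i : Fin k} {j : Fin l} {i' : Fin n₁} {h₁ : n₁ + 1 = k + l}
    {h₂ : n + 1 = n₁ + m} {h₄ : n + 1 = k + n₂} (hi : (i' : ℕ) = i + j)
    (x : Fin n) : outer i h₁ (outer i' h₂ x) = outer i h₄ x := by
  have a1 := outer_spec i' h₂ x
  have a2 := outer_spec i h₁ (outer i' h₂ x)
  have a3 := outer_spec i h₄ x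
  rw [Fin.ext_iff]
  simp only [InBlock] at *
  omega

lemma seq_block {i : Fin k} {j : Fin l} {i' : Fin n₁} {h₂ : n + 1 = n₁ + m}
    (h₃ : n₂ + 1 = l + m) (hi : (i' : ℕ) = i + j)
    (x : Fin n) : InBlock i l (outer i' h₂ x) ↔ InBlock i n₂ x := by
  have a1 := outer_spec i' h₂ x
  simp only [InBlock] at *
  omega

lemma seq_block' {i : Fin k} {j : Fin l} {i' : Fin n₁} (hi : (i' : ℕ) = i + j)
    {x : Fin n} (hx : InBlock i n₂ x) : InBlock i' m x ↔ InBlock j m (sub hx) := by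
  simp only [InBlock, sub] at *
  omega

lemma seq_block'' {i : Fin k} {j : Fin l} {i' : Fin n₁}
    (h₃ : n₂ + 1 = l + m) (hi : (i' : ℕ) = i + j)
    {x : Fin n} (hx : InBlock i' m x) : InBlock i n₂ x := by
  simp only [InBlock] at *
  omega

lemma seq_sub {i : Fin k} {j : Fin l} {i' : Fin n₁} {h₂ : n + 1 = n₁ + m}
    (h₃ : n₂ + 1 = l + m) (hi : (i' : ℕ) = i + j)
    {x : Fin n} (hx : InBlock i n₂ x) (hx' : InBlock i l (outer i' h₂ x)) :
    sub hx' = outer j h₃ (sub hx) := by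
  have a1 := outer_spec i' h₂ x
  have a2 := outer_spec j h₃ (sub hx)
  rw [Fin.ext_iff]
  simp only [InBlock, sub] at *
  omega

lemma seq_sub' {i : Fin k} {j : Fin l} {i' : Fin n₁} (hi : (i' : ℕ) = i + j)
    {x : Fin n} (hx : InBlock i n₂ x) (hx' : InBlock i' m x) (hx'' : InBlock j m (sub hx)) :
    sub hx' = sub hx'' := by
  rw [Fin.ext_iff]
  simp only [sub] at *
  omega

lemma ins2_seq {E : Type*} (i : Fin k) (j : Fin l) (i' : Fin n₁) (h₁ : n₁ + 1 = k + l)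
    (h₂ : n + 1 = n₁ + m) (h₃ : n₂ + 1 = l + m) (h₄ : n + 1 = k + n₂) (hi : (i' : ℕ) = i + j)
    (P : Fin k → Fin k → E) (Q : Fin l → Fin l → E) (R : Fin m → Fin m → E) :
    ins2 i' h₂ (ins2 i h₁ P Q) R = ins2 i h₄ P (ins2 j h₃ Q R) := by
  ext x y
  by_cases hb : InBlock i n₂ x ∧ InBlock i n₂ y
  · have hb' : InBlock i l (outer i' h₂ x) ∧ InBlock i l (outer i' h₂ y) := by
      rwa [seq_block h₃ hi, seq_block h₃ hi]
    by_cases hc : InBlock i' m x ∧ InBlock i' m y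
    · have hc' : InBlock j m (sub hb.1) ∧ InBlock j m (sub hb.2) := by
        rwa [← seq_block' hi, ← seq_block' hi]
      simp only [ins2, dif_pos hb, dif_pos hc, dif_pos hc', seq_sub' hi hb.1 hc.1 hc'.1,
        seq_sub' hi hb.2 hc.2 hc'.2]
    · have hc' : ¬ (InBlock j m (sub hb.1) ∧ InBlock j m (sub hb.2)) := by
        rwa [← seq_block' hi, ← seq_block' hi]
      simp only [ins2, dif_pos hb, dif_pos hb', dif_neg hc, dif_neg hc', seq_sub h₃ hi hb.1 hb'.1,
        seq_sub h₃ hi hb.2 hb'.2]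
  · have hc : ¬ (InBlock i' m x ∧ InBlock i' m y) := fun hc =>
      hb ⟨seq_block'' h₃ hi hc.1, seq_block'' h₃ hi hc.2⟩
    have hb' : ¬ (InBlock i l (outer i' h₂ x) ∧ InBlock i l (outer i' h₂ y)) := by
      rwa [seq_block h₃ hi, seq_block h₃ hi]
    simp only [ins2, dif_neg hb, dif_neg hc, dif_neg hb', seq_outer (h₄ := h₄) hi]

lemma ins3_seq {E : Type*} (i : Fin k) (j : Fin l) (i' : Fin n₁) (h₁ : n₁ + 1 = k + l)
    (h₂ : n + 1 = n₁ + m) (h₃ : n₂ + 1 = l + m) (h₄ : n + 1 = k + n₂) (hi : (i' : ℕ) = i + j)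
    (P : Fin k → Fin k → Fin k → E) (Q : Fin l → Fin l → Fin l → E)
    (R : Fin m → Fin m → Fin m → E) :
    ins3 i' h₂ (ins3 i h₁ P Q) R = ins3 i h₄ P (ins3 j h₃ Q R) := by
  ext x y z
  by_cases hb : InBlock i n₂ x ∧ InBlock i n₂ y ∧ InBlock i n₂ z
  · have hb' : InBlock i l (outer i' h₂ x) ∧ InBlock i l (outer i' h₂ y) ∧
        InBlock i l (outer i' h₂ z) := by
      rwa [seq_block h₃ hi, seq_block h₃ hi, seq_block h₃ hi]
    by_cases hc : InBlock i' m x ∧ InBlock i' m y ∧ InBlock i' m z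
    · have hc' : InBlock j m (sub hb.1) ∧ InBlock j m (sub hb.2.1) ∧
          InBlock j m (sub hb.2.2) := by
        rwa [← seq_block' hi, ← seq_block' hi, ← seq_block' hi]
      simp only [ins3, dif_pos hb, dif_pos hc, dif_pos hc', seq_sub' hi hb.1 hc.1 hc'.1,
        seq_sub' hi hb.2.1 hc.2.1 hc'.2.1, seq_sub' hi hb.2.2 hc.2.2 hc'.2.2]
    · have hc' : ¬ (InBlock j m (sub hb.1) ∧ InBlock j m (sub hb.2.1) ∧
          InBlock j m (sub hb.2.2)) := by
        rwa [← seq_block' hi, ← seq_block' hi, ← seq_block' hi]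
      simp only [ins3, dif_pos hb, dif_pos hb', dif_neg hc, dif_neg hc', seq_sub h₃ hi hb.1 hb'.1,
        seq_sub h₃ hi hb.2.1 hb'.2.1, seq_sub h₃ hi hb.2.2 hb'.2.2]
  · have hc : ¬ (InBlock i' m x ∧ InBlock i' m y ∧ InBlock i' m z) := fun hc =>
      hb ⟨seq_block'' h₃ hi hc.1, seq_block'' h₃ hi hc.2.1, seq_block'' h₃ hi hc.2.2⟩
    have hb' : ¬ (InBlock i l (outer i' h₂ x) ∧ InBlock i l (outer i' h₂ y) ∧
        InBlock i l (outer i' h₂ z)) := by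
      rwa [seq_block h₃ hi, seq_block h₃ hi, seq_block h₃ hi]
    simp only [ins3, dif_neg hb, dif_neg hc, dif_neg hb', seq_outer (h₄ := h₄) hi]

lemma par_outer {i j : Fin k} {j' : Fin n₁} {i' : Fin n₂}
    {h₁ : n₁ + 1 = k + l} {h₂ : n + 1 = n₁ + m} {h₃ : n₂ + 1 = k + m} {h₄ : n + 1 = n₂ + l}
    (hij : i < j) (hj : (j' : ℕ) + 1 = j + l) (hi : (i' : ℕ) = i) (x : Fin n) :
    outer i h₁ (outer j' h₂ x) = outer j h₃ (outer i' h₄ x) := by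
  have a1 := outer_spec j' h₂ x
  have a2 := outer_spec i h₁ (outer j' h₂ x)
  have a3 := outer_spec i' h₄ x
  have a4 := outer_spec j h₃ (outer i' h₄ x)
  rw [Fin.ext_iff]
  rw [Fin.lt_def] at hij
  simp only [InBlock] at *
  omega

lemma par_block {i j : Fin k} {j' : Fin n₁} {i' : Fin n₂} {h₂ : n + 1 = n₁ + m}
    (hij : i < j) (hj : (j' : ℕ) + 1 = j + l) (hi : (i' : ℕ) = i) (x : Fin n) :
    InBlock i l (outer j' h₂ x) ↔ InBlock i' l x := by
  have a1 := outer_spec j' h₂ x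
  rw [Fin.lt_def] at hij
  simp only [InBlock] at *
  omega

lemma par_block' {i j : Fin k} {j' : Fin n₁} {i' : Fin n₂} {h₄ : n + 1 = n₂ + l}
    (hij : i < j) (hj : (j' : ℕ) + 1 = j + l) (hi : (i' : ℕ) = i) (x : Fin n) :
    InBlock j m (outer i' h₄ x) ↔ InBlock j' m x := by
  have a1 := outer_spec i' h₄ x
  rw [Fin.lt_def] at hij
  simp only [InBlock] at *
  omega

lemma par_sub {i j : Fin k} {j' : Fin n₁} {i' : Fin n₂} {h₂ : n + 1 = n₁ + m}
    (hij : i < j) (hj : (j' : ℕ) + 1 = j + l) (hi : (i' : ℕ) = i) {x : Fin n}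
    (hx : InBlock i l (outer j' h₂ x)) (hx' : InBlock i' l x) : sub hx = sub hx' := by
  have a1 := outer_spec j' h₂ x
  rw [Fin.lt_def] at hij
  rw [Fin.ext_iff]
  simp only [InBlock, sub] at *
  omega

lemma par_sub' {i j : Fin k} {j' : Fin n₁} {i' : Fin n₂} {h₄ : n + 1 = n₂ + l}
    (hij : i < j) (hj : (j' : ℕ) + 1 = j + l) (hi : (i' : ℕ) = i) {x : Fin n}
    (hx : InBlock j m (outer i' h₄ x)) (hx' : InBlock j' m x) : sub hx = sub hx' := by
  have a1 := outer_spec i' h₄ x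
  rw [Fin.lt_def] at hij
  rw [Fin.ext_iff]
  simp only [InBlock, sub] at *
  omega

lemma par_disj {i j : Fin k} {j' : Fin n₁} {i' : Fin n₂}
    (hij : i < j) (hj : (j' : ℕ) + 1 = j + l) (hi : (i' : ℕ) = i) {x : Fin n}
    (hx : InBlock i' l x) (hx' : InBlock j' m x) : False := by
  rw [Fin.lt_def] at hij
  simp only [InBlock] at *
  omega

lemma ins2_par {E : Type*} (i j : Fin k) (j' : Fin n₁) (i' : Fin n₂)
    (h₁ : n₁ + 1 = k + l) (h₂ : n + 1 = n₁ + m) (h₃ : n₂ + 1 = k + m) (h₄ : n + 1 = n₂ + l)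
    (hij : i < j) (hj : (j' : ℕ) + 1 = j + l) (hi : (i' : ℕ) = i)
    (P : Fin k → Fin k → E) (Q : Fin l → Fin l → E) (R : Fin m → Fin m → E) :
    ins2 j' h₂ (ins2 i h₁ P Q) R = ins2 i' h₄ (ins2 j h₃ P R) Q := by
  ext x y
  have hb := and_congr (par_block (h₂ := h₂) hij hj hi x) (par_block (h₂ := h₂) hij hj hi y)
  have hc := and_congr (par_block' (m := m) (h₄ := h₄) hij hj hi x)
    (par_block' (m := m) (h₄ := h₄) hij hj hi y)
  by_cases hB : InBlock i' l x ∧ InBlock i' l y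
  · have hC : ¬ (InBlock j' m x ∧ InBlock j' m y) := fun hC => par_disj hij hj hi hB.1 hC.1
    have hB' := hb.2 hB
    simp only [ins2, dif_pos hB, dif_pos hB', dif_neg hC, par_sub hij hj hi hB'.1 hB.1,
      par_sub hij hj hi hB'.2 hB.2]
  · by_cases hC : InBlock j' m x ∧ InBlock j' m y
    · have hC' := hc.2 hC
      simp only [ins2, dif_neg hB, dif_pos hC, dif_pos hC', par_sub' hij hj hi hC'.1 hC.1,
        par_sub' hij hj hi hC'.2 hC.2]
    · simp only [ins2, dif_neg hB, dif_neg hC, dif_neg (mt hb.1 hB), dif_neg (mt hc.1 hC),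
        par_outer (h₁ := h₁) (h₂ := h₂) (h₃ := h₃) (h₄ := h₄) hij hj hi]

lemma ins3_par {E : Type*} (i j : Fin k) (j' : Fin n₁) (i' : Fin n₂)
    (h₁ : n₁ + 1 = k + l) (h₂ : n + 1 = n₁ + m) (h₃ : n₂ + 1 = k + m) (h₄ : n + 1 = n₂ + l)
    (hij : i < j) (hj : (j' : ℕ) + 1 = j + l) (hi : (i' : ℕ) = i)
    (P : Fin k → Fin k → Fin k → E) (Q : Fin l → Fin l → Fin l → E)
    (R : Fin m → Fin m → Fin m → E) :
    ins3 j' h₂ (ins3 i h₁ P Q) R = ins3 i' h₄ (ins3 j h₃ P R) Q := by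
  ext x y z
  have hb := and_congr (par_block (h₂ := h₂) hij hj hi x)
    (and_congr (par_block (h₂ := h₂) hij hj hi y) (par_block (h₂ := h₂) hij hj hi z))
  have hc := and_congr (par_block' (m := m) (h₄ := h₄) hij hj hi x)
    (and_congr (par_block' (m := m) (h₄ := h₄) hij hj hi y)
      (par_block' (m := m) (h₄ := h₄) hij hj hi z))
  by_cases hB : InBlock i' l x ∧ InBlock i' l y ∧ InBlock i' l z
  · have hC : ¬ (InBlock j' m x ∧ InBlock j' m y ∧ InBlock j' m z) :=
      fun hC => par_disj hij hj hi hB.1 hC.1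
    have hB' := hb.2 hB
    simp only [ins3, dif_pos hB, dif_pos hB', dif_neg hC, par_sub hij hj hi hB'.1 hB.1,
      par_sub hij hj hi hB'.2.1 hB.2.1, par_sub hij hj hi hB'.2.2 hB.2.2]
  · by_cases hC : InBlock j' m x ∧ InBlock j' m y ∧ InBlock j' m z
    · have hC' := hc.2 hC
      simp only [ins3, dif_neg hB, dif_pos hC, dif_pos hC', par_sub' hij hj hi hC'.1 hC.1,
        par_sub' hij hj hi hC'.2.1 hC.2.1, par_sub' hij hj hi hC'.2.2 hC.2.2]
    · simp only [ins3, dif_neg hB, dif_neg hC, dif_neg (mt hb.1 hB), dif_neg (mt hc.1 hC),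
        par_outer (h₁ := h₁) (h₂ := h₂) (h₃ := h₃) (h₄ := h₄) hij hj hi]

lemma ins2_perm {E : Type*} (i : Fin k) (h : n + 1 = k + l) (σ : Equiv.Perm (Fin k))
    (τ : Equiv.Perm (Fin l)) (ω : Equiv.Perm (Fin n))
    (h1 : ∀ j, outer (σ i) h (ω j) = σ (outer i h j))
    (h2 : ∀ b, ω (inner i h b) = inner (σ i) h (τ b))
    (P : Fin k → Fin k → E) (Q : Fin l → Fin l → E) :
    ins2 i h (fun a b => P (σ a) (σ b)) (fun a b => Q (τ a) (τ b)) =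
      fun x y => ins2 (σ i) h P Q (ω x) (ω y) := by
  ext x y
  have hb := and_congr (block_perm (l := l) h1 x) (block_perm (l := l) h1 y)
  by_cases hB : InBlock i l x ∧ InBlock i l y
  · have hB' := hb.2 hB
    simp only [ins2, dif_pos hB, dif_pos hB', sub_perm h2 hB.1 hB'.1, sub_perm h2 hB.2 hB'.2]
  · simp only [ins2, dif_neg hB, dif_neg (mt hb.1 hB), h1]

lemma ins3_perm {E : Type*} (i : Fin k) (h : n + 1 = k + l) (σ : Equiv.Perm (Fin k))
    (τ : Equiv.Perm (Fin l)) (ω : Equiv.Perm (Fin n))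
    (h1 : ∀ j, outer (σ i) h (ω j) = σ (outer i h j))
    (h2 : ∀ b, ω (inner i h b) = inner (σ i) h (τ b))
    (P : Fin k → Fin k → Fin k → E) (Q : Fin l → Fin l → Fin l → E) :
    ins3 i h (fun a b c => P (σ a) (σ b) (σ c)) (fun a b c => Q (τ a) (τ b) (τ c)) =
      fun x y z => ins3 (σ i) h P Q (ω x) (ω y) (ω z) := by
  ext x y z
  have hb := and_congr (block_perm (l := l) h1 x)
    (and_congr (block_perm (l := l) h1 y) (block_perm (l := l) h1 z))
  by_cases hB : InBlock i l x ∧ InBlock i l y ∧ InBlock i l z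
  · have hB' := hb.2 hB
    simp only [ins3, dif_pos hB, dif_pos hB', sub_perm h2 hB.1 hB'.1, sub_perm h2 hB.2.1 hB'.2.1,
      sub_perm h2 hB.2.2 hB'.2.2]
  · simp only [ins3, dif_neg hB, dif_neg (mt hb.1 hB), h1]

lemma outer_unit (i : Fin k) (x : Fin k) : outer i rfl x = x := by
  have := outer_spec i rfl x
  rw [Fin.ext_iff]
  simp only [InBlock] at *
  omega

lemma ins2_unit {E : Type*} (i : Fin k) (P : Fin k → Fin k → E) (Q : Fin 1 → Fin 1 → E)
    (hPQ : P i i = Q 0 0) : ins2 i rfl P Q = P := by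
  ext x y
  unfold ins2
  split_ifs with hb
  · obtain ⟨hx, hy⟩ := hb
    obtain rfl : x = i := by rw [← outer_unit i x]; exact (outer_eq_iff i rfl x).2 hx
    obtain rfl : y = x := by rw [← outer_unit x y]; exact (outer_eq_iff x rfl y).2 hy
    rw [hPQ, Subsingleton.elim (sub hx) 0]
  · rw [outer_unit, outer_unit]

lemma ins3_unit {E : Type*} (i : Fin k) (P : Fin k → Fin k → Fin k → E)
    (Q : Fin 1 → Fin 1 → Fin 1 → E) (hPQ : P i i i = Q 0 0 0) : ins3 i rfl P Q = P := by
  ext x y z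
  unfold ins3
  split_ifs with hb
  · obtain ⟨hx, hy, hz⟩ := hb
    obtain rfl : x = i := by rw [← outer_unit i x]; exact (outer_eq_iff i rfl x).2 hx
    obtain rfl : y = x := by rw [← outer_unit x y]; exact (outer_eq_iff x rfl y).2 hy
    obtain rfl : z = y := by rw [← outer_unit y z]; exact (outer_eq_iff y rfl z).2 hz
    rw [hPQ, Subsingleton.elim (sub hx) 0]
  · rw [outer_unit, outer_unit, outer_unit]

lemma unit_block (x : Fin l) : InBlock ((0 : Fin 1) : ℕ) l x := by
  constructor
  · exact Nat.zero_le _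
  · have := x.2
    simp

lemma sub_unit (x : Fin l) : sub (unit_block x) = x := by
  rw [Fin.ext_iff]
  simp [sub]

lemma unit_ins2 {E : Type*} (h : l + 1 = 1 + l) (P : Fin 1 → Fin 1 → E) (Q : Fin l → Fin l → E) :
    ins2 0 h P Q = Q := by
  ext x y
  unfold ins2
  rw [dif_pos ⟨unit_block x, unit_block y⟩, sub_unit, sub_unit]

lemma unit_ins3 {E : Type*} (h : l + 1 = 1 + l) (P : Fin 1 → Fin 1 → Fin 1 → E)
    (Q : Fin l → Fin l → Fin l → E) : ins3 0 h P Q = Q := by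
  ext x y z
  unfold ins3
  rw [dif_pos ⟨unit_block x, unit_block y, unit_block z⟩, sub_unit, sub_unit, sub_unit]

end laws

/-! ### Compactified configuration spaces: associahedra and cyclohedra -/

/-- The direction `(x_b - x_a) / |x_b - x_a|` from the point `x_a` to the point `x_b` (`0` if the
two points coincide). -/
def pairCoord {E : Type*} [NormedAddCommGroup E] [NormedSpace ℝ E] {n : ℕ} (x : Fin n → E)
    (a b : Fin n) : E :=
  ‖x b - x a‖⁻¹ • (x b - x a)

/-- The relative distance of `x_b` from `x_a` and `x_c`, that is `d(x_a, x_b) : d(x_b, x_c)` in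
`[0, ∞]`, with `[0, ∞]` identified with `[0, 1]` through `s : t ↦ s / (s + t)`. On triples with
repeated entries it is a constant, independent of `x` as long as the points are distinct. -/
def tripleCoord {E : Type*} [NormedAddCommGroup E] {n : ℕ} (x : Fin n → E) (a b c : Fin n) : ℝ :=
  ‖x b - x a‖ / (‖x b - x a‖ + ‖x c - x b‖)

/-- Coordinates of a configuration on the line: directions and relative distances. They are
invariant under `x ↦ s x + t` with `s > 0`, and determine a configuration of distinct points up to
these maps. So configurations in the unit interval and in the line have the same coordinates. -/
abbrev LineCoord (n : ℕ) : Type := (Fin n → Fin n → ℝ) × (Fin n → Fin n → Fin n → ℝ)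

/-- The coordinates of a configuration of points on the line. -/
def lineCoord {n : ℕ} (x : Fin n → ℝ) : LineCoord n := (pairCoord x, tripleCoord x)

/-- The (symmetric) `n`-th associahedron, `n ≥ 1`: the Fulton–MacPherson (Axelrod–Singer)
compactification of the space of `n` distinct labelled points in the interval, modulo translations
and dilatations. It is a disjoint union of `n!` copies of Stasheff's polytope, one for each order
of the points. There are no operations of arity `0`. -/
def assocSet (n : ℕ) : Set (LineCoord n) :=
  {p | 0 < n ∧ p ∈ closure (lineCoord '' {x : Fin n → ℝ | Function.Injective x})}

/-- Coordinates of a configuration on the circle: the positions of the points, the directions of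
the chords (in `ℂ`) and the relative distances. -/
abbrev CircleCoord (n : ℕ) : Type :=
  (Fin n → Circle) × (Fin n → Fin n → ℂ) × (Fin n → Fin n → Fin n → ℝ)

/-- The coordinates of a configuration of points on the circle. -/
def circleCoord {n : ℕ} (z : Fin n → Circle) : CircleCoord n :=
  (z, pairCoord fun a => (z a : ℂ), tripleCoord fun a => (z a : ℂ))

/-- The `n`-th cyclohedron `C_n` (with the circle factor and the labellings): the
Fulton–MacPherson (Axelrod–Singer) compactification of the space of `n` distinct labelled points in
the circle. -/
def cycloSet (n : ℕ) : Set (CircleCoord n) :=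
  closure (circleCoord '' {z : Fin n → Circle | Function.Injective z})

/-- Insertion of a configuration on the line into another one, infinitesimally, at the `i`-th
point. -/
def lineIns {k l n : ℕ} (i : Fin k) (h : n + 1 = k + l) (p : LineCoord k) (q : LineCoord l) :
    LineCoord n :=
  (ins2 i h p.1 q.1, ins3 i h p.2 q.2)

/-- Insertion of a configuration on the line into a configuration on the circle, infinitesimally,
at the `i`-th point: the line is identified with the tangent line of the circle at that point
`z_i`, with the unit tangent vector `√-1 z_i`. -/
def circleIns {k l n : ℕ} (i : Fin k) (h : n + 1 = k + l) (p : CircleCoord k) (q : LineCoord l) :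
    CircleCoord n :=
  (fun j => p.1 (outer i h j),
    ins2 i h p.2.1 (fun a b => q.1 a b • (Complex.I * (p.1 i : ℂ))), ins3 i h p.2.2 q.2)

section approximation

variable {E : Type*} [NormedAddCommGroup E] [NormedSpace ℝ E] {k l n : ℕ}

lemma pairCoord_smul {a b : Fin n} {x : Fin n → E} {r : ℝ} (hr : 0 < r) {v : E}
    (hv : x b - x a = r • v) : pairCoord x a b = ‖v‖⁻¹ • v := by
  unfold pairCoord
  rw [hv, norm_smul, Real.norm_of_nonneg hr.le, smul_smul]
  congr 1
  field_simp

lemma tripleCoord_smul {a b c : Fin n} {x : Fin n → E} {r : ℝ} (hr : 0 < r) {v w : E}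
    (hv : x b - x a = r • v) (hw : x c - x b = r • w) :
    tripleCoord x a b c = ‖v‖ / (‖v‖ + ‖w‖) := by
  unfold tripleCoord
  rw [hv, hw, norm_smul, norm_smul, Real.norm_of_nonneg hr.le, ← mul_add]
  exact mul_div_mul_left _ _ hr.ne'

lemma eventually_injective_F (i : Fin k) (h : n + 1 = k + l) (X : Fin k → E) (hX : Function.Injective X)
    (y : Fin l → ℝ) (hy : Function.Injective y) (v : E) (hv : ‖v‖ = 1) (F : ℝ → Fin n → E)
    (h1 : ∀ j, Tendsto (fun ε => F ε j) (𝓝[>] 0) (𝓝 (X (outer i h j))))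
    (h2 : ∀ (a b : Fin n) (ha : InBlock i l a) (hb : InBlock i l b),
      Tendsto (fun ε : ℝ => ε⁻¹ • (F ε b - F ε a)) (𝓝[>] 0) (𝓝 ((y (sub hb) - y (sub ha)) • v))) : ∀ᶠ ε in 𝓝[>] (0 : ℝ), Function.Injective (F ε) := by
  have key : ∀ a b : Fin n, a ≠ b → ∀ᶠ ε in 𝓝[>] (0 : ℝ), F ε a ≠ F ε b := by
    intro a b hab
    by_cases ho : outer i h a = outer i h b
    · by_cases hB : InBlock i l a ∧ InBlock i l b
      · have hne : (y (sub hB.2) - y (sub hB.1)) • v ≠ 0 := by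
          refine smul_ne_zero (sub_ne_zero.2 fun e => hab ?_) (by rintro rfl; simp at hv)
          have := hy e
          rw [Fin.ext_iff] at this ⊢
          obtain ⟨hA, hB⟩ := hB
          simp only [sub, InBlock] at *
          omega
        filter_upwards [(h2 a b hB.1 hB.2).eventually_ne hne] with ε hε he
        rw [he, sub_self, smul_zero] at hε
        exact hε rfl
      · exact absurd (eq_of_outer_eq i h ho hB) hab
    · have hne : X (outer i h a) - X (outer i h b) ≠ 0 := sub_ne_zero.2 (hX.ne ho)
      filter_upwards [((h1 a).sub (h1 b)).eventually_ne hne] with ε hε he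
      exact hε (sub_eq_zero.2 he)
  have : ∀ᶠ ε in 𝓝[>] (0 : ℝ), ∀ a b : Fin n, a ≠ b → F ε a ≠ F ε b := by
    simp only [eventually_all]
    exact fun a b hab => key a b hab
  filter_upwards [this] with ε hε a b hab
  by_contra hne
  exact hε a b hne hab

lemma tendsto_pairCoord_F (i : Fin k) (h : n + 1 = k + l) (X : Fin k → E) (hX : Function.Injective X)
    (y : Fin l → ℝ) (hy : Function.Injective y) (v : E) (hv : ‖v‖ = 1) (F : ℝ → Fin n → E)
    (h1 : ∀ j, Tendsto (fun ε => F ε j) (𝓝[>] 0) (𝓝 (X (outer i h j))))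
    (h2 : ∀ (a b : Fin n) (ha : InBlock i l a) (hb : InBlock i l b),
      Tendsto (fun ε : ℝ => ε⁻¹ • (F ε b - F ε a)) (𝓝[>] 0) (𝓝 ((y (sub hb) - y (sub ha)) • v))) : Tendsto (fun ε => pairCoord (F ε)) (𝓝[>] (0 : ℝ))
    (𝓝 (ins2 i h (pairCoord X) fun a b => pairCoord y a b • v)) := by
  refine tendsto_pi_nhds.2 fun a => tendsto_pi_nhds.2 fun b => ?_
  by_cases hab : a = b
  · subst hab
    have e : ins2 i h (pairCoord X) (fun a b => pairCoord y a b • v) a a = 0 := by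
      unfold ins2; split_ifs <;> simp [pairCoord]
    rw [e]
    simp [pairCoord]
  unfold ins2
  split_ifs with hB
  · have hne : y (sub hB.2) - y (sub hB.1) ≠ 0 := by
      refine sub_ne_zero.2 fun e => hab ?_
      have := hy e
      rw [Fin.ext_iff] at this ⊢
      obtain ⟨hA, hB⟩ := hB
      simp only [sub, InBlock] at *
      omega
    have hne' : (y (sub hB.2) - y (sub hB.1)) • v ≠ 0 :=
      smul_ne_zero hne (by rintro rfl; simp at hv)
    have T := ((h2 a b hB.1 hB.2).norm.inv₀ (norm_ne_zero_iff.2 hne')).smul (h2 a b hB.1 hB.2)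
    have e : pairCoord y (sub hB.1) (sub hB.2) • v =
        ‖(y (sub hB.2) - y (sub hB.1)) • v‖⁻¹ • (y (sub hB.2) - y (sub hB.1)) • v := by
      rw [norm_smul, hv, mul_one, smul_smul]; rfl
    change Tendsto _ _ (𝓝 (pairCoord y (sub hB.1) (sub hB.2) • v))
    rw [e]
    refine T.congr' ?_
    filter_upwards [self_mem_nhdsWithin] with ε hε
    have hε : (0 : ℝ) < ε := hε
    exact (pairCoord_smul hε (by rw [smul_smul, mul_inv_cancel₀ hε.ne', one_smul])).symm
  · have hne : X (outer i h b) - X (outer i h a) ≠ 0 :=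
      sub_ne_zero.2 (hX.ne fun e => hab (eq_of_outer_eq i h e.symm hB))
    have T := (h1 b).sub (h1 a)
    exact (T.norm.inv₀ (norm_ne_zero_iff.2 hne)).smul T

lemma tendsto_tripleCoord_F (i : Fin k) (h : n + 1 = k + l) (X : Fin k → E) (hX : Function.Injective X)
    (y : Fin l → ℝ) (hy : Function.Injective y) (v : E) (hv : ‖v‖ = 1) (F : ℝ → Fin n → E)
    (h1 : ∀ j, Tendsto (fun ε => F ε j) (𝓝[>] 0) (𝓝 (X (outer i h j))))
    (h2 : ∀ (a b : Fin n) (ha : InBlock i l a) (hb : InBlock i l b),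
      Tendsto (fun ε : ℝ => ε⁻¹ • (F ε b - F ε a)) (𝓝[>] 0) (𝓝 ((y (sub hb) - y (sub ha)) • v))) : Tendsto (fun ε => tripleCoord (F ε)) (𝓝[>] (0 : ℝ))
    (𝓝 (ins3 i h (tripleCoord X) (tripleCoord y))) := by
  refine tendsto_pi_nhds.2 fun a => tendsto_pi_nhds.2 fun b => tendsto_pi_nhds.2 fun c => ?_
  by_cases habc : a = b ∧ b = c
  · obtain ⟨rfl, rfl⟩ := habc
    have e : ins3 i h (tripleCoord X) (tripleCoord y) a a a = 0 := by
      unfold ins3; split_ifs <;> simp [tripleCoord]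
    rw [e]
    simp [tripleCoord]
  unfold ins3
  split_ifs with hB
  · have hne : |y (sub hB.2.1) - y (sub hB.1)| + |y (sub hB.2.2) - y (sub hB.2.1)| ≠ 0 := by
      intro e
      refine habc ?_
      have e1 := abs_nonneg (y (sub hB.2.1) - y (sub hB.1))
      have e2 := abs_nonneg (y (sub hB.2.2) - y (sub hB.2.1))
      have f1 := hy (sub_eq_zero.1 (abs_eq_zero.1 (by linarith :
        |y (sub hB.2.1) - y (sub hB.1)| = 0)))
      have f2 := hy (sub_eq_zero.1 (abs_eq_zero.1 (by linarith :
        |y (sub hB.2.2) - y (sub hB.2.1)| = 0)))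
      rw [Fin.ext_iff] at f1 f2 ⊢
      rw [Fin.ext_iff]
      obtain ⟨hA, hB, hC⟩ := hB
      simp only [sub, InBlock] at *
      omega
    have T1 := (h2 a b hB.1 hB.2.1).norm
    have T2 := (h2 b c hB.2.1 hB.2.2).norm
    rw [norm_smul, hv, mul_one, Real.norm_eq_abs] at T1 T2
    refine (T1.div (T1.add T2) hne).congr' ?_
    filter_upwards [self_mem_nhdsWithin] with ε hε
    have hε : (0 : ℝ) < ε := hε
    exact (tripleCoord_smul hε (by rw [smul_smul, mul_inv_cancel₀ hε.ne', one_smul])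
      (by rw [smul_smul, mul_inv_cancel₀ hε.ne', one_smul])).symm
  · have hne : ‖X (outer i h b) - X (outer i h a)‖ + ‖X (outer i h c) - X (outer i h b)‖ ≠ 0 := by
      intro e
      have e1 := norm_nonneg (X (outer i h b) - X (outer i h a))
      have e2 := norm_nonneg (X (outer i h c) - X (outer i h b))
      have f1 := hX (sub_eq_zero.1 (norm_eq_zero.1 (by linarith :
        ‖X (outer i h b) - X (outer i h a)‖ = 0)))
      have f2 := hX (sub_eq_zero.1 (norm_eq_zero.1 (by linarith :
        ‖X (outer i h c) - X (outer i h b)‖ = 0)))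
      by_cases hb : InBlock i l b
      · have ho := (outer_eq_iff i h b).2 hb
        exact hB ⟨(outer_eq_iff i h a).1 (by rw [← f1, ho]), hb,
          (outer_eq_iff i h c).1 (by rw [f2, ho])⟩
      · exact habc ⟨eq_of_outer_eq i h f1.symm fun H => hb H.2,
          eq_of_outer_eq i h f2.symm fun H => hb H.1⟩
    have T1 := ((h1 b).sub (h1 a)).norm
    have T2 := ((h1 c).sub (h1 b)).norm
    exact T1.div (T1.add T2) hne

end approximation

section closure

variable {k l n : ℕ}

/-- The displacement of the input `j` when the configuration `y` is inserted with size `ε`. -/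
def shift (i : Fin k) (y : Fin l → ℝ) (ε : ℝ) (j : Fin n) : ℝ :=
  if hb : InBlock i l j then ε * y (sub hb) else 0

lemma tendsto_shift (i : Fin k) (y : Fin l → ℝ) (j : Fin n) :
    Tendsto (fun ε => shift i y ε j) (𝓝[>] 0) (𝓝 0) := by
  refine Tendsto.mono_left ?_ nhdsWithin_le_nhds
  have : Continuous fun ε => shift i y ε j := by
    unfold shift; split_ifs <;> fun_prop
  have h := this.tendsto 0
  have e : shift i y 0 j = 0 := by unfold shift; split_ifs <;> simp
  rwa [e] at h

lemma continuous_lineIns (i : Fin k) (h : n + 1 = k + l) :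
    Continuous fun x : LineCoord k × LineCoord l => lineIns i h x.1 x.2 :=
  ((continuous_ins2 i h).comp
    ((continuous_fst.comp continuous_fst).prodMk (continuous_fst.comp continuous_snd))).prodMk
  ((continuous_ins3 i h).comp
    ((continuous_snd.comp continuous_fst).prodMk (continuous_snd.comp continuous_snd)))

lemma continuous_circleIns (i : Fin k) (h : n + 1 = k + l) :
    Continuous fun x : CircleCoord k × LineCoord l => circleIns i h x.1 x.2 := by
  refine Continuous.prodMk (by fun_prop) (Continuous.prodMk ?_ ?_)
  · have hc : Continuous fun x : CircleCoord k × LineCoord l =>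
        (x.1.2.1, fun a b => x.2.1 a b • (Complex.I * (x.1.1 i : ℂ))) := by fun_prop
    exact (continuous_ins2 i h).comp hc
  · have hc : Continuous fun x : CircleCoord k × LineCoord l => (x.1.2.2, x.2.2) := by fun_prop
    exact (continuous_ins3 i h).comp hc

lemma lineIns_mem_closure (i : Fin k) (h : n + 1 = k + l) {x : Fin k → ℝ}
    (hx : Function.Injective x) {y : Fin l → ℝ} (hy : Function.Injective y) :
    lineIns i h (lineCoord x) (lineCoord y) ∈
      closure (lineCoord '' {x : Fin n → ℝ | Function.Injective x}) := by
  let F : ℝ → Fin n → ℝ := fun ε j => x (outer i h j) + shift i y ε j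
  have h1 : ∀ j, Tendsto (fun ε => F ε j) (𝓝[>] 0) (𝓝 (x (outer i h j))) := fun j => by
    simpa using (tendsto_shift i y j).const_add (x (outer i h j))
  have h2 : ∀ (a b : Fin n) (ha : InBlock i l a) (hb : InBlock i l b),
      Tendsto (fun ε : ℝ => ε⁻¹ • (F ε b - F ε a)) (𝓝[>] 0)
        (𝓝 ((y (sub hb) - y (sub ha)) • (1 : ℝ))) := by
    intro a b ha hb
    refine tendsto_const_nhds.congr' ?_
    filter_upwards [self_mem_nhdsWithin] with ε hε
    have hε : (0 : ℝ) < ε := hε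
    simp only [F, shift, dif_pos ha, dif_pos hb, (outer_eq_iff i h a).2 ha,
      (outer_eq_iff i h b).2 hb, smul_eq_mul]
    field_simp
    ring
  refine mem_closure_of_tendsto (b := 𝓝[>] (0 : ℝ)) (f := fun ε => lineCoord (F ε)) ?_ ?_
  · have T := (tendsto_pairCoord_F i h x hx y hy 1 (by simp) F h1 h2).prodMk_nhds
      (tendsto_tripleCoord_F i h x hx y hy 1 (by simp) F h1 h2)
    simpa [lineIns, lineCoord] using T
  · filter_upwards [eventually_injective_F i h x hx y hy 1 (by simp) F h1 h2] with ε hε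
    exact ⟨F ε, hε, rfl⟩

lemma circleIns_mem_closure (i : Fin k) (h : n + 1 = k + l) {z : Fin k → Circle}
    (hz : Function.Injective z) {y : Fin l → ℝ} (hy : Function.Injective y) :
    circleIns i h (circleCoord z) (lineCoord y) ∈
      closure (circleCoord '' {z : Fin n → Circle | Function.Injective z}) := by
  let w : ℝ → Fin n → Circle := fun ε j => z (outer i h j) * Circle.exp (shift i y ε j)
  let F : ℝ → Fin n → ℂ := fun ε j => (w ε j : ℂ)
  have h0 : ∀ j, Tendsto (fun ε => w ε j) (𝓝[>] 0) (𝓝 (z (outer i h j))) := fun j => by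
    have := ((Circle.exp.continuous.tendsto 0).comp (tendsto_shift i y j)).const_mul
      (z (outer i h j))
    simpa using this
  have h1 : ∀ j, Tendsto (fun ε => F ε j) (𝓝[>] 0) (𝓝 (z (outer i h j) : ℂ)) := fun j =>
    (continuous_subtype_val.tendsto _).comp (h0 j)
  have h2 : ∀ (a b : Fin n) (ha : InBlock i l a) (hb : InBlock i l b),
      Tendsto (fun ε : ℝ => ε⁻¹ • (F ε b - F ε a)) (𝓝[>] 0)
        (𝓝 ((y (sub hb) - y (sub ha)) • (Complex.I * (z i : ℂ)))) := by
    intro a b ha hb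
    have hd : ∀ c : ℝ, HasDerivAt (fun ε : ℝ => Complex.exp (((ε * c : ℝ) : ℂ) * Complex.I))
        (c * Complex.I) 0 := by
      intro c
      have e1 : HasDerivAt (fun ε : ℝ => ((ε * c : ℝ) : ℂ) * Complex.I) (c * Complex.I) 0 := by
        have := ((hasDerivAt_id (0 : ℝ)).mul_const c).ofReal_comp.mul_const Complex.I
        simpa using this
      simpa using e1.cexp
    have hD := ((hd (y (sub hb))).sub (hd (y (sub ha)))).const_mul (z i : ℂ)
    have hT := (hasDerivAt_iff_tendsto_slope_zero.1 hD).mono_left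
      (nhdsWithin_mono (0 : ℝ) (fun x (hx : 0 < x) => ne_of_gt hx))
    have e : ((y (sub hb) - y (sub ha)) • (Complex.I * (z i : ℂ))) =
        (z i : ℂ) * (y (sub hb) * Complex.I - y (sub ha) * Complex.I) := by
      rw [Complex.real_smul]; push_cast; ring
    rw [e]
    refine hT.congr fun ε => ?_
    simp only [F, w, shift, dif_pos ha, dif_pos hb, (outer_eq_iff i h a).2 ha,
      (outer_eq_iff i h b).2 hb, Circle.coe_mul, Circle.coe_exp, Pi.sub_apply]
    simp
    left
    ring
  have hZ : Function.Injective fun a => (z a : ℂ) := fun a b hab => hz (Circle.ext hab)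
  have hI : ‖Complex.I * (z i : ℂ)‖ = 1 := by
    rw [norm_mul, Complex.norm_I, Circle.norm_coe, one_mul]
  refine mem_closure_of_tendsto (b := 𝓝[>] (0 : ℝ)) (f := fun ε => circleCoord (w ε)) ?_ ?_
  · exact (tendsto_pi_nhds.2 h0).prodMk_nhds
      ((tendsto_pairCoord_F i h _ hZ y hy _ hI F h1 h2).prodMk_nhds
        (tendsto_tripleCoord_F i h _ hZ y hy _ hI F h1 h2))
  · filter_upwards [eventually_injective_F i h _ hZ y hy _ hI F h1 h2] with ε hε
    exact ⟨w ε, fun a b hab => hε (congrArg (fun u : Circle => (u : ℂ)) hab), rfl⟩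

lemma lineIns_mem (i : Fin k) (h : n + 1 = k + l) {p : LineCoord k} (hp : p ∈ assocSet k)
    {q : LineCoord l} (hq : q ∈ assocSet l) : lineIns i h p q ∈ assocSet n := by
  refine ⟨by have := hp.1; have := hq.1; omega, ?_⟩
  rw [← closure_closure]
  refine map_mem_closure₂ (continuous_lineIns i h) hp.2 hq.2 ?_
  rintro _ ⟨x, hx, rfl⟩ _ ⟨y, hy, rfl⟩
  exact lineIns_mem_closure i h hx hy

lemma circleIns_mem (i : Fin k) (h : n + 1 = k + l) {p : CircleCoord k} (hp : p ∈ cycloSet k)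
    {q : LineCoord l} (hq : q ∈ assocSet l) : circleIns i h p q ∈ cycloSet n := by
  unfold cycloSet
  rw [← closure_closure]
  refine map_mem_closure₂ (continuous_circleIns i h) hp hq.2 ?_
  rintro _ ⟨x, hx, rfl⟩ _ ⟨y, hy, rfl⟩
  exact circleIns_mem_closure i h hx hy

/-- Relabelling of a configuration on the line. -/
def lineAct (p : LineCoord n) (σ : Equiv.Perm (Fin n)) : LineCoord n :=
  (fun a b => p.1 (σ a) (σ b), fun a b c => p.2 (σ a) (σ b) (σ c))

/-- Relabelling of a configuration on the circle. -/
def circleAct (p : CircleCoord n) (σ : Equiv.Perm (Fin n)) : CircleCoord n :=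
  (fun a => p.1 (σ a), fun a b => p.2.1 (σ a) (σ b), fun a b c => p.2.2 (σ a) (σ b) (σ c))

lemma continuous_lineAct (σ : Equiv.Perm (Fin n)) :
    Continuous fun p : LineCoord n => lineAct p σ := by
  unfold lineAct; fun_prop

lemma continuous_circleAct (σ : Equiv.Perm (Fin n)) :
    Continuous fun p : CircleCoord n => circleAct p σ := by
  unfold circleAct; fun_prop

lemma lineAct_mem {p : LineCoord n} (hp : p ∈ assocSet n) (σ : Equiv.Perm (Fin n)) :
    lineAct p σ ∈ assocSet n := by
  refine ⟨hp.1, map_mem_closure (f := fun p => lineAct p σ) (continuous_lineAct σ) hp.2 ?_⟩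
  rintro _ ⟨x, hx, rfl⟩
  exact ⟨x ∘ σ, Function.Injective.comp hx σ.injective, rfl⟩

lemma circleAct_mem {p : CircleCoord n} (hp : p ∈ cycloSet n) (σ : Equiv.Perm (Fin n)) :
    circleAct p σ ∈ cycloSet n := by
  refine map_mem_closure (f := fun p => circleAct p σ) (continuous_circleAct σ) hp ?_
  rintro _ ⟨x, hx, rfl⟩
  exact ⟨x ∘ σ, Function.Injective.comp hx σ.injective, rfl⟩

lemma assoc_diag {p : LineCoord n} (hp : p ∈ assocSet n) (i : Fin n) :
    p.1 i i = 0 ∧ p.2 i i i = 0 := by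
  have hc : IsClosed {p : LineCoord n | p.1 i i = 0 ∧ p.2 i i i = 0} :=
    (isClosed_eq (by fun_prop) continuous_const).inter (isClosed_eq (by fun_prop) continuous_const)
  refine closure_minimal ?_ hc hp.2
  rintro _ ⟨x, -, rfl⟩
  simp [lineCoord, pairCoord, tripleCoord]

lemma cyclo_diag {p : CircleCoord n} (hp : p ∈ cycloSet n) (i : Fin n) :
    p.2.1 i i = 0 ∧ p.2.2 i i i = 0 := by
  have hc : IsClosed {p : CircleCoord n | p.2.1 i i = 0 ∧ p.2.2 i i i = 0} :=
    (isClosed_eq (by fun_prop) continuous_const).inter (isClosed_eq (by fun_prop) continuous_const)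
  refine closure_minimal ?_ hc hp
  rintro _ ⟨x, -, rfl⟩
  simp [circleCoord, pairCoord, tripleCoord]

end closure

/-- Stasheff's operad `K` of associahedra, in its symmetric version. -/
def associahedra : TopOperad where
  obj n := assocSet n
  act p σ := ⟨lineAct p.1 σ, lineAct_mem p.2 σ⟩
  unit := ⟨lineCoord fun _ => 0, Nat.one_pos, subset_closure
    ⟨_, Function.injective_of_subsingleton _, rfl⟩⟩
  comp i h p q := ⟨lineIns i h p.1 q.1, lineIns_mem i h p.2 q.2⟩
  continuous_act σ := ((continuous_lineAct σ).comp continuous_subtype_val).subtype_mk _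
  continuous_comp i h := ((continuous_lineIns i h).comp
    ((continuous_subtype_val.comp continuous_fst).prodMk
      (continuous_subtype_val.comp continuous_snd))).subtype_mk _
  act_one _ := rfl
  act_mul _ _ _ := rfl
  comp_unit i p := by
    have hd := assoc_diag p.2 i
    refine Subtype.ext (Prod.ext (ins2_unit i _ _ ?_) (ins3_unit i _ _ ?_))
    · simp [hd.1, lineCoord, pairCoord]
    · simp [hd.2, lineCoord, tripleCoord]
  unit_comp h q := Subtype.ext (Prod.ext (unit_ins2 h _ _) (unit_ins3 h _ _))
  assoc_seq i j i' h₁ h₂ h₃ h₄ hi _ _ _ := Subtype.ext (Prod.ext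
    (ins2_seq i j i' h₁ h₂ h₃ h₄ hi _ _ _) (ins3_seq i j i' h₁ h₂ h₃ h₄ hi _ _ _))
  assoc_par i j j' i' h₁ h₂ h₃ h₄ hij hj hi _ _ _ := Subtype.ext (Prod.ext
    (ins2_par i j j' i' h₁ h₂ h₃ h₄ hij hj hi _ _ _)
    (ins3_par i j j' i' h₁ h₂ h₃ h₄ hij hj hi _ _ _))
  equivariant i h σ τ ω h1 h2 _ _ := Subtype.ext (Prod.ext
    (ins2_perm i h σ τ ω h1 h2 _ _) (ins3_perm i h σ τ ω h1 h2 _ _))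

section circleIns

variable {k l m n n₁ n₂ : ℕ}

lemma circleIns_seq (i : Fin k) (j : Fin l) (i' : Fin n₁) (h₁ : n₁ + 1 = k + l)
    (h₂ : n + 1 = n₁ + m) (h₃ : n₂ + 1 = l + m) (h₄ : n + 1 = k + n₂) (hi : (i' : ℕ) = i + j)
    (p : CircleCoord k) (q : LineCoord l) (r : LineCoord m) :
    circleIns i' h₂ (circleIns i h₁ p q) r = circleIns i h₄ p (lineIns j h₃ q r) := by
  have e : outer i h₁ i' = i := (outer_eq_iff i h₁ i').2 ⟨by omega, by omega⟩
  refine Prod.ext ?_ (Prod.ext ?_ (ins3_seq i j i' h₁ h₂ h₃ h₄ hi _ _ _))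
  · exact funext fun x => congrArg p.1 (seq_outer hi x)
  · simp only [circleIns, lineIns, e]
    refine (ins2_seq i j i' h₁ h₂ h₃ h₄ hi _ _ _).trans ?_
    congr 1
    ext x y
    unfold ins2
    split_ifs <;> rfl

lemma circleIns_par (i j : Fin k) (j' : Fin n₁) (i' : Fin n₂)
    (h₁ : n₁ + 1 = k + l) (h₂ : n + 1 = n₁ + m) (h₃ : n₂ + 1 = k + m) (h₄ : n + 1 = n₂ + l)
    (hij : i < j) (hj : (j' : ℕ) + 1 = j + l) (hi : (i' : ℕ) = i)
    (p : CircleCoord k) (q : LineCoord l) (r : LineCoord m) :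
    circleIns j' h₂ (circleIns i h₁ p q) r = circleIns i' h₄ (circleIns j h₃ p r) q := by
  have e1 : outer i h₁ j' = j := by
    have := outer_spec i h₁ j'
    rw [Fin.lt_def] at hij
    rw [Fin.ext_iff]
    simp only [InBlock] at *
    omega
  have e2 : outer j h₃ i' = i := by
    have := outer_spec j h₃ i'
    rw [Fin.lt_def] at hij
    rw [Fin.ext_iff]
    simp only [InBlock] at *
    omega
  refine Prod.ext ?_ (Prod.ext ?_ (ins3_par i j j' i' h₁ h₂ h₃ h₄ hij hj hi _ _ _))
  · exact funext fun x => congrArg p.1 (par_outer hij hj hi x)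
  · simp only [circleIns, e1, e2]
    exact ins2_par i j j' i' h₁ h₂ h₃ h₄ hij hj hi _ _ _

lemma circleIns_perm (i : Fin k) (h : n + 1 = k + l) (σ : Equiv.Perm (Fin k))
    (τ : Equiv.Perm (Fin l)) (ω : Equiv.Perm (Fin n))
    (h1 : ∀ j, outer (σ i) h (ω j) = σ (outer i h j))
    (h2 : ∀ b, ω (inner i h b) = inner (σ i) h (τ b)) (p : CircleCoord k) (q : LineCoord l) :
    circleIns i h (circleAct p σ) (lineAct q τ) = circleAct (circleIns (σ i) h p q) ω := by
  refine Prod.ext ?_ (Prod.ext ?_ (ins3_perm i h σ τ ω h1 h2 _ _))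
  · exact funext fun x => congrArg p.1 (h1 x).symm
  · exact ins2_perm i h σ τ ω h1 h2 p.2.1 (fun a b => q.1 a b • (Complex.I * (p.1 (σ i) : ℂ)))

lemma circleIns_unit (i : Fin k) {p : CircleCoord k} (hp : p ∈ cycloSet k) :
    circleIns i rfl p (lineCoord fun _ : Fin 1 => 0) = p := by
  have hd := cyclo_diag hp i
  refine Prod.ext ?_ (Prod.ext ?_ (ins3_unit i _ _ ?_))
  · exact funext fun x => congrArg p.1 (outer_unit i x)
  · exact ins2_unit i _ (fun a b => pairCoord (fun _ : Fin 1 => (0 : ℝ)) a b •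
      (Complex.I * (p.1 i : ℂ))) (by simp [hd.1, pairCoord])
  · simp [hd.2, lineCoord, tripleCoord]

end circleIns

/-- The right `K`-module `C` of cyclohedra. -/
def cyclohedra : RightModule associahedra where
  obj n := cycloSet n
  act p σ := ⟨circleAct p.1 σ, circleAct_mem p.2 σ⟩
  comp i h p q := ⟨circleIns i h p.1 q.1, circleIns_mem i h p.2 q.2⟩
  continuous_act σ := ((continuous_circleAct σ).comp continuous_subtype_val).subtype_mk _
  continuous_comp i h := ((continuous_circleIns i h).comp
    ((continuous_subtype_val.comp continuous_fst).prodMk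
      (continuous_subtype_val.comp continuous_snd))).subtype_mk _
  act_one _ := rfl
  act_mul _ _ _ := rfl
  comp_unit i p := Subtype.ext (circleIns_unit i p.2)
  assoc_seq i j i' h₁ h₂ h₃ h₄ hi p q r :=
    Subtype.ext (circleIns_seq i j i' h₁ h₂ h₃ h₄ hi p.1 q.1 r.1)
  assoc_par i j j' i' h₁ h₂ h₃ h₄ hij hj hi p q r :=
    Subtype.ext (circleIns_par i j j' i' h₁ h₂ h₃ h₄ hij hj hi p.1 q.1 r.1)
  equivariant i h σ τ ω h1 h2 p q := Subtype.ext (circleIns_perm i h σ τ ω h1 h2 p.1 q.1)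

/-! ### Little intervals in the interval and in the circle -/

/-- Insertion of `l` maps `I → I` into the `i`-th one of `k` maps `I → Y`. -/
def insMaps {Y : Type*} [TopologicalSpace Y] {k l n : ℕ} (i : Fin k) (h : n + 1 = k + l)
    (p : Fin k → C(unitInterval, Y)) (q : Fin l → C(unitInterval, unitInterval)) (j : Fin n) :
    C(unitInterval, Y) :=
  if hb : InBlock i l j then (p i).comp (q (sub hb)) else p (outer i h j)

section insMaps

variable {Y : Type*} [TopologicalSpace Y] {k l m n n₁ n₂ : ℕ}

lemma continuous_insMaps (i : Fin k) (h : n + 1 = k + l) :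
    Continuous fun x : (Fin k → C(unitInterval, Y)) × (Fin l → C(unitInterval, unitInterval)) =>
      (insMaps i h x.1 x.2 : Fin n → C(unitInterval, Y)) := by
  refine continuous_pi fun j => ?_
  unfold insMaps
  split_ifs
  · exact ContinuousMap.continuous_comp'.comp (Continuous.prodMk (by fun_prop) (by fun_prop))
  · fun_prop

lemma insMaps_unit (i : Fin k) (p : Fin k → C(unitInterval, Y)) :
    insMaps i rfl p (fun _ : Fin 1 => ContinuousMap.id _) = p := by
  ext j : 1
  unfold insMaps
  split_ifs with hb
  · have := (outer_eq_iff i rfl j).2 hb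
    rw [outer_unit] at this
    subst this
    exact ContinuousMap.comp_id _
  · rw [outer_unit]

lemma unit_insMaps (h : l + 1 = 1 + l) (q : Fin l → C(unitInterval, unitInterval)) :
    insMaps 0 h (fun _ : Fin 1 => ContinuousMap.id _) q = q := by
  ext j : 1
  unfold insMaps
  rw [dif_pos (unit_block j), sub_unit, ContinuousMap.id_comp]

lemma insMaps_seq (i : Fin k) (j : Fin l) (i' : Fin n₁) (h₁ : n₁ + 1 = k + l)
    (h₂ : n + 1 = n₁ + m) (h₃ : n₂ + 1 = l + m) (h₄ : n + 1 = k + n₂) (hi : (i' : ℕ) = i + j)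
    (p : Fin k → C(unitInterval, Y)) (q : Fin l → C(unitInterval, unitInterval))
    (r : Fin m → C(unitInterval, unitInterval)) :
    insMaps i' h₂ (insMaps i h₁ p q) r = insMaps i h₄ p (insMaps j h₃ q r) := by
  ext x : 1
  have hi' : InBlock i l i' := ⟨by omega, by omega⟩
  have hs : sub hi' = j := by rw [Fin.ext_iff]; simp only [sub]; omega
  by_cases hb : InBlock i n₂ x
  · have hb' := (seq_block (h₂ := h₂) h₃ hi x).2 hb
    by_cases hc : InBlock i' m x
    · have hc' := (seq_block' hi hb).1 hc
      simp only [insMaps, dif_pos hb, dif_pos hc, dif_pos hc', dif_pos hi', hs,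
        seq_sub' hi hb hc hc', ContinuousMap.comp_assoc]
    · have hc' := mt (seq_block' hi hb).2 hc
      simp only [insMaps, dif_pos hb, dif_pos hb', dif_neg hc, dif_neg hc', seq_sub h₃ hi hb hb']
  · have hc : ¬ InBlock i' m x := fun hc => hb (seq_block'' h₃ hi hc)
    have hb' := mt (seq_block (h₂ := h₂) h₃ hi x).1 hb
    simp only [insMaps, dif_neg hb, dif_neg hc, dif_neg hb', seq_outer (h₄ := h₄) hi]

lemma insMaps_par (i j : Fin k) (j' : Fin n₁) (i' : Fin n₂)
    (h₁ : n₁ + 1 = k + l) (h₂ : n + 1 = n₁ + m) (h₃ : n₂ + 1 = k + m) (h₄ : n + 1 = n₂ + l)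
    (hij : i < j) (hj : (j' : ℕ) + 1 = j + l) (hi : (i' : ℕ) = i)
    (p : Fin k → C(unitInterval, Y)) (q : Fin l → C(unitInterval, unitInterval))
    (r : Fin m → C(unitInterval, unitInterval)) :
    insMaps j' h₂ (insMaps i h₁ p q) r = insMaps i' h₄ (insMaps j h₃ p r) q := by
  ext x : 1
  have hj' : ¬ InBlock i l j' := by
    rw [Fin.lt_def] at hij
    simp only [InBlock]
    omega
  have hi' : ¬ InBlock j m i' := by
    rw [Fin.lt_def] at hij
    simp only [InBlock]
    omega
  have e1 : outer i h₁ j' = j := by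
    have := outer_spec i h₁ j'
    rw [Fin.lt_def] at hij
    rw [Fin.ext_iff]
    simp only [InBlock] at *
    omega
  have e2 : outer j h₃ i' = i := by
    have := outer_spec j h₃ i'
    rw [Fin.lt_def] at hij
    rw [Fin.ext_iff]
    simp only [InBlock] at *
    omega
  have hb := par_block (h₂ := h₂) hij hj hi x
  have hc := par_block' (m := m) (h₄ := h₄) hij hj hi x
  by_cases hB : InBlock i' l x
  · have hC : ¬ InBlock j' m x := fun hC => par_disj hij hj hi hB hC
    have hB' := hb.2 hB
    simp only [insMaps, dif_pos hB, dif_pos hB', dif_neg hC, dif_neg hi', e2,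
      par_sub hij hj hi hB' hB]
  · by_cases hC : InBlock j' m x
    · have hC' := hc.2 hC
      simp only [insMaps, dif_neg hB, dif_pos hC, dif_pos hC', dif_neg hj', e1,
        par_sub' hij hj hi hC' hC]
    · simp only [insMaps, dif_neg hB, dif_neg hC, dif_neg (mt hb.1 hB), dif_neg (mt hc.1 hC),
        par_outer (h₁ := h₁) (h₂ := h₂) (h₃ := h₃) (h₄ := h₄) hij hj hi]

lemma insMaps_perm (i : Fin k) (h : n + 1 = k + l) (σ : Equiv.Perm (Fin k))
    (τ : Equiv.Perm (Fin l)) (ω : Equiv.Perm (Fin n))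
    (h1 : ∀ j, outer (σ i) h (ω j) = σ (outer i h j))
    (h2 : ∀ b, ω (inner i h b) = inner (σ i) h (τ b))
    (p : Fin k → C(unitInterval, Y)) (q : Fin l → C(unitInterval, unitInterval)) :
    insMaps i h (fun a => p (σ a)) (fun a => q (τ a)) =
      fun x => insMaps (σ i) h p q (ω x) := by
  ext x : 1
  have hb := block_perm (l := l) h1 x
  by_cases hB : InBlock i l x
  · have hB' := hb.2 hB
    simp only [insMaps, dif_pos hB, dif_pos hB', sub_perm h2 hB hB']
  · simp only [insMaps, dif_neg hB, dif_neg (mt hb.1 hB), h1]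

lemma continuous_maps_perm (σ : Equiv.Perm (Fin n)) :
    Continuous fun (p : Fin n → C(unitInterval, Y)) (a : Fin n) => p (σ a) :=
  continuous_pi fun a => continuous_apply (σ a)

/-- The images of the interior of the interval under the given maps are mutually disjoint. -/
def DisjointInteriors (p : Fin n → C(unitInterval, Y)) : Prop :=
  ∀ a b, a ≠ b → Disjoint (p a '' Ioo 0 1) (p b '' Ioo 0 1)

/-- A linear imbedding of the unit interval into itself, as in the little intervals operad. -/
def IsLinearInterval (f : C(unitInterval, unitInterval)) : Prop :=
  ∃ a s : ℝ, 0 < s ∧ ∀ t : unitInterval, (f t : ℝ) = a + s * t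

/-- A linear imbedding of the unit interval into the circle: an imbedding which is the composition
of an increasing linear map into the line and the exponential map. -/
def IsLinearArc (f : C(unitInterval, Circle)) : Prop :=
  Function.Injective f ∧ ∃ a s : ℝ, 0 < s ∧ ∀ t : unitInterval, f t = Circle.exp (a + s * t)

lemma IsLinearInterval.injective {f : C(unitInterval, unitInterval)} (hf : IsLinearInterval f) :
    Function.Injective f := by
  obtain ⟨a, s, hs, hf⟩ := hf
  intro x y hxy
  have := congrArg (fun t : unitInterval => (t : ℝ)) hxy
  simp only [hf] at this
  have : s * (x : ℝ) = s * y := by linarith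
  exact Subtype.ext (mul_left_cancel₀ hs.ne' this)

lemma IsLinearInterval.image_subset {f : C(unitInterval, unitInterval)} (hf : IsLinearInterval f) :
    f '' Ioo 0 1 ⊆ Ioo 0 1 := by
  obtain ⟨a, s, hs, hf⟩ := hf
  rintro _ ⟨t, ⟨h0, h1⟩, rfl⟩
  have h0' : (0 : ℝ) < t := h0
  have h1' : (t : ℝ) < 1 := h1
  have e0 := (f 0).2.1
  have e1 := (f 1).2.2
  rw [hf] at e0 e1
  rw [Icc.coe_zero] at e0
  rw [Icc.coe_one] at e1
  constructor
  · change (0 : ℝ) < f t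
    rw [hf]
    nlinarith
  · change (f t : ℝ) < 1
    rw [hf]
    nlinarith

lemma IsLinearInterval.comp {f g : C(unitInterval, unitInterval)} (hf : IsLinearInterval f)
    (hg : IsLinearInterval g) : IsLinearInterval (f.comp g) := by
  obtain ⟨a, s, hs, hf⟩ := hf
  obtain ⟨b, r, hr, hg⟩ := hg
  refine ⟨a + s * b, s * r, mul_pos hs hr, fun t => ?_⟩
  rw [ContinuousMap.comp_apply, hf, hg]
  ring

lemma IsLinearArc.comp {f : C(unitInterval, Circle)} {g : C(unitInterval, unitInterval)}
    (hf : IsLinearArc f) (hg : IsLinearInterval g) : IsLinearArc (f.comp g) := by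
  refine ⟨hf.1.comp hg.injective, ?_⟩
  obtain ⟨-, a, s, hs, hf⟩ := hf
  obtain ⟨b, r, hr, hg⟩ := hg
  refine ⟨a + s * b, s * r, mul_pos hs hr, fun t => ?_⟩
  rw [ContinuousMap.comp_apply, hf, hg]
  congr 1
  ring

lemma disjointInteriors_insMaps (i : Fin k) (h : n + 1 = k + l) {p : Fin k → C(unitInterval, Y)}
    (hp : DisjointInteriors p) (hp' : ∀ a, Function.Injective (p a))
    {q : Fin l → C(unitInterval, unitInterval)} (hq : DisjointInteriors q)
    (hq' : ∀ b, IsLinearInterval (q b)) : DisjointInteriors (insMaps i h p q : Fin n → _) := by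
  intro a b hab
  have key : ∀ x : Fin n, insMaps i h p q x '' Ioo 0 1 ⊆ p (outer i h x) '' Ioo 0 1 := by
    intro x
    unfold insMaps
    split_ifs with hx
    · rw [(outer_eq_iff i h x).2 hx, ContinuousMap.coe_comp, image_comp]
      exact image_mono (hq' _).image_subset
    · exact subset_rfl
  by_cases ho : outer i h a = outer i h b
  · by_cases hB : InBlock i l a ∧ InBlock i l b
    · have hne : sub hB.1 ≠ sub hB.2 := by
        intro e
        refine hab ?_
        rw [Fin.ext_iff] at e ⊢
        obtain ⟨hA, hB⟩ := hB
        simp only [sub] at *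
        omega
      unfold insMaps
      rw [dif_pos hB.1, dif_pos hB.2, ContinuousMap.coe_comp, ContinuousMap.coe_comp, image_comp,
        image_comp]
      exact (disjoint_image_iff (hp' i)).2 (hq _ _ hne)
    · exact absurd (eq_of_outer_eq i h ho hB) hab
  · exact (hp _ _ ho).mono (key a) (key b)

/-- The space of `n` little intervals in the interval, with the compact-open topology. -/
def intervalSet (n : ℕ) : Set (Fin n → C(unitInterval, unitInterval)) :=
  {p | (∀ a, IsLinearInterval (p a)) ∧ DisjointInteriors p}

/-- The space of `n` little intervals in the circle, with the compact-open topology. -/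
def arcSet (n : ℕ) : Set (Fin n → C(unitInterval, Circle)) :=
  {p | (∀ a, IsLinearArc (p a)) ∧ DisjointInteriors p}

lemma insMaps_mem_intervalSet (i : Fin k) (h : n + 1 = k + l)
    {p : Fin k → C(unitInterval, unitInterval)} (hp : p ∈ intervalSet k)
    {q : Fin l → C(unitInterval, unitInterval)} (hq : q ∈ intervalSet l) :
    (insMaps i h p q : Fin n → _) ∈ intervalSet n := by
  refine ⟨fun a => ?_, disjointInteriors_insMaps i h hp.2 (fun a => (hp.1 a).injective) hq.2 hq.1⟩
  unfold insMaps
  split_ifs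
  · exact (hp.1 _).comp (hq.1 _)
  · exact hp.1 _

lemma insMaps_mem_arcSet (i : Fin k) (h : n + 1 = k + l)
    {p : Fin k → C(unitInterval, Circle)} (hp : p ∈ arcSet k)
    {q : Fin l → C(unitInterval, unitInterval)} (hq : q ∈ intervalSet l) :
    (insMaps i h p q : Fin n → _) ∈ arcSet n := by
  refine ⟨fun a => ?_, disjointInteriors_insMaps i h hp.2 (fun a => (hp.1 a).1) hq.2 hq.1⟩
  unfold insMaps
  split_ifs
  · exact (hp.1 _).comp (hq.1 _)
  · exact hp.1 _

lemma disjointInteriors_perm {p : Fin n → C(unitInterval, Y)} (hp : DisjointInteriors p)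
    (σ : Equiv.Perm (Fin n)) : DisjointInteriors fun a => p (σ a) :=
  fun _ _ hab => hp _ _ (σ.injective.ne hab)

end insMaps

/-- The little intervals operad `𝒞₁`. -/
def littleIntervals : TopOperad where
  obj n := intervalSet n
  act p σ := ⟨fun a => p.1 (σ a), fun _ => p.2.1 _, disjointInteriors_perm p.2.2 σ⟩
  unit := ⟨fun _ => ContinuousMap.id _, fun _ => ⟨0, 1, one_pos, fun t => by simp⟩,
    fun a b hab => absurd (Subsingleton.elim a b) hab⟩
  comp i h p q := ⟨insMaps i h p.1 q.1, insMaps_mem_intervalSet i h p.2 q.2⟩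
  continuous_act σ := ((continuous_maps_perm σ).comp continuous_subtype_val).subtype_mk _
  continuous_comp i h := ((continuous_insMaps i h).comp
    ((continuous_subtype_val.comp continuous_fst).prodMk
      (continuous_subtype_val.comp continuous_snd))).subtype_mk _
  act_one _ := rfl
  act_mul _ _ _ := rfl
  comp_unit i p := Subtype.ext (insMaps_unit i p.1)
  unit_comp h q := Subtype.ext (unit_insMaps h q.1)
  assoc_seq i j i' h₁ h₂ h₃ h₄ hi p q r :=
    Subtype.ext (insMaps_seq i j i' h₁ h₂ h₃ h₄ hi p.1 q.1 r.1)
  assoc_par i j j' i' h₁ h₂ h₃ h₄ hij hj hi p q r :=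
    Subtype.ext (insMaps_par i j j' i' h₁ h₂ h₃ h₄ hij hj hi p.1 q.1 r.1)
  equivariant i h σ τ ω h1 h2 p q := Subtype.ext (insMaps_perm i h σ τ ω h1 h2 p.1 q.1)

/-- The right `𝒞₁`-module `𝒥₁` of little intervals in the circle. -/
def circleIntervals : RightModule littleIntervals where
  obj n := arcSet n
  act p σ := ⟨fun a => p.1 (σ a), fun _ => p.2.1 _, disjointInteriors_perm p.2.2 σ⟩
  comp i h p q := ⟨insMaps i h p.1 q.1, insMaps_mem_arcSet i h p.2 q.2⟩
  continuous_act σ := ((continuous_maps_perm σ).comp continuous_subtype_val).subtype_mk _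
  continuous_comp i h := ((continuous_insMaps i h).comp
    ((continuous_subtype_val.comp continuous_fst).prodMk
      (continuous_subtype_val.comp continuous_snd))).subtype_mk _
  act_one _ := rfl
  act_mul _ _ _ := rfl
  comp_unit i p := Subtype.ext (insMaps_unit i p.1)
  assoc_seq i j i' h₁ h₂ h₃ h₄ hi p q r :=
    Subtype.ext (insMaps_seq i j i' h₁ h₂ h₃ h₄ hi p.1 q.1 r.1)
  assoc_par i j j' i' h₁ h₂ h₃ h₄ hij hj hi p q r :=
    Subtype.ext (insMaps_par i j j' i' h₁ h₂ h₃ h₄ hij hj hi p.1 q.1 r.1)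
  equivariant i h σ τ ω h1 h2 p q := Subtype.ext (insMaps_perm i h σ τ ω h1 h2 p.1 q.1)

/-! ### Loop spaces and the actions of the little intervals -/

/-- The free loop space of `X`, with the compact-open topology. -/
abbrev FreeLoopSpace (X : Type*) [TopologicalSpace X] : Type _ := C(Circle, X)

/-- The space of loops in `X` based at `b`, a subspace of the free loop space. -/
abbrev BasedLoopSpace (X : Type*) [TopologicalSpace X] (b : X) : Type _ :=
  {f : FreeLoopSpace X // f 1 = b}

/-- The linear parametrization `[0,1] → S¹` of the circle. -/
def wrap (t : unitInterval) : Circle := Circle.exp (2 * Real.pi * t)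

/-- The structure maps of `A` are the classical action of the little intervals on the based loop
space: `A(c)(φ_1, …, φ_n)` runs through `φ_j` on the `j`-th little interval and is constant outside
of the little intervals. -/
def IsClassicalAction {X : Type*} [TopologicalSpace X] {b : X}
    (A : OperadAlgebra littleIntervals (BasedLoopSpace X b)) : Prop :=
  ∀ (n : ℕ) (c : intervalSet n) (φ : Fin n → BasedLoopSpace X b),
    (∀ (j : Fin n) (t : unitInterval), (A.map (n := n) c φ).1 (wrap (c.1 j t)) = (φ j).1 (wrap t)) ∧
    ∀ t : unitInterval, (∀ j, t ∉ range (c.1 j)) → (A.map (n := n) c φ).1 (wrap t) = b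

/-- The structure maps of `T` are given by the formula `T(d)(φ_1, …, φ_n) = φ_j ∘ d_j⁻¹` on the
`j`-th little interval of the circle, and `b` outside of the little intervals. -/
def IsLoopTrace {X : Type*} [TopologicalSpace X] {b : X}
    {A : OperadAlgebra littleIntervals (BasedLoopSpace X b)}
    (T : Trace circleIntervals A (FreeLoopSpace X)) : Prop :=
  ∀ (n : ℕ) (d : arcSet n) (φ : Fin n → BasedLoopSpace X b),
    (∀ (j : Fin n) (t : unitInterval), T.map (n := n) d φ (d.1 j t) = (φ j).1 (wrap t)) ∧
    ∀ z : Circle, (∀ j, z ∉ range (d.1 j)) → T.map (n := n) d φ z = b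

end CycloLoop

end

/-!
A little interval, or an arc `exp (u + s t)`, is given by the two numbers `u` and `s`. The
conditions on a family of intervals, namely being contained in `[0, 1]`, having disjoint interiors
in the order prescribed by a configuration of points, or not overlapping around the circle, are
affine inequalities in these numbers as long as the combinatorial type of the configuration is
fixed, and the bounds vary continuously over the compactification. Hence, at a fixed
configuration, the admissible families form a convex set, and this set has a point at which all
inequalities are strict. This replaces any obstruction theory: values that are admissible on a
closed set extend to everywhere (`exists_extension_of_affine`, `exists_valid_extension`).

The homomorphisms from the associahedra to the little intervals and from the cyclohedra to the
little intervals in the circle are therefore constructed by recursion on the arity. On the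
boundary, which consists of the insertions, the values are forced by those in lower arities
(`glue`). They do not depend on the insertion that is used, because sets of collided labels are
nested or disjoint (`glue_eq_glue`). The extension to the interior is averaged over the symmetric
group in order to become equivariant (`exists_step`). The two recursions, `exists_line_family` and
`exists_circle_family`, are instances of a single one for an abstract system of configuration
spaces.

The homotopy types are found by forgetting the last point of a configuration. The fibres of this
map are intervals, because the coordinates that involve the last point are mutually monotone along
them (`exists_section_of_monotone`). Hence the components of the associahedra are contractible
(`exists_line_model`), and those of the cyclohedra in positive arity are homotopy equivalent to
circles (`exists_circle_model`). Passing to the centers of the intervals gives homotopy inverses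
of the two homomorphisms (`lineCenters_homotopyInverse`, `circleMap_centers_homotopic`,
`centers_circleMap_homotopic`), and a homotopy equivalence is a weak homotopy equivalence
(`isWeakHomotopyEquiv_of_homotopic`), although the homotopies move the base points.

Let now `ρ` be an arbitrary homomorphism from the associahedra to the little intervals. In arity
two, it preserves or reverses the order of the labels. Since an order on more labels is detected
by forming compositions and by connectedness of the components, the same holds in all arities
(`orderPreserving_of_before`). If the order is preserved, then `ρ` plays the part of the family on
the associahedra in the recursion for the circle. If it is reversed, the same construction is
applied to the reflected homomorphism, and the result is reflected back (`ModuleHom.flip`). Thus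
`exists_moduleHom` covers every `ρ`.

Finally, the loop algebra and the loop trace are both given by spreading loops over a family of
arcs with disjoint interiors (`spread`). Such a map is well defined and continuous because closed
arcs meet in endpoints only, where all loops have the base point as value (`continuous_spread`).
The trace over the cyclohedra is the restriction of the trace over the little intervals along the
two homomorphisms (`Trace.restrict`).
-/

open Set Filter Topology

noncomputable section

namespace CycloLoop

/-! ### Homotopy equivalences are weak homotopy equivalences -/

section HomotopyExtension

/-- The homotopy extension property of the unit ball and the unit sphere of a normed space: the
cylinder over the ball is retracted onto its bottom and its side by the central projection from
`(2, 0)`. -/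
lemma exists_homotopy_extension {E X : Type*} [NormedAddCommGroup E] [NormedSpace ℝ E]
    [TopologicalSpace X] (α : E → X) (b : ℝ × E → X)
    (hα : ContinuousOn α (Metric.closedBall 0 1))
    (hb : ContinuousOn b (Icc 0 1 ×ˢ Metric.sphere 0 1))
    (h0 : ∀ v ∈ Metric.sphere (0 : E) 1, b (0, v) = α v) :
    ∃ Φ : ℝ × E → X, ContinuousOn Φ (Icc 0 1 ×ˢ Metric.closedBall 0 1) ∧
      (∀ v ∈ Metric.closedBall (0 : E) 1, Φ (0, v) = α v) ∧
      ∀ t ∈ Icc (0 : ℝ) 1, ∀ v ∈ Metric.sphere (0 : E) 1, Φ (t, v) = b (t, v) := by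
  classical
  -- The ray from `(2, 0)` through `(t, v)` meets the bottom if `‖v‖ ≤ (2 - t) / 2`, and the side
  -- otherwise.
  let Φ : ℝ × E → X := fun p =>
    if ‖p.2‖ ≤ (2 - p.1) / 2 then α ((2 / (2 - p.1)) • p.2)
    else b (2 - (2 - p.1) / ‖p.2‖, ‖p.2‖⁻¹ • p.2)
  refine ⟨Φ, ?_, ?_, ?_⟩
  · rw [continuousOn_iff_continuous_domRestrict]
    refine continuous_if_le (f := fun p : (Icc (0 : ℝ) 1 ×ˢ Metric.closedBall (0 : E) 1 : Set _) =>
      ‖p.1.2‖) (g := fun p => (2 - p.1.1) / 2)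
      (f' := fun p => α ((2 / (2 - p.1.1)) • p.1.2))
      (g' := fun p => b (2 - (2 - p.1.1) / ‖p.1.2‖, ‖p.1.2‖⁻¹ • p.1.2)) (by fun_prop) (by fun_prop)
      ?_ ?_ ?_
    · refine hα.comp (Continuous.continuousOn ?_) ?_
      · refine Continuous.smul (Continuous.div₀ (by fun_prop) (by fun_prop) ?_) (by fun_prop)
        rintro ⟨p, hp⟩
        have := hp.1.2
        simp only at *
        linarith
      · rintro ⟨p, hp⟩ h
        have h1 := hp.1.2
        simp only [mem_ofPred_eq] at h
        have h2 : 0 < 2 - p.1 := by linarith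
        rw [mem_closedBall_zero_iff, norm_smul, Real.norm_of_nonneg (by positivity),
          div_mul_eq_mul_div, div_le_one h2]
        linarith
    · have hn : ∀ p : (Icc (0 : ℝ) 1 ×ˢ Metric.closedBall (0 : E) 1 : Set (ℝ × E)),
          p ∈ {p : (Icc (0 : ℝ) 1 ×ˢ Metric.closedBall (0 : E) 1 : Set (ℝ × E)) |
            (2 - p.1.1) / 2 ≤ ‖p.1.2‖} → 0 < ‖p.1.2‖ := by
        rintro ⟨p, hp⟩ h
        have h1 := hp.1.2
        simp only [mem_ofPred_eq] at *
        linarith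
      refine hb.comp ?_ ?_
      · refine ContinuousOn.prodMk ?_ ?_
        · exact (continuousOn_const).sub (ContinuousOn.div (by fun_prop) (by fun_prop)
            fun p hp => (hn p hp).ne')
        · exact ContinuousOn.smul (ContinuousOn.inv₀ (by fun_prop) fun p hp => (hn p hp).ne')
            (by fun_prop)
      · intro p h
        have h0 := hn p h
        obtain ⟨p, hp⟩ := p
        have h1 := hp.1
        have h2 := hp.2
        rw [mem_closedBall_zero_iff] at h2
        simp only [mem_ofPred_eq] at *
        refine ⟨⟨?_, ?_⟩, ?_⟩
        · rw [sub_nonneg, div_le_iff₀ h0]; linarith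
        · rw [sub_le_comm, le_div_iff₀ h0]; nlinarith [h1.1, h1.2]
        · rw [mem_sphere_zero_iff_norm, norm_smul, norm_inv, norm_norm, inv_mul_cancel₀ h0.ne']
    · rintro ⟨p, hp⟩ h
      have h1 := hp.1
      simp only at h ⊢
      have h2 : 0 < 2 - p.1 := by linarith [h1.2]
      have e1 : (2 : ℝ) - (2 - p.1) / ‖p.2‖ = 0 := by
        rw [h]; field_simp; ring
      have e2 : (2 / (2 - p.1)) • p.2 = ‖p.2‖⁻¹ • p.2 := by rw [h, inv_div]
      rw [e1, e2, h0]
      have h3 : 0 < ‖p.2‖ := by rw [h]; linarith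
      rw [mem_sphere_zero_iff_norm, norm_smul, norm_inv, norm_norm, inv_mul_cancel₀ h3.ne']
  · intro v hv
    rw [mem_closedBall_zero_iff] at hv
    simp [Φ, hv]
  · intro t ht v hv
    rw [mem_sphere_zero_iff_norm] at hv
    rcases eq_or_lt_of_le ht.1 with rfl | h
    · simp [Φ, hv, h0 v (by simpa using hv)]
    · have : ¬ (1 : ℝ) ≤ (2 - t) / 2 := by linarith
      simp [Φ, hv, this]

end HomotopyExtension

section ChangeOfBasePoint

open unitInterval

variable {X : Type*} [TopologicalSpace X] {N : Type*}

/-- The point of the cube with centred coordinates `v`; coordinates out of range are clamped. -/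
def toCube (v : N → ℝ) : N → I := fun i => projIcc 0 1 zero_le_one ((v i + 1) / 2)

/-- Centred coordinates of a point of the cube. -/
def ofCube (y : N → I) : N → ℝ := fun i => 2 * (y i : ℝ) - 1

lemma continuous_toCube : Continuous (toCube : (N → ℝ) → N → I) :=
  continuous_pi fun i => continuous_projIcc.comp (by fun_prop)

lemma continuous_ofCube : Continuous (ofCube : (N → I) → N → ℝ) := by unfold ofCube; fun_prop

lemma toCube_ofCube (y : N → I) : toCube (ofCube y) = y := by
  ext i
  simp [toCube, ofCube]

lemma norm_ofCube [Fintype N] (y : N → I) : ‖ofCube y‖ ≤ 1 := by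
  refine (pi_norm_le_iff_of_nonneg zero_le_one).2 fun i => ?_
  have := (y i).2
  rw [ofCube, Real.norm_eq_abs, abs_le]
  constructor <;> linarith [this.1, this.2]

lemma toCube_mem_boundary [Fintype N] {v : N → ℝ} (hv : ‖v‖ = 1) :
    toCube v ∈ Cube.boundary N := by
  by_contra h
  have : ‖v‖ < 1 := by
    refine (pi_norm_lt_iff one_pos).2 fun i => ?_
    have h1 : |v i| ≤ 1 := (norm_le_pi_norm v i).trans hv.le
    refine lt_of_le_of_ne h1 fun e => h ⟨i, ?_⟩
    rcases abs_eq zero_le_one |>.1 e with e | e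
    · right; simp [toCube, e]
    · left; simp [toCube, e]
  exact this.ne hv

lemma norm_ofCube_of_mem_boundary [Fintype N] {y : N → I} (hy : y ∈ Cube.boundary N) :
    ‖ofCube y‖ = 1 := by
  obtain ⟨i, hi⟩ := hy
  refine le_antisymm (norm_ofCube y) (le_trans (le_of_eq ?_) (norm_le_pi_norm _ i))
  rcases hi with hi | hi <;> norm_num [ofCube, hi]

/-- Transport of generalized loops along a path of base points. -/
lemma exists_transport [Fintype N] (γ : C(I, X)) (α : GenLoop N X (γ 0)) :
    ∃ (β : GenLoop N X (γ 1)) (F : C(I × (N → I), X)), (∀ y, F (0, y) = α y) ∧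
      (∀ y, F (1, y) = β y) ∧ ∀ t, ∀ y ∈ Cube.boundary N, F (t, y) = γ t := by
  obtain ⟨Φ, h1, h2, h3⟩ := exists_homotopy_extension (E := N → ℝ) (X := X)
    (fun v => α (toCube v)) (fun p => γ (projIcc 0 1 zero_le_one p.1))
    (α.1.continuous.comp continuous_toCube).continuousOn
    (γ.continuous.comp (continuous_projIcc.comp continuous_fst)).continuousOn
    (fun v hv => by
      have := α.2 _ (toCube_mem_boundary (mem_sphere_zero_iff_norm.1 hv))
      simpa using this.symm)
  have hm : ∀ y : N → I, ofCube y ∈ Metric.closedBall (0 : N → ℝ) 1 := fun y =>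
    mem_closedBall_zero_iff.2 (norm_ofCube y)
  have hF : Continuous fun p : I × (N → I) => Φ (p.1, ofCube p.2) :=
    h1.comp_continuous (by have := continuous_ofCube (N := N); fun_prop) fun p => ⟨p.1.2, hm _⟩
  have hbd : ∀ t, ∀ y ∈ Cube.boundary N, Φ ((t : I), ofCube y) = γ t := fun t y hy => by
    rw [h3 t t.2 _ (mem_sphere_zero_iff_norm.2 (norm_ofCube_of_mem_boundary hy))]
    simp
  refine ⟨⟨⟨fun y => Φ ((1 : I), ofCube y), hF.comp (Continuous.prodMk_right 1)⟩,
    fun y hy => hbd 1 y hy⟩, ⟨_, hF⟩, fun y => ?_, fun y => rfl, hbd⟩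
  have := h2 _ (hm y)
  rw [toCube_ofCube] at this
  simpa using this

/-- Transport along a path of base points respects homotopies relative to the boundary. -/
lemma homotopic_of_transport [Fintype N] {γ : C(I, X)} {x₀ x₁ : X} (e0 : γ 0 = x₀)
    (e1 : γ 1 = x₁) {α α' : GenLoop N X x₀}
    {β β' : GenLoop N X x₁} {F F' : C(I × (N → I), X)} (hF0 : ∀ y, F (0, y) = α y)
    (hF1 : ∀ y, F (1, y) = β y) (hF : ∀ t, ∀ y ∈ Cube.boundary N, F (t, y) = γ t)
    (hF0' : ∀ y, F' (0, y) = α' y) (hF1' : ∀ y, F' (1, y) = β' y)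
    (hF' : ∀ t, ∀ y ∈ Cube.boundary N, F' (t, y) = γ t) (h : GenLoop.Homotopic α α') :
    GenLoop.Homotopic β β' := by
  classical
  obtain ⟨G⟩ := h
  let c : ℝ → I := projIcc 0 1 zero_le_one
  have hc : Continuous c := continuous_projIcc
  have hcc : ∀ t : I, c t = t := fun t => projIcc_val _ _
  -- The cube gets the parameter of the homotopy `G` as an additional coordinate. On the boundary of
  -- the enlarged cube, `F` and the other transport on two opposite faces and `γ` on the others
  -- extend `G`; the other end of the resulting homotopy of `G` is a homotopy between `β` and the
  -- other loop.
  let b : ℝ × (ℝ × (N → ℝ)) → X := fun p =>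
    if p.2.1 = -1 then F (c p.1, toCube p.2.2) else if p.2.1 = 1 then F' (c p.1, toCube p.2.2)
    else γ (c p.1)
  have hct := continuous_toCube (N := N)
  have hb : ContinuousOn b (Icc 0 1 ×ˢ Metric.sphere 0 1) := by
    have hs : (Icc 0 1 ×ˢ Metric.sphere 0 1 : Set (ℝ × (ℝ × (N → ℝ)))) ⊆
        ({p | p.2.1 = -1} ∪ {p | p.2.1 = 1}) ∪ {p | ‖p.2.2‖ = 1} := by
      rintro ⟨t, s, w⟩ ⟨-, h⟩
      rw [mem_sphere_zero_iff_norm, Prod.norm_def] at h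
      simp only [mem_union, mem_ofPred_eq]
      rcases max_choice ‖s‖ ‖w‖ with h' | h' <;> rw [h'] at h
      · rw [Real.norm_eq_abs, abs_eq zero_le_one] at h; tauto
      · tauto
    have c1 : IsClosed {p : ℝ × (ℝ × (N → ℝ)) | p.2.1 = -1} :=
      isClosed_eq (by fun_prop) (by fun_prop)
    have c2 : IsClosed {p : ℝ × (ℝ × (N → ℝ)) | p.2.1 = 1} :=
      isClosed_eq (by fun_prop) (by fun_prop)
    have c3 : IsClosed {p : ℝ × (ℝ × (N → ℝ)) | ‖p.2.2‖ = 1} :=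
      isClosed_eq (by fun_prop) (by fun_prop)
    refine ContinuousOn.mono ?_ hs
    refine ContinuousOn.union_of_isClosed (ContinuousOn.union_of_isClosed ?_ ?_ c1 c2) ?_
      (c1.union c2) c3
    · refine ContinuousOn.congr (f := fun p => F (c p.1, toCube p.2.2)) (by fun_prop) ?_
      intro p hp
      simp only [mem_ofPred_eq] at hp
      simp [b, hp]
    · refine ContinuousOn.congr (f := fun p => F' (c p.1, toCube p.2.2)) (by fun_prop) ?_
      intro p hp
      simp only [mem_ofPred_eq] at hp
      have : ¬ (1 : ℝ) = -1 := by norm_num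
      simp [b, hp, this]
    · refine ContinuousOn.congr (f := fun p => γ (c p.1)) (by fun_prop) ?_
      intro p hp
      have := toCube_mem_boundary hp
      simp only [b]
      split_ifs
      · exact hF _ _ this
      · exact hF' _ _ this
      · rfl
  obtain ⟨Φ, h1, h2, h3⟩ := exists_homotopy_extension (E := ℝ × (N → ℝ)) (X := X)
    (fun v => G (c ((v.1 + 1) / 2), toCube v.2)) b
    (by fun_prop) hb (by
      rintro ⟨s, w⟩ hv
      rw [mem_sphere_zero_iff_norm, Prod.norm_def] at hv
      have hc0 : c 0 = 0 := hcc 0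
      simp only [b, hc0]
      split_ifs with k1 k2
      · rw [k1, hF0]
        have : c ((-1 + 1) / 2) = 0 := by rw [← hcc 0]; simp
        rw [this, G.apply_zero]; rfl
      · rw [k2, hF0']
        have : c ((1 + 1) / 2) = 1 := by rw [← hcc 1]; simp
        rw [this, G.apply_one]; rfl
      · have hw : ‖w‖ = 1 := by
          rcases max_choice ‖s‖ ‖w‖ with h' | h' <;> simp only [h'] at hv
          · rw [Real.norm_eq_abs, abs_eq zero_le_one] at hv; tauto
          · exact hv
        have hw' := toCube_mem_boundary hw
        rw [G.eq_fst _ hw']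
        exact e0.trans (α.2 _ hw').symm)
  have hm : ∀ (s : I) (y : N → I), ((2 * (s : ℝ) - 1, ofCube y) : ℝ × (N → ℝ)) ∈
      Metric.closedBall (0 : ℝ × (N → ℝ)) 1 := fun s y => by
    rw [mem_closedBall_zero_iff, Prod.norm_def]
    refine max_le ?_ (norm_ofCube y)
    have := s.2
    rw [Real.norm_eq_abs, abs_le]
    constructor <;> linarith [this.1, this.2]
  have hK : Continuous fun p : I × (N → I) => Φ (1, (2 * (p.1 : ℝ) - 1, ofCube p.2)) :=
    h1.comp_continuous (by have := continuous_ofCube (N := N); fun_prop)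
      fun p => ⟨⟨zero_le_one, le_rfl⟩, hm _ _⟩
  have hc1 : c 1 = 1 := hcc 1
  have hside : ∀ (s : I) (y : N → I), (s = 0 ∨ s = 1 ∨ y ∈ Cube.boundary N) →
      Φ (1, (2 * (s : ℝ) - 1, ofCube y)) = b (1, (2 * (s : ℝ) - 1, ofCube y)) := by
    intro s y h
    refine h3 1 ⟨zero_le_one, le_rfl⟩ _ ?_
    have hle := mem_closedBall_zero_iff.1 (hm s y)
    rw [mem_sphere_zero_iff_norm]
    refine le_antisymm hle ?_
    rw [Prod.norm_def]
    rcases h with rfl | rfl | h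
    · refine le_max_of_le_left ?_; norm_num
    · refine le_max_of_le_left ?_; norm_num
    · exact le_max_of_le_right (norm_ofCube_of_mem_boundary h).ge
  have z0 : ∀ y, Φ (1, (2 * ((0 : I) : ℝ) - 1, ofCube y)) = β y := fun y => by
    rw [hside 0 y (Or.inl rfl)]
    simp [b, hc1, toCube_ofCube, hF1]
  have z1 : ∀ y, Φ (1, (2 * ((1 : I) : ℝ) - 1, ofCube y)) = β' y := fun y => by
    rw [hside 1 y (Or.inr (Or.inl rfl))]
    have k1 : ¬ (2 * ((1 : I) : ℝ) - 1) = -1 := by norm_num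
    have k2 : 2 * ((1 : I) : ℝ) - 1 = 1 := by norm_num
    simp only [b]
    rw [if_neg k1, if_pos k2, hc1, toCube_ofCube, hF1']
  refine ⟨⟨⟨⟨_, hK⟩, z0, z1⟩, ?_⟩⟩
  intro s y hy
  change Φ (1, (2 * (s : ℝ) - 1, ofCube y)) = β y
  rw [hside s y (Or.inr (Or.inr hy)), show β y = x₁ from β.2 y hy]
  simp only [b, hc1, toCube_ofCube]
  split_ifs
  · rw [hF _ _ hy, e1]
  · rw [hF' _ _ hy, e1]
  · exact e1

end ChangeOfBasePoint

section WeakEquivalences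

open unitInterval

variable {X Y Z : Type*} [TopologicalSpace X] [TopologicalSpace Y] [TopologicalSpace Z]

/-- A self-map homotopic to the identity acts bijectively on homotopy groups. -/
lemma bijective_piMap_of_homotopic_id {f : C(X, X)} (hf : f.Homotopic (ContinuousMap.id X))
    (n : ℕ) (x : X) : Function.Bijective (piMap f n x) := by
  obtain ⟨H⟩ := hf
  let γ : C(I, X) := ⟨fun t => H (t, x), by fun_prop⟩
  have e0 : γ 0 = f x := H.apply_zero x
  have e1 : γ 1 = x := H.apply_one x
  -- The homotopy transports `f ∘ α` to `α` along the track `γ` of the base point.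
  let tr : GenLoop (Fin n) X x → C(I × (Fin n → I), X) := fun α =>
    ⟨fun p => H (p.1, α p.2), by
      have := α.1.continuous
      exact H.continuous.comp (continuous_fst.prodMk (this.comp continuous_snd))⟩
  have tr0 : ∀ α y, tr α (0, y) = f (α y) := fun α y => H.apply_zero _
  have tr1 : ∀ α y, tr α (1, y) = α y := fun α y => H.apply_one _
  have trb : ∀ α t, ∀ y ∈ Cube.boundary (Fin n), tr α (t, y) = γ t := fun α t y hy => by
    change H (t, α y) = H (t, x)
    rw [show α y = x from α.2 y hy]
  let im : GenLoop (Fin n) X x → GenLoop (Fin n) X (f x) := fun α =>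
    ⟨f.comp α.1, fun y hy => congrArg f (α.2 y hy)⟩
  constructor
  · rintro ⟨α⟩ ⟨α'⟩ h
    have h' : GenLoop.Homotopic (im α) (im α') := Quotient.exact h
    exact Quotient.sound (homotopic_of_transport e0 e1 (tr0 α) (tr1 α) (trb α)
      (tr0 α') (tr1 α') (trb α') h')
  · rintro ⟨β⟩
    -- A preimage of the class of `β` is obtained by transport along `γ`. Its image and `β` are both
    -- transported to it, so they agree by transport along the reversed path.
    let β' : GenLoop (Fin n) X (γ 0) := ⟨β.1, fun y hy => (β.2 y hy).trans e0.symm⟩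
    obtain ⟨α, F, hF0, hF1, hF⟩ := exists_transport γ β'
    let α' : GenLoop (Fin n) X x := ⟨α.1, fun y hy => (α.2 y hy).trans e1⟩
    refine ⟨Quotient.mk _ α', Quotient.sound ?_⟩
    change GenLoop.Homotopic (im α') β
    let rev : C(I × (Fin n → I), X) → C(I × (Fin n → I), X) := fun F =>
      ⟨fun p => F (σ p.1, p.2), by fun_prop⟩
    have hr0 : ∀ F y, rev F (0, y) = F (1, y) := fun F y => by simp [rev]
    have hr1 : ∀ F y, rev F (1, y) = F (0, y) := fun F y => by simp [rev]
    refine homotopic_of_transport (γ := ⟨fun t => γ (σ t), by fun_prop⟩) (by simpa using e1)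
      (by simpa using e0)
      (α := α') (α' := α') (F := rev (tr α')) (F' := rev F)
      (fun y => by rw [hr0, tr1]) (fun y => by rw [hr1, tr0]; rfl) (fun t y hy => trb α' _ y hy)
      (fun y => by rw [hr0, hF1]; rfl) (fun y => by rw [hr1, hF0]; rfl) (fun t y hy => hF _ y hy)
      (GenLoop.Homotopic.refl _)

lemma pathComponentMap_of_homotopic_id {f : C(X, X)} (hf : f.Homotopic (ContinuousMap.id X)) :
    pathComponentMap f = id := by
  obtain ⟨H⟩ := hf
  ext ⟨x⟩
  exact Quotient.sound ⟨⟨⟨fun t => H (t, x), by fun_prop⟩, H.apply_zero x, H.apply_one x⟩⟩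

lemma piMap_comp (g : C(Y, Z)) (f : C(X, Y)) (n : ℕ) (x : X) :
    piMap (g.comp f) n x = piMap g n (f x) ∘ piMap f n x := by
  ext ⟨α⟩
  rfl

lemma pathComponentMap_comp (g : C(Y, Z)) (f : C(X, Y)) :
    pathComponentMap (g.comp f) = pathComponentMap g ∘ pathComponentMap f := by
  ext ⟨α⟩
  rfl

/-- A homotopy equivalence is a weak homotopy equivalence. On homotopy groups, `g ∘ f` and `f ∘ g`
being bijective leaves a middle map, induced by `g`, that is injective and surjective. -/
theorem isWeakHomotopyEquiv_of_homotopic (f : C(X, Y)) (g : C(Y, X))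
    (h1 : (g.comp f).Homotopic (ContinuousMap.id X))
    (h2 : (f.comp g).Homotopic (ContinuousMap.id Y)) : IsWeakHomotopyEquiv f := by
  refine ⟨f.continuous, ?_, fun n x => ?_⟩
  · have e1 := pathComponentMap_of_homotopic_id h1
    have e2 := pathComponentMap_of_homotopic_id h2
    rw [pathComponentMap_comp] at e1 e2
    exact Function.bijective_iff_has_inverse.2 ⟨pathComponentMap g, congrFun e1, congrFun e2⟩
  · have b1 := bijective_piMap_of_homotopic_id h1 n x
    have b2 := bijective_piMap_of_homotopic_id h2 n (f x)
    have c1 : piMap (g.comp f) n x = piMap g n (f x) ∘ piMap f n x := piMap_comp g f n x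
    have c2 : piMap (f.comp g) n (f x) = piMap f n (g (f x)) ∘ piMap g n (f x) :=
      piMap_comp f g n (f x)
    rw [c1] at b1
    rw [c2] at b2
    have hg : Function.Bijective (piMap g n (f x)) :=
      ⟨b2.1.of_comp, b1.2.of_comp⟩
    exact (hg.of_comp_iff' _).1 b1

end WeakEquivalences

/-! ### Loops spread over families of arcs -/

section LoopActions

/-- The midpoint of the unit interval. -/
def half : unitInterval := ⟨1 / 2, by norm_num, by norm_num⟩

/-- Arcs of the circle of length at most `2π`, traversed linearly: the linear arcs, and the images
of linear intervals under `wrap`. -/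
def IsClosedArc (f : C(unitInterval, Circle)) : Prop :=
  ∃ a s : ℝ, 0 < s ∧ s ≤ 2 * Real.pi ∧ ∀ t : unitInterval, f t = Circle.exp (a + s * t)

lemma IsLinearArc.lt_two_pi {f : C(unitInterval, Circle)} (hf : Function.Injective f) {a s : ℝ}
    (hs : 0 < s)
    (h : ∀ t : unitInterval, f t = Circle.exp (a + s * t)) : s < 2 * Real.pi := by
  by_contra hlt
  push Not at hlt
  have hp := Real.two_pi_pos
  let t : unitInterval := ⟨2 * Real.pi / s, by positivity, (div_le_one hs).2 hlt⟩
  have e : f t = f 0 := by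
    rw [h, h]
    have : a + s * (t : ℝ) = a + s * ((0 : unitInterval) : ℝ) + 2 * Real.pi := by
      simp only [t, Icc.coe_zero]; field_simp; ring
    rw [this, Circle.exp_add_two_pi]
  have := congrArg (fun t : unitInterval => (t : ℝ)) (hf e)
  simp only [t, Icc.coe_zero] at this
  have h2 : 0 < 2 * Real.pi / s := by positivity
  linarith

lemma IsLinearArc.isClosedArc {f : C(unitInterval, Circle)} (hf : IsLinearArc f) :
    IsClosedArc f := by
  obtain ⟨hi, a, s, hs, h⟩ := hf
  exact ⟨a, s, hs, (IsLinearArc.lt_two_pi hi hs h).le, h⟩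

lemma continuous_wrap : Continuous wrap := by unfold wrap; fun_prop

lemma wrap_zero : wrap 0 = 1 := by simp [wrap]

lemma wrap_one : wrap 1 = 1 := by simp [wrap]

lemma wrap_eq_wrap {t t' : unitInterval} (h : wrap t = wrap t') :
    t = t' ∨ (t = 0 ∧ t' = 1) ∨ (t = 1 ∧ t' = 0) := by
  unfold wrap at h
  obtain ⟨m, hm⟩ := Circle.exp_eq_exp.1 h
  have hp := Real.two_pi_pos
  have e : (t : ℝ) = t' + m := by
    have : 2 * Real.pi * (t - t' - m) = 0 := by linarith
    rcases mul_eq_zero.1 this with h | h <;> linarith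
  have a1 := t.2.1; have a2 := t.2.2; have a3 := t'.2.1; have a4 := t'.2.2
  have b1 : (m : ℝ) ≤ 1 := by linarith
  have b2 : (-1 : ℝ) ≤ m := by linarith
  have b1' : m ≤ 1 := by exact_mod_cast b1
  have b2' : -1 ≤ m := by exact_mod_cast b2
  have : m = -1 ∨ m = 0 ∨ m = 1 := by omega
  rcases this with rfl | rfl | rfl
  · right; left
    push_cast at e
    exact ⟨Subtype.ext (by simp only [Icc.coe_zero]; linarith),
      Subtype.ext (by simp only [Icc.coe_one]; linarith)⟩
  · left; push_cast at e; exact Subtype.ext (by linarith)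
  · right; right
    push_cast at e
    exact ⟨Subtype.ext (by simp only [Icc.coe_one]; linarith),
      Subtype.ext (by simp only [Icc.coe_zero]; linarith)⟩

/-- The composition of `wrap` and a map of the interval. -/
def wrapMap (f : C(unitInterval, unitInterval)) : C(unitInterval, Circle) :=
  (⟨wrap, continuous_wrap⟩ : C(unitInterval, Circle)).comp f

lemma continuous_wrapMap : Continuous wrapMap := ContinuousMap.continuous_postcomp _

lemma IsLinearInterval.isClosedArc {f : C(unitInterval, unitInterval)} (hf : IsLinearInterval f) :
    IsClosedArc (wrapMap f) := by
  obtain ⟨a, s, hs, h⟩ := hf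
  have hp := Real.two_pi_pos
  refine ⟨2 * Real.pi * a, 2 * Real.pi * s, by positivity, ?_, fun t => ?_⟩
  · have h0 := (f 0).2.1
    have h1 := (f 1).2.2
    rw [h] at h0 h1
    simp only [Icc.coe_zero, Icc.coe_one] at h0 h1
    nlinarith
  · change wrap (f t) = _
    rw [wrap, h]; congr 1; ring

/-- The interior of an arc, described by its centre and its half-length. -/
lemma IsClosedArc.mem_interior {f : C(unitInterval, Circle)} (hf : IsClosedArc f) (z : Circle) :
    z ∈ f '' Ioo 0 1 ↔ Real.arccos ((z / f half : Circle) : ℂ).re <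
      Real.arccos ((f 1 / f half : Circle) : ℂ).re := by
  have key : ∀ w : Circle, Real.arccos (w : ℂ).re = |Complex.arg w| := fun w => by
    have h1 : (w : ℂ).re = Real.cos |Complex.arg w| := by
      rw [Real.cos_abs, Complex.cos_arg (Circle.coe_ne_zero w), Circle.norm_coe, div_one]
    rw [h1, Real.arccos_cos (abs_nonneg _) (Complex.abs_arg_le_pi _)]
  obtain ⟨a, s, hs, hs', h⟩ := hf
  have hp := Real.pi_pos
  have e : f 1 / f half = Circle.exp (s / 2) := by
    rw [h, h, ← Circle.exp_sub]; congr 1; simp only [Icc.coe_one, half]; ring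
  rw [key (z / f half), e, key (Circle.exp (s / 2)), Circle.arg_exp (by linarith) (by linarith),
    abs_of_pos (show 0 < s / 2 by linarith),
    ← Circle.mem_centeredArc (by linarith), Circle.centeredArc]
  constructor
  · rintro ⟨t, ht, rfl⟩
    have h0 : (0 : ℝ) < t := ht.1
    have h1 : (t : ℝ) < 1 := ht.2
    refine ⟨s * (t - 1 / 2), ?_, ?_⟩
    · simp only [mem_ofPred_eq]
      rw [abs_lt]; constructor <;> nlinarith
    · rw [h, h, ← Circle.exp_sub]; congr 1; simp only [half]; ring
  · rintro ⟨x, hx, hxz⟩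
    simp only [mem_ofPred_eq] at hx
    rw [abs_lt] at hx
    have k1 : 0 < x / s + 1 / 2 := by
      have : x / s + 1 / 2 = (x + s / 2) / s := by field_simp
      rw [this]; apply div_pos <;> linarith
    have k2 : x / s + 1 / 2 < 1 := by
      have : x / s + 1 / 2 = (x + s / 2) / s := by field_simp
      rw [this, div_lt_one hs]; linarith
    refine ⟨⟨x / s + 1 / 2, k1.le, k2.le⟩, ⟨k1, k2⟩, ?_⟩
    rw [eq_div_iff_mul_eq', h, ← Circle.exp_add] at hxz
    rw [h, ← hxz]; congr 1; simp only [half]; field_simp; ring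

variable {X : Type*} [TopologicalSpace X] {b : X} {n : ℕ}

/-- Families of arcs with disjoint interiors. -/
def closedArcSet (n : ℕ) : Set (Fin n → C(unitInterval, Circle)) :=
  {d | (∀ a, IsClosedArc (d a)) ∧ DisjointInteriors d}

lemma loop_wrap_endpoint (φ : BasedLoopSpace X b) {t : unitInterval}
    (ht : t ∉ Ioo (0 : unitInterval) 1) : φ.1 (wrap t) = b := by
  have : t = 0 ∨ t = 1 := by
    by_contra hne
    push Not at hne
    exact ht ⟨lt_of_le_of_ne t.2.1 hne.1.symm, lt_of_le_of_ne t.2.2 hne.2⟩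
  rcases this with rfl | rfl
  · rw [wrap_zero, φ.2]
  · rw [wrap_one, φ.2]

lemma isOpen_interior {f : C(unitInterval, Circle)} (hf : IsClosedArc f) :
    IsOpen (f '' Ioo 0 1) := by
  have : f '' Ioo 0 1 = {z | Real.arccos ((z / f half : Circle) : ℂ).re <
      Real.arccos ((f 1 / f half : Circle) : ℂ).re} :=
    Set.ext hf.mem_interior
  rw [this]
  refine isOpen_lt (Real.continuous_arccos.comp (Complex.continuous_re.comp
    (continuous_subtype_val.comp (continuous_id.div' continuous_const)))) continuous_const

/-- Different arcs with disjoint interiors meet in endpoints only, since the interiors are open. -/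
lemma not_mem_Ioo_of_meet {d : Fin n → C(unitInterval, Circle)} (hd : d ∈ closedArcSet n)
    {j j' : Fin n} (hne : j ≠ j') {t t' : unitInterval} (h : d j t = d j' t') :
    t ∉ Ioo (0 : unitInterval) 1 := by
  intro ht
  have ho := isOpen_interior (hd.1 j)
  have hU : IsOpen (d j' ⁻¹' (d j '' Ioo 0 1)) := ho.preimage (d j').continuous
  have ht' : t' ∈ closure (Ioo (0 : unitInterval) 1) := by
    rw [closure_Ioo zero_ne_one]; exact ⟨t'.2.1, t'.2.2⟩
  obtain ⟨s, hs1, hs2⟩ := mem_closure_iff.1 ht' _ hU ⟨t, ht, h⟩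
  exact Set.disjoint_left.1 (hd.2 j j' hne) hs1 ⟨s, hs2, rfl⟩

/-- The loop spread over the arcs is well defined: a point that is reached in two ways is an
endpoint of the arcs involved, where all loops have the value `b`. This includes the endpoints of a
single arc of length `2π`. -/
lemma loop_value_unique {d : Fin n → C(unitInterval, Circle)} (hd : d ∈ closedArcSet n)
    (φ : Fin n → BasedLoopSpace X b) {j j' : Fin n} {t t' : unitInterval} (h : d j t = d j' t') :
    (φ j).1 (wrap t) = (φ j').1 (wrap t') := by
  by_cases hne : j = j'
  · subst hne
    obtain ⟨a, s, hs, hs', hd⟩ := hd.1 j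
    rw [hd, hd] at h
    obtain ⟨m, hm⟩ := Circle.exp_eq_exp.1 h
    have hp := Real.two_pi_pos
    by_cases hm0 : m = 0
    · subst hm0
      have : s * ((t : ℝ) - t') = 0 := by push_cast at hm; linarith
      rcases mul_eq_zero.1 this with h | h
      · exact absurd h hs.ne'
      · rw [show t = t' from Subtype.ext (by linarith)]
    · have e : s * ((t : ℝ) - t') = m * (2 * Real.pi) := by linarith
      have a1 := t.2.1; have a2 := t.2.2; have a3 := t'.2.1; have a4 := t'.2.2
      have hend : t ∉ Ioo (0 : unitInterval) 1 ∧ t' ∉ Ioo (0 : unitInterval) 1 := by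
        have hm1 : (1 : ℝ) ≤ m ∨ (m : ℝ) ≤ -1 := by
          rcases lt_or_gt_of_ne hm0 with h | h
          · right; exact_mod_cast (by omega : m ≤ -1)
          · left; exact_mod_cast h
        constructor <;> rintro ⟨h1, h2⟩
        · have h1 : (0 : ℝ) < t := h1
          have h2 : (t : ℝ) < 1 := h2
          rcases hm1 with h | h <;> nlinarith
        · have h1 : (0 : ℝ) < t' := h1
          have h2 : (t' : ℝ) < 1 := h2
          rcases hm1 with h | h <;> nlinarith
      rw [loop_wrap_endpoint _ hend.1, loop_wrap_endpoint _ hend.2]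
  · rw [loop_wrap_endpoint _ (not_mem_Ioo_of_meet hd hne h),
      loop_wrap_endpoint _ (not_mem_Ioo_of_meet hd (Ne.symm hne) h.symm)]

open Classical in
/-- The loop running through `φ j` on the `j`-th arc, and constant outside of the arcs. -/
def spread (d : Fin n → C(unitInterval, Circle)) (φ : Fin n → BasedLoopSpace X b)
    (z : Circle) : X :=
  if h : ∃ p : Fin n × unitInterval, d p.1 p.2 = z then (φ h.choose.1).1 (wrap h.choose.2) else b

lemma spread_apply {d : Fin n → C(unitInterval, Circle)} (hd : d ∈ closedArcSet n)
    (φ : Fin n → BasedLoopSpace X b) (j : Fin n) (t : unitInterval) :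
    spread d φ (d j t) = (φ j).1 (wrap t) := by
  have h : ∃ p : Fin n × unitInterval, d p.1 p.2 = d j t := ⟨(j, t), rfl⟩
  unfold spread
  rw [dif_pos h]
  exact loop_value_unique hd φ h.choose_spec

lemma spread_of_notMem {d : Fin n → C(unitInterval, Circle)} (φ : Fin n → BasedLoopSpace X b)
    {z : Circle} (hz : ∀ j, z ∉ range (d j)) : spread d φ z = b := by
  unfold spread
  rw [dif_neg]
  rintro ⟨p, hp⟩
  exact hz p.1 ⟨p.2, hp⟩

lemma eq_spread {d : Fin n → C(unitInterval, Circle)} (hd : d ∈ closedArcSet n)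
    {φ : Fin n → BasedLoopSpace X b} {g : Circle → X}
    (h1 : ∀ j t, g (d j t) = (φ j).1 (wrap t)) (h2 : ∀ z, (∀ j, z ∉ range (d j)) → g z = b) :
    g = spread d φ := by
  ext z
  by_cases hz : ∀ j, z ∉ range (d j)
  · rw [h2 z hz, spread_of_notMem φ hz]
  · push Not at hz
    obtain ⟨j, t, rfl⟩ := hz
    rw [h1, spread_apply hd]

/-- The spread loop depends continuously on all data: preimages of closed sets are projections of
closed sets along the compact interval, up to the closed complement of the open arcs. -/
lemma continuous_spread : Continuous
    fun p : (closedArcSet n × (Fin n → BasedLoopSpace X b)) × Circle =>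
      spread p.1.1.1 p.1.2 p.2 := by
  have hev : ∀ j : Fin n, Continuous
      fun q : ((closedArcSet n × (Fin n → BasedLoopSpace X b)) × Circle) × unitInterval =>
        q.1.1.1.1 j q.2 := fun j => by
    have h1 : Continuous fun q :
        ((closedArcSet n × (Fin n → BasedLoopSpace X b)) × Circle) × unitInterval =>
      q.1.1.1.1 j := (continuous_apply j).comp (continuous_subtype_val.comp
        (continuous_fst.comp (continuous_fst.comp continuous_fst)))
    exact ContinuousEval.continuous_eval.comp (h1.prodMk continuous_snd)
  have hev' : ∀ (j : Fin n) (t : unitInterval), Continuous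
      fun q : (closedArcSet n × (Fin n → BasedLoopSpace X b)) × Circle => q.1.1.1 j t :=
    fun j t => (hev j).comp (continuous_id.prodMk continuous_const)
  refine continuous_iff_isClosed.2 fun C hC => ?_
  -- `K j` lies over the points of the `j`-th arc with value in `C`, and `G` consists of the points
  -- outside of the open arcs, if `b ∈ C`
  let K : Fin n →
      Set (((closedArcSet n × (Fin n → BasedLoopSpace X b)) × Circle) × unitInterval) := fun j =>
    {q | q.1.1.1.1 j q.2 = q.1.2 ∧ (q.1.1.2 j).1 (wrap q.2) ∈ C}
  have hK : ∀ j, IsClosed (K j) := fun j => by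
    refine (isClosed_eq (hev j) (by fun_prop)).inter (hC.preimage ?_)
    have h1 : Continuous fun q :
        ((closedArcSet n × (Fin n → BasedLoopSpace X b)) × Circle) × unitInterval =>
      (q.1.1.2 j).1 := by fun_prop
    exact ContinuousEval.continuous_eval.comp (h1.prodMk (continuous_wrap.comp continuous_snd))
  let G : Set ((closedArcSet n × (Fin n → BasedLoopSpace X b)) × Circle) :=
    {q | b ∈ C ∧ ∀ j, q.2 ∉ q.1.1.1 j '' Ioo 0 1}
  have hG : IsClosed G := by
    refine isClosed_const.inter ?_
    have : {q : (closedArcSet n × (Fin n → BasedLoopSpace X b)) × Circle |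
        ∀ j, q.2 ∉ q.1.1.1 j '' Ioo 0 1} = ⋂ j,
        {q | Real.arccos ((q.1.1.1 j 1 / q.1.1.1 j half : Circle) : ℂ).re
          ≤ Real.arccos ((q.2 / q.1.1.1 j half : Circle) : ℂ).re} := by
      ext q
      simp only [mem_ofPred_eq, mem_iInter]
      exact forall_congr' fun j => by rw [(q.1.1.2.1 j).mem_interior, not_lt]
    change IsClosed {q : (closedArcSet n × (Fin n → BasedLoopSpace X b)) × Circle |
        ∀ j, q.2 ∉ q.1.1.1 j '' Ioo 0 1}
    rw [this]
    refine isClosed_iInter fun j => isClosed_le ?_ ?_ <;>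
    refine Real.continuous_arccos.comp (Complex.continuous_re.comp (continuous_subtype_val.comp ?_))
    · exact (hev' j _).div' (hev' j _)
    · exact continuous_snd.div' (hev' j _)
  have e : (fun p : (closedArcSet n × (Fin n → BasedLoopSpace X b)) × Circle =>
      spread p.1.1.1 p.1.2 p.2) ⁻¹' C = (⋃ j, Prod.fst '' K j) ∪ G := by
    ext ⟨⟨d, φ⟩, z⟩
    simp only [mem_preimage, mem_union, mem_iUnion, mem_image]
    constructor
    · intro h
      by_cases hz : ∀ j, z ∉ range (d.1 j)
      · right
        rw [spread_of_notMem φ hz] at h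
        exact ⟨h, fun j hj => hz j (image_subset_range _ _ hj)⟩
      · left
        push Not at hz
        obtain ⟨j, t, rfl⟩ := hz
        rw [spread_apply d.2] at h
        exact ⟨j, (((d, φ), d.1 j t), t), ⟨rfl, h⟩, rfl⟩
    · rintro (⟨j, ⟨_, t⟩, ⟨h1, h2⟩, rfl⟩ | ⟨h1, h2⟩)
      · simp only at h1 h2
        rw [← h1, spread_apply d.2]
        exact h2
      · by_cases hz : ∀ j, z ∉ range (d.1 j)
        · rwa [spread_of_notMem φ hz]
        · push Not at hz
          obtain ⟨j, t, rfl⟩ := hz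
          rw [spread_apply d.2, loop_wrap_endpoint]
          · exact h1
          · exact fun ht => h2 j ⟨t, ht, rfl⟩
  rw [e]
  exact (isClosed_iUnion_of_finite fun j => isClosedMap_fst_of_compactSpace _ (hK j)).union hG

/-- The spread loop as a point of the free loop space. -/
def spreadLoop (d : closedArcSet n) (φ : Fin n → BasedLoopSpace X b) : FreeLoopSpace X :=
  ⟨spread d.1 φ, continuous_spread.comp (Continuous.prodMk_right (d, φ))⟩

lemma continuous_spreadLoop : Continuous
    fun p : closedArcSet n × (Fin n → BasedLoopSpace X b) => spreadLoop p.1 p.2 :=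
  ContinuousMap.continuous_of_continuous_uncurry _ continuous_spread

lemma spread_perm {d : Fin n → C(unitInterval, Circle)} (hd : d ∈ closedArcSet n)
    (σ : Equiv.Perm (Fin n)) (φ : Fin n → BasedLoopSpace X b) :
    spread (fun a => d (σ a)) φ = spread d (fun a => φ (σ⁻¹ a)) := by
  refine (eq_spread (φ := φ)
    ⟨fun a => hd.1 _, disjointInteriors_perm hd.2 σ⟩ (fun j t => ?_) fun z hz => ?_).symm
  · rw [spread_apply hd]; simp
  · refine spread_of_notMem _ fun j => ?_
    have := hz (σ⁻¹ j)
    simpa using this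

lemma wrapMap_mem (c : intervalSet n) :
    (fun j => wrapMap (c.1 j)) ∈ closedArcSet n := by
  refine ⟨fun j => (c.2.1 j).isClosedArc, fun j j' hne => ?_⟩
  have hc := c.2.2 j j' hne
  rw [Set.disjoint_left] at hc ⊢
  rintro _ ⟨t, ht, rfl⟩ ⟨t', ht', h⟩
  have k := (c.2.1 j).image_subset ⟨t, ht, rfl⟩
  have k' := (c.2.1 j').image_subset ⟨t', ht', rfl⟩
  rcases wrap_eq_wrap h with e | ⟨e, -⟩ | ⟨e, -⟩
  · exact hc ⟨t, ht, rfl⟩ ⟨t', ht', e⟩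
  · exact k'.1.ne' e
  · exact k'.2.ne e

lemma spread_wrapMap_one (c : intervalSet n) (φ : Fin n → BasedLoopSpace X b) :
    spread (fun j => wrapMap (c.1 j)) φ 1 = b := by
  by_cases hz : ∀ j, (1 : Circle) ∉ range (wrapMap (c.1 j))
  · exact spread_of_notMem φ hz
  · push Not at hz
    obtain ⟨j, t, ht⟩ := hz
    rw [← ht]
    refine (spread_apply (wrapMap_mem c) φ j t).trans (loop_wrap_endpoint _ fun hI => ?_)
    have k := (c.2.1 j).image_subset ⟨_, hI, rfl⟩
    rw [← wrap_zero] at ht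
    rcases wrap_eq_wrap ht with e | ⟨e, -⟩ | ⟨e, -⟩
    · exact k.1.ne' e
    · exact k.1.ne' e
    · exact k.2.ne e

/-- The based loop obtained by spreading loops over linear intervals. -/
def intervalLoop (c : intervalSet n) (φ : Fin n → BasedLoopSpace X b) : BasedLoopSpace X b :=
  ⟨spreadLoop ⟨fun j => wrapMap (c.1 j), wrapMap_mem c⟩ φ, spread_wrapMap_one c φ⟩

lemma intervalLoop_apply (c : intervalSet n) (φ : Fin n → BasedLoopSpace X b) (j : Fin n)
    (t : unitInterval) : (intervalLoop c φ).1 (wrap (c.1 j t)) = (φ j).1 (wrap t) :=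
  spread_apply (wrapMap_mem c) φ j t

lemma intervalLoop_of_notMem (c : intervalSet n) (φ : Fin n → BasedLoopSpace X b) {t : unitInterval}
    (ht : ∀ j, t ∉ range (c.1 j)) : (intervalLoop c φ).1 (wrap t) = b := by
  by_cases h : t ∈ Ioo (0 : unitInterval) 1
  · refine spread_of_notMem φ fun j => ?_
    rintro ⟨t', h'⟩
    rcases wrap_eq_wrap h' with e | ⟨-, e⟩ | ⟨-, e⟩
    · exact ht j ⟨t', e⟩
    · exact h.2.ne e
    · exact h.1.ne' e
  · exact loop_wrap_endpoint _ h

/-- Spreading over the composition of arcs with intervals may be done in two steps: first over the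
intervals inserted in the arc `i`, then over the arcs. -/
lemma spread_insMaps {k l : ℕ} (i : Fin k) (h : n + 1 = k + l) {d : Fin k → C(unitInterval, Circle)}
    (hd : d ∈ closedArcSet k) (c : intervalSet l) (φ : Fin n → BasedLoopSpace X b)
    (hdc : insMaps i h d c.1 ∈ closedArcSet n) :
    spread (insMaps i h d c.1) φ = spread d (plug i h (intervalLoop c) φ) := by
  have hpl : ∀ j : Fin n, ¬ InBlock i l j → plug i h (intervalLoop c) φ (outer i h j) = φ j := by
    intro j hj
    have hs := outer_spec i h j
    unfold plug
    split_ifs with h1 h2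
    · congr 1; rw [Fin.ext_iff]; simp only [InBlock] at *; omega
    · exfalso; simp only [InBlock] at *; omega
    · congr 1; rw [Fin.ext_iff]; simp only [InBlock] at *; omega
  have hpi : plug i h (intervalLoop c) φ i = intervalLoop c fun a => φ (inner i h a) := by
    unfold plug; simp
  refine (eq_spread hdc (fun j t => ?_) fun z hz => ?_).symm
  · unfold insMaps
    split_ifs with hb
    · rw [ContinuousMap.comp_apply, spread_apply hd, hpi, intervalLoop_apply]
      congr 3
      rw [Fin.ext_iff]; simp only [inner, sub, InBlock] at *; omega
    · rw [spread_apply hd, hpl j hb]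
  · by_cases hz' : ∀ a, z ∉ range (d a)
    · exact spread_of_notMem _ hz'
    · push Not at hz'
      obtain ⟨a, t, rfl⟩ := hz'
      rw [spread_apply hd]
      by_cases ha : a = i
      · subst ha
        rw [hpi]
        refine intervalLoop_of_notMem c _ fun e => ?_
        rintro ⟨t', rfl⟩
        have hb : InBlock a l (inner a h e : Fin n) := by
          have := e.2
          simp only [inner, InBlock]; omega
        refine hz (inner a h e) ⟨t', ?_⟩
        unfold insMaps
        rw [dif_pos hb, ContinuousMap.comp_apply]
        have es : sub hb = e := by rw [Fin.ext_iff]; simp [sub, inner]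
        rw [es]
      · exfalso
        -- a label `a ≠ i` survives the insertion, shifted by `l - 1` if it comes after `i`
        obtain ⟨j, hj⟩ : ∃ j : Fin n, outer i h j = a ∧ ¬ InBlock i l j := by
          have h1 := a.2
          have h3 : (a : ℕ) ≠ i := fun e => ha (Fin.ext e)
          by_cases h2 : (a : ℕ) < i
          · refine ⟨⟨a, by omega⟩, ?_, ?_⟩
            · have := outer_spec i h ⟨a, by omega⟩
              rw [Fin.ext_iff]; simp only [InBlock] at *; omega
            · simp only [InBlock]; omega
          · refine ⟨⟨a + l - 1, by omega⟩, ?_, ?_⟩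
            · have := outer_spec i h ⟨a + l - 1, by omega⟩
              rw [Fin.ext_iff]; simp only [InBlock] at *; omega
            · simp only [InBlock]; omega
        refine hz j ⟨t, ?_⟩
        unfold insMaps
        rw [dif_neg hj.2, hj.1]

lemma continuous_intervalLoop : Continuous
    fun x : intervalSet n × (Fin n → BasedLoopSpace X b) => intervalLoop x.1 x.2 := by
  refine Continuous.subtype_mk (continuous_spreadLoop.comp (Continuous.prodMk ?_ continuous_snd)) _
  refine Continuous.subtype_mk (continuous_pi fun j => continuous_wrapMap.comp ?_) _
  exact (continuous_apply j).comp (continuous_subtype_val.comp continuous_fst)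

lemma wrapMap_insMaps {k l : ℕ} (i : Fin k) (h : n + 1 = k + l)
    (p : Fin k → C(unitInterval, unitInterval)) (q : Fin l → C(unitInterval, unitInterval)) :
    (fun j : Fin n => wrapMap (insMaps i h p q j)) = insMaps i h (fun j => wrapMap (p j)) q := by
  ext j : 1
  unfold insMaps
  split_ifs <;> rfl

/-- The classical action of the little intervals on a based loop space. -/
def loopAlgebra (X : Type*) [TopologicalSpace X] (b : X) :
    OperadAlgebra littleIntervals (BasedLoopSpace X b) where
  map c φ := intervalLoop c φ
  continuous_map _ := continuous_intervalLoop
  map_act c σ φ := Subtype.ext (ContinuousMap.ext fun z =>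
    congrFun (spread_perm (wrapMap_mem c) σ φ) z)
  map_unit φ := by
    refine Subtype.ext (ContinuousMap.ext fun z => ?_)
    obtain ⟨t, rfl⟩ : ∃ t, wrap t = z := by
      have hp := Real.two_pi_pos
      obtain ⟨x, hx⟩ := Circle.exp_surjective z
      have := Circle.periodic_exp.exists_mem_Ico₀ hp x
      obtain ⟨y, hy, hxy⟩ := this
      refine ⟨⟨y / (2 * Real.pi), div_nonneg hy.1 hp.le, (div_le_one hp).2 hy.2.le⟩, ?_⟩
      rw [wrap, ← hx, hxy]; congr 1; simp only; field_simp
    exact intervalLoop_apply (n := 1) littleIntervals.unit φ 0 t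
  map_comp {k l n} i h p q φ := Subtype.ext (ContinuousMap.ext fun z => by
    have hm := wrapMap_mem (n := n) (littleIntervals.comp i h p q)
    have e := wrapMap_insMaps (n := n) i h p.1 q.1
    change spread (fun j => wrapMap (insMaps i h p.1 q.1 j)) φ z = spread _ _ z
    change (fun j => wrapMap (insMaps i h p.1 q.1 j)) ∈ _ at hm
    rw [e] at hm ⊢
    exact congrFun (spread_insMaps i h (wrapMap_mem p) q φ hm) z)

lemma isClassicalAction_loopAlgebra (X : Type*) [TopologicalSpace X] (b : X) :
    IsClassicalAction (loopAlgebra X b) := fun _ c φ =>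
  ⟨intervalLoop_apply c φ, fun _ ht => intervalLoop_of_notMem c φ ht⟩

lemma mem_closedArcSet_of_mem_arcSet {d : Fin n → C(unitInterval, Circle)} (hd : d ∈ arcSet n) :
    d ∈ closedArcSet n := ⟨fun a => (hd.1 a).isClosedArc, hd.2⟩

/-- The trace of the little intervals in the circle on a free loop space. -/
def loopTrace (X : Type*) [TopologicalSpace X] (b : X) :
    Trace circleIntervals (loopAlgebra X b) (FreeLoopSpace X) where
  map d φ := spreadLoop ⟨d.1, mem_closedArcSet_of_mem_arcSet d.2⟩ φ
  continuous_map _ := continuous_spreadLoop.comp (Continuous.prodMk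
    (Continuous.subtype_mk (continuous_subtype_val.comp continuous_fst) _) continuous_snd)
  map_act d σ φ := ContinuousMap.ext fun z =>
    congrFun (spread_perm (mem_closedArcSet_of_mem_arcSet d.2) σ φ) z
  map_comp i h d c φ := ContinuousMap.ext fun z =>
    congrFun (spread_insMaps i h (mem_closedArcSet_of_mem_arcSet d.2) c φ
      (mem_closedArcSet_of_mem_arcSet (insMaps_mem_arcSet i h d.2 c.2))) z

lemma isLoopTrace_loopTrace (X : Type*) [TopologicalSpace X] (b : X) :
    IsLoopTrace (loopTrace X b) := fun _ d φ =>
  ⟨spread_apply (mem_closedArcSet_of_mem_arcSet d.2) φ, fun _ hz => spread_of_notMem φ hz⟩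

/-- The trace obtained by restriction along a homomorphism of right modules. -/
def Trace.restrict {P Q : TopOperad} {ρ : OperadHom P Q} {M : RightModule P} {N : RightModule Q}
    {U : Type*} [TopologicalSpace U] {A : OperadAlgebra Q U} {V : Type*} [TopologicalSpace V]
    (T : Trace N A V) (f : ModuleHom ρ M N) : Trace M (A.restrict ρ) V where
  map m u := T.map (f.map m) u
  continuous_map n :=
    (T.continuous_map n).comp (((f.continuous_map n).comp continuous_fst).prodMk continuous_snd)
  map_act m σ u := by rw [f.map_act, T.map_act]
  map_comp i h m p u := by rw [f.map_comp, T.map_comp]; rfl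

end LoopActions

/-! ### Restriction and collapse of coordinates -/

section Coordinates

variable {E : Type*} {k l n m : ℕ}

/-- Restriction of a configuration on the line along a map of labels. -/
def linePull (p : LineCoord n) (f : Fin k → Fin n) : LineCoord k :=
  (fun a b => p.1 (f a) (f b), fun a b c => p.2 (f a) (f b) (f c))

/-- Restriction of a configuration on the circle along a map of labels. -/
def circlePull (p : CircleCoord n) (f : Fin k → Fin n) : CircleCoord k :=
  (fun a => p.1 (f a), fun a b => p.2.1 (f a) (f b), fun a b c => p.2.2 (f a) (f b) (f c))

/-- The component of the directions of a configuration on the circle along the unit tangent vectors,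
together with the relative distances. On points that have collided these are the coordinates of the
infinitesimal configuration on the tangent line. -/
def circleLin (p : CircleCoord n) : LineCoord n :=
  (fun a b => (p.2.1 a b * (starRingEnd ℂ) (Complex.I * (p.1 a : ℂ))).re, p.2.2)

lemma continuous_linePull (f : Fin k → Fin n) : Continuous fun p : LineCoord n => linePull p f := by
  unfold linePull; fun_prop

lemma continuous_circlePull (f : Fin k → Fin n) :
    Continuous fun p : CircleCoord n => circlePull p f := by
  unfold circlePull; fun_prop

lemma continuous_circleLin : Continuous fun p : CircleCoord n => circleLin p := by
  unfold circleLin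
  refine Continuous.prodMk (continuous_pi fun a => continuous_pi fun b => ?_) (by fun_prop)
  refine Complex.continuous_re.comp (Continuous.mul (by fun_prop) ?_)
  exact Complex.continuous_conj.comp (by fun_prop)

lemma linePull_mem {p : LineCoord n} (hp : p ∈ assocSet n) {f : Fin k → Fin n}
    (hf : Function.Injective f) (hk : 0 < k) : linePull p f ∈ assocSet k := by
  refine ⟨hk, map_mem_closure (f := fun p => linePull p f) (continuous_linePull f) hp.2 ?_⟩
  rintro _ ⟨x, hx, rfl⟩
  exact ⟨x ∘ f, Function.Injective.comp hx hf, rfl⟩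

lemma circlePull_mem {p : CircleCoord n} (hp : p ∈ cycloSet n) {f : Fin k → Fin n}
    (hf : Function.Injective f) : circlePull p f ∈ cycloSet k := by
  refine map_mem_closure (f := fun p => circlePull p f) (continuous_circlePull f) hp ?_
  rintro _ ⟨x, hx, rfl⟩
  exact ⟨x ∘ f, Function.Injective.comp hx hf, rfl⟩

/-- The map sending a set of labels to one of its elements, and fixing the other labels. -/
def collapse (S : Finset (Fin n)) (e x : Fin n) : Fin n := if x ∈ S then e else x

/-- A binary family does not distinguish the elements of `S`, unless both arguments lie in `S`. -/
def Collapses2 (S : Finset (Fin n)) (P : Fin n → Fin n → E) : Prop :=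
  ∀ e ∈ S, ∀ x y, ¬ (x ∈ S ∧ y ∈ S) → P x y = P (collapse S e x) (collapse S e y)

/-- A ternary family does not distinguish the elements of `S`, unless all arguments lie in `S`. -/
def Collapses3 (S : Finset (Fin n)) (P : Fin n → Fin n → Fin n → E) : Prop :=
  ∀ e ∈ S, ∀ x y z, ¬ (x ∈ S ∧ y ∈ S ∧ z ∈ S) →
    P x y z = P (collapse S e x) (collapse S e y) (collapse S e z)

/-- The labels mapped into `S`. -/
def preim (f : Fin k → Fin n) (S : Finset (Fin n)) : Finset (Fin k) :=
  Finset.univ.filter fun a => f a ∈ S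

lemma mem_preim {f : Fin k → Fin n} {S : Finset (Fin n)} {a : Fin k} : a ∈ preim f S ↔ f a ∈ S := by
  simp [preim]

lemma map_collapse (f : Fin k → Fin n) (S : Finset (Fin n)) (e x : Fin k) :
    f (collapse (preim f S) e x) = collapse S (f e) (f x) := by
  unfold collapse
  simp only [mem_preim]
  split_ifs <;> rfl

lemma Collapses2.pull {S : Finset (Fin n)} {P : Fin n → Fin n → E} (h : Collapses2 S P)
    (f : Fin k → Fin n) : Collapses2 (preim f S) fun a b => P (f a) (f b) := by
  intro e he x y hxy
  simp only [mem_preim] at he hxy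
  simp only [map_collapse]
  exact h _ he _ _ hxy

lemma Collapses3.pull {S : Finset (Fin n)} {P : Fin n → Fin n → Fin n → E} (h : Collapses3 S P)
    (f : Fin k → Fin n) : Collapses3 (preim f S) fun a b c => P (f a) (f b) (f c) := by
  intro e he x y z hxy
  simp only [mem_preim] at he hxy
  simp only [map_collapse]
  exact h _ he _ _ _ hxy

/-- The labels of the inserted configuration. -/
def block (i l n : ℕ) : Finset (Fin n) := Finset.univ.filter fun j => InBlock i l j

lemma mem_block {i l n : ℕ} {j : Fin n} : j ∈ block i l n ↔ InBlock i l j := by simp [block]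

lemma outer_collapse (i : Fin k) (h : n + 1 = k + l) {e : Fin n} (he : InBlock i l e) (x : Fin n) :
    outer i h (collapse (block i l n) e x) = outer i h x := by
  unfold collapse
  split_ifs with hx
  · rw [(outer_eq_iff i h e).2 he, (outer_eq_iff i h x).2 (mem_block.1 hx)]
  · rfl

lemma collapse_mem_iff {S : Finset (Fin n)} {e : Fin n} (he : e ∈ S) (x : Fin n) :
    collapse S e x ∈ S ↔ x ∈ S := by
  unfold collapse; split_ifs with h <;> simp [h, he]

lemma collapses2_ins2 (i : Fin k) (h : n + 1 = k + l) (P : Fin k → Fin k → E)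
    (Q : Fin l → Fin l → E) : Collapses2 (block i l n) (ins2 i h P Q) := by
  intro e he x y hxy
  have h1 : ¬ (InBlock i l (collapse (block i l n) e x) ∧
      InBlock i l (collapse (block i l n) e y)) := by
    rwa [← mem_block, ← mem_block, collapse_mem_iff he, collapse_mem_iff he]
  rw [mem_block, mem_block] at hxy
  unfold ins2
  rw [dif_neg hxy, dif_neg h1, outer_collapse i h (mem_block.1 he),
    outer_collapse i h (mem_block.1 he)]

lemma collapses3_ins3 (i : Fin k) (h : n + 1 = k + l) (P : Fin k → Fin k → Fin k → E)
    (Q : Fin l → Fin l → Fin l → E) : Collapses3 (block i l n) (ins3 i h P Q) := by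
  intro e he x y z hxy
  have h1 : ¬ (InBlock i l (collapse (block i l n) e x) ∧
      InBlock i l (collapse (block i l n) e y) ∧ InBlock i l (collapse (block i l n) e z)) := by
    rwa [← mem_block, ← mem_block, ← mem_block, collapse_mem_iff he, collapse_mem_iff he,
      collapse_mem_iff he]
  rw [mem_block, mem_block, mem_block] at hxy
  unfold ins3
  rw [dif_neg hxy, dif_neg h1, outer_collapse i h (mem_block.1 he),
    outer_collapse i h (mem_block.1 he), outer_collapse i h (mem_block.1 he)]

/-- Maps of labels `f`, `g` and a label `i` describing `Fin n` as the result of replacing the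
element `i` of `Fin k` by the set `S`, which is enumerated by `g`. -/
structure Splitting (S : Finset (Fin n)) (f : Fin k → Fin n) (g : Fin l → Fin n) (i : Fin k) :
    Prop where
  card : n + 1 = k + l
  inj_left : Function.Injective f
  inj_right : Function.Injective g
  left_mem : ∀ a, f a ∈ S ↔ a = i
  right_mem : ∀ x, x ∈ S ↔ ∃ b, g b = x

namespace Splitting

variable {S : Finset (Fin n)} {f : Fin k → Fin n} {g : Fin l → Fin n} {i : Fin k}

/-- The relabelling that turns `S` into a block. -/
def toFun (hs : Splitting S f g i) (x : Fin n) : Fin n :=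
  if hb : InBlock i l x then g (sub hb) else f (outer i hs.card x)

lemma toFun_mem (hs : Splitting S f g i) (x : Fin n) : hs.toFun x ∈ S ↔ InBlock i l x := by
  unfold toFun
  split_ifs with hb
  · exact iff_of_true ((hs.right_mem _).2 ⟨_, rfl⟩) hb
  · rw [hs.left_mem, outer_eq_iff]

lemma toFun_of_mem (hs : Splitting S f g i) {x : Fin n} (hb : InBlock i l x) :
    hs.toFun x = g (sub hb) := by rw [toFun, dif_pos hb]

lemma toFun_inner (hs : Splitting S f g i) (b : Fin l) : hs.toFun (inner i hs.card b) = g b := by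
  have hb : InBlock i l (inner i hs.card b : Fin n) :=
    ⟨Nat.le_add_right _ _, Nat.add_lt_add_left b.2 _⟩
  rw [hs.toFun_of_mem hb]
  congr 1
  rw [Fin.ext_iff]; simp [sub, inner]

lemma collapse_toFun (hs : Splitting S f g i) (x : Fin n) :
    collapse S (f i) (hs.toFun x) = f (outer i hs.card x) := by
  unfold collapse
  split_ifs with hx
  · rw [toFun_mem] at hx
    rw [(outer_eq_iff i hs.card x).2 hx]
  · rw [toFun_mem] at hx
    rw [toFun, dif_neg hx]

lemma toFun_injective (hs : Splitting S f g i) : Function.Injective hs.toFun := by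
  intro x y hxy
  have hb : InBlock i l x ↔ InBlock i l y := by rw [← hs.toFun_mem, ← hs.toFun_mem, hxy]
  have ho : outer i hs.card x = outer i hs.card y := by
    apply hs.inj_left
    rw [← hs.collapse_toFun, ← hs.collapse_toFun, hxy]
  by_cases hx : InBlock i l x
  · have hy := hb.1 hx
    rw [hs.toFun_of_mem hx, hs.toFun_of_mem hy] at hxy
    have := hs.inj_right hxy
    rw [Fin.ext_iff] at this ⊢
    simp only [sub, InBlock] at *
    omega
  · exact eq_of_outer_eq i hs.card ho fun h => hx h.1

/-- The relabelling that turns `S` into a block, as a permutation. -/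
def perm (hs : Splitting S f g i) : Equiv.Perm (Fin n) :=
  Equiv.ofBijective hs.toFun (Finite.injective_iff_bijective.1 hs.toFun_injective)

lemma collapses2 {P : Fin n → Fin n → E} (hs : Splitting S f g i) (hP : Collapses2 S P) :
    (fun x y => P (hs.toFun x) (hs.toFun y)) =
      ins2 i hs.card (fun a b => P (f a) (f b)) fun a b => P (g a) (g b) := by
  ext x y
  unfold ins2
  split_ifs with hb
  · rw [hs.toFun_of_mem hb.1, hs.toFun_of_mem hb.2]
  · rw [hP (f i) ((hs.left_mem i).2 rfl) _ _ (by rwa [hs.toFun_mem, hs.toFun_mem]),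
      hs.collapse_toFun, hs.collapse_toFun]

lemma collapses3 {P : Fin n → Fin n → Fin n → E} (hs : Splitting S f g i) (hP : Collapses3 S P) :
    (fun x y z => P (hs.toFun x) (hs.toFun y) (hs.toFun z)) =
      ins3 i hs.card (fun a b c => P (f a) (f b) (f c)) fun a b c => P (g a) (g b) (g c) := by
  ext x y z
  unfold ins3
  split_ifs with hb
  · rw [hs.toFun_of_mem hb.1, hs.toFun_of_mem hb.2.1, hs.toFun_of_mem hb.2.2]
  · rw [hP (f i) ((hs.left_mem i).2 rfl) _ _ _
      (by rwa [hs.toFun_mem, hs.toFun_mem, hs.toFun_mem]),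
      hs.collapse_toFun, hs.collapse_toFun, hs.collapse_toFun]

end Splitting

lemma collapses2_update {S : Finset (Fin n)} {P : Fin n → Fin n → E} (hP : Collapses2 S P)
    (hd : ∀ x ∈ S, ∀ y ∈ S, P x x = P y y) {f f' : Fin k → Fin n} {i : Fin k}
    (hf : ∀ a, f a ∈ S ↔ a = i) (hi : f' i ∈ S) (hff : ∀ a, a ≠ i → f a = f' a) (a b : Fin k) :
    P (f a) (f b) = P (f' a) (f' b) := by
  have hc : ∀ a, collapse S (f' i) (f a) = f' a := fun a => by
    unfold collapse
    split_ifs with h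
    · rw [(hf a).1 h]
    · exact hff a fun e => h ((hf a).2 e)
  by_cases h : f a ∈ S ∧ f b ∈ S
  · have ha := (hf a).1 h.1
    have hb := (hf b).1 h.2
    subst ha
    rw [hb]
    exact hd _ h.1 _ hi
  · rw [hP (f' i) hi _ _ h, hc, hc]

lemma collapses3_update {S : Finset (Fin n)} {P : Fin n → Fin n → Fin n → E} (hP : Collapses3 S P)
    (hd : ∀ x ∈ S, ∀ y ∈ S, P x x x = P y y y) {f f' : Fin k → Fin n} {i : Fin k}
    (hf : ∀ a, f a ∈ S ↔ a = i) (hi : f' i ∈ S) (hff : ∀ a, a ≠ i → f a = f' a) (a b c : Fin k) :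
    P (f a) (f b) (f c) = P (f' a) (f' b) (f' c) := by
  have hc : ∀ a, collapse S (f' i) (f a) = f' a := fun a => by
    unfold collapse
    split_ifs with h
    · rw [(hf a).1 h]
    · exact hff a fun e => h ((hf a).2 e)
  by_cases h : f a ∈ S ∧ f b ∈ S ∧ f c ∈ S
  · have ha := (hf a).1 h.1
    have hb := (hf b).1 h.2.1
    have hc := (hf c).1 h.2.2
    subst ha
    rw [hb, hc]
    exact hd _ h.1 _ hi
  · rw [hP (f' i) hi _ _ _ h, hc, hc, hc]

lemma isClosed_collapses2 {X : Type*} [TopologicalSpace X] [TopologicalSpace E] [T2Space E]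
    (S : Finset (Fin n)) {P : X → Fin n → Fin n → E} (hP : Continuous P) :
    IsClosed {x | Collapses2 S (P x)} := by
  simp only [Collapses2, ofPred_forall]
  refine isClosed_iInter fun e => isClosed_iInter fun _ => isClosed_iInter fun x =>
    isClosed_iInter fun y => isClosed_iInter fun _ => ?_
  exact isClosed_eq (by fun_prop) (by fun_prop)

lemma isClosed_collapses3 {X : Type*} [TopologicalSpace X] [TopologicalSpace E] [T2Space E]
    (S : Finset (Fin n)) {P : X → Fin n → Fin n → Fin n → E} (hP : Continuous P) :
    IsClosed {x | Collapses3 S (P x)} := by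
  simp only [Collapses3, ofPred_forall]
  refine isClosed_iInter fun e => isClosed_iInter fun _ => isClosed_iInter fun x =>
    isClosed_iInter fun y => isClosed_iInter fun z => isClosed_iInter fun _ => ?_
  exact isClosed_eq (by fun_prop) (by fun_prop)

end Coordinates

/-! ### Relations satisfied on the compactifications -/

section Relations

variable {n : ℕ}

lemma assoc_induction {P : LineCoord n → Prop} (hP : IsClosed {p | P p})
    (h : ∀ x : Fin n → ℝ, Function.Injective x → P (lineCoord x)) {p : LineCoord n}
    (hp : p ∈ assocSet n) : P p := by
  refine closure_minimal ?_ hP hp.2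
  rintro _ ⟨x, hx, rfl⟩
  exact h x hx

lemma cyclo_induction {P : CircleCoord n → Prop} (hP : IsClosed {p | P p})
    (h : ∀ x : Fin n → Circle, Function.Injective x → P (circleCoord x)) {p : CircleCoord n}
    (hp : p ∈ cycloSet n) : P p := by
  refine closure_minimal ?_ hP hp
  rintro _ ⟨x, hx, rfl⟩
  exact h x hx

lemma circleCoe_injective {z : Fin n → Circle} (hz : Function.Injective z) :
    Function.Injective fun a => (z a : ℂ) := fun _ _ hab => hz (Circle.ext hab)

lemma tripleCoord_left {E : Type*} [NormedAddCommGroup E] (x : Fin n → E) (a b : Fin n) :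
    tripleCoord x a a b = 0 := by simp [tripleCoord]

lemma tripleCoord_right {E : Type*} [NormedAddCommGroup E] {x : Fin n → E}
    (hx : Function.Injective x) {a b : Fin n} (hab : a ≠ b) : tripleCoord x a b b = 1 := by
  have : ‖x b - x a‖ ≠ 0 := norm_ne_zero_iff.2 (sub_ne_zero.2 (hx.ne hab.symm))
  simp [tripleCoord, this]

lemma assoc_triple_left {p : LineCoord n} (hp : p ∈ assocSet n) (a b : Fin n) : p.2 a a b = 0 :=
  assoc_induction (P := fun p => p.2 a a b = 0) (isClosed_eq (by fun_prop) (by fun_prop))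
    (fun x _ => tripleCoord_left x a b) hp

lemma assoc_triple_right {p : LineCoord n} (hp : p ∈ assocSet n) {a b : Fin n} (hab : a ≠ b) :
    p.2 a b b = 1 :=
  assoc_induction (P := fun p => p.2 a b b = 1) (isClosed_eq (by fun_prop) (by fun_prop))
    (fun _ hx => tripleCoord_right hx hab) hp

lemma cyclo_triple_left {p : CircleCoord n} (hp : p ∈ cycloSet n) (a b : Fin n) :
    p.2.2 a a b = 0 :=
  cyclo_induction (P := fun p => p.2.2 a a b = 0) (isClosed_eq (by fun_prop) (by fun_prop))
    (fun z _ => tripleCoord_left (fun a => (z a : ℂ)) a b) hp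

lemma cyclo_triple_right {p : CircleCoord n} (hp : p ∈ cycloSet n) {a b : Fin n} (hab : a ≠ b) :
    p.2.2 a b b = 1 :=
  cyclo_induction (P := fun p => p.2.2 a b b = 1) (isClosed_eq (by fun_prop) (by fun_prop))
    (fun _ hx => tripleCoord_right (circleCoe_injective hx) hab) hp

lemma pairCoord_line {x : Fin n → ℝ} {a b : Fin n} (h : x a < x b) :
    pairCoord x a b = 1 ∧ pairCoord x b a = -1 := by
  have h1 : 0 < x b - x a := sub_pos.2 h
  unfold pairCoord
  rw [norm_sub_rev (x a), Real.norm_of_nonneg h1.le, smul_eq_mul, smul_eq_mul]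
  constructor
  · exact inv_mul_cancel₀ h1.ne'
  · have : x a - x b = -(x b - x a) := (neg_sub _ _).symm
    simp only [this, mul_neg, inv_mul_cancel₀ h1.ne']

lemma assoc_pair {p : LineCoord n} (hp : p ∈ assocSet n) {a b : Fin n} (hab : a ≠ b) :
    (p.1 a b = 1 ∧ p.1 b a = -1) ∨ (p.1 a b = -1 ∧ p.1 b a = 1) := by
  refine assoc_induction (P := fun p => (p.1 a b = 1 ∧ p.1 b a = -1) ∨
    (p.1 a b = -1 ∧ p.1 b a = 1)) ?_ (fun x hx => ?_) hp
  · exact ((isClosed_eq (by fun_prop) (by fun_prop)).inter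
      (isClosed_eq (by fun_prop) (by fun_prop))).union
      ((isClosed_eq (by fun_prop) (by fun_prop)).inter (isClosed_eq (by fun_prop) (by fun_prop)))
  · rcases lt_or_gt_of_ne (hx.ne hab) with h | h
    · exact Or.inl (pairCoord_line h)
    · exact Or.inr (pairCoord_line h).symm

/-- Two sets of labels that have both collided are nested or disjoint. -/
lemma laminar_of_collapses {P : Fin n → Fin n → Fin n → ℝ} (h0 : ∀ a b, P a a b = 0)
    (h1 : ∀ a b, a ≠ b → P a b b = 1) {S S' : Finset (Fin n)} (hS : Collapses3 S P)
    (hS' : Collapses3 S' P) : Disjoint S S' ∨ S ⊆ S' ∨ S' ⊆ S := by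
  by_contra hne
  push Not at hne
  obtain ⟨hd, hn, hn'⟩ := hne
  obtain ⟨b, hb, hb'⟩ := Finset.not_disjoint_iff.1 hd
  obtain ⟨a, ha, ha'⟩ := Finset.not_subset.1 hn
  obtain ⟨c, hc', hc⟩ := Finset.not_subset.1 hn'
  have e1 := hS b hb a b c fun h => hc h.2.2
  have e2 := hS' b hb' a b c fun h => ha' h.1
  simp only [collapse, if_pos ha, if_pos hb, if_neg hc, if_pos hb', if_pos hc', if_neg ha'] at e1 e2
  rw [h0] at e1
  rw [h1 a b (by rintro rfl; exact ha' hb')] at e2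
  rw [e1] at e2
  exact zero_ne_one e2

/-! ### Angles between points of the circle -/

/-- The angle of the anticlockwise arc from the point `a` to the point `b`; it is continuous on
the compactification, with value `0` or `2π` when the points have collided. -/
def ang (p : CircleCoord n) (a b : Fin n) : ℝ := 2 * Real.arccos ((circleLin p).1 a b)

lemma continuous_ang (a b : Fin n) : Continuous fun p : CircleCoord n => ang p a b := by
  have h : Continuous fun p : CircleCoord n => (circleLin p).1 a b :=
    ((continuous_apply b).comp ((continuous_apply a).comp continuous_fst)).comp continuous_circleLin
  exact continuous_const.mul (Real.continuous_arccos.comp h)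

lemma ang_nonneg (p : CircleCoord n) (a b : Fin n) : 0 ≤ ang p a b :=
  mul_nonneg zero_le_two (Real.arccos_nonneg _)

lemma ang_le (p : CircleCoord n) (a b : Fin n) : ang p a b ≤ 2 * Real.pi :=
  mul_le_mul_of_nonneg_left (Real.arccos_le_pi _) zero_le_two

lemma ang_pull {k : ℕ} (p : CircleCoord n) (f : Fin k → Fin n) (a b : Fin k) :
    ang (circlePull p f) a b = ang p (f a) (f b) := rfl

lemma exp_sub_one_eq (θ : ℝ) : Complex.exp (θ * Complex.I) - 1 =
    ((2 * Real.sin (θ / 2) : ℝ) : ℂ) * (Complex.I * Complex.exp ((θ / 2 : ℝ) * Complex.I)) := by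
  have h1 : Complex.exp (θ * Complex.I) = Complex.exp ((θ / 2 : ℝ) * Complex.I) *
      Complex.exp ((θ / 2 : ℝ) * Complex.I) := by
    rw [← Complex.exp_add]; congr 1; push_cast; ring
  rw [h1, Complex.exp_mul_I, ← Complex.ofReal_cos, ← Complex.ofReal_sin]
  have h2 : (Real.cos (θ / 2) : ℂ) ^ 2 + (Real.sin (θ / 2) : ℂ) ^ 2 = 1 := by
    exact_mod_cast Real.cos_sq_add_sin_sq (θ / 2)
  have h3 := Complex.I_sq
  push_cast
  push_cast at h2
  generalize Complex.cos _ = c at *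
  generalize Complex.sin _ = s at *
  linear_combination h2 + (s ^ 2 - 2 * s ^ 2) * h3

lemma coe_angleDiff (z w : Circle) :
    (w : ℂ) - z = ((2 * Real.sin (Circle.angleDiff z w / 2) : ℝ) : ℂ) *
      (Complex.I * (z * Complex.exp ((Circle.angleDiff z w / 2 : ℝ) * Complex.I))) := by
  have h : (w : ℂ) = Complex.exp (Circle.angleDiff z w * Complex.I) * z := by
    rw [← Circle.coe_exp, ← Circle.coe_mul, Circle.exp_angleDiff_mul]
  have := exp_sub_one_eq (Circle.angleDiff z w)
  rw [h]
  linear_combination (z : ℂ) * this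

lemma sin_half_angleDiff_pos {z w : Circle} (h : z ≠ w) :
    0 < Real.sin (Circle.angleDiff z w / 2) := by
  have h1 := Circle.angleDiff_pos h
  have h2 := Circle.angleDiff_lt_two_pi z w
  exact Real.sin_pos_of_pos_of_lt_pi (by linarith) (by linarith)

lemma norm_sub_circle {z w : Circle} (h : z ≠ w) :
    ‖(w : ℂ) - z‖ = 2 * Real.sin (Circle.angleDiff z w / 2) := by
  have h1 := sin_half_angleDiff_pos h
  rw [coe_angleDiff, norm_mul, norm_mul, norm_mul, Complex.norm_real, Complex.norm_I,
    Circle.norm_coe, Complex.norm_exp_ofReal_mul_I, Real.norm_of_nonneg (by positivity)]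
  ring

lemma pairCoord_circle {z : Fin n → Circle} {a b : Fin n} (h : z a ≠ z b) :
    pairCoord (fun a => (z a : ℂ)) a b = Complex.I * ((z a : ℂ) *
      Complex.exp ((Circle.angleDiff (z a) (z b) / 2 : ℝ) * Complex.I)) := by
  have h1 := sin_half_angleDiff_pos h
  unfold pairCoord
  rw [norm_sub_circle h, coe_angleDiff, Complex.real_smul, ← mul_assoc, ← Complex.ofReal_mul,
    inv_mul_cancel₀ (by positivity), Complex.ofReal_one, one_mul]

lemma I_mul_conj (z : Circle) :
    (Complex.I * (z : ℂ)) * (starRingEnd ℂ) (Complex.I * (z : ℂ)) = 1 := by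
  rw [Complex.mul_conj, Complex.normSq_eq_norm_sq, norm_mul, Complex.norm_I, Circle.norm_coe]
  norm_num

lemma ang_circleCoord {z : Fin n → Circle} {a b : Fin n} (h : z a ≠ z b) :
    ang (circleCoord z) a b = Circle.angleDiff (z a) (z b) := by
  have h1 := Circle.angleDiff_pos h
  have h2 := Circle.angleDiff_lt_two_pi (z a) (z b)
  have e : (circleLin (circleCoord z)).1 a b = Real.cos (Circle.angleDiff (z a) (z b) / 2) := by
    change (pairCoord (fun a => (z a : ℂ)) a b * _).re = _
    rw [pairCoord_circle h]
    have : Complex.I * ((z a : ℂ) *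
      Complex.exp ((Circle.angleDiff (z a) (z b) / 2 : ℝ) * Complex.I)) *
      (starRingEnd ℂ) (Complex.I * (z a : ℂ)) =
      Complex.exp ((Circle.angleDiff (z a) (z b) / 2 : ℝ) * Complex.I) := by
      linear_combination Complex.exp ((Circle.angleDiff (z a) (z b) / 2 : ℝ) * Complex.I) *
        I_mul_conj (z a)
    change (Complex.I * ((z a : ℂ) *
      Complex.exp ((Circle.angleDiff (z a) (z b) / 2 : ℝ) * Complex.I)) *
      (starRingEnd ℂ) (Complex.I * (z a : ℂ))).re = _
    rw [this, Complex.exp_ofReal_mul_I_re]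
  rw [ang, e, Real.arccos_cos (by linarith) (by linarith)]
  ring

lemma ang_circleCoord_pos {z : Fin n → Circle} {a b : Fin n} (h : z a ≠ z b) :
    0 < ang (circleCoord z) a b := by
  rw [ang_circleCoord h]; exact Circle.angleDiff_pos h

lemma ang_add_ang {p : CircleCoord n} (hp : p ∈ cycloSet n) {a b : Fin n} (hab : a ≠ b) :
    ang p a b + ang p b a = 2 * Real.pi := by
  refine cyclo_induction (P := fun p => ang p a b + ang p b a = 2 * Real.pi)
    (isClosed_eq ((continuous_ang a b).add (continuous_ang b a)) continuous_const)
    (fun z hz => ?_) hp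
  rw [ang_circleCoord (hz.ne hab), ang_circleCoord (hz.ne hab.symm),
    Circle.angleDiff_add_angleDiff (hz.ne hab)]

lemma circle_eq_mul_exp_ang {p : CircleCoord n} (hp : p ∈ cycloSet n) {a b : Fin n} (hab : a ≠ b) :
    p.1 b = p.1 a * Circle.exp (ang p a b) := by
  have hc := continuous_ang (n := n) a b
  refine cyclo_induction (P := fun p => p.1 b = p.1 a * Circle.exp (ang p a b))
    (isClosed_eq (by fun_prop) (Continuous.mul (by fun_prop) (Circle.exp.continuous.comp hc)))
    (fun z hz => ?_) hp
  rw [ang_circleCoord (hz.ne hab), mul_comm]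
  exact (Circle.exp_angleDiff_mul).symm

lemma cyclo_pair {p : CircleCoord n} (hp : p ∈ cycloSet n) {a b : Fin n} (hab : a ≠ b) :
    p.2.1 a b = Complex.I * ((p.1 a : ℂ) * Complex.exp ((ang p a b / 2 : ℝ) * Complex.I)) := by
  have hc := continuous_ang (n := n) a b
  refine cyclo_induction (P := fun p => p.2.1 a b = Complex.I * ((p.1 a : ℂ) *
    Complex.exp ((ang p a b / 2 : ℝ) * Complex.I))) (isClosed_eq (by fun_prop) (by fun_prop))
    (fun z hz => ?_) hp
  rw [ang_circleCoord (hz.ne hab)]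
  exact pairCoord_circle (hz.ne hab)

/-- Three points of the circle are in anticlockwise or in clockwise order. -/
lemma ang_cocycle {p : CircleCoord n} (hp : p ∈ cycloSet n) {a b c : Fin n} (hab : a ≠ b)
    (hbc : b ≠ c) (hac : a ≠ c) : ang p a b + ang p b c = ang p a c ∨
      ang p a b + ang p b c = ang p a c + 2 * Real.pi := by
  have h1 := continuous_ang (n := n) a b
  have h2 := continuous_ang (n := n) b c
  have h3 := continuous_ang (n := n) a c
  refine cyclo_induction (P := fun p => ang p a b + ang p b c = ang p a c ∨
      ang p a b + ang p b c = ang p a c + 2 * Real.pi)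
    ((isClosed_eq (by fun_prop) (by fun_prop)).union (isClosed_eq (by fun_prop) (by fun_prop)))
    (fun z hz => ?_) hp
  have hm : circleCoord z ∈ cycloSet n := subset_closure ⟨z, hz, rfl⟩
  have e1 := circle_eq_mul_exp_ang hm hab
  have e2 := circle_eq_mul_exp_ang hm hbc
  have e3 := circle_eq_mul_exp_ang hm hac
  rw [e1, e3, mul_assoc, mul_right_inj, ← Circle.exp_add] at e2
  obtain ⟨k, hk⟩ := Circle.exp_eq_exp.1 e2
  have hp := Real.pi_pos
  have l1 := ang_circleCoord_pos (hz.ne hab)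
  have l2 := ang_circleCoord_pos (hz.ne hbc)
  have l3 := ang_circleCoord_pos (hz.ne hac)
  have u1 := Circle.angleDiff_lt_two_pi (z a) (z b)
  have u2 := Circle.angleDiff_lt_two_pi (z b) (z c)
  have u3 := Circle.angleDiff_lt_two_pi (z a) (z c)
  rw [← ang_circleCoord (hz.ne hab)] at u1
  rw [← ang_circleCoord (hz.ne hbc)] at u2
  rw [← ang_circleCoord (hz.ne hac)] at u3
  have k1 : (k : ℝ) < 1 := by by_contra h; push Not at h; nlinarith
  have k2 : (-2 : ℝ) < k := by by_contra h; push Not at h; nlinarith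
  have k1' : k < 1 := by exact_mod_cast k1
  have k2' : -2 < k := by exact_mod_cast k2
  obtain rfl | rfl : k = 0 ∨ k = -1 := by omega
  · left; push_cast at hk; linarith
  · right; push_cast at hk; linarith

end Relations

/-! ### Extension of maps satisfying affine inequalities -/

/-- A map on a closed subset that satisfies finitely many affine inequalities, each of which can be
satisfied strictly at every point, extends to a map on the whole space satisfying them. An arbitrary
extension is pulled back towards a strictly feasible selection, just as far as needed. -/
theorem exists_extension_of_affine {X V ι : Type} [TopologicalSpace X] [CompactSpace X] [T2Space X]
    [NormedAddCommGroup V] [NormedSpace ℝ V] [TietzeExtension.{0} V] [Fintype ι]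
    (Φ : ι → X → V → ℝ) (hc : ∀ i, Continuous fun p : X × V => Φ i p.1 p.2)
    (ha : ∀ i x v w (t : ℝ), Φ i x (v + t • (w - v)) = (1 - t) * Φ i x v + t * Φ i x w)
    (hf : ∀ x, ∃ v, ∀ i, 0 < Φ i x v) {A : Set X} (hA : IsClosed A) {v : X → V}
    (hv : ContinuousOn v A) (δ : ι → ℝ) (hδ : ∀ i, 0 ≤ δ i)
    (hvA : ∀ x ∈ A, ∀ i, δ i ≤ Φ i x (v x)) :
    ∃ w : C(X, V), (∀ x ∈ A, w x = v x) ∧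
      ∀ x i, 0 ≤ Φ i x (w x) ∧ (0 < δ i → 0 < Φ i x (w x)) := by
  -- the strictly feasible values form a convex set at each point, so they have a continuous
  -- selection
  obtain ⟨c, hcΦ⟩ : ∃ c : C(X, V), ∀ x, c x ∈ {v | ∀ i, 0 < Φ i x v} := by
    refine exists_continuous_forall_mem_convex_of_local_const (fun x => ?_) fun x => ?_
    · rw [convex_iff_forall_pos]
      intro v hv w hw a b ha' hb hab i
      have e : a • v + b • w = v + b • (w - v) := by
        obtain rfl : a = 1 - b := by linarith
        rw [sub_smul, one_smul, smul_sub]; abel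
      rw [e, ha]
      have h1 := hv i
      have h2 := hw i
      have : 0 < 1 - b := by linarith
      positivity
    · obtain ⟨v, hv⟩ := hf x
      refine ⟨v, ?_⟩
      simp only [mem_ofPred_eq]
      rw [eventually_all]
      intro i
      have : Continuous fun y => Φ i y v := (hc i).comp (by fun_prop : Continuous fun y => (y, v))
      exact this.continuousAt.eventually (lt_mem_nhds (hv i))
  -- an extension by the theorem of Tietze, which may violate the inequalities
  obtain ⟨e, he⟩ :=
    ContinuousMap.exists_restrict_eq hA (⟨A.domRestrict v, hv.domRestrict⟩ : C(A, V))
  have heA : ∀ x ∈ A, e x = v x := fun x hx => DFunLike.congr_fun he ⟨x, hx⟩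
  have hη : ∀ i, Continuous fun x => Φ i x (c x) := fun i =>
    (hc i).comp (by fun_prop : Continuous fun y => (y, c y))
  have hψ : ∀ i, Continuous fun x => Φ i x (e x) := fun i =>
    (hc i).comp (by fun_prop : Continuous fun y => (y, e y))
  let φ : ι → X → ℝ := fun i x => max 0 (δ i - Φ i x (e x))
  have hφ0 : ∀ i x, 0 ≤ φ i x := fun i x => le_max_left _ _
  have hφ : ∀ i, Continuous (φ i) := fun i => continuous_const.max (continuous_const.sub (hψ i))
  -- on the segment from `c x` to `e x`, the inequality `i` holds up to the parameter `τ i x`, which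
  -- is `1` if `e x` satisfies it with the margin `δ i`, in particular on `A`
  let τ : ι → X → ℝ := fun i x => Φ i x (c x) / (Φ i x (c x) + 2 * φ i x)
  have hpos : ∀ i x, 0 < Φ i x (c x) + 2 * φ i x := fun i x => by
    have := hcΦ x i
    have := hφ0 i x
    positivity
  have hτ : ∀ i, Continuous (τ i) := fun i =>
    (hη i).div ((hη i).add (continuous_const.mul (hφ i))) fun x => (hpos i x).ne'
  have hτ0 : ∀ i x, 0 < τ i x := fun i x => div_pos (hcΦ x i) (hpos i x)
  have hτ1 : ∀ i x, τ i x ≤ 1 := fun i x => (div_le_one (hpos i x)).2 (by have := hφ0 i x; linarith)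
  let t : X → ℝ := fun x => ∏ i, τ i x
  have htc : Continuous t := continuous_finsetProd _ fun i _ => hτ i
  have ht0 : ∀ x, 0 < t x := fun x => Finset.prod_pos fun i _ => hτ0 i x
  have htτ : ∀ i x, t x ≤ τ i x := fun i x => by
    classical
    change ∏ j, τ j x ≤ _
    rw [← Finset.mul_prod_erase _ _ (Finset.mem_univ i)]
    exact mul_le_of_le_one_right (hτ0 i x).le
      (Finset.prod_le_one (fun j _ => (hτ0 j x).le) fun j _ => hτ1 j x)
  refine ⟨⟨fun x => c x + t x • (e x - c x), by fun_prop⟩, fun x hx => ?_, fun x i => ?_⟩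
  · have h1 : t x = 1 := by
      refine Finset.prod_eq_one fun i _ => ?_
      have : φ i x = 0 := max_eq_left (by rw [heA x hx]; linarith [hvA x hx i])
      change _ / _ = _
      rw [this, mul_zero, add_zero, div_self (hcΦ x i).ne']
    change c x + t x • (e x - c x) = v x
    rw [h1, one_smul, heA x hx]
    abel
  · have h1 := (le_div_iff₀ (hpos i x)).1 (htτ i x)
    have h2 : δ i - φ i x ≤ Φ i x (e x) := by
      have : δ i - Φ i x (e x) ≤ φ i x := le_max_right _ _
      linarith
    have h3 := ht0 x
    have h4 := mul_nonneg h3.le (hφ0 i x)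
    have key : t x * δ i ≤ Φ i x (c x + t x • (e x - c x)) := by
      rw [ha]
      nlinarith [mul_le_mul_of_nonneg_left h2 h3.le]
    refine ⟨(mul_nonneg h3.le (hδ i)).trans key, fun hi => (mul_pos h3 hi).trans_le key⟩

/-- Recursive construction of a sequence each of whose terms has a property depending on the
previous ones. -/
theorem exists_seq_of_step {Y : ℕ → Type} [∀ n, Nonempty (Y n)] (P : ℕ → (∀ n, Y n) → Prop)
    (hP : ∀ n L L', (∀ k ≤ n, L k = L' k) → P n L → P n L')
    (step : ∀ n L, (∀ k < n, P k L) → ∃ L', (∀ k < n, L' k = L k) ∧ P n L') :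
    ∃ L, ∀ n, P n L := by
  have step' : ∀ n (L : {L // ∀ k < n, P k L}),
      ∃ L' : {L // ∀ k < n + 1, P k L}, ∀ k < n, L'.1 k = L.1 k := by
    intro n L
    obtain ⟨L', h1, h2⟩ := step n L.1 L.2
    refine ⟨⟨L', fun k hk => ?_⟩, h1⟩
    rcases Nat.lt_succ_iff_lt_or_eq.1 hk with hk | rfl
    · exact hP k L.1 L' (fun j hj => (h1 j (hj.trans_lt hk)).symm) (L.2 k hk)
    · exact h2
  choose F hF using step'
  let s : ∀ n, {L // ∀ k < n, P k L} := fun n =>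
    Nat.rec ⟨fun _ => Classical.arbitrary _, fun k hk => absurd hk (Nat.not_lt_zero k)⟩ F n
  have hs : ∀ k d, (s (k + 1 + d)).1 k = (s (k + 1)).1 k := by
    intro k d
    induction d with
    | zero => rfl
    | succ d ih =>
      rw [← ih]
      exact hF (k + 1 + d) (s (k + 1 + d)) k (by omega)
  refine ⟨fun k => (s (k + 1)).1 k, fun n => ?_⟩
  refine hP n (s (n + 1)).1 _ (fun k hk => ?_) ((s (n + 1)).2 n (Nat.lt_succ_self n))
  obtain ⟨d, hd⟩ := Nat.exists_eq_add_of_le hk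
  subst hd
  have := hs k d
  rwa [show k + 1 + d = k + d + 1 by omega] at this

/-! ### Systems of compactified configuration spaces -/

/-- The composition of affine maps: `(u, s)` stands for `t ↦ u + s t`. -/
def vmul (x y : ℝ × ℝ) : ℝ × ℝ := (x.1 + x.2 * y.1, x.2 * y.2)

lemma vmul_assoc (x y z : ℝ × ℝ) : vmul (vmul x y) z = vmul x (vmul y z) := by
  unfold vmul; ext <;> simp <;> ring

lemma vmul_unit (x : ℝ × ℝ) : vmul x (0, 1) = x := by simp [vmul]

lemma unit_vmul (x : ℝ × ℝ) : vmul (0, 1) x = x := by simp [vmul]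

/-- The affine inequality with the given coefficients holds. -/
abbrev InBound (c : ℝ × ℝ × ℝ) (x : ℝ × ℝ) : Prop := 0 ≤ c.1 + c.2.1 * x.1 + c.2.2 * x.2

/-- The formal properties of the families of associahedra and of cyclohedra that enter the
construction of maps into little intervals. A value `(u, s)` at the label `a` stands for the
interval from `u` to `u + s`, the coordinate on the line or on the circle being chosen so that
disjointness of intervals amounts to `u_a + s_a ≤ gap a b + u_b`. -/
structure ConfSystem where
  /-- the ambient space of the compactification -/
  obj : ℕ → Type
  [top : ∀ n, TopologicalSpace (obj n)]
  [t2 : ∀ n, T2Space (obj n)]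
  /-- the compactification -/
  carrier : ∀ n, Set (obj n)
  isCompact_carrier : ∀ n, IsCompact (carrier n)
  /-- restriction along a map of labels -/
  pull : ∀ {k n : ℕ}, obj n → (Fin k → Fin n) → obj k
  continuous_pull : ∀ {k n : ℕ} (f : Fin k → Fin n), Continuous fun m => pull m f
  pull_pull : ∀ {j k n : ℕ} (m : obj n) (f : Fin k → Fin n) (g : Fin j → Fin k),
    pull (pull m f) g = pull m (f ∘ g)
  pull_id : ∀ {n : ℕ} (m : obj n), pull m id = m
  pull_mem : ∀ {k n : ℕ} {m : obj n}, m ∈ carrier n → ∀ {f : Fin k → Fin n},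
    Function.Injective f → 0 < k → pull m f ∈ carrier k
  /-- the coordinates of the infinitesimal configurations -/
  lin : ∀ {n : ℕ}, obj n → LineCoord n
  continuous_lin : ∀ n : ℕ, Continuous (lin : obj n → LineCoord n)
  lin_pull : ∀ {k n : ℕ} (m : obj n) (f : Fin k → Fin n), lin (pull m f) = linePull (lin m) f
  /-- insertion of an infinitesimal configuration -/
  ins : ∀ {k l n : ℕ}, Fin k → n + 1 = k + l → obj k → LineCoord l → obj n
  ins_mem : ∀ {k l n : ℕ} (i : Fin k) (h : n + 1 = k + l) {m : obj k}, m ∈ carrier k →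
    ∀ {q : LineCoord l}, q ∈ assocSet l → ins i h m q ∈ carrier n
  /-- the distance from a point to another one in the positive direction -/
  gap : ∀ {n : ℕ}, obj n → Fin n → Fin n → ℝ
  continuous_gap : ∀ {n : ℕ} (a b : Fin n), Continuous fun m => gap m a b
  gap_pull : ∀ {k n : ℕ} (m : obj n) (f : Fin k → Fin n) (a b : Fin k),
    gap (pull m f) a b = gap m (f a) (f b)
  /-- the labels in `S` have collided -/
  Cluster : ∀ {n : ℕ}, obj n → Finset (Fin n) → Prop
  isClosed_cluster : ∀ {n : ℕ} (S : Finset (Fin n)), IsClosed {m | Cluster m S}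
  cluster_pull : ∀ {k n : ℕ} {m : obj n} {S : Finset (Fin n)}, Cluster m S →
    ∀ {f : Fin k → Fin n}, Function.Injective f → Cluster (pull m f) (preim f S)
  /-- collided labels cannot be told apart by the coordinates that involve further labels -/
  collapses : ∀ {n : ℕ} {m : obj n} {S : Finset (Fin n)}, Cluster m S →
    Collapses2 S (lin m).1 ∧ Collapses3 S (lin m).2
  /-- sets of collided labels are nested or disjoint -/
  laminar : ∀ {n : ℕ} {m : obj n}, m ∈ carrier n → ∀ {S S' : Finset (Fin n)}, Cluster m S →
    Cluster m S' → Disjoint S S' ∨ S ⊆ S' ∨ S' ⊆ S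
  /-- collided labels carry an infinitesimal configuration -/
  lin_mem : ∀ {l n : ℕ} {m : obj n}, m ∈ carrier n → ∀ {S : Finset (Fin n)}, Cluster m S →
    ∀ {g : Fin l → Fin n}, Function.Injective g → (∀ b, g b ∈ S) → 0 < l →
      linePull (lin m) g ∈ assocSet l
  /-- a configuration with collided labels is an insertion -/
  pull_split : ∀ {k l n : ℕ} {m : obj n} {S : Finset (Fin n)}, Cluster m S →
    ∀ {f : Fin k → Fin n} {g : Fin l → Fin n} {i : Fin k} (hs : Splitting S f g i),
      pull m hs.toFun = ins i hs.card (pull m f) (linePull (lin m) g)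
  /-- any of the collided labels may represent all of them -/
  pull_congr : ∀ {k n : ℕ} {m : obj n}, m ∈ carrier n → ∀ {S : Finset (Fin n)}, Cluster m S →
    ∀ {f f' : Fin k → Fin n} {i : Fin k}, (∀ a, f a ∈ S ↔ a = i) → f' i ∈ S →
      (∀ a, a ≠ i → f a = f' a) → pull m f = pull m f'
  cluster_ins : ∀ {k l n : ℕ} (i : Fin k) (h : n + 1 = k + l) (m : obj k)
    {q : LineCoord l}, q ∈ assocSet l → Cluster (ins i h m q) (block i l n)
  pull_ins : ∀ {k l n : ℕ} (i : Fin k) (h : n + 1 = k + l) {m : obj k}, m ∈ carrier k →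
    ∀ {q : LineCoord l}, q ∈ assocSet l → ∀ {f : Fin k → Fin n}, (∀ a, outer i h (f a) = a) →
      pull (ins i h m q) f = m
  lin_ins : ∀ {k l n : ℕ} (i : Fin k) (h : n + 1 = k + l) (m : obj k) (q : LineCoord l),
    linePull (lin (ins i h m q)) (inner i h) = q
  /-- the distance between labels depends on sets of collided labels only -/
  gap_collapse : ∀ {n : ℕ} {m : obj n} {S : Finset (Fin n)}, Cluster m S → ∀ e ∈ S, ∀ x y,
    ¬ (x ∈ S ∧ y ∈ S) → gap m x y = gap m (collapse S e x) (collapse S e y)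
  /-- coefficients of two affine inequalities imposed on the values -/
  bound : Fin 2 → ℝ × ℝ × ℝ
  /-- the inequalities are inherited by the intervals inserted into an interval -/
  bound_vmul : ∀ {x y : ℝ × ℝ}, 0 < x.2 → (∀ c, InBound (bound c) x) → 0 < y.2 → 0 ≤ y.1 →
    y.1 + y.2 ≤ 1 → ∀ c, InBound (bound c) (vmul x y)
  /-- the separation of collided labels in the infinitesimal configuration, scaled to an interval
  that satisfies the inequalities, implies their separation -/
  bound_gap : ∀ {n : ℕ} {m : obj n}, m ∈ carrier n → ∀ {S : Finset (Fin n)}, Cluster m S →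
    ∀ {a b : Fin n}, a ∈ S → b ∈ S → a ≠ b → ∀ {x : ℝ × ℝ}, 0 < x.2 →
      (∀ c, InBound (bound c) x) → x.2 * (1 - (lin m).1 a b) ≤ gap m a b
  /-- all inequalities can be satisfied strictly, at every single configuration -/
  feasible : ∀ {n : ℕ} {m : obj n}, m ∈ carrier n → ∃ v : Fin n → ℝ × ℝ,
    (∀ a, 0 < (v a).2) ∧
    (∀ a c, 0 < (bound c).1 + (bound c).2.1 * (v a).1 + (bound c).2.2 * (v a).2) ∧
    ∀ a b, a ≠ b → (v a).1 + (v a).2 < gap m a b + (v b).1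

attribute [instance] ConfSystem.top ConfSystem.t2

/-- Positions that are separated according to an order given by vanishing gaps. -/
lemma exists_separated {n : ℕ} {g : Fin n → Fin n → ℝ} (h0 : ∀ a b, a ≠ b → 0 ≤ g a b)
    (hs : ∀ a b, a ≠ b → g a b = 0 → g b a ≠ 0)
    (ht : ∀ a b c, a ≠ b → b ≠ c → a ≠ c → g a b = 0 → g b c = 0 → g a c = 0) {c : ℝ}
    (hc : 0 < c) : ∃ u s : Fin n → ℝ, (∀ a, 0 < u a ∧ 0 < s a ∧ u a + s a < c) ∧
      ∀ a b, a ≠ b → u a + s a < g a b + u b := by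
  classical
  -- a lower bound of `c` and of all gaps that are positive
  obtain ⟨δ, hδ, hδc, hδg⟩ : ∃ δ, 0 < δ ∧ δ ≤ c ∧ ∀ a b, 0 < g a b → δ ≤ g a b := by
    let F : Finset ℝ := insert c ((Finset.univ.image fun x : Fin n × Fin n => g x.1 x.2).filter
      (0 < ·))
    have hF : F.Nonempty := Finset.insert_nonempty _ _
    refine ⟨F.min' hF, ?_, F.min'_le c (Finset.mem_insert_self _ _), fun a b hab =>
      F.min'_le _ (Finset.mem_insert_of_mem (Finset.mem_filter.2
        ⟨Finset.mem_image.2 ⟨(a, b), Finset.mem_univ _, rfl⟩, hab⟩))⟩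
    rcases Finset.mem_insert.1 (F.min'_mem hF) with h | h
    · rw [h]; exact hc
    · exact (Finset.mem_filter.1 h).2
  -- the rank of `a` among the labels at distance zero; the interval of `a` begins at `ε` times the
  -- rank plus one, and has length `ε / 2`
  let r : Fin n → Finset (Fin n) := fun a => Finset.univ.filter fun b => b ≠ a ∧ g b a = 0
  have hr : ∀ a, (r a).card < n := fun a => by
    have : r a ⊂ Finset.univ := Finset.ssubset_univ_iff.2 fun h => by
      have := h ▸ Finset.mem_univ a
      simp [r] at this
    simpa using Finset.card_lt_card this
  have hlt : ∀ a b, a ≠ b → g a b = 0 → (r a).card < (r b).card := fun a b hab hg => by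
    refine Finset.card_lt_card (Finset.ssubset_iff_of_subset ?_ |>.2 ⟨a, by simp [r, hab, hg],
      by simp [r]⟩)
    intro x hx
    simp only [r, Finset.mem_filter, Finset.mem_univ, true_and] at hx ⊢
    have hxb : x ≠ b := by rintro rfl; exact hs _ _ hab hg hx.2
    exact ⟨hxb, ht x a b hx.1 hab hxb hx.2 hg⟩
  let ε : ℝ := δ / (n + 2)
  have hε : 0 < ε := by positivity
  have hεδ : ε * (n + 2) = δ := div_mul_cancel₀ _ (by positivity)
  refine ⟨fun a => ε * ((r a).card + 1), fun _ => ε / 2,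
    fun a => ⟨by positivity, by positivity, ?_⟩, fun a b hab => ?_⟩
  · have : ((r a).card : ℝ) + 1 ≤ n := by exact_mod_cast hr a
    nlinarith
  · have h1 : ((r a).card : ℝ) + 1 ≤ n := by exact_mod_cast hr a
    rcases (h0 a b hab).eq_or_lt with h | h
    · have : ((r a).card : ℝ) + 1 ≤ (r b).card := by exact_mod_cast hlt a b hab h.symm
      nlinarith
    · have := hδg a b h
      have h2 : (0 : ℝ) ≤ (r b).card := Nat.cast_nonneg _
      nlinarith

section Instances

variable {k l n : ℕ}

/-- A choice of a label of the composite for each label of the outer operation, which is the first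
label of the block for `i`. -/
lemma exists_section_outer (i : Fin k) (h : n + 1 = k + l) (hl : 0 < l) :
    ∃ f : Fin k → Fin n, (∀ a, outer i h (f a) = a) ∧ f i = inner i h ⟨0, hl⟩ := by
  have key : ∀ a : Fin k, ∃ x : Fin n, outer i h x = a ∧ (a = i → x = inner i h ⟨0, hl⟩) := by
    intro a
    by_cases hai : a = i
    · subst hai
      exact ⟨inner a h ⟨0, hl⟩, (outer_eq_iff a h _).2
        ⟨Nat.le_add_right _ _, Nat.add_lt_add_left hl _⟩, fun _ => rfl⟩
    · have h1 := a.2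
      rcases lt_or_gt_of_ne (Fin.val_ne_of_ne hai) with h2 | h2
      · refine ⟨⟨a, by omega⟩, ?_, fun e => absurd e hai⟩
        have := outer_spec i h ⟨a, by omega⟩
        rw [Fin.ext_iff]
        simp only [InBlock] at *
        omega
      · refine ⟨⟨a + l - 1, by omega⟩, ?_, fun e => absurd e hai⟩
        have := outer_spec i h ⟨a + l - 1, by omega⟩
        rw [Fin.ext_iff]
        simp only [InBlock] at *
        omega
  choose f hf hf' using key
  exact ⟨f, hf, hf' i rfl⟩

lemma inBlock_inner (i : Fin k) (h : n + 1 = k + l) (b : Fin l) :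
    InBlock i l (inner i h b : Fin n) := ⟨Nat.le_add_right _ _, Nat.add_lt_add_left b.2 _⟩

lemma sub_inner (i : Fin k) (h : n + 1 = k + l) (b : Fin l) :
    sub (inBlock_inner i h b) = b := by rw [Fin.ext_iff]; simp [sub, inner]

lemma ins2_inner {E : Type*} (i : Fin k) (h : n + 1 = k + l) (P : Fin k → Fin k → E)
    (Q : Fin l → Fin l → E) (a b : Fin l) : ins2 i h P Q (inner i h a) (inner i h b) = Q a b := by
  unfold ins2
  rw [dif_pos ⟨inBlock_inner i h a, inBlock_inner i h b⟩, sub_inner, sub_inner]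

lemma ins3_inner {E : Type*} (i : Fin k) (h : n + 1 = k + l) (P : Fin k → Fin k → Fin k → E)
    (Q : Fin l → Fin l → Fin l → E) (a b c : Fin l) :
    ins3 i h P Q (inner i h a) (inner i h b) (inner i h c) = Q a b c := by
  unfold ins3
  rw [dif_pos ⟨inBlock_inner i h a, inBlock_inner i h b, inBlock_inner i h c⟩, sub_inner, sub_inner,
    sub_inner]

lemma ins2_section {E : Type*} (i : Fin k) (h : n + 1 = k + l) {P : Fin k → Fin k → E}
    {Q : Fin l → Fin l → E} (hPQ : ∀ b, Q b b = P i i) {f : Fin k → Fin n}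
    (hf : ∀ a, outer i h (f a) = a) (a b : Fin k) : ins2 i h P Q (f a) (f b) = P a b := by
  unfold ins2
  split_ifs with hb
  · have ha' : a = i := by rw [← hf a]; exact (outer_eq_iff i h _).2 hb.1
    have hb' : b = i := by rw [← hf b]; exact (outer_eq_iff i h _).2 hb.2
    subst ha'
    subst hb'
    exact hPQ _
  · rw [hf, hf]

lemma ins3_section {E : Type*} (i : Fin k) (h : n + 1 = k + l) {P : Fin k → Fin k → Fin k → E}
    {Q : Fin l → Fin l → Fin l → E} (hPQ : ∀ b, Q b b b = P i i i) {f : Fin k → Fin n}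
    (hf : ∀ a, outer i h (f a) = a) (a b c : Fin k) :
    ins3 i h P Q (f a) (f b) (f c) = P a b c := by
  unfold ins3
  split_ifs with hb
  · have ha' : a = i := by rw [← hf a]; exact (outer_eq_iff i h _).2 hb.1
    have hb' : b = i := by rw [← hf b]; exact (outer_eq_iff i h _).2 hb.2.1
    have hc' : c = i := by rw [← hf c]; exact (outer_eq_iff i h _).2 hb.2.2
    subst ha'
    subst hb'
    subst hc'
    exact hPQ _
  · rw [hf, hf, hf]

lemma isClosed_assocSet (n : ℕ) : IsClosed (assocSet n) := by
  rcases Nat.eq_zero_or_pos n with rfl | hn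
  · have : assocSet 0 = ∅ := by ext p; simp [assocSet]
    rw [this]; exact isClosed_empty
  · have : assocSet n = closure (lineCoord '' {x : Fin n → ℝ | Function.Injective x}) := by
      ext p; simp [assocSet, hn]
    rw [this]; exact isClosed_closure

lemma norm_pairCoord_le {E : Type*} [NormedAddCommGroup E] [NormedSpace ℝ E] (x : Fin n → E)
    (a b : Fin n) : ‖pairCoord x a b‖ ≤ 1 := by
  unfold pairCoord
  rw [norm_smul, norm_inv, norm_norm]
  exact inv_mul_le_one

lemma tripleCoord_mem_Icc {E : Type*} [NormedAddCommGroup E] (x : Fin n → E)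
    (a b c : Fin n) : tripleCoord x a b c ∈ Icc (0 : ℝ) 1 := by
  unfold tripleCoord
  exact ⟨by positivity, div_le_one_of_le₀ (by linarith [norm_nonneg (x c - x b)]) (by positivity)⟩

lemma isCompact_assocSet (n : ℕ) : IsCompact (assocSet n) := by
  refine IsCompact.of_isClosed_subset (s := (Set.univ.pi fun _ => Set.univ.pi fun _ =>
    Metric.closedBall (0 : ℝ) 1) ×ˢ (Set.univ.pi fun _ => Set.univ.pi fun _ => Set.univ.pi fun _ =>
    Icc (0 : ℝ) 1)) ?_ (isClosed_assocSet n) ?_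
  · exact (isCompact_univ_pi fun _ => isCompact_univ_pi fun _ => isCompact_closedBall 0 1).prod
      (isCompact_univ_pi fun _ => isCompact_univ_pi fun _ => isCompact_univ_pi fun _ =>
        isCompact_Icc)
  · intro p hp
    refine closure_minimal ?_ ?_ hp.2
    · rintro _ ⟨x, -, rfl⟩
      refine ⟨fun a _ b _ => ?_, fun a _ b _ c _ => tripleCoord_mem_Icc x a b c⟩
      exact mem_closedBall_zero_iff.2 (norm_pairCoord_le x a b)
    · exact (isClosed_set_pi fun _ _ => isClosed_set_pi fun _ _ => Metric.isClosed_closedBall).prod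
        (isClosed_set_pi fun _ _ => isClosed_set_pi fun _ _ => isClosed_set_pi fun _ _ =>
          isClosed_Icc)

lemma isCompact_cycloSet (n : ℕ) : IsCompact (cycloSet n) := by
  refine IsCompact.of_isClosed_subset (s := (Set.univ : Set (Fin n → Circle)) ×ˢ
    (Set.univ.pi fun _ => Set.univ.pi fun _ => Metric.closedBall (0 : ℂ) 1) ×ˢ
    (Set.univ.pi fun _ => Set.univ.pi fun _ => Set.univ.pi fun _ => Icc (0 : ℝ) 1)) ?_
    isClosed_closure ?_
  · exact isCompact_univ.prod ((isCompact_univ_pi fun _ => isCompact_univ_pi fun _ =>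
      isCompact_closedBall 0 1).prod (isCompact_univ_pi fun _ => isCompact_univ_pi fun _ =>
        isCompact_univ_pi fun _ => isCompact_Icc))
  · refine closure_minimal ?_ ?_
    · rintro _ ⟨x, -, rfl⟩
      refine ⟨trivial, fun a _ b _ => ?_,
        fun a _ b _ c _ => tripleCoord_mem_Icc (fun a => (x a : ℂ)) a b c⟩
      exact mem_closedBall_zero_iff.2 (norm_pairCoord_le (fun a => (x a : ℂ)) a b)
    · exact isClosed_univ.prod ((isClosed_set_pi fun _ _ => isClosed_set_pi fun _ _ =>
        Metric.isClosed_closedBall).prod (isClosed_set_pi fun _ _ => isClosed_set_pi fun _ _ =>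
          isClosed_set_pi fun _ _ => isClosed_Icc))

lemma assoc_pair_trans {p : LineCoord n} (hp : p ∈ assocSet n) {a b c : Fin n}
    (h1 : p.1 a b = 1) (h2 : p.1 b c = 1) : p.1 a c = 1 := by
  have hab : a ≠ b := by rintro rfl; rw [(assoc_diag hp a).1] at h1; norm_num at h1
  have hbc : b ≠ c := by rintro rfl; rw [(assoc_diag hp b).1] at h2; norm_num at h2
  have key : p.1 a b = -1 ∨ p.1 b c = -1 ∨ p.1 a c = 1 := by
    refine assoc_induction (P := fun p => p.1 a b = -1 ∨ p.1 b c = -1 ∨ p.1 a c = 1) ?_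
      (fun x hx => ?_) hp
    · exact (isClosed_eq (by fun_prop) (by fun_prop)).union
        ((isClosed_eq (by fun_prop) (by fun_prop)).union (isClosed_eq (by fun_prop) (by fun_prop)))
    · rcases lt_or_gt_of_ne (hx.ne hab) with h | h
      · rcases lt_or_gt_of_ne (hx.ne hbc) with h' | h'
        · exact Or.inr (Or.inr (pairCoord_line (h.trans h')).1)
        · exact Or.inr (Or.inl (pairCoord_line h').2)
      · exact Or.inl (pairCoord_line h).2
  rcases key with h | h | h
  · rw [h] at h1; norm_num at h1
  · rw [h] at h2; norm_num at h2
  · exact h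

lemma assoc_pair_le {p : LineCoord n} (hp : p ∈ assocSet n) (a b : Fin n) : p.1 a b ≤ 1 := by
  by_cases hab : a = b
  · subst hab; rw [(assoc_diag hp a).1]; norm_num
  · rcases assoc_pair hp hab with h | h <;> rw [h.1]; norm_num

/-- The system of associahedra. The gap between two points on the line is `0` or `2`, according to
their order; since the affine inequalities express that the intervals lie in `[0, 1]`, only the gap
`0` imposes a condition. -/
def lineSystem : ConfSystem where
  obj := LineCoord
  carrier := assocSet
  isCompact_carrier := isCompact_assocSet
  pull := linePull
  continuous_pull := continuous_linePull
  pull_pull _ _ _ := rfl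
  pull_id _ := rfl
  pull_mem hp _ hf hk := linePull_mem hp hf hk
  lin p := p
  continuous_lin _ := continuous_id
  lin_pull _ _ := rfl
  ins := lineIns
  ins_mem i h _ hp _ hq := lineIns_mem i h hp hq
  gap p a b := 1 - p.1 a b
  continuous_gap a b := by fun_prop
  gap_pull _ _ _ _ := rfl
  Cluster p S := Collapses2 S p.1 ∧ Collapses3 S p.2
  isClosed_cluster S := (isClosed_collapses2 S continuous_fst).inter
    (isClosed_collapses3 S continuous_snd)
  cluster_pull h f _ := ⟨h.1.pull f, h.2.pull f⟩
  collapses h := h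
  laminar hp _ _ h h' := laminar_of_collapses (assoc_triple_left hp)
    (fun _ _ => assoc_triple_right hp) h.2 h'.2
  lin_mem hp _ _ _ hg _ hl := linePull_mem hp hg hl
  pull_split h _ _ _ hs := Prod.ext (hs.collapses2 h.1) (hs.collapses3 h.2)
  pull_congr hp _ h _ _ _ h1 h2 h3 := Prod.ext
    (funext₂ fun a b => collapses2_update h.1 (fun x _ y _ => by
      rw [(assoc_diag hp x).1, (assoc_diag hp y).1]) h1 h2 h3 a b)
    (funext₂ fun a b => funext fun c => collapses3_update h.2 (fun x _ y _ => by
      rw [(assoc_diag hp x).2, (assoc_diag hp y).2]) h1 h2 h3 a b c)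
  cluster_ins i h m q _ := ⟨collapses2_ins2 i h _ _, collapses3_ins3 i h _ _⟩
  pull_ins i h m hm q hq f hf := Prod.ext
    (funext₂ fun a b => ins2_section i h (fun b => by
      rw [(assoc_diag hq b).1, (assoc_diag hm i).1]) hf a b)
    (funext₂ fun a b => funext fun c => ins3_section i h (fun b => by
      rw [(assoc_diag hq b).2, (assoc_diag hm i).2]) hf a b c)
  lin_ins i h m q := Prod.ext (funext₂ fun a b => ins2_inner i h _ _ a b)
    (funext₂ fun a b => funext fun c => ins3_inner i h _ _ a b c)
  gap_collapse h e he x y hxy := by rw [h.1 e he x y hxy]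
  bound := ![(0, 1, 0), (1, -1, -1)]
  bound_vmul {x y} hx h hy h1 h2 c := by
    have e0 := h 0
    have e1 := h 1
    simp only [InBound, Matrix.cons_val_zero, Matrix.cons_val_one, vmul] at *
    fin_cases c
    · simp
      nlinarith
    · simp
      nlinarith
  bound_gap {n m} hm S _ a b _ _ hab x hx h := by
    have e0 := h 0
    have e1 := h 1
    simp only [InBound, Matrix.cons_val_zero, Matrix.cons_val_one] at *
    have := assoc_pair_le hm a b
    nlinarith
  feasible {n m} hm := by
    obtain ⟨u, s, h1, h2⟩ := exists_separated (g := fun a b => 1 - m.1 a b)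
      (fun a b _ => by linarith [assoc_pair_le hm a b])
      (fun a b hab h => by
        rcases assoc_pair hm hab with e | e
        · rw [e.2]; norm_num
        · rw [e.1] at h; norm_num at h)
      (fun a b c _ _ _ h h' => by
        have := assoc_pair_trans hm (a := a) (b := b) (c := c) (by linarith) (by linarith)
        rw [this]; norm_num) one_pos
    refine ⟨fun a => (u a, s a), fun a => (h1 a).2.1, fun a c => ?_, h2⟩
    have := h1 a
    fin_cases c <;> simp <;> linarith

lemma circleLin_ins (i : Fin k) (h : n + 1 = k + l) (m : CircleCoord k) (q : LineCoord l)
    {x y : Fin n} (hx : InBlock i l x) (hy : InBlock i l y) :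
    (circleLin (circleIns i h m q)).1 x y = q.1 (sub hx) (sub hy) := by
  have e1 : (circleIns i h m q).2.1 x y = q.1 (sub hx) (sub hy) • (Complex.I * (m.1 i : ℂ)) := by
    simp only [circleIns, ins2]
    rw [dif_pos ⟨hx, hy⟩]
  have e2 : (circleIns i h m q).1 x = m.1 i := by
    simp only [circleIns]
    rw [(outer_eq_iff i h x).2 hx]
  simp only [circleLin]
  rw [e1, e2, smul_mul_assoc, I_mul_conj]
  simp

lemma circleLin_ins_triple (i : Fin k) (h : n + 1 = k + l) (m : CircleCoord k) (q : LineCoord l)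
    {x y z : Fin n} (hx : InBlock i l x) (hy : InBlock i l y) (hz : InBlock i l z) :
    (circleLin (circleIns i h m q)).2 x y z = q.2 (sub hx) (sub hy) (sub hz) := by
  simp only [circleLin, circleIns, ins3]
  rw [dif_pos ⟨hx, hy, hz⟩]

lemma circleLin_le (m : CircleCoord n) {a b : Fin n}
    (h : (circleLin m).1 a b = 1 ∨ (circleLin m).1 a b = -1) {s : ℝ}
    (hs : s ≤ Real.pi) : s * (1 - (circleLin m).1 a b) ≤ ang m a b := by
  unfold ang
  rcases h with h | h
  · rw [h, Real.arccos_one]; simp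
  · rw [h, Real.arccos_neg_one]; linarith

/-- The points of a configuration on the circle labelled by `S` have collided, and are described
by an infinitesimal configuration on the tangent line. -/
def CircleCluster (m : CircleCoord n) (S : Finset (Fin n)) : Prop :=
  Collapses2 S m.2.1 ∧ Collapses3 S m.2.2 ∧ (∀ x ∈ S, ∀ y ∈ S, m.1 x = m.1 y) ∧
    (∀ x ∈ S, ∀ y ∈ S, m.2.1 x y = (circleLin m).1 x y • (Complex.I * (m.1 x : ℂ))) ∧
    ∀ (l : ℕ) (g : Fin l → Fin n), 0 < l → Function.Injective g → (∀ b, g b ∈ S) →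
      linePull (circleLin m) g ∈ assocSet l

lemma CircleCluster.collapses {m : CircleCoord n} {S : Finset (Fin n)} (h : CircleCluster m S) :
    Collapses2 S (circleLin m).1 := by
  intro e he x y hxy
  have hz : m.1 x = m.1 (collapse S e x) := by
    unfold collapse
    split_ifs with hx
    · exact h.2.2.1 x hx e he
    · rfl
  simp only [circleLin]
  rw [h.1 e he x y hxy, hz]

lemma isClosed_circleCluster (S : Finset (Fin n)) :
    IsClosed {m : CircleCoord n | CircleCluster m S} := by
  have h1 : IsClosed {m : CircleCoord n | ∀ x ∈ S, ∀ y ∈ S, m.1 x = m.1 y} := by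
    simp only [ofPred_forall]
    exact isClosed_iInter fun x => isClosed_iInter fun _ => isClosed_iInter fun y =>
      isClosed_iInter fun _ => isClosed_eq (by fun_prop) (by fun_prop)
  have h2 : IsClosed {m : CircleCoord n | ∀ x ∈ S, ∀ y ∈ S,
      m.2.1 x y = (circleLin m).1 x y • (Complex.I * (m.1 x : ℂ))} := by
    simp only [ofPred_forall]
    refine isClosed_iInter fun x => isClosed_iInter fun _ => isClosed_iInter fun y =>
      isClosed_iInter fun _ => isClosed_eq (by fun_prop) ?_
    have hl : Continuous fun m : CircleCoord n => (circleLin m).1 x y :=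
      (continuous_apply y).comp ((continuous_apply x).comp
        (continuous_fst.comp continuous_circleLin))
    exact hl.smul (by fun_prop)
  have h3 : IsClosed {m : CircleCoord n | ∀ (l : ℕ) (g : Fin l → Fin n), 0 < l →
      Function.Injective g → (∀ b, g b ∈ S) → linePull (circleLin m) g ∈ assocSet l} := by
    simp only [ofPred_forall]
    exact isClosed_iInter fun l => isClosed_iInter fun g => isClosed_iInter fun _ =>
      isClosed_iInter fun _ => isClosed_iInter fun _ =>
        (isClosed_assocSet l).preimage ((continuous_linePull g).comp continuous_circleLin)
  exact (isClosed_collapses2 S (P := fun m : CircleCoord n => m.2.1) (by fun_prop)).inter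
    ((isClosed_collapses3 S (P := fun m : CircleCoord n => m.2.2) (by fun_prop)).inter
      (h1.inter (h2.inter h3)))

/-- The system of cyclohedra. The gap is the angle of the anticlockwise arc, and `u` and `s` are
angles relative to the position of the point. The affine inequality, which is imposed twice, bounds
the lengths by a half turn: this gives `bound_gap` for collided points at the angle `2π`. -/
def circleSystem : ConfSystem where
  obj := CircleCoord
  carrier := cycloSet
  isCompact_carrier := isCompact_cycloSet
  pull := circlePull
  continuous_pull := continuous_circlePull
  pull_pull _ _ _ := rfl
  pull_id _ := rfl
  pull_mem hp _ hf _ := circlePull_mem hp hf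
  lin := circleLin
  continuous_lin _ := continuous_circleLin
  lin_pull _ _ := rfl
  ins := circleIns
  ins_mem i h _ hp _ hq := circleIns_mem i h hp hq
  gap := ang
  continuous_gap := continuous_ang
  gap_pull := ang_pull
  Cluster := CircleCluster
  isClosed_cluster := isClosed_circleCluster
  cluster_pull h f hf := ⟨h.1.pull f, h.2.1.pull f,
    fun x hx y hy => h.2.2.1 _ (mem_preim.1 hx) _ (mem_preim.1 hy),
    fun x hx y hy => h.2.2.2.1 _ (mem_preim.1 hx) _ (mem_preim.1 hy),
    fun l g hl hg hS => h.2.2.2.2 l (f ∘ g) hl (hf.comp hg) fun b => (mem_preim (f := f)).1 (hS b)⟩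
  collapses h := ⟨h.collapses, h.2.1⟩
  laminar hp _ _ h h' := laminar_of_collapses (cyclo_triple_left hp)
    (fun _ _ => cyclo_triple_right hp) h.2.1 h'.2.1
  lin_mem _ _ h _ hg hS hl := h.2.2.2.2 _ _ hl hg hS
  pull_split {k l n m S} h f g i hs := by
    have hi : f i ∈ S := (hs.left_mem i).2 rfl
    have hg : ∀ b, g b ∈ S := fun b => (hs.right_mem _).2 ⟨b, rfl⟩
    refine Prod.ext (funext fun x => ?_) (Prod.ext ?_ (hs.collapses3 h.2.1))
    · change m.1 (hs.toFun x) = m.1 (f (outer i hs.card x))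
      rw [← hs.collapse_toFun]
      unfold collapse
      split_ifs with hx
      · exact h.2.2.1 _ hx _ hi
      · rfl
    · refine (hs.collapses2 h.1).trans ?_
      have : (fun a b => m.2.1 (g a) (g b)) = fun a b => (linePull (circleLin m) g).1 a b •
          (Complex.I * ((circlePull m f).1 i : ℂ)) := by
        ext a b
        rw [h.2.2.2.1 _ (hg a) _ (hg b), h.2.2.1 _ (hg a) _ hi]
        rfl
      rw [this]
      rfl
  pull_congr {k n m} hp S h f f' i h1 h2 h3 := Prod.ext
    (funext fun a => by
      by_cases ha : a = i
      · subst ha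
        exact h.2.2.1 _ ((h1 a).2 rfl) _ h2
      · exact congrArg m.1 (h3 a ha))
    (Prod.ext (funext₂ fun a b => collapses2_update h.1 (fun x _ y _ => by
      rw [(cyclo_diag hp x).1, (cyclo_diag hp y).1]) h1 h2 h3 a b)
    (funext₂ fun a b => funext fun c => collapses3_update h.2.1 (fun x _ y _ => by
      rw [(cyclo_diag hp x).2, (cyclo_diag hp y).2]) h1 h2 h3 a b c))
  cluster_ins {k l n} i h m q hq := by
    refine ⟨collapses2_ins2 i h m.2.1 fun a b => q.1 a b • (Complex.I * (m.1 i : ℂ)),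
      collapses3_ins3 i h _ _, fun x hx y hy => ?_,
      fun x hx y hy => ?_, fun j g hj hg hS => ?_⟩
    · simp only [circleIns]
      rw [(outer_eq_iff i h x).2 (mem_block.1 hx), (outer_eq_iff i h y).2 (mem_block.1 hy)]
    · rw [circleLin_ins i h m q (mem_block.1 hx) (mem_block.1 hy)]
      simp only [circleIns, ins2]
      rw [dif_pos ⟨mem_block.1 hx, mem_block.1 hy⟩, (outer_eq_iff i h x).2 (mem_block.1 hx)]
    · have hb : ∀ b, InBlock i l (g b) := fun b => mem_block.1 (hS b)
      have e : linePull (circleLin (circleIns i h m q)) g = linePull q fun b => sub (hb b) :=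
        Prod.ext (funext₂ fun a b => circleLin_ins i h m q (hb a) (hb b))
          (funext₂ fun a b => funext fun c => circleLin_ins_triple i h m q (hb a) (hb b) (hb c))
      rw [e]
      refine linePull_mem hq (fun a b hab => hg ?_) hj
      have h1 := hb a
      have h2 := hb b
      rw [Fin.ext_iff] at hab ⊢
      simp only [sub, InBlock] at *
      omega
  pull_ins {k l n} i h m hm q hq f hf := Prod.ext (funext fun a => congrArg m.1 (hf a)) (Prod.ext
    (funext₂ fun a b => ins2_section i h (P := m.2.1)
      (Q := fun a b => q.1 a b • (Complex.I * (m.1 i : ℂ))) (fun b => by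
        simp only [(assoc_diag hq b).1, (cyclo_diag hm i).1, zero_smul]) hf a b)
    (funext₂ fun a b => funext fun c => ins3_section i h (fun b => by
      rw [(assoc_diag hq b).2, (cyclo_diag hm i).2]) hf a b c))
  lin_ins {k l n} i h m q := by
    refine Prod.ext (funext₂ fun a b => ?_) (funext₂ fun a b => funext fun c => ?_)
    · have := circleLin_ins i h m q (inBlock_inner i h a) (inBlock_inner i h b)
      rwa [sub_inner, sub_inner] at this
    · have := circleLin_ins_triple i h m q (inBlock_inner i h a) (inBlock_inner i h b)
        (inBlock_inner i h c)
      rwa [sub_inner, sub_inner, sub_inner] at this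
  gap_collapse h e he x y hxy := by
    unfold ang
    rw [h.collapses e he x y hxy]
  bound := ![(Real.pi, 0, -1), (Real.pi, 0, -1)]
  bound_vmul {x y} hx h hy h1 h2 c := by
    have e0 := h 0
    simp only [InBound, Matrix.cons_val_zero, vmul] at *
    have : x.2 * y.2 ≤ x.2 * 1 := mul_le_mul_of_nonneg_left (by linarith) hx.le
    fin_cases c <;> simp <;> linarith
  bound_gap {n m} hm S hS a b ha hb hab x hx h := by
    have e0 := h 0
    simp only [InBound, Matrix.cons_val_zero] at e0
    have hp := hS.2.2.2.2 2 ![a, b] two_pos (by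
      intro i j hij
      fin_cases i <;> fin_cases j <;> simp_all) (by
      intro i; fin_cases i <;> simp [ha, hb])
    have := assoc_pair hp (a := 0) (b := 1) (by decide)
    simp only [linePull, Matrix.cons_val_zero, Matrix.cons_val_one] at this
    refine circleLin_le m ?_ (by linarith)
    rcases this with h | h
    · exact Or.inl h.1
    · exact Or.inr h.1
  feasible {n m} hm := by
    have hpi := Real.pi_pos
    obtain ⟨u, s, h1, h2⟩ := exists_separated (g := ang m)
      (fun a b _ => ang_nonneg m a b)
      (fun a b hab h => by
        have := ang_add_ang hm hab
        rw [h] at this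
        intro h'
        linarith)
      (fun a b c hab hbc hac h h' => by
        have h3 := ang_nonneg m a c
        rcases ang_cocycle hm hab hbc hac with h0 | h0 <;> rw [h, h'] at h0 <;> linarith) hpi
    refine ⟨fun a => (u a, s a), fun a => (h1 a).2.1, fun a c => ?_, h2⟩
    have := h1 a
    fin_cases c <;> simp <;> linarith

end Instances

/-! ### Values on a set of labels -/

lemma Splitting.exists_left {k l n : ℕ} {S : Finset (Fin n)} {f : Fin k → Fin n} {g : Fin l → Fin n}
    {i : Fin k} (hs : Splitting S f g i) {x : Fin n} (hx : x ∉ S) : ∃ a, a ≠ i ∧ f a = x := by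
  obtain ⟨y, rfl⟩ := hs.perm.surjective x
  change hs.toFun y ∉ S at hx
  rw [hs.toFun_mem] at hx
  refine ⟨outer i hs.card y, fun e => hx ((outer_eq_iff i hs.card y).1 e), ?_⟩
  change _ = hs.toFun y
  rw [Splitting.toFun, dif_neg hx]

lemma Splitting.pos {k l n : ℕ} {S : Finset (Fin n)} {f : Fin k → Fin n} {g : Fin l → Fin n}
    {i : Fin k} (hs : Splitting S f g i) : 0 < l := by
  obtain ⟨b, -⟩ := (hs.right_mem _).1 ((hs.left_mem i).2 rfl)
  exact Fin.pos b

/-- Every set with a distinguished element belongs to a splitting: `f` and `g` enumerate the labels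
outside of the set, together with the distinguished one, and the labels in the set. -/
lemma exists_splitting {n : ℕ} {S : Finset (Fin n)} {e : Fin n} (he : e ∈ S) :
    ∃ (k l : ℕ) (f : Fin k → Fin n) (g : Fin l → Fin n) (i : Fin k),
      Splitting S f g i ∧ f i = e := by
  classical
  let T : Finset (Fin n) := insert e Sᶜ
  have heT : e ∈ T := Finset.mem_insert_self _ _
  let i := (T.orderIsoOfFin rfl).symm ⟨e, heT⟩
  have hi : T.orderEmbOfFin rfl i = e := by
    rw [← Finset.coe_orderIsoOfFin_apply]; simp [i]
  refine ⟨T.card, S.card, T.orderEmbOfFin rfl, S.orderEmbOfFin rfl, i, ⟨?_,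
    (T.orderEmbOfFin rfl).injective, (S.orderEmbOfFin rfl).injective, fun a => ⟨fun ha => ?_, ?_⟩,
    fun x => ?_⟩, hi⟩
  · rw [Finset.card_insert_of_notMem (by simp [he]), Finset.card_compl, Fintype.card_fin]
    have := Finset.card_le_univ S
    rw [Fintype.card_fin] at this
    omega
  · have h := Finset.orderEmbOfFin_mem T rfl a
    rcases Finset.mem_insert.1 h with h | h
    · exact (T.orderEmbOfFin rfl).injective (h.trans hi.symm)
    · exact absurd ha (Finset.mem_compl.1 h)
  · rintro rfl; rw [hi]; exact he
  · have := Finset.range_orderEmbOfFin S rfl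
    rw [← Finset.mem_coe, ← this]; rfl

namespace ConfSystem

variable {sys : ConfSystem} {k l n : ℕ}

/-- The inequalities required of the values at the configuration `m`. -/
structure Valid (sys : ConfSystem) (m : sys.obj n) (v : Fin n → ℝ × ℝ) : Prop where
  pos : ∀ a, 0 < (v a).2
  bound : ∀ a c, InBound (sys.bound c) (v a)
  sep : ∀ a b, a ≠ b → (v a).1 + (v a).2 ≤ sys.gap m a b + (v b).1

/-- The component `L n` of a family of maps into little intervals is continuous, equivariant, and
compatible with insertions, the values of insertions being computed by the family `R`. -/
structure GoodAt (sys : ConfSystem) (L : ∀ n, sys.obj n → Fin n → ℝ × ℝ)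
    (R : ∀ n, LineCoord n → Fin n → ℝ × ℝ) (n : ℕ) : Prop where
  continuousOn : ContinuousOn (L n) (sys.carrier n)
  valid : ∀ m ∈ sys.carrier n, sys.Valid m (L n m)
  perm : ∀ m ∈ sys.carrier n, ∀ (σ : Equiv.Perm (Fin n)) (a : Fin n),
    L n (sys.pull m σ) a = L n m (σ a)
  comp : ∀ {k l : ℕ} (i : Fin k) (h : n + 1 = k + l), ∀ m ∈ sys.carrier k, ∀ q ∈ assocSet l,
    ∀ j : Fin n, L n (sys.ins i h m q) j =
      if hb : InBlock i l j then vmul (L k m i) (R l q (sub hb)) else L k m (outer i h j)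

variable {L : ∀ n, sys.obj n → Fin n → ℝ × ℝ} {R : ∀ n, LineCoord n → Fin n → ℝ × ℝ}

/-- The values at collided labels, for any splitting: by equivariance, the labels may be arranged so
that the configuration is an insertion. -/
lemma GoodAt.split_right (hg : sys.GoodAt L R n) {m : sys.obj n} (hm : m ∈ sys.carrier n)
    {S : Finset (Fin n)} (hS : sys.Cluster m S) {f : Fin k → Fin n} {g : Fin l → Fin n} {i : Fin k}
    (hs : Splitting S f g i) (b : Fin l) :
    L n m (g b) = vmul (L k (sys.pull m f) i) (R l (linePull (sys.lin m) g) b) := by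
  have h1 := hg.perm m hm hs.perm (inner i hs.card b)
  have e : hs.perm (inner i hs.card b) = g b := hs.toFun_inner b
  rw [e] at h1
  rw [← h1]
  change L n (sys.pull m hs.toFun) _ = _
  rw [sys.pull_split hS hs, hg.comp i hs.card _ (sys.pull_mem hm hs.inj_left (Fin.pos i)) _
    (sys.lin_mem hm hS hs.inj_right (fun b => (hs.right_mem _).2 ⟨b, rfl⟩) hs.pos),
    dif_pos (inBlock_inner i hs.card b), sub_inner]

/-- The values at the labels that do not take part in a collision, for any splitting. -/
lemma GoodAt.split_left (hg : sys.GoodAt L R n) {m : sys.obj n} (hm : m ∈ sys.carrier n)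
    {S : Finset (Fin n)} (hS : sys.Cluster m S) {f : Fin k → Fin n} {g : Fin l → Fin n} {i : Fin k}
    (hs : Splitting S f g i) {a : Fin k} (ha : a ≠ i) : L n m (f a) = L k (sys.pull m f) a := by
  obtain ⟨x, hx⟩ := hs.perm.surjective (f a)
  have hxb : ¬ InBlock i l x := by
    rw [← hs.toFun_mem]
    change hs.perm x ∉ S
    rw [hx, hs.left_mem]
    exact ha
  have ho : outer i hs.card x = a := by
    apply hs.inj_left
    rw [← hx]
    change _ = hs.toFun x
    rw [Splitting.toFun, dif_neg hxb]
  rw [← hx, ← hg.perm m hm hs.perm x]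
  change L n (sys.pull m hs.toFun) _ = _
  rw [sys.pull_split hS hs, hg.comp i hs.card _ (sys.pull_mem hm hs.inj_left (Fin.pos i)) _
    (sys.lin_mem hm hS hs.inj_right (fun b => (hs.right_mem _).2 ⟨b, rfl⟩) hs.pos),
    dif_neg hxb, ho]

/-- The value at the label `j ∈ T` of the restriction of the configuration `m` to `T`. -/
def restr (sys : ConfSystem) (L : ∀ n, sys.obj n → Fin n → ℝ × ℝ) (m : sys.obj n)
    (T : Finset (Fin n)) (j : Fin n) : ℝ × ℝ :=
  if h : j ∈ T then
    L T.card (sys.pull m (T.orderEmbOfFin rfl)) ((T.orderIsoOfFin rfl).symm ⟨j, h⟩)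
  else 0

/-- By equivariance, the values on a set of labels may be computed with any enumeration of the set.
-/
lemma restr_eq (hg : sys.GoodAt L R k) {m : sys.obj n} {T : Finset (Fin n)} {f : Fin k → Fin n}
    (hm : sys.pull m f ∈ sys.carrier k) (hf : Function.Injective f)
    (hT : ∀ x, x ∈ T ↔ ∃ a, f a = x) (a : Fin k) :
    sys.restr L m T (f a) = L k (sys.pull m f) a := by
  classical
  have hk : k = T.card := by
    have : T = Finset.univ.image f := by ext x; simp [hT]
    rw [this, Finset.card_image_of_injective _ hf, Finset.card_univ, Fintype.card_fin]
  subst hk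
  have hfT : ∀ a, f a ∈ T := fun a => (hT _).2 ⟨a, rfl⟩
  let s : Fin T.card → Fin T.card := fun a => (T.orderIsoOfFin rfl).symm ⟨f a, hfT a⟩
  have hs : ∀ a, T.orderEmbOfFin rfl (s a) = f a := fun a => by
    rw [← Finset.coe_orderIsoOfFin_apply]; simp [s]
  have hsi : Function.Injective s := fun a b hab => hf (by rw [← hs, ← hs, hab])
  let σ : Equiv.Perm (Fin T.card) := Equiv.ofBijective s (Finite.injective_iff_bijective.1 hsi)
  have e1 : sys.pull m f = sys.pull (sys.pull m (T.orderEmbOfFin rfl)) σ := by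
    rw [sys.pull_pull]; congr 1; ext a : 1; exact (hs a).symm
  have hm' : sys.pull m (T.orderEmbOfFin rfl) ∈ sys.carrier T.card := by
    have h1 := sys.pull_mem hm (f := σ.symm) σ.symm.injective (Fin.pos a)
    rw [e1, sys.pull_pull, Equiv.self_comp_symm, sys.pull_id] at h1
    exact h1
  rw [e1, hg.perm _ hm', restr, dif_pos (hfT a)]
  rfl

section Inside

variable {m : sys.obj n} {S T : Finset (Fin n)} {e : Fin n}

/-- The values on a set of labels of which some have collided. -/
lemma restr_cluster (hL : ∀ k ≤ T.card, sys.GoodAt L R k)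
    (hR : ∀ l ≤ T.card, lineSystem.GoodAt R R l)
    (hm : sys.pull m (T.orderEmbOfFin rfl) ∈ sys.carrier T.card) (hS : sys.Cluster m S)
    (heT : e ∈ T) (heS : e ∈ S) :
    (∀ j ∈ T, j ∈ S → sys.restr L m T j = vmul (sys.restr L m (insert e (T \ S)) e)
      (lineSystem.restr R (sys.lin m) (T ∩ S) j)) ∧
    ∀ j ∈ T, j ∉ S → sys.restr L m T j = sys.restr L m (insert e (T \ S)) j := by
  have hT : ∀ x, x ∈ T ↔ ∃ a, T.orderEmbOfFin rfl a = x := fun x => by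
    rw [← Finset.mem_coe, ← Finset.range_orderEmbOfFin T rfl]; rfl
  obtain ⟨e', he'⟩ := (hT e).1 heT
  have hinj := (T.orderEmbOfFin rfl).injective
  have hS' := sys.cluster_pull hS hinj
  obtain ⟨k, l, f, g, i, hs, hi⟩ := exists_splitting (S := preim (T.orderEmbOfFin rfl) S) (e := e')
    (mem_preim.2 (he' ▸ heS))
  have hk : k ≤ T.card := by have := hs.card; have := hs.pos; omega
  have hl : l ≤ T.card := by have := hs.card; have := Fin.pos i; omega
  have hmf := sys.pull_mem hm hs.inj_left (Fin.pos i)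
  have hgS : ∀ b, g b ∈ preim (T.orderEmbOfFin rfl) S := fun b => (hs.right_mem _).2 ⟨b, rfl⟩
  have hmg := sys.lin_mem hm hS' hs.inj_right hgS hs.pos
  have h0 := restr_eq (hL _ le_rfl) hm hinj hT
  have h1 := restr_eq (T := insert e (T \ S)) (f := T.orderEmbOfFin rfl ∘ f) (hL k hk)
    (by rwa [← sys.pull_pull]) (hinj.comp hs.inj_left) fun x => by
      simp only [Finset.mem_insert, Finset.mem_sdiff, Function.comp]
      constructor
      · rintro (rfl | ⟨h, h'⟩)
        · exact ⟨i, by rw [hi, he']⟩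
        · obtain ⟨y, rfl⟩ := (hT x).1 h
          obtain ⟨a, -, rfl⟩ := hs.exists_left (x := y) (by rwa [mem_preim])
          exact ⟨a, rfl⟩
      · rintro ⟨a, rfl⟩
        by_cases ha : a = i
        · left; rw [ha, hi, he']
        · right
          refine ⟨(hT _).2 ⟨_, rfl⟩, fun h => ha ((hs.left_mem a).1 (mem_preim.2 h))⟩
  rw [← sys.pull_pull] at h1
  have h2 := restr_eq (sys := lineSystem) (m := sys.lin m) (T := T ∩ S)
    (f := T.orderEmbOfFin rfl ∘ g) (hR l hl)
    (by rw [sys.lin_pull] at hmg; exact hmg) (hinj.comp hs.inj_right) fun x => by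
      simp only [Finset.mem_inter, Function.comp]
      constructor
      · rintro ⟨h, h'⟩
        obtain ⟨y, rfl⟩ := (hT x).1 h
        obtain ⟨b, rfl⟩ := (hs.right_mem y).1 (mem_preim.2 h')
        exact ⟨b, rfl⟩
      · rintro ⟨b, rfl⟩
        exact ⟨(hT _).2 ⟨_, rfl⟩, mem_preim.1 (hgS b)⟩
  refine ⟨fun j hj hjS => ?_, fun j hj hjS => ?_⟩
  · obtain ⟨j', rfl⟩ := (hT j).1 hj
    obtain ⟨b, rfl⟩ := (hs.right_mem j').1 (mem_preim.2 hjS)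
    have h3 := h1 i
    simp only [Function.comp, hi, he'] at h3
    rw [h0, (hL _ le_rfl).split_right hm hS' hs, h3]
    congr 1
    rw [sys.lin_pull]
    exact (h2 b).symm
  · obtain ⟨j', rfl⟩ := (hT j).1 hj
    obtain ⟨a, ha, rfl⟩ := hs.exists_left (x := j') (by rwa [mem_preim])
    rw [h0, (hL _ le_rfl).split_left hm hS' hs ha]
    exact (h1 a).symm

end Inside

/-! ### Values on the boundary -/

/-- The values at a configuration in which the labels in `B` have collided, computed from the
configuration in which they are replaced by the single label `e ∈ B` and from the infinitesimal
configuration. -/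
def glue (sys : ConfSystem) (L : ∀ n, sys.obj n → Fin n → ℝ × ℝ)
    (R : ∀ n, LineCoord n → Fin n → ℝ × ℝ) (m : sys.obj n) (B : Finset (Fin n)) (e j : Fin n) :
    ℝ × ℝ :=
  if j ∈ B then vmul (sys.restr L m (insert e Bᶜ) e) (lineSystem.restr R (sys.lin m) B j)
  else sys.restr L m (insert e Bᶜ) j

lemma card_insert_compl_lt {B : Finset (Fin n)} {e : Fin n} (hB : 2 ≤ B.card) :
    (insert e Bᶜ).card < n := by
  have h1 := Finset.card_insert_le e Bᶜ
  have h2 := Finset.card_le_univ B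
  rw [Finset.card_compl] at h1
  rw [Fintype.card_fin] at h1 h2
  omega

lemma pull_enum_mem {m : sys.obj n} (hm : m ∈ sys.carrier n) {T : Finset (Fin n)} {e : Fin n}
    (he : e ∈ T) : sys.pull m (T.orderEmbOfFin rfl) ∈ sys.carrier T.card :=
  sys.pull_mem hm (T.orderEmbOfFin rfl).injective (Finset.card_pos.2 ⟨e, he⟩)

lemma Splitting_range {S : Finset (Fin n)} {f : Fin k → Fin n} {g : Fin l → Fin n} {i : Fin k}
    (hs : Splitting S f g i) (x : Fin n) : x ∈ insert (f i) Sᶜ ↔ ∃ a, f a = x := by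
  simp only [Finset.mem_insert, Finset.mem_compl]
  constructor
  · rintro (rfl | h)
    · exact ⟨i, rfl⟩
    · obtain ⟨a, -, ha⟩ := hs.exists_left h
      exact ⟨a, ha⟩
  · rintro ⟨a, rfl⟩
    by_cases ha : a = i
    · left; rw [ha]
    · right; rwa [hs.left_mem]

section Glue

variable {m : sys.obj n} {B B' : Finset (Fin n)} {e e' : Fin n}

/-- The values do not depend on the label that represents the collided ones. -/
lemma glue_congr (hL : ∀ k < n, sys.GoodAt L R k) (hm : m ∈ sys.carrier n) (hB : sys.Cluster m B)
    (h2 : 2 ≤ B.card) (he : e ∈ B) (he' : e' ∈ B) (j : Fin n) :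
    sys.glue L R m B e j = sys.glue L R m B e' j := by
  obtain ⟨k, l, f, g, i, hs, rfl⟩ := exists_splitting he
  have hs' : Splitting B (Function.update f i e') g i := by
    refine ⟨hs.card, fun a b hab => ?_, hs.inj_right, fun a => ?_, hs.right_mem⟩
    · by_cases ha : a = i <;> by_cases hb : b = i
      · rw [ha, hb]
      · subst ha
        rw [Function.update_self, Function.update_of_ne hb] at hab
        exact absurd ((hs.left_mem b).1 (hab ▸ he')) hb
      · subst hb
        rw [Function.update_self, Function.update_of_ne ha] at hab
        exact absurd ((hs.left_mem a).1 (hab ▸ he')) ha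
      · rw [Function.update_of_ne ha, Function.update_of_ne hb] at hab
        exact hs.inj_left hab
    · by_cases ha : a = i
      · subst ha; simpa using he'
      · rw [Function.update_of_ne ha]; exact hs.left_mem a
  have hk : k < n := by
    have h1 := hs.card
    have : l = B.card := by
      classical
      have : B = Finset.univ.image g := by ext x; simp [hs.right_mem]
      rw [this, Finset.card_image_of_injective _ hs.inj_right, Finset.card_univ, Fintype.card_fin]
    omega
  have hp : sys.pull m f = sys.pull m (Function.update f i e') :=
    sys.pull_congr hm hB hs.left_mem (by simpa using he') fun a ha => by
      rw [Function.update_of_ne ha]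
  have h1 := restr_eq (hL k hk) (sys.pull_mem hm hs.inj_left (Fin.pos i)) hs.inj_left
    (Splitting_range hs)
  have h2 := restr_eq (hL k hk) (sys.pull_mem hm hs'.inj_left (Fin.pos i)) hs'.inj_left
    (Splitting_range hs')
  rw [← hp] at h2
  have h2' := h2 i
  rw [Function.update_self] at h2 h2'
  unfold glue
  split_ifs with hj
  · rw [h1, h2']
  · obtain ⟨a, ha, rfl⟩ := hs.exists_left hj
    rw [h1]
    have := h2 a
    rw [Function.update_of_ne ha] at this
    exact this.symm

/-- The values computed from nested sets of collided labels agree, since the lower families are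
compatible with insertions and composition of affine maps is associative. -/
lemma glue_nested (hL : ∀ k < n, sys.GoodAt L R k) (hR : ∀ l < n, lineSystem.GoodAt R R l)
    (hR' : lineSystem.GoodAt R R B'.card)
    (hm : m ∈ sys.carrier n) (hB : sys.Cluster m B) (hB' : sys.Cluster m B')
    (h2 : 2 ≤ B.card) (hBB : B ⊆ B') (he : e ∈ B) (j : Fin n) :
    sys.glue L R m B e j = sys.glue L R m B' e j := by
  classical
  have he' := hBB he
  have hR'' : ∀ l ≤ B'.card, lineSystem.GoodAt R R l := fun l hl => by
    rcases hl.eq_or_lt with rfl | hl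
    · exact hR'
    · refine hR l (hl.trans_le ?_)
      have := Finset.card_le_univ B'
      rwa [Fintype.card_fin] at this
  have hT := card_insert_compl_lt (e := e) h2
  have heT : e ∈ insert e Bᶜ := Finset.mem_insert_self _ _
  obtain ⟨a1, a2⟩ := restr_cluster (T := insert e Bᶜ) (fun k hk => hL k (hk.trans_lt hT))
    (fun l hl => hR l (hl.trans_lt hT)) (pull_enum_mem hm heT) hB' heT he'
  obtain ⟨b1, b2⟩ := restr_cluster (sys := lineSystem) (m := sys.lin m) (T := B') (S := B) hR'' hR''
    (sys.lin_mem hm hB' (B'.orderEmbOfFin rfl).injective (fun b => Finset.orderEmbOfFin_mem _ _ _)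
      (Finset.card_pos.2 ⟨e, he'⟩)) (sys.collapses hB) he' he
  have c1 : insert e (insert e Bᶜ \ B') = insert e B'ᶜ := by
    ext x
    simp only [Finset.mem_insert, Finset.mem_sdiff, Finset.mem_compl]
    have := @hBB x
    tauto
  have c2 : insert e Bᶜ ∩ B' = insert e (B' \ B) := by
    ext x
    simp only [Finset.mem_insert, Finset.mem_inter, Finset.mem_sdiff, Finset.mem_compl]
    constructor
    · tauto
    · rintro (rfl | h) <;> tauto
  rw [c1, c2] at a1
  rw [c1] at a2
  rw [Finset.inter_eq_right.2 hBB] at b1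
  change ∀ j ∈ B', j ∈ B → _ = vmul _ (lineSystem.restr R (sys.lin m) B j) at b1
  unfold glue
  by_cases hj : j ∈ B
  · rw [if_pos hj, if_pos (hBB hj), a1 e heT he', b1 j (hBB hj) hj, vmul_assoc]
  · have hjT : j ∈ insert e Bᶜ := Finset.mem_insert_of_mem (Finset.mem_compl.2 hj)
    by_cases hj' : j ∈ B'
    · rw [if_neg hj, if_pos hj', a1 j hjT hj', b2 j hj' hj]
    · rw [if_neg hj, if_neg hj', a2 j hjT hj']

/-- The values computed from disjoint sets of collided labels agree: both are computed from the
configuration in which either set is replaced by a single label. -/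
lemma glue_disjoint (hL : ∀ k < n, sys.GoodAt L R k) (hR : ∀ l < n, lineSystem.GoodAt R R l)
    (hm : m ∈ sys.carrier n) (hB : sys.Cluster m B) (hB' : sys.Cluster m B')
    (h2 : 2 ≤ B.card) (h2' : 2 ≤ B'.card) (hBB : Disjoint B B') (he : e ∈ B) (he' : e' ∈ B')
    (j : Fin n) : sys.glue L R m B e j = sys.glue L R m B' e' j := by
  classical
  have hd : ∀ x, x ∈ B → x ∉ B' := fun _ => (Finset.disjoint_left.1 hBB ·)
  have hT := card_insert_compl_lt (e := e) h2
  have hT' := card_insert_compl_lt (e := e') h2'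
  have heT : e ∈ insert e Bᶜ := Finset.mem_insert_self _ _
  have heT' : e' ∈ insert e Bᶜ :=
    Finset.mem_insert_of_mem (Finset.mem_compl.2 fun h => hd _ h he')
  have heU' : e' ∈ insert e' B'ᶜ := Finset.mem_insert_self _ _
  have heU : e ∈ insert e' B'ᶜ := Finset.mem_insert_of_mem (Finset.mem_compl.2 (hd _ he))
  obtain ⟨a1, a2⟩ := restr_cluster (T := insert e Bᶜ) (fun k hk => hL k (hk.trans_lt hT))
    (fun l hl => hR l (hl.trans_lt hT)) (pull_enum_mem hm heT) hB' heT' he'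
  obtain ⟨b1, b2⟩ := restr_cluster (T := insert e' B'ᶜ) (fun k hk => hL k (hk.trans_lt hT'))
    (fun l hl => hR l (hl.trans_lt hT')) (pull_enum_mem hm heU) hB heU he
  have c1 : insert e' (insert e Bᶜ \ B') = insert e (insert e' B'ᶜ \ B) := by
    ext x
    simp only [Finset.mem_insert, Finset.mem_sdiff, Finset.mem_compl]
    have := hd x
    constructor
    · rintro (rfl | ⟨rfl | h, h'⟩) <;> tauto
    · rintro (rfl | ⟨rfl | h, h'⟩) <;> tauto
  have c2 : insert e Bᶜ ∩ B' = B' := by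
    ext x
    simp only [Finset.mem_insert, Finset.mem_inter, Finset.mem_compl]
    have := hd x
    tauto
  have c3 : insert e' B'ᶜ ∩ B = B := by
    ext x
    simp only [Finset.mem_insert, Finset.mem_inter, Finset.mem_compl]
    have := hd x
    tauto
  rw [c2] at a1
  rw [c3] at b1
  unfold glue
  by_cases hj : j ∈ B
  · rw [if_pos hj, if_neg (hd _ hj), a2 e heT (hd _ he), c1,
      b1 j (Finset.mem_insert_of_mem (Finset.mem_compl.2 (hd _ hj))) hj]
  · have hjT : j ∈ insert e Bᶜ := Finset.mem_insert_of_mem (Finset.mem_compl.2 hj)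
    by_cases hj' : j ∈ B'
    · rw [if_neg hj, if_pos hj', a1 j hjT hj', b2 e' heU' (fun h => hd _ h he'), c1]
    · rw [if_neg hj, if_neg hj', a2 j hjT hj', c1,
        b2 j (Finset.mem_insert_of_mem (Finset.mem_compl.2 hj')) hj]

/-- The values at a configuration do not depend on the set of collided labels that is used to
compute them. -/
lemma glue_eq_glue (hL : ∀ k < n, sys.GoodAt L R k) (hR : ∀ l < n, lineSystem.GoodAt R R l)
    (hRB : lineSystem.GoodAt R R B.card) (hRB' : lineSystem.GoodAt R R B'.card)
    (hm : m ∈ sys.carrier n) (hB : sys.Cluster m B) (hB' : sys.Cluster m B')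
    (h2 : 2 ≤ B.card) (h2' : 2 ≤ B'.card) (he : e ∈ B) (he' : e' ∈ B')
    (j : Fin n) : sys.glue L R m B e j = sys.glue L R m B' e' j := by
  rcases sys.laminar hm hB hB' with h | h | h
  · exact glue_disjoint hL hR hm hB hB' h2 h2' h he he' j
  · rw [glue_nested hL hR hRB' hm hB hB' h2 h he, glue_congr hL hm hB' h2' (h he) he']
  · rw [glue_congr hL hm hB h2 he (h he'), glue_nested hL hR hRB hm hB' hB h2' h he']

lemma restr_valid (hg : sys.GoodAt L R B.card) (hm : sys.pull m (B.orderEmbOfFin rfl) ∈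
    sys.carrier B.card) :
    (∀ a ∈ B, 0 < (sys.restr L m B a).2 ∧ ∀ c, InBound (sys.bound c) (sys.restr L m B a)) ∧
    ∀ a ∈ B, ∀ b ∈ B, a ≠ b → (sys.restr L m B a).1 + (sys.restr L m B a).2 ≤
      sys.gap m a b + (sys.restr L m B b).1 := by
  have hT : ∀ x, x ∈ B ↔ ∃ a, B.orderEmbOfFin rfl a = x := fun x => by
    rw [← Finset.mem_coe, ← Finset.range_orderEmbOfFin B rfl]; rfl
  have h0 := restr_eq hg hm (B.orderEmbOfFin rfl).injective hT
  have hv := hg.valid _ hm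
  refine ⟨fun a ha => ?_, fun a ha b hb hab => ?_⟩
  · obtain ⟨a, rfl⟩ := (hT a).1 ha
    rw [h0]
    exact ⟨hv.pos a, hv.bound a⟩
  · obtain ⟨a, rfl⟩ := (hT a).1 ha
    obtain ⟨b, rfl⟩ := (hT b).1 hb
    rw [h0, h0]
    have := hv.sep a b fun h => hab (by rw [h])
    rwa [sys.gap_pull] at this

/-- The intervals given by the glued values are separated, by comparison with the separation of the
intervals before the insertion and of the inserted ones. -/
lemma glue_valid (hL : ∀ k < n, sys.GoodAt L R k) (hR : lineSystem.GoodAt R R B.card)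
    (hm : m ∈ sys.carrier n) (hB : sys.Cluster m B) (h2 : 2 ≤ B.card) (he : e ∈ B) :
    sys.Valid m (sys.glue L R m B e) := by
  have heT : e ∈ insert e Bᶜ := Finset.mem_insert_self _ _
  obtain ⟨o1, o2⟩ := restr_valid (hL _ (card_insert_compl_lt (e := e) h2)) (pull_enum_mem hm heT)
  obtain ⟨q1, q2⟩ := restr_valid (sys := lineSystem) (m := sys.lin m) hR
    (sys.lin_mem hm hB (B.orderEmbOfFin rfl).injective (fun b => Finset.orderEmbOfFin_mem _ _ _)
      (Finset.card_pos.2 ⟨e, he⟩))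
  have q3 : ∀ a ∈ B, 0 ≤ (lineSystem.restr R (sys.lin m) B a).1 ∧
      (lineSystem.restr R (sys.lin m) B a).1 + (lineSystem.restr R (sys.lin m) B a).2 ≤ 1 :=
    fun a ha => by
      have h0 := (q1 a ha).2 0
      have h1 := (q1 a ha).2 1
      simp only [lineSystem, InBound, Matrix.cons_val_zero, Matrix.cons_val_one] at h0 h1 ⊢
      constructor <;> linarith
  have hsep : ∀ a ∈ B, ∀ b ∈ B, a ≠ b → (lineSystem.restr R (sys.lin m) B a).1 +
      (lineSystem.restr R (sys.lin m) B a).2 ≤ 1 - (sys.lin m).1 a b +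
        (lineSystem.restr R (sys.lin m) B b).1 := q2
  have hT : ∀ x, x ∉ B → x ∈ insert e Bᶜ := fun x hx =>
    Finset.mem_insert_of_mem (Finset.mem_compl.2 hx)
  obtain ⟨p1, p2⟩ := o1 e heT
  refine ⟨fun a => ?_, fun a => ?_, fun a b hab => ?_⟩
  · unfold glue
    split_ifs with ha
    · exact mul_pos p1 (q1 a ha).1
    · exact (o1 a (hT a ha)).1
  · unfold glue
    split_ifs with ha
    · exact sys.bound_vmul p1 p2 (q1 a ha).1 (q3 a ha).1 (q3 a ha).2
    · exact (o1 a (hT a ha)).2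
  · unfold glue
    by_cases ha : a ∈ B <;> by_cases hb : b ∈ B
    · rw [if_pos ha, if_pos hb]
      have h3 := sys.bound_gap hm hB ha hb hab p1 p2
      have h4 := mul_le_mul_of_nonneg_left (hsep a ha b hb hab) p1.le
      simp only [vmul]
      linarith
    · rw [if_pos ha, if_neg hb]
      have h3 := o2 e heT b (hT b hb) (fun h => hb (h ▸ he))
      have h4 := sys.gap_collapse hB e he a b fun h => hb h.2
      simp only [collapse, if_pos ha, if_neg hb] at h4
      have h5 := mul_le_mul_of_nonneg_left (q3 a ha).2 p1.le
      simp only [vmul]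
      rw [h4]
      linarith
    · rw [if_neg ha, if_pos hb]
      have h3 := o2 a (hT a ha) e heT (fun h => ha (h ▸ he))
      have h4 := sys.gap_collapse hB e he a b fun h => ha h.1
      simp only [collapse, if_pos hb, if_neg ha] at h4
      have h5 := mul_nonneg p1.le (q3 b hb).1
      simp only [vmul]
      rw [h4]
      linarith
    · rw [if_neg ha, if_neg hb]
      exact o2 a (hT a ha) b (hT b hb) hab

lemma restr_perm (hg : sys.GoodAt L R B.card) (hm : sys.pull m (B.orderEmbOfFin rfl) ∈
    sys.carrier B.card) (σ : Equiv.Perm (Fin n)) {a : Fin n} (ha : σ a ∈ B) :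
    sys.restr L (sys.pull m σ) (preim σ B) a = sys.restr L m B (σ a) := by
  have hT : ∀ x, x ∈ B ↔ ∃ a, B.orderEmbOfFin rfl a = x := fun x => by
    rw [← Finset.mem_coe, ← Finset.range_orderEmbOfFin B rfl]; rfl
  have hinj := (B.orderEmbOfFin rfl).injective
  obtain ⟨b, hb⟩ := (hT _).1 ha
  have hc : σ ∘ (σ.symm ∘ B.orderEmbOfFin rfl) = B.orderEmbOfFin rfl := by ext x : 1; simp
  have h1 := restr_eq (m := sys.pull m σ) (T := preim σ B) (f := σ.symm ∘ B.orderEmbOfFin rfl) hg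
    (by rwa [sys.pull_pull, hc]) (σ.symm.injective.comp hinj) (fun x => by
      rw [mem_preim, hT]
      simp only [Function.comp, Equiv.symm_apply_eq]) b
  rw [sys.pull_pull, hc] at h1
  have h2 := restr_eq hg hm hinj hT b
  rw [← hb, h2, ← h1]
  congr 1
  simp only [Function.comp, hb, Equiv.symm_apply_apply]

lemma glue_perm (hL : ∀ k < n, sys.GoodAt L R k) (hR : lineSystem.GoodAt R R B.card)
    (hm : m ∈ sys.carrier n) (hB : sys.Cluster m B) (h2 : 2 ≤ B.card) (σ : Equiv.Perm (Fin n))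
    (he : σ e ∈ B) (a : Fin n) :
    sys.glue L R (sys.pull m σ) (preim σ B) e a = sys.glue L R m B (σ e) (σ a) := by
  classical
  have heT : σ e ∈ insert (σ e) Bᶜ := Finset.mem_insert_self _ _
  have hT : insert e (preim σ B)ᶜ = preim σ (insert (σ e) Bᶜ) := by
    ext x
    simp only [Finset.mem_insert, Finset.mem_compl, mem_preim, σ.injective.eq_iff]
  have h1 := fun a ha => restr_perm (hL _ (card_insert_compl_lt (e := σ e) h2))
    (pull_enum_mem hm heT) σ (a := a) ha
  have h3 := fun a ha => restr_perm (sys := lineSystem) (m := sys.lin m) hR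
    (sys.lin_mem hm hB (B.orderEmbOfFin rfl).injective (fun b => Finset.orderEmbOfFin_mem _ _ _)
      (Finset.card_pos.2 ⟨_, he⟩)) σ (a := a) ha
  unfold glue
  simp only [mem_preim, hT]
  split_ifs with ha
  · rw [h1 e heT, sys.lin_pull]
    congr 1
    exact h3 a ha
  · exact h1 a (Finset.mem_insert_of_mem (Finset.mem_compl.2 ha))

lemma continuousOn_restr (hg : sys.GoodAt L R B.card) {U : Set (sys.obj n)}
    (hU : ∀ m ∈ U, sys.pull m (B.orderEmbOfFin rfl) ∈ sys.carrier B.card) (j : Fin n) :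
    ContinuousOn (fun m => sys.restr L m B j) U := by
  unfold restr
  split_ifs with h
  · exact (continuous_apply _).comp_continuousOn
      (hg.continuousOn.comp (sys.continuous_pull _).continuousOn hU)
  · exact continuousOn_const

lemma continuousOn_glue (hL : ∀ k < n, sys.GoodAt L R k) (hR : lineSystem.GoodAt R R B.card)
    (h2 : 2 ≤ B.card) (he : e ∈ B) (j : Fin n) :
    ContinuousOn (fun m => sys.glue L R m B e j) (sys.carrier n ∩ {m | sys.Cluster m B}) := by
  have heT : e ∈ insert e Bᶜ := Finset.mem_insert_self _ _
  have h1 := fun j => continuousOn_restr (hL _ (card_insert_compl_lt (e := e) h2))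
    (U := sys.carrier n ∩ {m | sys.Cluster m B}) (fun m hm => pull_enum_mem hm.1 heT) j
  have h3 := (continuousOn_restr (sys := lineSystem)
    (U := {p | linePull p (B.orderEmbOfFin rfl) ∈ assocSet B.card}) hR (fun m hm => hm) j).comp
    (sys.continuous_lin n).continuousOn (s := sys.carrier n ∩ {m | sys.Cluster m B}) fun m hm =>
      sys.lin_mem hm.1 hm.2 (B.orderEmbOfFin rfl).injective
        (fun b => Finset.orderEmbOfFin_mem _ _ _) (Finset.card_pos.2 ⟨_, he⟩)
  unfold glue vmul
  split_ifs with hj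
  · have h4 := h1 e
    exact ((continuous_fst.comp_continuousOn h4).add ((continuous_snd.comp_continuousOn h4).mul
      (continuous_fst.comp_continuousOn h3))).prodMk ((continuous_snd.comp_continuousOn h4).mul
      (continuous_snd.comp_continuousOn h3))
  · exact h1 j

end Glue

lemma glue_ins (hL : ∀ k < n, sys.GoodAt L R k) (hR : lineSystem.GoodAt R R l) (hl : 2 ≤ l)
    (i : Fin k) (h : n + 1 = k + l) {m : sys.obj k} (hm : m ∈ sys.carrier k) {q : LineCoord l}
    (hq : q ∈ assocSet l) (j : Fin n) :
    sys.glue L R (sys.ins i h m q) (block i l n) (inner i h ⟨0, by omega⟩) j =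
      if hb : InBlock i l j then vmul (L k m i) (R l q (sub hb)) else L k m (outer i h j) := by
  obtain ⟨f, hf, hfi⟩ := exists_section_outer i h (show 0 < l by omega)
  have hinj : Function.Injective f := fun a b hab => by rw [← hf a, ← hf b, hab]
  have hpf := sys.pull_ins i h hm hq hf
  have hfo : ∀ x : Fin n, ¬ InBlock i l x → f (outer i h x) = x := fun x hx =>
    eq_of_outer_eq i h (hf _) fun hb => hx hb.2
  have h1 := restr_eq (T := insert (inner i h ⟨0, by omega⟩) (block i l n)ᶜ) (hL k (by omega))
    (m := sys.ins i h m q) (f := f) (by rwa [hpf]) hinj fun x => by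
      rw [← hfi, Finset.mem_insert, Finset.mem_compl, mem_block]
      constructor
      · rintro (rfl | hx)
        · exact ⟨i, rfl⟩
        · exact ⟨_, hfo x hx⟩
      · rintro ⟨a, rfl⟩
        by_cases ha : a = i
        · left; rw [ha]
        · right; rwa [← outer_eq_iff i h, hf]
  rw [hpf] at h1
  have hlin := sys.lin_ins i h m q
  have h2 := restr_eq (sys := lineSystem) (m := sys.lin (sys.ins i h m q)) (T := block i l n)
    (f := inner i h) hR (show linePull _ _ ∈ assocSet l by rwa [hlin])
    (fun a b hab => by rw [Fin.ext_iff] at hab ⊢; simpa [inner] using hab) fun x => by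
      rw [mem_block]
      constructor
      · intro hx
        refine ⟨sub hx, ?_⟩
        rw [Fin.ext_iff]
        simp only [inner, sub, InBlock] at *
        omega
      · rintro ⟨b, rfl⟩
        exact inBlock_inner i h b
  unfold glue
  simp only [mem_block]
  split_ifs with hb
  · have e1 := h1 i
    rw [hfi] at e1
    rw [e1]
    have e2 := h2 (sub hb)
    have e3 : (inner i h (sub hb) : Fin n) = j := by
      rw [Fin.ext_iff]; simp only [inner, sub, InBlock] at *; omega
    rw [e3] at e2
    rw [e2]
    congr 2
  · have := h1 (outer i h j)
    rwa [hfo j hb] at this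

end ConfSystem

namespace ConfSystem

variable {sys : ConfSystem} {k l n : ℕ}
  {L : ∀ n, sys.obj n → Fin n → ℝ × ℝ} {R : ∀ n, LineCoord n → Fin n → ℝ × ℝ}

/-! ### Extension from the boundary -/

/-- The inequalities of `Valid`, as a family of affine functions of the values. -/
def constraint (sys : ConfSystem) (m : sys.obj n) (v : Fin n → ℝ × ℝ) :
    Fin n ⊕ (Fin n × Fin 2) ⊕ (Fin n × Fin n) → ℝ
  | Sum.inl a => (v a).2
  | Sum.inr (Sum.inl x) =>
    (sys.bound x.2).1 + (sys.bound x.2).2.1 * (v x.1).1 + (sys.bound x.2).2.2 * (v x.1).2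
  | Sum.inr (Sum.inr x) =>
    if x.1 = x.2 then 1 else sys.gap m x.1 x.2 + (v x.2).1 - ((v x.1).1 + (v x.1).2)

lemma constraint_affine (m : sys.obj n) (v w : Fin n → ℝ × ℝ) (t : ℝ)
    (i : Fin n ⊕ (Fin n × Fin 2) ⊕ (Fin n × Fin n)) :
    sys.constraint m (v + t • (w - v)) i =
      (1 - t) * sys.constraint m v i + t * sys.constraint m w i := by
  rcases i with a | x | x
  · simp [constraint]; ring
  · simp [constraint]; ring
  · simp only [constraint]
    split_ifs
    · ring
    · simp; ring

lemma continuous_constraint (i : Fin n ⊕ (Fin n × Fin 2) ⊕ (Fin n × Fin n)) :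
    Continuous fun p : sys.obj n × (Fin n → ℝ × ℝ) => sys.constraint p.1 p.2 i := by
  rcases i with a | x | x
  · simp only [constraint]; fun_prop
  · simp only [constraint]; fun_prop
  · simp only [constraint]
    split_ifs
    · exact continuous_const
    · have := (sys.continuous_gap x.1 x.2).comp
        (continuous_fst : Continuous fun p : sys.obj n × (Fin n → ℝ × ℝ) => p.1)
      exact (Continuous.add this (by fun_prop)).sub (by fun_prop)

lemma valid_iff {m : sys.obj n} {v : Fin n → ℝ × ℝ} : sys.Valid m v ↔
    (∀ i, 0 ≤ sys.constraint m v i) ∧ ∀ a, 0 < (v a).2 := by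
  constructor
  · intro h
    refine ⟨?_, h.pos⟩
    rintro (a | x | x)
    · exact (h.pos a).le
    · exact h.bound x.1 x.2
    · simp only [constraint]
      split_ifs with hx
      · exact zero_le_one
      · linarith [h.sep x.1 x.2 hx]
  · rintro ⟨h, hp⟩
    refine ⟨hp, fun a c => h (Sum.inr (Sum.inl (a, c))), fun a b hab => ?_⟩
    have := h (Sum.inr (Sum.inr (a, b)))
    simp only [constraint, if_neg hab] at this
    linarith

/-- Valid values given on a closed set extend to valid values. -/
lemma exists_valid_extension {A : Set (sys.obj n)} (hA : IsClosed A)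
    (hAc : A ⊆ sys.carrier n) {v : sys.obj n → Fin n → ℝ × ℝ} (hv : ContinuousOn v A)
    (hvA : ∀ m ∈ A, sys.Valid m (v m)) :
    ∃ w : sys.obj n → Fin n → ℝ × ℝ, ContinuousOn w (sys.carrier n) ∧
      (∀ m ∈ sys.carrier n, sys.Valid m (w m)) ∧ ∀ m ∈ A, w m = v m := by
  classical
  have : CompactSpace (sys.carrier n) := isCompact_iff_compactSpace.1 (sys.isCompact_carrier n)
  -- the lengths on the compact set `A` are bounded below; this margin keeps them positive
  obtain ⟨δ, hδ, hδA⟩ : ∃ δ : ℝ, 0 < δ ∧ ∀ m ∈ A, ∀ a, δ ≤ (v m a).2 := by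
    have hAk : IsCompact A := (sys.isCompact_carrier n).of_isClosed_subset hA hAc
    have : ∀ a : Fin n, ∃ δ : ℝ, 0 < δ ∧ ∀ m ∈ A, δ ≤ (v m a).2 := by
      intro a
      rcases A.eq_empty_or_nonempty with rfl | hne
      · exact ⟨1, one_pos, by simp⟩
      · obtain ⟨m, hm, hmin⟩ := hAk.exists_isMinOn hne
          ((by fun_prop : Continuous fun v : Fin n → ℝ × ℝ => (v a).2).comp_continuousOn hv)
        exact ⟨(v m a).2, (hvA m hm).pos a, fun m' hm' => hmin hm'⟩
    choose d hd hd' using this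
    rcases isEmpty_or_nonempty (Fin n) with hn | hn
    · exact ⟨1, one_pos, fun _ _ a => (hn.false a).elim⟩
    · obtain ⟨a, ha⟩ := exists_eq_ciInf_of_finite (f := d)
      exact ⟨d a, hd a, fun m hm b => (ha ▸ ciInf_le (Set.finite_range d).bddBelow b).trans
        (hd' b m hm)⟩
  have hcont : Continuous fun x : sys.carrier n × (Fin n → ℝ × ℝ) => ((x.1 : sys.obj n), x.2) := by
    fun_prop
  obtain ⟨w, hw1, hw2⟩ := exists_extension_of_affine
    (X := sys.carrier n) (V := Fin n → ℝ × ℝ) (fun i x v => sys.constraint x.1 v i)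
    (fun i => (continuous_constraint i).comp hcont)
    (fun i x v w t => constraint_affine x.1 v w t i)
    (fun x => by
      obtain ⟨v, h1, h2, h3⟩ := sys.feasible x.2
      refine ⟨v, ?_⟩
      rintro (a | y | y)
      · exact h1 a
      · exact h2 y.1 y.2
      · simp only [constraint]
        split_ifs with hy
        · exact one_pos
        · linarith [h3 y.1 y.2 hy])
    (hA.preimage continuous_subtype_val) (v := fun x => v x.1)
    (hv.comp continuous_subtype_val.continuousOn fun x hx => hx)
    (fun i => Sum.elim (fun _ => δ) (fun _ => 0) i)
    (by rintro (a | x) <;> simp [hδ.le])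
    (by
      rintro x hx (a | y)
      · exact hδA x.1 hx a
      · exact (valid_iff.1 (hvA x.1 hx)).1 (Sum.inr y))
  refine ⟨fun m => if h : m ∈ sys.carrier n then w ⟨m, h⟩ else 0, ?_, fun m hm => ?_,
    fun m hm => ?_⟩
  · rw [continuousOn_iff_continuous_domRestrict]
    have : (sys.carrier n).domRestrict (fun m => if h : m ∈ sys.carrier n then w ⟨m, h⟩ else 0) =
        w := by
      ext x : 1
      simp [Set.domRestrict]
    rw [this]
    exact w.continuous
  · simp only [dif_pos hm]
    exact valid_iff.2 ⟨fun i => (hw2 ⟨m, hm⟩ i).1, fun a => (hw2 ⟨m, hm⟩ (Sum.inl a)).2 hδ⟩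
  · simp only [dif_pos (hAc hm)]
    exact hw1 ⟨m, hAc hm⟩ hm

lemma Valid.pull {m : sys.obj n} {v : Fin n → ℝ × ℝ} {σ : Equiv.Perm (Fin n)}
    (h : sys.Valid (sys.pull m σ) v) : sys.Valid m fun a => v (σ.symm a) := by
  refine ⟨fun a => h.pos _, fun a => h.bound _, fun a b hab => ?_⟩
  have := h.sep (σ.symm a) (σ.symm b) (σ.symm.injective.ne hab)
  rwa [sys.gap_pull, Equiv.apply_symm_apply, Equiv.apply_symm_apply] at this

lemma constraint_average {ι : Type*} [Fintype ι] [Nonempty ι] (m : sys.obj n)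
    (v : ι → Fin n → ℝ × ℝ) (i : Fin n ⊕ (Fin n × Fin 2) ⊕ (Fin n × Fin n)) :
    sys.constraint m ((Fintype.card ι : ℝ)⁻¹ • ∑ s, v s) i =
      (Fintype.card ι : ℝ)⁻¹ * ∑ s, sys.constraint m (v s) i := by
  have hc : (Fintype.card ι : ℝ) ≠ 0 := by simp
  have e : ∀ c : ℝ, c = (Fintype.card ι : ℝ)⁻¹ * ∑ _s : ι, c := fun c => by
    rw [Finset.sum_const, Finset.card_univ, nsmul_eq_mul, inv_mul_cancel_left₀ hc]
  have f1 : ∀ a, (((Fintype.card ι : ℝ)⁻¹ • ∑ s, v s) a).1 =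
      (Fintype.card ι : ℝ)⁻¹ * ∑ s, (v s a).1 := fun a => by
    simp [Finset.sum_apply, Prod.fst_sum]
  have f2 : ∀ a, (((Fintype.card ι : ℝ)⁻¹ • ∑ s, v s) a).2 =
      (Fintype.card ι : ℝ)⁻¹ * ∑ s, (v s a).2 := fun a => by
    simp [Finset.sum_apply, Prod.snd_sum]
  rcases i with a | x | x
  · simp only [constraint, f2]
  · simp only [constraint, f1, f2, Finset.sum_add_distrib, ← Finset.mul_sum]
    rw [e (sys.bound x.2).1]
    simp only [Finset.sum_const, Finset.card_univ, nsmul_eq_mul]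
    field_simp
  · simp only [constraint]
    split_ifs
    · exact e 1
    · simp only [f1, f2, Finset.sum_add_distrib, Finset.sum_sub_distrib]
      rw [e (sys.gap m x.1 x.2)]
      simp only [Finset.sum_const, Finset.card_univ, nsmul_eq_mul]
      field_simp

/-- The values in arity `n` can be chosen when those in lower arities are given. The condition
`full` expresses that configurations in which all labels have collided are insertions as well. -/
theorem exists_step (full : Prop) (hL : ∀ k < n, sys.GoodAt L R k)
    (hR : ∀ l, (l < n ∨ full) → lineSystem.GoodAt R R l) :
    ∃ g : sys.obj n → Fin n → ℝ × ℝ, ContinuousOn g (sys.carrier n) ∧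
      (∀ m ∈ sys.carrier n, sys.Valid m (g m)) ∧
      (∀ m ∈ sys.carrier n, ∀ (σ : Equiv.Perm (Fin n)) (a : Fin n),
        g (sys.pull m σ) a = g m (σ a)) ∧
      ∀ {k l : ℕ} (i : Fin k) (h : n + 1 = k + l), 2 ≤ l → (full ∨ 2 ≤ k) →
        ∀ m ∈ sys.carrier k, ∀ q ∈ assocSet l, ∀ j : Fin n, g (sys.ins i h m q) j =
          if hb : InBlock i l j then vmul (L k m i) (R l q (sub hb)) else L k m (outer i h j) := by
  classical
  -- the labels in `B` have collided, and `m` is an insertion at that place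
  let bd : Finset (Fin n) → Prop := fun B => 2 ≤ B.card ∧ (full ∨ B ≠ Finset.univ)
  have hRB : ∀ B, bd B → lineSystem.GoodAt R R B.card := fun B hB => hR _ (hB.2.symm.imp_left
    fun h => by
      have := Finset.card_lt_card (Finset.ssubset_univ_iff.2 h)
      rwa [Finset.card_univ, Fintype.card_fin] at this)
  have hR' : ∀ l < n, lineSystem.GoodAt R R l := fun l hl => hR l (Or.inl hl)
  let I : Type := {x : Finset (Fin n) × Fin n // bd x.1 ∧ x.2 ∈ x.1}
  let U : I → Set (sys.obj n) := fun x => sys.carrier n ∩ {m | sys.Cluster m x.1.1}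
  have hUc : ∀ x, IsClosed (U x) := fun x =>
    (sys.isCompact_carrier n).isClosed.inter (sys.isClosed_cluster _)
  -- the values on the boundary, which are forced by those in lower arities
  let v : sys.obj n → Fin n → ℝ × ℝ := fun m j =>
    if h : ∃ x : I, m ∈ U x then sys.glue L R m h.choose.1.1 h.choose.1.2 j else 0
  have hvU : ∀ (x : I) (m : sys.obj n), m ∈ U x → v m = sys.glue L R m x.1.1 x.1.2 := by
    intro x m hm
    have h : ∃ x : I, m ∈ U x := ⟨x, hm⟩
    ext1 j
    simp only [v, dif_pos h]
    have hc := h.choose_spec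
    generalize h.choose = y at hc
    exact glue_eq_glue hL hR' (hRB _ y.2.1) (hRB _ x.2.1) hm.1 hc.2 hm.2 y.2.1.1 x.2.1.1 y.2.2
      x.2.2 j
  have hvc : ContinuousOn v (⋃ x, U x) := by
    refine (locallyFinite_of_finite U).continuousOn_iUnion hUc fun x => ?_
    refine ContinuousOn.congr ?_ (hvU x)
    exact continuousOn_pi.2 fun j => continuousOn_glue hL (hRB _ x.2.1) x.2.1.1 x.2.2 j
  have hvv : ∀ m ∈ ⋃ x, U x, sys.Valid m (v m) := by
    intro m hm
    obtain ⟨x, hx⟩ := mem_iUnion.1 hm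
    rw [hvU x m hx]
    exact glue_valid hL (hRB _ x.2.1) hx.1 hx.2 x.2.1.1 x.2.2
  have hvp : ∀ m ∈ ⋃ x, U x, ∀ σ : Equiv.Perm (Fin n), sys.pull m σ ∈ (⋃ x, U x) ∧
      ∀ a, v (sys.pull m σ) a = v m (σ a) := by
    intro m hm σ
    obtain ⟨⟨⟨B, e⟩, hB, he⟩, hx⟩ := mem_iUnion.1 hm
    have hcard : (preim σ B).card = B.card := by
      rw [← Finset.card_map σ.toEmbedding]
      congr 1
      ext x
      simp only [Finset.mem_map, mem_preim]
      exact ⟨fun ⟨y, hy, e⟩ => e ▸ hy, fun h => ⟨σ.symm x, by simpa using h, by simp⟩⟩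
    have hB' : bd (preim σ B) := ⟨hcard ▸ hB.1, hB.2.imp_right fun h h' => h (by
      ext x
      have := h' ▸ Finset.mem_univ (σ.symm x)
      rw [mem_preim] at this
      simpa using this)⟩
    have he' : σ (σ.symm e) ∈ B := by simpa using he
    have hm' : sys.pull m σ ∈ U ⟨(preim σ B, σ.symm e), hB', mem_preim.2 he'⟩ :=
      ⟨sys.pull_mem hx.1 σ.injective (Fin.pos e), sys.cluster_pull hx.2 σ.injective⟩
    refine ⟨mem_iUnion.2 ⟨_, hm'⟩, fun a => ?_⟩
    rw [hvU _ _ hm', hvU _ _ hx, glue_perm hL (hRB _ hB) hx.1 hx.2 hB.1 σ he',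
      Equiv.apply_symm_apply]
  obtain ⟨w, hw1, hw2, hw3⟩ := exists_valid_extension (isClosed_iUnion_of_finite hUc)
    (iUnion_subset fun x => inter_subset_left) hvc hvv
  rcases Nat.eq_zero_or_pos n with rfl | hn
  · refine ⟨w, hw1, hw2, fun m hm σ a => a.elim0, fun {k l} i h hl => ?_⟩
    have := Fin.pos i
    omega
  let P := Equiv.Perm (Fin n)
  have hpm : ∀ m ∈ sys.carrier n, ∀ σ : P, sys.pull m σ ∈ sys.carrier n := fun m hm σ =>
    sys.pull_mem hm σ.injective hn
  -- averaging over the symmetric group makes the extension equivariant, preserves the inequalities,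
  -- and changes nothing on the boundary, where the values are equivariant already
  let g : sys.obj n → Fin n → ℝ × ℝ := fun m =>
    (Fintype.card P : ℝ)⁻¹ • ∑ σ : P, fun a => w (sys.pull m σ) (σ.symm a)
  have hgA : ∀ m ∈ ⋃ x, U x, g m = v m := by
    intro m hm
    have : ∀ σ : P, (fun a => w (sys.pull m σ) (σ.symm a)) = v m := fun σ => by
      ext1 a
      rw [hw3 _ (hvp m hm σ).1, (hvp m hm σ).2, Equiv.apply_symm_apply]
    simp only [g, this, Finset.sum_const, Finset.card_univ]
    rw [← Nat.cast_smul_eq_nsmul ℝ, smul_smul, inv_mul_cancel₀ (by simp), one_smul]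
  refine ⟨g, ?_, fun m hm => ?_, fun m hm σ a => ?_, fun {k l} i h hl hk m hm q hq j => ?_⟩
  · have hs : ∀ σ : P, ContinuousOn (fun m (a : Fin n) => w (sys.pull m σ) (σ.symm a))
        (sys.carrier n) := fun σ =>
      continuousOn_pi.2 fun a => (continuous_apply (σ.symm a)).comp_continuousOn
        (hw1.comp (sys.continuous_pull _).continuousOn fun m hm => hpm m hm σ)
    exact (continuousOn_finsetSum Finset.univ fun σ _ => hs σ).const_smul
      (Fintype.card P : ℝ)⁻¹
  · have hv := fun σ : P => (hw2 _ (hpm m hm σ)).pull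
    rw [valid_iff]
    have hpos : 0 < (Fintype.card P : ℝ)⁻¹ := by
      have : (0 : ℝ) < Fintype.card P := by exact_mod_cast Fintype.card_pos
      positivity
    refine ⟨fun i => ?_, fun a => ?_⟩
    · simp only [g]
      rw [constraint_average]
      exact mul_nonneg hpos.le (Finset.sum_nonneg fun σ _ => (valid_iff.1 (hv σ)).1 i)
    · have := constraint_average (sys := sys) m (fun (σ : P) a => w (sys.pull m σ) (σ.symm a))
        (Sum.inl a)
      simp only [constraint] at this
      simp only [g]
      rw [this]
      exact mul_pos hpos (Finset.sum_pos (fun σ _ => (hv σ).pos a) Finset.univ_nonempty)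
  · simp only [g, Pi.smul_apply, Finset.sum_apply]
    congr 1
    refine Fintype.sum_equiv (Equiv.mulLeft σ) _ _ fun τ => ?_
    simp only [Equiv.coe_mulLeft, sys.pull_pull]
    congr 1
    rw [Equiv.eq_symm_apply]
    simp
  · have hcard : (block i l n).card = l := by
      have : block i l n = Finset.univ.map ⟨inner i h, fun a b hab => by
          rw [Fin.ext_iff] at hab ⊢; simpa [inner] using hab⟩ := by
        ext x
        simp only [mem_block, Finset.mem_map, Finset.mem_univ, true_and]
        constructor
        · intro hx
          refine ⟨sub hx, Fin.ext ?_⟩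
          change (i : ℕ) + (x - i) = x
          exact Nat.add_sub_cancel' hx.1
        · rintro ⟨b, rfl⟩
          exact inBlock_inner i h b
      rw [this, Finset.card_map, Finset.card_univ, Fintype.card_fin]
    have hB : bd (block i l n) := ⟨by omega, hk.imp_right fun h2 h3 => by
      rw [h3, Finset.card_univ, Fintype.card_fin] at hcard
      omega⟩
    have hm' : sys.ins i h m q ∈ U ⟨(block i l n, inner i h ⟨0, by omega⟩), hB,
        mem_block.2 (inBlock_inner i h _)⟩ := ⟨sys.ins_mem i h hm hq, sys.cluster_ins i h m hq⟩
    rw [hgA _ (mem_iUnion.2 ⟨_, hm'⟩), hvU _ _ hm']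
    have hRl := hRB _ hB
    rw [hcard] at hRl
    exact glue_ins hL hRl hl i h hm hq j

end ConfSystem

/-! ### The families of maps into little intervals -/

lemma lineIns_one {k l : ℕ} (i : Fin k) (h : k + 1 = k + l) {p : LineCoord k} (hp : p ∈ assocSet k)
    {q : LineCoord l} (hq : q ∈ assocSet l) : lineIns i h p q = p := by
  obtain rfl : l = 1 := by omega
  exact Prod.ext (ins2_unit i _ _ (by rw [(assoc_diag hp i).1, (assoc_diag hq 0).1]))
    (ins3_unit i _ _ (by rw [(assoc_diag hp i).2, (assoc_diag hq 0).2]))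

lemma one_lineIns {l n : ℕ} (i : Fin 1) (h : n + 1 = 1 + l) {p : LineCoord 1}
    {q : LineCoord l} (e : l = n) : lineIns i h p q = e ▸ q := by
  subst e
  obtain rfl := Subsingleton.elim i 0
  exact Prod.ext (unit_ins2 h _ _) (unit_ins3 h _ _)

lemma circleIns_one {k l : ℕ} (i : Fin k) (h : k + 1 = k + l) {p : CircleCoord k}
    (hp : p ∈ cycloSet k) {q : LineCoord l} (hq : q ∈ assocSet l) : circleIns i h p q = p := by
  obtain rfl : l = 1 := by omega
  refine Prod.ext (funext fun x => congrArg p.1 (outer_unit i x)) (Prod.ext ?_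
    (ins3_unit i _ _ (by rw [(cyclo_diag hp i).2, (assoc_diag hq 0).2])))
  exact ins2_unit i _ (fun a b => q.1 a b • (Complex.I * (p.1 i : ℂ)))
    (by rw [(cyclo_diag hp i).1, (assoc_diag hq 0).1, zero_smul])

lemma ite_one {k l : ℕ} (i : Fin k) (h : k + 1 = k + l) {x : Fin k → ℝ × ℝ} {y : Fin l → ℝ × ℝ}
    (hy : ∀ b, y b = (0, 1)) (j : Fin k) :
    (if hb : InBlock i l j then vmul (x i) (y (sub hb)) else x (outer i h j)) = x j := by
  obtain rfl : l = 1 := by omega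
  split_ifs with hb
  · rw [hy, vmul_unit]
    congr 1
    rw [Fin.ext_iff]
    simp only [InBlock] at hb
    omega
  · rw [outer_unit]

/-- There is a family of maps from the associahedra to the little intervals that is compatible with
the structures of operads. -/
theorem exists_line_family : ∃ R : ∀ n, LineCoord n → Fin n → ℝ × ℝ,
    (∀ n, lineSystem.GoodAt R R n) ∧ ∀ p a, R 1 p a = (0, 1) := by
  suffices key : ∃ R : ∀ n, LineCoord n → Fin n → ℝ × ℝ, ∀ n, lineSystem.GoodAt R R n ∧
      (1 ≤ n → ∀ p a, R 1 p a = (0, 1)) by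
    obtain ⟨R, hR⟩ := key
    exact ⟨R, fun n => (hR n).1, (hR 1).2 le_rfl⟩
  refine exists_seq_of_step (Y := fun n => LineCoord n → Fin n → ℝ × ℝ)
    (P := fun n R => lineSystem.GoodAt R R n ∧ (1 ≤ n → ∀ p a, R 1 p a = (0, 1))) ?_ ?_
  · rintro n L L' hLL ⟨h, h1⟩
    have e : ∀ k, k ≤ n → L' k = L k := fun k hk => (hLL k hk).symm
    refine ⟨⟨?_, fun m hm => ?_, fun m hm σ a => ?_, fun {k l} i h' m hm q hq j => ?_⟩,
      fun hn => ?_⟩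
    · rw [e n le_rfl]; exact h.continuousOn
    · rw [e n le_rfl]; exact h.valid m hm
    · rw [e n le_rfl]; exact h.perm m hm σ a
    · have := hq.1
      have := hm.1
      rw [e n le_rfl, e k (by omega), e l (by omega)]; exact h.comp i h' m hm q hq j
    · rw [e 1 hn]; exact h1 hn
  · intro n L hL
    rcases Nat.lt_or_ge n 2 with hn | hn
    · -- the single interval is the full one
      refine ⟨Function.update L n fun _ _ => (0, 1),
        fun k hk => Function.update_of_ne hk.ne _ _, ?_⟩
      refine ⟨⟨?_, fun m hm => ?_, fun m hm σ a => ?_, fun {k l} i h' m hm q hq j => ?_⟩,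
        fun h => ?_⟩
      · rw [Function.update_self]; exact continuousOn_const
      · rw [Function.update_self]
        refine ⟨fun a => one_pos, fun a c => ?_, fun a b hab => absurd ?_ hab⟩
        · fin_cases c <;> simp [lineSystem]
        · rw [Fin.ext_iff]; omega
      · rw [Function.update_self]
      · have h1 := hq.1
        have h2 := hm.1
        obtain rfl : n = 1 := by omega
        obtain rfl : k = 1 := by omega
        obtain rfl : l = 1 := by omega
        rw [Function.update_self]
        split_ifs
        · rw [vmul_unit]
        · rfl
      · obtain rfl : n = 1 := by omega
        intro p a
        rw [Function.update_self]
    · have h1 := (hL 1 (by omega)).2 le_rfl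
      -- the boundary consists of the insertions with both arities at least two; the collision of
      -- all labels is not an insertion of this kind
      obtain ⟨g, g1, g2, g3, g4⟩ := ConfSystem.exists_step (sys := lineSystem) (n := n) False
        (fun k hk => (hL k hk).1) (fun l hl => (hL l (hl.resolve_right id)).1)
      change LineCoord n → Fin n → ℝ × ℝ at g
      have e : ∀ k, k < n → Function.update L n g k = L k := fun k hk =>
        Function.update_of_ne hk.ne _ _
      refine ⟨Function.update L n g, e, ⟨?_, fun m hm => ?_, fun m hm σ a => ?_,
        fun {k l} i h' m hm q hq j => ?_⟩, fun _ => ?_⟩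
      · rw [Function.update_self]; exact g1
      · rw [Function.update_self]; exact g2 m hm
      · rw [Function.update_self]; exact g3 m hm σ a
      · have := hq.1
        have := hm.1
        by_cases hl : l = 1
        · obtain rfl : k = n := by omega
          rw [ite_one i h' (fun b => by subst hl; rw [e 1 (by omega)]; exact h1 _ _)]
          change Function.update L k g k (lineIns i h' m q) j = _
          rw [lineIns_one i h' hm hq]
        · by_cases hk : k = 1
          · subst hk
            obtain rfl : l = n := by omega
            change LineCoord 1 at m
            change Function.update L l g l (lineIns i h' m q) j = _
            have hb : InBlock i l j := by
              obtain rfl := Subsingleton.elim i 0; exact unit_block j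
            rw [dif_pos hb, one_lineIns i h' rfl, e 1 (by omega), h1, unit_vmul]
            change Function.update L l g l q j = _
            refine congrArg (Function.update L l g l q) (Fin.ext ?_)
            simp [sub]
          · rw [Function.update_self, e k (by omega), e l (by omega)]
            exact g4 i h' (by omega) (Or.inr (by omega)) m hm q hq j
      · rw [e 1 (by omega)]; exact h1

/-- For every family of maps from the associahedra to the little intervals in the interval, there
is a compatible family of maps from the cyclohedra to the little intervals in the circle. -/
theorem exists_circle_family {R : ∀ n, LineCoord n → Fin n → ℝ × ℝ}
    (hR : ∀ n, lineSystem.GoodAt R R n) (hR1 : ∀ p ∈ assocSet 1, ∀ a, R 1 p a = (0, 1)) :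
    ∃ L : ∀ n, CircleCoord n → Fin n → ℝ × ℝ, ∀ n, circleSystem.GoodAt L R n := by
  refine exists_seq_of_step (Y := fun n => CircleCoord n → Fin n → ℝ × ℝ)
    (P := fun n L => circleSystem.GoodAt L R n) ?_ ?_
  · rintro n L L' hLL h
    have e : ∀ k, k ≤ n → L' k = L k := fun k hk => (hLL k hk).symm
    refine ⟨?_, fun m hm => ?_, fun m hm σ a => ?_, fun {k l} i h' m hm q hq j => ?_⟩
    · rw [e n le_rfl]; exact h.continuousOn
    · rw [e n le_rfl]; exact h.valid m hm
    · rw [e n le_rfl]; exact h.perm m hm σ a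
    · have := hq.1
      rw [e n le_rfl, e k (by omega)]; exact h.comp i h' m hm q hq j
  · intro n L hL
    -- configurations in which all labels have collided belong to the boundary, so the family on the
    -- associahedra is needed in the same arity
    obtain ⟨g, g1, g2, g3, g4⟩ := ConfSystem.exists_step (sys := circleSystem) (n := n) True hL
      (fun l _ => hR l)
    change CircleCoord n → Fin n → ℝ × ℝ at g
    have e : ∀ k, k < n → Function.update L n g k = L k := fun k hk =>
      Function.update_of_ne hk.ne _ _
    refine ⟨Function.update L n g, e, ?_, fun m hm => ?_, fun m hm σ a => ?_,
      fun {k l} i h' m hm q hq j => ?_⟩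
    · rw [Function.update_self]; exact g1
    · rw [Function.update_self]; exact g2 m hm
    · rw [Function.update_self]; exact g3 m hm σ a
    · have := hq.1
      by_cases hl : l = 1
      · obtain rfl : k = n := by omega
        rw [ite_one i h' (fun b => by subst hl; exact hR1 _ hq _)]
        change Function.update L k g k (circleIns i h' m q) j = _
        rw [circleIns_one i h' hm hq]
      · rw [Function.update_self, e k (by omega)]
        exact g4 i h' (by omega) (Or.inl trivial) m hm q hq j

/-! ### Fibrations with intervals as fibres -/

section Fibres

variable {X Y B ι : Type*} [TopologicalSpace X] [TopologicalSpace Y] [TopologicalSpace B]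
  [Fintype ι]

/-- If `X` is homeomorphic to `Y × [0,1]` over `Y`, a homotopy section of `ev : Y → B` (which is
a homotopy inverse on one side) gives one for `X → B`. -/
theorem exists_section_of_homeomorph (Ψ : X ≃ₜ Y × unitInterval) (ev : C(Y, B))
    (hY : ∃ s : C(B, Y), (s.comp ev).Homotopic (ContinuousMap.id Y)) :
    ∃ s : C(B, X), (s.comp (ev.comp ⟨fun x => (Ψ x).1, by fun_prop⟩)).Homotopic
      (ContinuousMap.id X) := by
  obtain ⟨s, ⟨H⟩⟩ := hY
  refine ⟨⟨fun b => Ψ.symm (s b, 0), by fun_prop⟩, ⟨?_⟩⟩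
  refine { toFun := fun x => Ψ.symm (H (x.1, (Ψ x.2).1), x.1 * (Ψ x.2).2)
           continuous_toFun := by fun_prop
           map_zero_left := fun x => ?_
           map_one_left := fun x => ?_ }
  · simp
  · simp

variable [CompactSpace X] [T2Space Y]

/-- A map `π : X → Y` of compact spaces whose fibres are intervals, in the sense that the
coordinates `f i` on the fibres are weakly increasing functions of each other and separate the
points, is a homeomorphism onto `Y × [0,1]` over `Y`. So a homotopy section over `Y` gives one
over `X`. The interval over `y` is only required to be the full one for a dense set of `y`. -/
theorem exists_section_of_monotone (π : C(X, Y)) (f : ι → X → ℝ) (hf : ∀ i, Continuous (f i))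
    (lo hi : ι → Y → ℝ) (hlo : ∀ i, Continuous (lo i)) (hhi : ∀ i, Continuous (hi i))
    (hf1 : ∀ i x, lo i (π x) ≤ f i x) (hf2 : ∀ i x, f i x ≤ hi i (π x))
    (hlt : ∀ y, ∃ i, lo i y < hi i y) (hle : ∀ i y, lo i y ≤ hi i y)
    (mono : ∀ x x', π x = π x' → ∀ i j, f i x < f i x' → f j x ≤ f j x')
    (sep : ∀ x x', π x = π x' → (∀ i, f i x = f i x') → x = x')
    {D : Set Y} (hD : Dense D)
    (path : ∀ y ∈ D, ∃ (γ : ℝ → X) (φ : ι → ℝ → ℝ),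
      (∀ t ∈ Ioo (0 : ℝ) 1, π (γ t) = y ∧ ∀ i, f i (γ t) = φ i t) ∧
      ∀ i, ContinuousOn (φ i) (Icc 0 1) ∧ φ i 0 = lo i y ∧ φ i 1 = hi i y)
    (ev : C(Y, B)) (hY : ∃ s : C(B, Y), (s.comp ev).Homotopic (ContinuousMap.id Y)) :
    ∃ s : C(B, X), (s.comp (ev.comp π)).Homotopic (ContinuousMap.id X) := by
  have hpos : ∀ y, 0 < ∑ i, (hi i y - lo i y) := fun y =>
    Finset.sum_pos' (fun i _ => sub_nonneg.2 (hle i y))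
      ((hlt y).imp fun i h => ⟨Finset.mem_univ i, sub_pos.2 h⟩)
  -- the sum of the coordinates, normalized to `[0, 1]`, serves as the coordinate on the fibres
  set R : X → ℝ := fun x => (∑ i, (f i x - lo i (π x))) / ∑ i, (hi i (π x) - lo i (π x)) with hR
  have hR0 : ∀ x, R x ∈ Icc (0 : ℝ) 1 := fun x =>
    ⟨div_nonneg (Finset.sum_nonneg fun i _ => sub_nonneg.2 (hf1 i x)) (hpos _).le,
      (div_le_one (hpos _)).2 (Finset.sum_le_sum fun i _ => sub_le_sub_right (hf2 i x) _)⟩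
  have hRc : Continuous R := by
    refine Continuous.div ?_ ?_ fun x => (hpos _).ne'
    · exact continuous_finsetSum _ fun i _ => (hf i).sub ((hlo i).comp π.continuous)
    · exact continuous_finsetSum _ fun i _ =>
        ((hhi i).comp π.continuous).sub ((hlo i).comp π.continuous)
  let Φ : X → Y × unitInterval := fun x => (π x, ⟨R x, hR0 x⟩)
  have hΦ : Continuous Φ := π.continuous.prodMk (hRc.subtype_mk _)
  -- mutually monotone coordinates with equal sums are equal
  have hinj : Function.Injective Φ := by
    intro x x' h
    have h1 : π x = π x' := congrArg Prod.fst h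
    have h2 : R x = R x' := congrArg (fun y => (y.2 : ℝ)) h
    have h3 : ∑ i, f i x = ∑ i, f i x' := by
      simp only [hR, h1, Finset.sum_sub_distrib] at h2
      have := hpos (π x')
      simp only [Finset.sum_sub_distrib] at this
      rw [div_left_inj' this.ne'] at h2
      linarith
    refine sep x x' h1 ?_
    by_contra hne
    push Not at hne
    obtain ⟨i, hi⟩ := hne
    rcases lt_or_gt_of_ne hi with h | h
    · exact (Finset.sum_lt_sum (fun j _ => mono x x' h1 i j h) ⟨i, Finset.mem_univ i, h⟩).ne h3
    · exact (Finset.sum_lt_sum (fun j _ => mono x' x h1.symm i j h)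
        ⟨i, Finset.mem_univ i, h⟩).ne h3.symm
  -- the image is closed, and dense by the intermediate value theorem
  have hsurj : Function.Surjective Φ := by
    have hcl : IsClosed (range Φ) := (isCompact_range hΦ).isClosed
    have hd : Dense (D ×ˢ {v : unitInterval | (v : ℝ) ∈ Ioo (0 : ℝ) 1}) := by
      refine hD.prod ?_
      have : Dense (Ioo (0 : unitInterval) 1) := by
        have := closure_Ioo (zero_ne_one (α := unitInterval))
        rw [dense_iff_closure_eq, this]
        ext v
        exact iff_of_true ⟨v.2.1, v.2.2⟩ trivial
      exact this
    rw [← range_eq_univ, ← hcl.closure_eq]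
    refine (hd.mono ?_).closure_eq
    rintro ⟨y, v⟩ ⟨hy, hv⟩
    obtain ⟨γ, φ, h1, h2⟩ := path y hy
    set ψ : ℝ → ℝ := fun t => (∑ i, (φ i t - lo i y)) / ∑ i, (hi i y - lo i y) with hψ
    have hc : ContinuousOn ψ (Icc 0 1) := by
      refine ContinuousOn.div_const ?_ _
      exact continuousOn_finsetSum _ fun i _ => (h2 i).1.sub continuousOn_const
    have e0 : ψ 0 = 0 := by simp [hψ, (h2 _).2.1]
    have e1 : ψ 1 = 1 := by
      simp only [hψ, (h2 _).2.2]
      exact div_self (hpos y).ne'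
    have := intermediate_value_Ioo zero_le_one hc
    rw [e0, e1] at this
    obtain ⟨t, ht, htv⟩ := this hv
    refine ⟨γ t, Prod.ext (h1 t ht).1 (Subtype.ext ?_)⟩
    rw [← htv]
    change R (γ t) = ψ t
    simp only [hR, hψ, (h1 t ht).1, (h1 t ht).2]
  let Ψ : X ≃ₜ Y × unitInterval :=
    Continuous.homeoOfEquivCompactToT2 (f := Equiv.ofBijective Φ ⟨hinj, hsurj⟩) hΦ
  exact exists_section_of_homeomorph Ψ ev hY

end Fibres

/-- Homotopies on the pieces of a decomposition into open sets fit together. -/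
theorem homotopic_of_isLocallyConstant {X Z S : Type*} [TopologicalSpace X] [TopologicalSpace Z]
    {T : X → S} (hT : IsLocallyConstant T) (f g : C(X, Z))
    (h : ∀ i, ∃ H : unitInterval × {x // T x = i} → Z, Continuous H ∧ (∀ x, H (0, x) = f x) ∧
      ∀ x, H (1, x) = g x) : f.Homotopic g := by
  choose H hc h0 h1 using h
  refine ⟨{ toFun := fun p => H (T p.2) (p.1, ⟨p.2, rfl⟩)
            continuous_toFun := ?_
            map_zero_left := fun x => h0 _ _
            map_one_left := fun x => h1 _ _ }⟩
  rw [continuous_iff_continuousAt]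
  rintro ⟨t, x⟩
  have ho : {p : unitInterval × X | T p.2 = T x} ∈ 𝓝 (t, x) :=
    ((hT.isOpen_fiber (T x)).preimage continuous_snd).mem_nhds rfl
  refine ContinuousOn.continuousAt ?_ ho
  rw [continuousOn_iff_continuous_domRestrict]
  have : Continuous fun p : {p : unitInterval × X | T p.2 = T x} =>
      H (T x) (p.1.1, ⟨p.1.2, p.2⟩) := (hc _).comp (by fun_prop)
  refine this.congr ?_
  rintro ⟨⟨s, y⟩, hy⟩
  have key : ∀ i (hi : T y = i), H i (s, ⟨y, hi⟩) = H (T y) (s, ⟨y, rfl⟩) := by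
    rintro _ rfl; rfl
  exact key _ hy

/-- Weak co-monotonicity of two quantities `f`, `g` in `[0,1]` whose odds are proportional. -/
lemma le_of_proportional {α β f g f' g' : ℝ} (hα : 0 ≤ α) (hβ : 0 ≤ β) (hαβ : 0 < α + β)
    (hg : 0 ≤ g') (hg1 : g ≤ 1) (hf0 : 0 ≤ f) (hf1 : f' ≤ 1)
    (h : α * (g * (1 - f)) = β * (f * (1 - g))) (h' : α * (g' * (1 - f')) = β * (f' * (1 - g')))
    (hlt : f < f') : g ≤ g' := by
  by_contra hgt
  push Not at hgt
  have h1 : g' * (1 - f') < g * (1 - f) := by nlinarith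
  have h2 : f * (1 - g) < f' * (1 - g') := by nlinarith
  rcases hα.eq_or_lt with rfl | hα
  · have : 0 < β := by linarith
    nlinarith
  · nlinarith

/-! ### The homotopy type of the associahedra -/

/-- The component of the associahedron where the points are in their natural order: Stasheff's
polytope. -/
def lineSorted (n : ℕ) : Set (LineCoord n) := closure (lineCoord '' {x : Fin n → ℝ | StrictMono x})

section Line

variable {n : ℕ}

lemma lineSorted_subset (hn : 0 < n) : lineSorted n ⊆ assocSet n := fun _ hp =>
  ⟨hn, closure_mono (image_mono fun _ hx => hx.injective) hp⟩

lemma lineSorted_induction {P : LineCoord n → Prop} (hP : IsClosed {p | P p})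
    (h : ∀ x : Fin n → ℝ, StrictMono x → P (lineCoord x)) {p : LineCoord n}
    (hp : p ∈ lineSorted n) : P p := by
  refine closure_minimal ?_ hP hp
  rintro _ ⟨x, hx, rfl⟩
  exact h x hx

lemma linePull_sorted {k : ℕ} {p : LineCoord n} (hp : p ∈ lineSorted n) {f : Fin k → Fin n}
    (hf : StrictMono f) : linePull p f ∈ lineSorted k := by
  refine map_mem_closure (f := fun p => linePull p f) (continuous_linePull f) hp ?_
  rintro _ ⟨x, hx, rfl⟩
  exact ⟨x ∘ f, hx.comp hf, rfl⟩

lemma lineSorted_pair {p : LineCoord n} (hp : p ∈ lineSorted n) {a b : Fin n} (hab : a < b) :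
    p.1 a b = 1 ∧ p.1 b a = -1 :=
  lineSorted_induction (P := fun p => p.1 a b = 1 ∧ p.1 b a = -1)
    ((isClosed_eq (by fun_prop) (by fun_prop)).inter (isClosed_eq (by fun_prop) (by fun_prop)))
    (fun _ hx => pairCoord_line (hx hab)) hp

lemma tripleCoord_line {x : Fin n → ℝ} (hx : StrictMono x) {a b c : Fin n} (hab : a < b)
    (hbc : b < c) : tripleCoord x a b c = (x b - x a) / (x c - x a) := by
  have h1 := hx hab
  have h2 := hx hbc
  unfold tripleCoord
  rw [Real.norm_of_nonneg (by linarith), Real.norm_of_nonneg (by linarith)]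
  congr 1
  ring

lemma tripleCoord_swap {E : Type*} [NormedAddCommGroup E] {x : Fin n → E}
    (hx : Function.Injective x) {a b c : Fin n} (h : a ≠ b) :
    tripleCoord x c b a = 1 - tripleCoord x a b c := by
  have h1 : 0 < ‖x b - x a‖ := norm_pos_iff.2 (sub_ne_zero.2 (hx.ne h.symm))
  have h2 := norm_nonneg (x c - x b)
  unfold tripleCoord
  rw [norm_sub_rev (x b) (x c), norm_sub_rev (x a) (x b)]
  field_simp
  ring

lemma assoc_triple_swap {p : LineCoord n} (hp : p ∈ assocSet n) {a b c : Fin n} (h : a ≠ b) :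
    p.2 c b a = 1 - p.2 a b c :=
  assoc_induction (P := fun p => p.2 c b a = 1 - p.2 a b c)
    (isClosed_eq (by fun_prop) (by fun_prop)) (fun _ hx => tripleCoord_swap hx h) hp

lemma cyclo_triple_swap {p : CircleCoord n} (hp : p ∈ cycloSet n) {a b c : Fin n} (h : a ≠ b) :
    p.2.2 c b a = 1 - p.2.2 a b c :=
  cyclo_induction (P := fun p => p.2.2 c b a = 1 - p.2.2 a b c)
    (isClosed_eq (by fun_prop) (by fun_prop))
    (fun _ hx => tripleCoord_swap (circleCoe_injective hx) h) hp

lemma assoc_triple_mem {p : LineCoord n} (hp : p ∈ assocSet n) (a b c : Fin n) :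
    p.2 a b c ∈ Icc (0 : ℝ) 1 :=
  assoc_induction (P := fun p => p.2 a b c ∈ Icc (0 : ℝ) 1)
    (isClosed_Icc.preimage (by fun_prop)) (fun x _ => tripleCoord_mem_Icc x a b c) hp

/-- The relative distances of three points in the orders different from the natural one. -/
lemma lineSorted_triple {p : LineCoord n} (hp : p ∈ lineSorted n) {a b c : Fin n} (hab : a < b)
    (hbc : b < c) :
    p.2 b a c * (1 + p.2 a b c) = p.2 a b c ∧ p.2 a c b * (2 - p.2 a b c) = 1 := by
  refine lineSorted_induction (P := fun p => p.2 b a c * (1 + p.2 a b c) = p.2 a b c ∧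
    p.2 a c b * (2 - p.2 a b c) = 1) ((isClosed_eq (by fun_prop) (by fun_prop)).inter
    (isClosed_eq (by fun_prop) (by fun_prop))) (fun x hx => ?_) hp
  have h1 := hx hab
  have h2 := hx hbc
  have h3 := hx (hab.trans hbc)
  change tripleCoord x b a c * (1 + tripleCoord x a b c) = tripleCoord x a b c ∧
    tripleCoord x a c b * (2 - tripleCoord x a b c) = 1
  rw [tripleCoord_line hx hab hbc]
  unfold tripleCoord
  rw [Real.norm_of_nonpos (by linarith), Real.norm_of_nonneg (by linarith),
    Real.norm_of_nonpos (by linarith)]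
  have e1 : -(x a - x b) + (x c - x a) ≠ 0 := by linarith
  have e2 : x c - x a + -(x b - x c) ≠ 0 := by linarith
  have e3 : x c - x a ≠ 0 := by linarith
  constructor
  · field_simp; ring
  · field_simp; ring

/-- A point of Stasheff's polytope is determined by the relative distances of the points in their
natural order. -/
lemma lineSorted_ext {p q : LineCoord n} (hp : p ∈ lineSorted n) (hq : q ∈ lineSorted n)
    (h : ∀ a b c, a < b → b < c → p.2 a b c = q.2 a b c) : p = q := by
  rcases Nat.eq_zero_or_pos n with rfl | hn
  · exact Prod.ext (funext fun a => a.elim0) (funext fun a => a.elim0)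
  have hp' := lineSorted_subset hn hp
  have hq' := lineSorted_subset hn hq
  refine Prod.ext ?_ ?_
  · ext a b
    rcases lt_trichotomy a b with hab | rfl | hab
    · rw [(lineSorted_pair hp hab).1, (lineSorted_pair hq hab).1]
    · rw [(assoc_diag hp' a).1, (assoc_diag hq' a).1]
    · rw [(lineSorted_pair hp hab).2, (lineSorted_pair hq hab).2]
  · have key : ∀ a b c, a < b → b < c → p.2 b a c = q.2 b a c ∧ p.2 a c b = q.2 a c b := by
      intro a b c hab hbc
      obtain ⟨e1, e2⟩ := lineSorted_triple hp hab hbc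
      obtain ⟨e3, e4⟩ := lineSorted_triple hq hab hbc
      have h0 := assoc_triple_mem hp' a b c
      rw [h a b c hab hbc] at e1 e2 h0
      have p1 : (1 + q.2 a b c) ≠ 0 := by linarith [h0.1]
      have p2 : (2 - q.2 a b c) ≠ 0 := by linarith [h0.2]
      exact ⟨mul_right_cancel₀ p1 (e1.trans e3.symm), mul_right_cancel₀ p2 (e2.trans e4.symm)⟩
    have hself : ∀ a b, a ≠ b → p.2 a b a = q.2 a b a := by
      intro a b hab
      have e1 := assoc_triple_swap hp' (c := a) hab
      have e2 := assoc_triple_swap hq' (c := a) hab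
      linarith
    have key' : ∀ a b c, a < c → p.2 a b c = q.2 a b c := by
      intro a b c hac
      rcases lt_trichotomy a b with hab | rfl | hab
      · rcases lt_trichotomy b c with hbc | rfl | hbc
        · exact h a b c hab hbc
        · rw [assoc_triple_right hp' hab.ne, assoc_triple_right hq' hab.ne]
        · exact (key a c b hac hbc).2
      · rw [assoc_triple_left hp', assoc_triple_left hq']
      · exact (key b a c hab hac).1
    ext a b c
    rcases lt_trichotomy a c with hac | rfl | hac
    · exact key' a b c hac
    · by_cases hab : a = b
      · subst hab
        rw [assoc_triple_left hp', assoc_triple_left hq']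
      · exact hself a b hab
    · by_cases hab : c = b
      · subst hab
        rw [assoc_triple_right hp' hac.ne', assoc_triple_right hq' hac.ne']
      · rw [assoc_triple_swap hp' hab, assoc_triple_swap hq' hab, key' c b a hac]

/-- Relations between the relative distances of four points on the line. -/
lemma lineSorted_quadruple {p : LineCoord n} (hp : p ∈ lineSorted n) {a b c d : Fin n} (hab : a < b)
    (hbc : b < c) (hcd : c < d) :
    p.2 b c d * (1 - p.2 a c d) = (1 - p.2 a b c) * (p.2 a c d * (1 - p.2 b c d)) ∧
    p.2 a b d = p.2 a b c * p.2 a c d := by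
  refine lineSorted_induction (P := fun p =>
    p.2 b c d * (1 - p.2 a c d) = (1 - p.2 a b c) * (p.2 a c d * (1 - p.2 b c d)) ∧
    p.2 a b d = p.2 a b c * p.2 a c d) ((isClosed_eq (by fun_prop) (by fun_prop)).inter
    (isClosed_eq (by fun_prop) (by fun_prop))) (fun x hx => ?_) hp
  have h1 := hx hab
  have h2 := hx hbc
  have h3 := hx hcd
  change tripleCoord x b c d * (1 - tripleCoord x a c d) = (1 - tripleCoord x a b c) *
    (tripleCoord x a c d * (1 - tripleCoord x b c d)) ∧
    tripleCoord x a b d = tripleCoord x a b c * tripleCoord x a c d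
  rw [tripleCoord_line hx hbc hcd, tripleCoord_line hx (hab.trans hbc) hcd,
    tripleCoord_line hx hab hbc, tripleCoord_line hx hab (hbc.trans hcd)]
  have e1 : x d - x b ≠ 0 := by linarith
  have e2 : x d - x a ≠ 0 := by linarith
  have e3 : x c - x a ≠ 0 := by linarith
  constructor
  · field_simp
    ring
  · field_simp

lemma isCompact_lineSorted (hn : 0 < n) : IsCompact (lineSorted n) :=
  (isCompact_assocSet n).of_isClosed_subset isClosed_closure (lineSorted_subset hn)

/-- Forgetting the last point of a configuration on the line. -/
def lineForget (n : ℕ) : C(lineSorted (n + 1), lineSorted n) where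
  toFun p := ⟨linePull p.1 Fin.castSucc, linePull_sorted p.2 Fin.strictMono_castSucc⟩
  continuous_toFun := ((continuous_linePull _).comp continuous_subtype_val).subtype_mk _

lemma dense_lineSorted : Dense {p : lineSorted n | p.1 ∈ lineCoord '' {x | StrictMono x}} := by
  intro p
  rw [closure_subtype]
  convert p.2 using 1
  unfold lineSorted
  congr 1
  ext q
  constructor
  · rintro ⟨r, hr, rfl⟩; exact hr
  · intro hq; exact ⟨⟨q, subset_closure hq⟩, hq, rfl⟩

lemma strictMono_snoc {x : Fin (n + 1) → ℝ} (hx : StrictMono x) {y : ℝ} (hy : x (Fin.last n) < y) :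
    StrictMono (Fin.snoc x y : Fin (n + 2) → ℝ) := by
  intro a b hab
  induction b using Fin.lastCases with
  | last =>
    induction a using Fin.lastCases with
    | last => exact absurd hab (lt_irrefl _)
    | cast a => simpa using (hx.monotone (Fin.le_last a)).trans_lt hy
  | cast b =>
    induction a using Fin.lastCases with
    | last => exact absurd hab (not_lt.2 (Fin.le_last _))
    | cast a => simpa using hx (by simpa using hab)

/-- Stasheff's polytopes are contractible: forgetting the last point is a fibration with intervals
as fibres, the position of the last point being determined by the ratios of its distance from its
predecessor and the distances of the predecessor from the other points. -/
theorem exists_section_lineSorted (n : ℕ) : ∃ s : C(Unit, lineSorted (n + 1)),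
    (s.comp (ContinuousMap.const _ ())).Homotopic (ContinuousMap.id _) := by
  -- with at most two points there is a single configuration
  have sub : ∀ n, n ≤ 2 → 0 < n → ∃ s : C(Unit, lineSorted n),
      (s.comp (ContinuousMap.const _ ())).Homotopic (ContinuousMap.id _) := by
    intro n hn hn0
    refine ⟨ContinuousMap.const _ ⟨lineCoord fun a => (a : ℝ),
      subset_closure ⟨_, fun a b hab => ?_, rfl⟩⟩, ?_⟩
    · exact Nat.cast_lt.2 hab
    · convert ContinuousMap.Homotopic.refl _
      ext1 p
      refine Subtype.ext (lineSorted_ext p.2 (Subtype.prop _) fun a b c hab hbc => ?_)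
      rw [Fin.lt_def] at hab hbc
      omega
  induction n with
  | zero => exact sub 1 (by norm_num) (by norm_num)
  | succ n ih =>
    rcases n with _ | k
    · exact sub 2 le_rfl (by norm_num)
    have : CompactSpace (lineSorted (k + 1 + 1 + 1)) :=
      isCompact_iff_compactSpace.1 (isCompact_lineSorted (by omega))
    let L : Fin (k + 2 + 1) := (Fin.last (k + 1)).castSucc
    let N : Fin (k + 2 + 1) := Fin.last (k + 2)
    have hLN : L < N := Fin.castSucc_lt_last _
    have haL : ∀ a : Fin (k + 1), a.castSucc.castSucc < L := fun a =>
      Fin.castSucc_lt_castSucc_iff.2 (Fin.castSucc_lt_last a)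
    have hmem : ∀ (a b c) (p : lineSorted (k + 2 + 1)), p.1.2 a b c ∈ Icc (0 : ℝ) 1 :=
      fun a b c p =>
      assoc_triple_mem (lineSorted_subset (by omega) p.2) a b c
    have hπ : ∀ {p p' : lineSorted (k + 2 + 1)}, lineForget (k + 2) p = lineForget (k + 2) p' →
        ∀ a b c : Fin (k + 2), p.1.2 a.castSucc b.castSucc c.castSucc =
          p'.1.2 a.castSucc b.castSucc c.castSucc := fun h a b c =>
      congrArg (fun q : lineSorted (k + 2) => q.1.2 a b c) h
    refine exists_section_of_monotone (ι := Fin (k + 1)) (lineForget (k + 2))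
      (fun a p => 1 - p.1.2 a.castSucc.castSucc L N) (fun a => by fun_prop) (fun _ _ => 0)
      (fun _ _ => 1) (fun _ => continuous_const) (fun _ => continuous_const) ?_ ?_
      (fun _ => ⟨0, one_pos⟩) (fun _ _ => zero_le_one) ?_ ?_ dense_lineSorted ?_
      (ContinuousMap.const _ ()) ih
    · intro a p
      linarith [(hmem a.castSucc.castSucc L N p).2]
    · intro a p
      linarith [(hmem a.castSucc.castSucc L N p).1]
    · intro p p' hpp a b hlt
      rcases lt_trichotomy a b with hab | rfl | hab
      · have hab' : a.castSucc.castSucc < b.castSucc.castSucc := by simpa using hab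
        have e := (lineSorted_quadruple p.2 hab' (haL b) hLN).1
        have e' := (lineSorted_quadruple p'.2 hab' (haL b) hLN).1
        rw [← hπ hpp a.castSucc b.castSucc (Fin.last (k + 1))] at e'
        have m1 := hmem a.castSucc.castSucc L N p
        have m2 := hmem b.castSucc.castSucc L N p
        have m3 := hmem a.castSucc.castSucc L N p'
        have m4 := hmem b.castSucc.castSucc L N p'
        have m5 := hmem a.castSucc.castSucc b.castSucc.castSucc L p
        refine le_of_proportional (α := 1 - p.1.2 a.castSucc.castSucc b.castSucc.castSucc L)
          (β := 1) (by linarith [m5.2]) zero_le_one (by linarith [m5.2]) (by linarith [m4.2])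
          (by linarith [m2.1]) (by linarith [m1.2]) (by linarith [m3.1]) ?_ ?_ hlt
        · linear_combination -e
        · linear_combination -e'
      · exact hlt.le
      · have hab' : b.castSucc.castSucc < a.castSucc.castSucc := by simpa using hab
        have e := (lineSorted_quadruple p.2 hab' (haL a) hLN).1
        have e' := (lineSorted_quadruple p'.2 hab' (haL a) hLN).1
        rw [← hπ hpp b.castSucc a.castSucc (Fin.last (k + 1))] at e'
        have m1 := hmem a.castSucc.castSucc L N p
        have m2 := hmem b.castSucc.castSucc L N p
        have m3 := hmem a.castSucc.castSucc L N p'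
        have m4 := hmem b.castSucc.castSucc L N p'
        have m5 := hmem b.castSucc.castSucc a.castSucc.castSucc L p
        refine le_of_proportional (β := 1 - p.1.2 b.castSucc.castSucc a.castSucc.castSucc L)
          (α := 1) zero_le_one (by linarith [m5.2]) (by linarith [m5.2]) (by linarith [m4.2])
          (by linarith [m2.1]) (by linarith [m1.2]) (by linarith [m3.1]) ?_ ?_ hlt
        · linear_combination e
        · linear_combination e'
    · intro p p' hpp hf
      replace hf : ∀ a : Fin (k + 1), p.1.2 a.castSucc.castSucc L N =
        p'.1.2 a.castSucc.castSucc L N := fun a => by linarith [hf a]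
      refine Subtype.ext (lineSorted_ext p.2 p'.2 fun a b c hab hbc => ?_)
      induction c using Fin.lastCases with
      | last =>
        induction b using Fin.lastCases with
        | last => exact absurd hbc (lt_irrefl _)
        | cast b =>
          induction a using Fin.lastCases with
          | last => exact absurd hab (not_lt.2 (Fin.le_last _))
          | cast a =>
            have ha : a ≠ Fin.last (k + 1) :=
              ((Fin.castSucc_lt_castSucc_iff.1 hab).trans_le (Fin.le_last b)).ne
            obtain ⟨a, rfl⟩ := Fin.exists_castSucc_eq.2 ha
            by_cases hb : b = Fin.last (k + 1)
            · subst hb; exact hf a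
            · obtain ⟨b, rfl⟩ := Fin.exists_castSucc_eq.2 hb
              rw [(lineSorted_quadruple p.2 hab (haL b) hLN).2,
                (lineSorted_quadruple p'.2 hab (haL b) hLN).2, hf,
                hπ hpp a.castSucc b.castSucc (Fin.last (k + 1))]
      | cast c =>
        obtain ⟨a, rfl⟩ := Fin.exists_castSucc_eq.2
          (((hab.trans hbc).trans (Fin.castSucc_lt_last c)).ne)
        obtain ⟨b, rfl⟩ := Fin.exists_castSucc_eq.2 ((hbc.trans (Fin.castSucc_lt_last c)).ne)
        exact hπ hpp a b c
    · rintro ⟨_, _⟩ ⟨x, hx, rfl⟩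
      have hx : StrictMono x := hx
      -- the new point is placed at the distance `t / (1 - t)` from the last one
      have hs : ∀ t ∈ Ioo (0 : ℝ) 1, StrictMono
          (Fin.snoc x (x (Fin.last _) + t / (1 - t)) : Fin (k + 2 + 1) → ℝ) := fun t ht =>
        strictMono_snoc hx (lt_add_of_pos_right _ (div_pos ht.1 (sub_pos.2 ht.2)))
      have hs' : StrictMono (Fin.snoc x (x (Fin.last _) + 1) : Fin (k + 2 + 1) → ℝ) :=
        strictMono_snoc hx (lt_add_of_pos_right _ one_pos)
      have hpos : ∀ a : Fin (k + 1), 0 < x (Fin.last _) - x a.castSucc := fun a =>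
        sub_pos.2 (hx (Fin.castSucc_lt_last a))
      refine ⟨fun t => if ht : t ∈ Ioo (0 : ℝ) 1 then ⟨_, subset_closure ⟨_, hs t ht, rfl⟩⟩ else
        ⟨_, subset_closure ⟨_, hs', rfl⟩⟩,
        fun a t => t / (t + (1 - t) * (x (Fin.last _) - x a.castSucc)), fun t ht => ?_, fun a => ?_⟩
      · simp only [dif_pos ht]
        constructor
        · refine Subtype.ext ?_
          change lineCoord ((Fin.snoc x _ : Fin (k + 2 + 1) → ℝ) ∘ Fin.castSucc) = _
          congr 1
          ext a
          simp
        · intro a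
          change 1 - tripleCoord _ _ L N = _
          rw [tripleCoord_line (hs t ht) (haL a) hLN]
          simp only [Fin.snoc_castSucc, L, N, Fin.snoc_last]
          have h1 := hpos a
          have h2 : 0 < 1 - t := sub_pos.2 ht.2
          have h3 := ht.1
          have e1 : x (Fin.last _) + t / (1 - t) - x a.castSucc =
            (t + (1 - t) * (x (Fin.last _) - x a.castSucc)) / (1 - t) := by
            field_simp; ring
          rw [e1]
          have : 0 < t + (1 - t) * (x (Fin.last _) - x a.castSucc) := by positivity
          field_simp
          ring
      · have h1 := hpos a
        refine ⟨ContinuousOn.div (by fun_prop) (by fun_prop) fun t ht => ?_, by simp, by simp⟩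
        rcases ht.1.eq_or_lt with rfl | h0
        · simpa using h1.ne'
        · have := mul_nonneg (sub_nonneg.2 ht.2) h1.le
          positivity

/-- The order of the points of a configuration. -/
def linePattern (p : LineCoord n) (a b : Fin n) : Prop := p.1 a b = 1

lemma assoc_pair_pos_iff {p : LineCoord n} (hp : p ∈ assocSet n) (a b : Fin n) :
    linePattern p a b ↔ 0 < p.1 a b := by
  unfold linePattern
  by_cases hab : a = b
  · subst hab; rw [(assoc_diag hp a).1]; norm_num
  · rcases assoc_pair hp hab with ⟨h, -⟩ | ⟨h, -⟩ <;> rw [h] <;> norm_num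

lemma assoc_pair_nonpos_iff {p : LineCoord n} (hp : p ∈ assocSet n) (a b : Fin n) :
    ¬ linePattern p a b ↔ p.1 a b < 1 := by
  unfold linePattern
  by_cases hab : a = b
  · subst hab; rw [(assoc_diag hp a).1]; norm_num
  · rcases assoc_pair hp hab with ⟨h, -⟩ | ⟨h, -⟩ <;> rw [h] <;> norm_num

lemma isLocallyConstant_linePattern :
    IsLocallyConstant fun p : assocSet n => linePattern p.1 := by
  rw [IsLocallyConstant.iff_eventually_eq]
  intro p
  have : ∀ᶠ q : assocSet n in 𝓝 p, ∀ a b, linePattern q.1 a b ↔ linePattern p.1 a b := by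
    refine eventually_all.2 fun a => eventually_all.2 fun b => ?_
    have hc : Continuous fun q : assocSet n => q.1.1 a b := by fun_prop
    by_cases h : linePattern p.1 a b
    · filter_upwards [hc.continuousAt.eventually (lt_mem_nhds ((assoc_pair_pos_iff p.2 a b).1 h))]
        with q hq
      exact iff_of_true ((assoc_pair_pos_iff q.2 a b).2 hq) h
    · filter_upwards [hc.continuousAt.eventually
        (gt_mem_nhds ((assoc_pair_nonpos_iff p.2 a b).1 h))] with q hq
      exact iff_of_false ((assoc_pair_nonpos_iff q.2 a b).2 hq) h
  filter_upwards [this] with q hq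
  exact funext fun a => funext fun b => propext (hq a b)

/-- Relabelling all configurations with a given order of the points into the natural order. -/
lemma exists_perm_lineSorted {p : LineCoord n} (hp : p ∈ assocSet n) :
    ∃ σ : Equiv.Perm (Fin n), ∀ q ∈ assocSet n, linePattern q = linePattern p →
      linePull q σ ∈ lineSorted n := by
  -- the configurations with the given order form an open set, in which configurations of distinct
  -- points are dense
  set U : Set (LineCoord n) := {q | ∀ a b, linePattern p a b → 0 < q.1 a b} with hU
  have hUo : IsOpen U := by
    simp only [hU, ofPred_forall]
    exact isOpen_iInter_of_finite fun a => isOpen_iInter_of_finite fun b =>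
      isOpen_iInter_of_finite fun _ => isOpen_lt (by fun_prop) (by fun_prop)
  have hUm : ∀ q ∈ assocSet n, linePattern q = linePattern p → q ∈ U := fun q hq h a b hab =>
    (assoc_pair_pos_iff hq a b).1 (by rwa [h])
  have hlt : ∀ x : Fin n → ℝ, Function.Injective x → lineCoord x ∈ U →
      ∀ a b, linePattern p a b → x a < x b := by
    intro x hx hxU a b hab
    have h1 := hxU a b hab
    by_contra hn
    rcases (not_lt.1 hn).eq_or_lt with h | h
    · obtain rfl := hx h
      simp [lineCoord, pairCoord] at h1
    · have h2 : (lineCoord x).1 a b = -1 := (pairCoord_line h).2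
      rw [h2] at h1
      norm_num at h1
  obtain ⟨_, hxU, x, hx, rfl⟩ := mem_closure_iff.1 hp.2 U hUo (hUm p hp rfl)
  have hx : Function.Injective x := hx
  have hiff : ∀ a b, linePattern p a b ↔ x a < x b := by
    intro a b
    refine ⟨hlt x hx hxU a b, fun h => ?_⟩
    have hne : a ≠ b := by rintro rfl; exact lt_irrefl _ h
    rcases assoc_pair hp hne with ⟨h', -⟩ | ⟨-, h'⟩
    · exact h'
    · exact absurd (hlt x hx hxU b a h') h.not_gt
  refine ⟨Tuple.sort x, fun q hq h => ?_⟩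
  have hqc : q ∈ closure (U ∩ lineCoord '' {x : Fin n → ℝ | Function.Injective x}) :=
    hUo.inter_closure ⟨hUm q hq h, hq.2⟩
  refine map_mem_closure (f := fun p => linePull p (Tuple.sort x)) (continuous_linePull _) hqc ?_
  rintro _ ⟨hyU, y, hy, rfl⟩
  refine ⟨y ∘ Tuple.sort x, fun a b hab => ?_, rfl⟩
  refine hlt y hy hyU _ _ ((hiff _ _).2 ?_)
  exact (Tuple.monotone_sort x).strictMono_of_injective
    (hx.comp (Tuple.sort x).injective) hab

/-- The homotopy type of the associahedron: it retracts by deformation onto finitely many points,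
one for each order of the labels. -/
theorem exists_line_model (hn : 0 < n) : ∃ (E : (Fin n → Fin n → Prop) → assocSet n)
    (e : C(assocSet n, assocSet n)), (∀ q, e q = E (linePattern q.1)) ∧
      e.Homotopic (ContinuousMap.id _) := by
  obtain ⟨m, rfl⟩ : ∃ m, n = m + 1 := ⟨n - 1, by omega⟩
  obtain ⟨s, ⟨H⟩⟩ := exists_section_lineSorted m
  have hσ : ∀ π : Fin (m + 1) → Fin (m + 1) → Prop, ∃ σ : Equiv.Perm (Fin (m + 1)),
      ∀ q ∈ assocSet (m + 1), linePattern q = π → linePull q σ ∈ lineSorted (m + 1) := by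
    intro π
    by_cases h : ∃ p ∈ assocSet (m + 1), linePattern p = π
    · obtain ⟨p, hp, rfl⟩ := h; exact exists_perm_lineSorted hp
    · exact ⟨1, fun q hq hqπ => absurd ⟨q, hq, hqπ⟩ h⟩
  choose σ hσ using hσ
  have hmem : ∀ (q : lineSorted (m + 1)) (τ : Equiv.Perm (Fin (m + 1))),
      linePull q.1 τ ∈ assocSet (m + 1) := fun q τ =>
    linePull_mem (lineSorted_subset hn q.2) τ.injective hn
  set E : (Fin (m + 1) → Fin (m + 1) → Prop) → assocSet (m + 1) := fun π =>
    ⟨linePull (s ()).1 (σ π).symm, hmem _ _⟩ with hE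
  have hec : Continuous fun q : assocSet (m + 1) => E (linePattern q.1) :=
    (isLocallyConstant_linePattern.comp E).continuous
  refine ⟨E, ⟨_, hec⟩, fun q => rfl,
    homotopic_of_isLocallyConstant isLocallyConstant_linePattern _ _ fun π => ?_⟩
  refine ⟨fun x => ⟨linePull (H (x.1, ⟨linePull x.2.1.1 (σ π), hσ π _ x.2.1.2 x.2.2⟩)).1
    (σ π).symm, hmem _ _⟩, ?_, ?_, ?_⟩
  · refine ((continuous_linePull _).comp (continuous_subtype_val.comp
      (H.continuous.comp (continuous_fst.prodMk ?_)))).subtype_mk _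
    exact ((continuous_linePull _).comp (by fun_prop)).subtype_mk _
  · rintro ⟨q, rfl⟩
    simp [hE]
  · rintro ⟨q, rfl⟩
    refine Subtype.ext ?_
    simp [linePull]

end Line

/-! ### Ratios of arcs on the cyclohedra -/

section Cyclic

variable {n : ℕ}

/-- The points `w e^{iθ_j}` of the circle. -/
def spiral (w : Circle) (θ : Fin n → ℝ) (j : Fin n) : Circle := w * Circle.exp (θ j)

/-- The angles increase and stay within a full turn. -/
def IsTurn (θ : Fin n → ℝ) : Prop := StrictMono θ ∧ ∀ a b, θ a < θ b + 2 * Real.pi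

/-- The part of the cyclohedron where the points are in their natural cyclic order. -/
def cyclicSorted (n : ℕ) : Set (CircleCoord n) :=
  closure {p | ∃ (w : Circle) (θ : Fin n → ℝ), IsTurn θ ∧ p = circleCoord (spiral w θ)}

/-- The natural (anticlockwise) cyclic order of three labels, the first and the last of which may
be equal. -/
def Cyc (x y z : Fin n) : Prop := (x < y ∧ y < z) ∨ (y < z ∧ z ≤ x) ∨ (z ≤ x ∧ x < y)

/-- The angle of the anticlockwise arc from one point to another, with value `2π` if the points
are equal. -/
def gap (θ : Fin n → ℝ) (a b : Fin n) : ℝ :=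
  if a < b then θ b - θ a else θ b - θ a + 2 * Real.pi

lemma gap_pos {θ : Fin n → ℝ} (hθ : IsTurn θ) (a b : Fin n) : 0 < gap θ a b := by
  unfold gap
  split_ifs with h
  · linarith [hθ.1 h]
  · linarith [hθ.2 a b]

lemma gap_lt {θ : Fin n → ℝ} (hθ : IsTurn θ) {a b : Fin n} (h : a ≠ b) :
    gap θ a b < 2 * Real.pi := by
  unfold gap
  split_ifs with h'
  · linarith [hθ.2 b a]
  · linarith [hθ.1 (lt_of_le_of_ne (not_lt.1 h') h.symm)]

lemma gap_self (θ : Fin n → ℝ) (a : Fin n) : gap θ a a = 2 * Real.pi := by simp [gap]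

lemma gap_add (θ : Fin n → ℝ) {x y z : Fin n} (h : Cyc x y z) :
    gap θ x y + gap θ y z = gap θ x z := by
  unfold gap Cyc at *
  simp only [Fin.lt_def, Fin.le_def] at *
  split_ifs
  all_goals first | (exfalso; omega) | ring

lemma Cyc.ne_left {x y z : Fin n} (h : Cyc x y z) : x ≠ y := by
  unfold Cyc at h; simp only [Fin.lt_def, Fin.le_def, ne_eq, Fin.ext_iff] at *; omega

lemma Cyc.ne_right {x y z : Fin n} (h : Cyc x y z) : y ≠ z := by
  unfold Cyc at h; simp only [Fin.lt_def, Fin.le_def, ne_eq, Fin.ext_iff] at *; omega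

lemma Cyc.rotate {x y z : Fin n} (h : Cyc x y z) (hxz : x ≠ z) : Cyc y z x := by
  unfold Cyc at *; simp only [Fin.lt_def, Fin.le_def, ne_eq, Fin.ext_iff] at *; omega

lemma cyc_self {x y : Fin n} (h : x ≠ y) : Cyc x y x := by
  unfold Cyc; simp only [Fin.lt_def, Fin.le_def, ne_eq, Fin.ext_iff] at *; omega

lemma cyc_or {x y z : Fin n} (hxy : x ≠ y) (hyz : y ≠ z) : Cyc x y z ∨ Cyc z y x := by
  unfold Cyc; simp only [Fin.lt_def, Fin.le_def, ne_eq, Fin.ext_iff] at *; omega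

lemma Cyc.right {a b c d : Fin n} (h1 : Cyc a b c) (h2 : Cyc a c d) (hac : a ≠ c) :
    Cyc b c d ∧ Cyc a b d ∧ b ≠ d := by
  unfold Cyc at *; simp only [Fin.lt_def, Fin.le_def, ne_eq, Fin.ext_iff] at *; omega

lemma spiral_injective {w : Circle} {θ : Fin n → ℝ} (hθ : IsTurn θ) :
    Function.Injective (spiral w θ) := by
  intro a b hab
  by_contra hne
  wlog h : a < b generalizing a b
  · exact this hab.symm (Ne.symm hne) (lt_of_le_of_ne (not_lt.1 h) (Ne.symm hne))
  refine (hθ.1 h).ne (Circle.exp_injOn_Ico (a := θ a) (b := θ a + 2 * Real.pi) (by linarith)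
    ⟨le_rfl, by linarith [Real.pi_pos]⟩ ⟨(hθ.1 h).le, hθ.2 b a⟩ (mul_left_cancel hab))

lemma ang_spiral {w : Circle} {θ : Fin n → ℝ} (hθ : IsTurn θ) {a b : Fin n} (h : a ≠ b) :
    ang (circleCoord (spiral w θ)) a b = gap θ a b := by
  have hz := spiral_injective (w := w) hθ
  have hm : circleCoord (spiral w θ) ∈ cycloSet n := subset_closure ⟨_, hz, rfl⟩
  have e := circle_eq_mul_exp_ang hm h
  have h1 := ang_circleCoord_pos (hz.ne h)
  have h2 : ang (circleCoord (spiral w θ)) a b < 2 * Real.pi := by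
    rw [ang_circleCoord (hz.ne h)]; exact Circle.angleDiff_lt_two_pi _ _
  have h3 := gap_pos hθ a b
  have h4 := gap_lt hθ h
  refine Circle.exp_injOn_Ico (a := 0) (b := 2 * Real.pi) (by linarith) ⟨h1.le, h2⟩ ⟨h3.le, h4⟩ ?_
  change w * Circle.exp (θ b) = w * Circle.exp (θ a) * _ at e
  rw [mul_assoc, mul_right_inj] at e
  have e2 : Circle.exp (θ b) = Circle.exp (θ a) * Circle.exp (gap θ a b) := by
    rw [← Circle.exp_add]
    unfold gap
    split_ifs
    · congr 1; ring
    · rw [← Circle.exp_add_two_pi]; congr 1; ring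
  rw [e] at e2
  exact mul_left_cancel e2

lemma spiral_mem {w : Circle} {θ : Fin n → ℝ} (hθ : IsTurn θ) :
    circleCoord (spiral w θ) ∈ cyclicSorted n := subset_closure ⟨w, θ, hθ, rfl⟩

lemma cyclicSorted_subset : cyclicSorted n ⊆ cycloSet n := by
  refine closure_mono ?_
  rintro _ ⟨w, θ, hθ, rfl⟩
  exact ⟨_, spiral_injective hθ, rfl⟩

lemma cyclicSorted_induction {P : CircleCoord n → Prop} (hP : IsClosed {p | P p})
    (h : ∀ w θ, IsTurn θ → P (circleCoord (spiral w θ))) {p : CircleCoord n}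
    (hp : p ∈ cyclicSorted n) : P p := by
  refine closure_minimal ?_ hP hp
  rintro _ ⟨w, θ, hθ, rfl⟩
  exact h w θ hθ

lemma cyclicSorted_eqOn {f g : CircleCoord n → ℝ} (hf : ContinuousOn f (cyclicSorted n))
    (hg : ContinuousOn g (cyclicSorted n))
    (h : ∀ w θ, IsTurn θ → f (circleCoord (spiral w θ)) = g (circleCoord (spiral w θ)))
    {p : CircleCoord n} (hp : p ∈ cyclicSorted n) : f p = g p := by
  refine Set.EqOn.of_subset_closure (s := {p | ∃ (w : Circle) (θ : Fin n → ℝ),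
    IsTurn θ ∧ p = circleCoord (spiral w θ)}) ?_ hf hg subset_closure subset_rfl hp
  rintro _ ⟨w, θ, hθ, rfl⟩
  exact h w θ hθ

/-- The quotient of half the chord by half the arc, from the point `a` to the point `b`. -/
def arcSinc (p : CircleCoord n) (a b : Fin n) : ℝ := Real.sinc (ang p a b / 2)

lemma continuous_arcSinc (a b : Fin n) : Continuous fun p : CircleCoord n => arcSinc p a b :=
  Real.continuous_sinc.comp ((continuous_ang a b).div_const 2)

lemma sinc_pos {x : ℝ} (h0 : 0 ≤ x) (h1 : x < Real.pi) : 0 < Real.sinc x := by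
  rcases h0.eq_or_lt with rfl | h0
  · simp
  · rw [Real.sinc_of_ne_zero h0.ne']
    exact div_pos (Real.sin_pos_of_pos_of_lt_pi h0 h1) h0

lemma arcSinc_pos {p : CircleCoord n} {a b : Fin n} (h : ang p a b < 2 * Real.pi) :
    0 < arcSinc p a b := sinc_pos (by linarith [ang_nonneg p a b]) (by linarith)

lemma arcSinc_nonneg (p : CircleCoord n) (a b : Fin n) : 0 ≤ arcSinc p a b := by
  rcases (ang_le p a b).eq_or_lt with h | h
  · unfold arcSinc
    rw [h, mul_div_cancel_left₀ _ two_ne_zero, Real.sinc_of_ne_zero Real.pi_ne_zero]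
    simp
  · exact (arcSinc_pos h).le

lemma arcSinc_of_eq_zero {p : CircleCoord n} {a b : Fin n} (h : ang p a b = 0) :
    arcSinc p a b = 1 := by unfold arcSinc; rw [h]; simp

lemma cyclo_triple_mem {p : CircleCoord n} (hp : p ∈ cycloSet n) (a b c : Fin n) :
    p.2.2 a b c ∈ Icc (0 : ℝ) 1 :=
  cyclo_induction (P := fun p => p.2.2 a b c ∈ Icc (0 : ℝ) 1)
    (isClosed_Icc.preimage (by fun_prop))
    (fun z _ => tripleCoord_mem_Icc (fun a => (z a : ℂ)) a b c) hp

/-- The ratio of the length of the arc from `x` to `y` to the length of the arc from `x` to `z`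
through `y` (or to the length of the circle, if `x = z`). It is expressed by the coordinates of the
compactification, so that it remains defined when points have collided: an arc is a chord, divided
by its `arcSinc`. -/
def arcRatio (p : CircleCoord n) (x y z : Fin n) : ℝ :=
  if z = x then ang p x y / (2 * Real.pi) else
    p.2.2 x y z * arcSinc p y z /
      (p.2.2 x y z * arcSinc p y z + (1 - p.2.2 x y z) * arcSinc p x y)

lemma arcRatio_mem {p : CircleCoord n} (hp : p ∈ cycloSet n) (x y z : Fin n) :
    arcRatio p x y z ∈ Icc (0 : ℝ) 1 := by
  have hpi := Real.pi_pos
  unfold arcRatio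
  split_ifs with h
  · exact ⟨div_nonneg (ang_nonneg _ _ _) (by linarith), (div_le_one (by linarith)).2 (ang_le _ _ _)⟩
  · obtain ⟨h0, h1⟩ := cyclo_triple_mem hp x y z
    have e1 := mul_nonneg h0 (arcSinc_nonneg p y z)
    have e2 := mul_nonneg (sub_nonneg.2 h1) (arcSinc_nonneg p x y)
    exact ⟨div_nonneg e1 (add_nonneg e1 e2), div_le_one_of_le₀ (by linarith) (add_nonneg e1 e2)⟩

/-- The length of a chord, in terms of the arc. -/
lemma norm_spiral {w : Circle} {θ : Fin n → ℝ} (hθ : IsTurn θ) {a b : Fin n} (h : a ≠ b) :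
    ‖(spiral w θ b : ℂ) - spiral w θ a‖ = 2 * Real.sin (gap θ a b / 2) := by
  have hz := (spiral_injective (w := w) hθ).ne h
  rw [norm_sub_circle hz, ← ang_circleCoord (z := spiral w θ) hz, ang_spiral hθ h]

lemma sin_half (x : ℝ) : Real.sin (x / 2) = x / 2 * Real.sinc (x / 2) := by
  by_cases h : x / 2 = 0
  · rw [h]; simp
  · rw [Real.sinc_of_ne_zero h, mul_div_cancel₀ _ h]

lemma arcSinc_spiral {w : Circle} {θ : Fin n → ℝ} (hθ : IsTurn θ) {a b : Fin n} (h : a ≠ b) :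
    arcSinc (circleCoord (spiral w θ)) a b = Real.sinc (gap θ a b / 2) := by
  rw [arcSinc, ang_spiral hθ h]

lemma sinc_gap_pos {θ : Fin n → ℝ} (hθ : IsTurn θ) {a b : Fin n} (h : a ≠ b) :
    0 < Real.sinc (gap θ a b / 2) :=
  sinc_pos (by linarith [gap_pos hθ a b]) (by linarith [gap_lt hθ h])

lemma triple_spiral {w : Circle} {θ : Fin n → ℝ} (hθ : IsTurn θ) {x y z : Fin n} (hxy : x ≠ y)
    (hyz : y ≠ z) : (circleCoord (spiral w θ)).2.2 x y z = gap θ x y * Real.sinc (gap θ x y / 2) /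
      (gap θ x y * Real.sinc (gap θ x y / 2) + gap θ y z * Real.sinc (gap θ y z / 2)) := by
  change tripleCoord (fun a => (spiral w θ a : ℂ)) x y z = _
  unfold tripleCoord
  rw [norm_spiral hθ hxy, norm_spiral hθ hyz, sin_half, sin_half]
  have h1 := mul_pos (gap_pos hθ x y) (sinc_gap_pos hθ hxy)
  have h2 := mul_pos (gap_pos hθ y z) (sinc_gap_pos hθ hyz)
  rw [div_eq_div_iff (by linarith) (by linarith)]
  ring

lemma arcRatio_spiral {w : Circle} {θ : Fin n → ℝ} (hθ : IsTurn θ) {x y z : Fin n}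
    (h : Cyc x y z) :
    arcRatio (circleCoord (spiral w θ)) x y z = gap θ x y / gap θ x z := by
  unfold arcRatio
  split_ifs with hxz
  · subst hxz
    rw [ang_spiral hθ h.ne_left, gap_self]
  · rw [triple_spiral hθ h.ne_left h.ne_right, arcSinc_spiral hθ h.ne_left,
      arcSinc_spiral hθ h.ne_right, ← gap_add θ h]
    have h1 := gap_pos hθ x y
    have h2 := gap_pos hθ y z
    have h3 := sinc_gap_pos hθ h.ne_left
    have h4 := sinc_gap_pos hθ h.ne_right
    generalize gap θ x y = A at *
    generalize gap θ y z = B at *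
    generalize Real.sinc (A / 2) = S at *
    generalize Real.sinc (B / 2) = T at *
    have e1 : A * S + B * T ≠ 0 := by positivity
    have e2 : A + B ≠ 0 := by positivity
    have e3 : 1 - A * S / (A * S + B * T) = B * T / (A * S + B * T) := by field_simp; ring
    rw [e3]
    have e4 : A * S / (A * S + B * T) * T + B * T / (A * S + B * T) * S =
      (A + B) * (S * T) / (A * S + B * T) := by field_simp
    rw [e4]
    field_simp

lemma cyclicSorted_ang_add {p : CircleCoord n} (hp : p ∈ cyclicSorted n) {x y z : Fin n}
    (h : Cyc x y z) (hxz : x ≠ z) : ang p x y + ang p y z = ang p x z := by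
  have h1 := continuous_ang x y
  have h2 := continuous_ang y z
  have h3 := continuous_ang x z
  refine cyclicSorted_eqOn (f := fun p => ang p x y + ang p y z) (g := fun p => ang p x z)
    (h1.add h2).continuousOn h3.continuousOn (fun w θ hθ => ?_) hp
  rw [ang_spiral hθ h.ne_left, ang_spiral hθ h.ne_right, ang_spiral hθ hxz, gap_add θ h]

/-- Of two adjacent arcs with total length at most `2π`, one that exceeds a half turn has at least
as long a chord as the other one. -/
lemma cyclicSorted_half {p : CircleCoord n} (hp : p ∈ cyclicSorted n) {x y z : Fin n}
    (h : Cyc x y z) : (ang p x y ≤ Real.pi ∨ 1 / 2 ≤ p.2.2 x y z) ∧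
      (ang p y z ≤ Real.pi ∨ p.2.2 x y z ≤ 1 / 2) := by
  have h1 := continuous_ang x y
  have h2 := continuous_ang y z
  refine cyclicSorted_induction (P := fun p => (ang p x y ≤ Real.pi ∨ 1 / 2 ≤ p.2.2 x y z) ∧
      (ang p y z ≤ Real.pi ∨ p.2.2 x y z ≤ 1 / 2)) ?_ (fun w θ hθ => ?_) hp
  · have h3 : Continuous fun p : CircleCoord n => p.2.2 x y z := by fun_prop
    exact ((isClosed_le h1 continuous_const).union (isClosed_le continuous_const h3)).inter
      ((isClosed_le h2 continuous_const).union (isClosed_le h3 continuous_const))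
  · rw [ang_spiral hθ h.ne_left, ang_spiral hθ h.ne_right, triple_spiral hθ h.ne_left h.ne_right]
    have g1 := gap_pos hθ x y
    have g2 := gap_pos hθ y z
    have p1 := mul_pos (gap_pos hθ x y) (sinc_gap_pos hθ h.ne_left)
    have p2 := mul_pos (gap_pos hθ y z) (sinc_gap_pos hθ h.ne_right)
    have e1 := sin_half (gap θ x y)
    have e2 := sin_half (gap θ y z)
    have hs : gap θ x y + gap θ y z ≤ 2 * Real.pi := by
      rw [gap_add θ h]
      by_cases hxz : x = z
      · rw [hxz, gap_self]
      · exact (gap_lt hθ hxz).le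
    rw [le_div_iff₀ (by linarith), div_le_iff₀ (by linarith)]
    constructor
    · rw [or_iff_not_imp_left]
      intro hlt
      push Not at hlt
      have := Real.sin_le_sin_of_le_of_le_pi_div_two (x := gap θ y z / 2)
        (y := Real.pi - gap θ x y / 2) (by linarith) (by linarith) (by linarith)
      rw [Real.sin_pi_sub] at this
      linarith
    · rw [or_iff_not_imp_left]
      intro hlt
      push Not at hlt
      have := Real.sin_le_sin_of_le_of_le_pi_div_two (x := gap θ x y / 2)
        (y := Real.pi - gap θ y z / 2) (by linarith) (by linarith) (by linarith)
      rw [Real.sin_pi_sub] at this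
      linarith

/-- The ratio of arcs is continuous even if one of them has become a full turn, where `arcSinc`
vanishes: the other arc is then zero, and its chord is not the longer one. -/
lemma arcRatio_denom_pos {p : CircleCoord n} (hp : p ∈ cyclicSorted n) {x y z : Fin n}
    (h : Cyc x y z) (hxz : x ≠ z) :
    0 < p.2.2 x y z * arcSinc p y z + (1 - p.2.2 x y z) * arcSinc p x y := by
  obtain ⟨h0, h1⟩ := cyclo_triple_mem (cyclicSorted_subset hp) x y z
  have hadd := cyclicSorted_ang_add hp h hxz
  have hle := ang_le p x z
  have n1 := ang_nonneg p x y
  have n2 := ang_nonneg p y z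
  have hpi := Real.pi_pos
  obtain ⟨c1, c2⟩ := cyclicSorted_half hp h
  have e1 := mul_nonneg h0 (arcSinc_nonneg p y z)
  have e2 := mul_nonneg (sub_nonneg.2 h1) (arcSinc_nonneg p x y)
  rcases (ang_le p x y).eq_or_lt with hx | hx
  · have : 1 / 2 ≤ p.2.2 x y z := c1.resolve_left (by linarith)
    rw [arcSinc_of_eq_zero (p := p) (a := y) (b := z) (by linarith)]
    linarith
  · rcases (ang_le p y z).eq_or_lt with hy | hy
    · have : p.2.2 x y z ≤ 1 / 2 := c2.resolve_left (by linarith)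
      rw [arcSinc_of_eq_zero (p := p) (a := x) (b := y) (by linarith)]
      linarith
    · have s1 := arcSinc_pos hx
      have s2 := arcSinc_pos hy
      rcases h0.eq_or_lt with h | h
      · rw [← h]; linarith
      · have := mul_pos h s2
        linarith

lemma continuousOn_arcRatio {x y z : Fin n} (h : Cyc x y z) :
    ContinuousOn (fun p => arcRatio p x y z) (cyclicSorted n) := by
  unfold arcRatio
  split_ifs with hxz
  · exact ((continuous_ang x y).div_const _).continuousOn
  · have h1 := continuous_arcSinc x y
    have h2 := continuous_arcSinc y z
    refine ContinuousOn.div (by fun_prop) (by fun_prop) fun p hp =>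
      (arcRatio_denom_pos hp h (Ne.symm hxz)).ne'

/-- Relations between the ratios of the arcs between four points in cyclic order. -/
lemma arcRatio_quadruple {p : CircleCoord n} (hp : p ∈ cyclicSorted n) {a b c d : Fin n}
    (h1 : Cyc a b c) (h2 : Cyc a c d) (hac : a ≠ c) :
    arcRatio p b c d * (1 - arcRatio p a c d) =
      (1 - arcRatio p a b c) * (arcRatio p a c d * (1 - arcRatio p b c d)) ∧
    (1 - arcRatio p a b c) * arcRatio p a b d =
      arcRatio p a b c * (arcRatio p b c d * (1 - arcRatio p a b d)) ∧
    arcRatio p a b d = arcRatio p a b c * arcRatio p a c d ∧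
    1 - arcRatio p a c d = (1 - arcRatio p b c d) * (1 - arcRatio p a b d) := by
  obtain ⟨h3, h4, hbd⟩ := h1.right h2 hac
  have c1 := continuousOn_arcRatio h1
  have c2 := continuousOn_arcRatio h2
  have c3 := continuousOn_arcRatio h3
  have c4 := continuousOn_arcRatio h4
  have key : ∀ (w : Circle) (θ : Fin n → ℝ), IsTurn θ → ∃ A B C : ℝ, 0 < A ∧ 0 < B ∧ 0 < C ∧
      arcRatio (circleCoord (spiral w θ)) a b c = A / (A + B) ∧
      arcRatio (circleCoord (spiral w θ)) a c d = (A + B) / (A + B + C) ∧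
      arcRatio (circleCoord (spiral w θ)) b c d = B / (B + C) ∧
      arcRatio (circleCoord (spiral w θ)) a b d = A / (A + B + C) := by
    intro w θ hθ
    refine ⟨gap θ a b, gap θ b c, gap θ c d, gap_pos hθ _ _, gap_pos hθ _ _, gap_pos hθ _ _, ?_⟩
    rw [arcRatio_spiral hθ h1, arcRatio_spiral hθ h2, arcRatio_spiral hθ h3,
      arcRatio_spiral hθ h4, gap_add θ h1, gap_add θ h3, gap_add θ h2]
    exact ⟨rfl, rfl, rfl, rfl⟩
  refine ⟨?_, ?_, ?_, ?_⟩
  · refine cyclicSorted_eqOn (f := fun p => arcRatio p b c d * (1 - arcRatio p a c d))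
      (g := fun p => (1 - arcRatio p a b c) * (arcRatio p a c d * (1 - arcRatio p b c d)))
      (by fun_prop) (by fun_prop) (fun w θ hθ => ?_) hp
    obtain ⟨A, B, C, hA, hB, hC, e1, e2, e3, e4⟩ := key w θ hθ
    simp only [e1, e2, e3]
    field_simp
    ring
  · refine cyclicSorted_eqOn (f := fun p => (1 - arcRatio p a b c) * arcRatio p a b d)
      (g := fun p => arcRatio p a b c * (arcRatio p b c d * (1 - arcRatio p a b d)))
      (by fun_prop) (by fun_prop) (fun w θ hθ => ?_) hp
    obtain ⟨A, B, C, hA, hB, hC, e1, e2, e3, e4⟩ := key w θ hθ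
    simp only [e1, e3, e4]
    field_simp
    ring
  · refine cyclicSorted_eqOn (f := fun p => arcRatio p a b d)
      (g := fun p => arcRatio p a b c * arcRatio p a c d)
      (by fun_prop) (by fun_prop) (fun w θ hθ => ?_) hp
    obtain ⟨A, B, C, hA, hB, hC, e1, e2, e3, e4⟩ := key w θ hθ
    simp only [e1, e2, e4]
    field_simp
  · refine cyclicSorted_eqOn (f := fun p => 1 - arcRatio p a c d)
      (g := fun p => (1 - arcRatio p b c d) * (1 - arcRatio p a b d))
      (by fun_prop) (by fun_prop) (fun w θ hθ => ?_) hp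
    obtain ⟨A, B, C, hA, hB, hC, e1, e2, e3, e4⟩ := key w θ hθ
    simp only [e2, e3, e4]
    field_simp
    ring

/-- Relations that express the relative distance of three points through the ratios of the arcs,
in case all three points have collided. -/
lemma cyclicSorted_triple {p : CircleCoord n} (hp : p ∈ cyclicSorted n) {x y z : Fin n}
    (h : Cyc x y z) (hxz : x ≠ z) :
    (1 - p.2.2 x y z) * arcSinc p y x = p.2.2 x y z * arcRatio p y z x * arcSinc p y z ∧
    p.2.2 x y z * arcSinc p z y = (1 - p.2.2 x y z) * (1 - arcRatio p z x y) * arcSinc p x y := by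
  have h' := h.rotate hxz
  have h'' := h'.rotate h.ne_left.symm
  have c1 := continuous_arcSinc y x
  have c2 := continuous_arcSinc y z
  have c3 := continuous_arcSinc z y
  have c4 := continuous_arcSinc x y
  have c5 := continuousOn_arcRatio h'
  have c6 := continuousOn_arcRatio h''
  constructor
  · refine cyclicSorted_eqOn (f := fun p => (1 - p.2.2 x y z) * arcSinc p y x)
      (g := fun p => p.2.2 x y z * arcRatio p y z x * arcSinc p y z)
      (by fun_prop) (by fun_prop) (fun w θ hθ => ?_) hp
    rw [arcSinc_spiral hθ h.ne_left.symm, arcSinc_spiral hθ h.ne_right, arcRatio_spiral hθ h']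
    -- the two arcs between `x` and `y` have the same chord
    have e : gap θ x y * Real.sinc (gap θ x y / 2) = gap θ y x * Real.sinc (gap θ y x / 2) := by
      have e1 := sin_half (gap θ x y)
      have e2 := sin_half (gap θ y x)
      have e3 : gap θ y x / 2 = Real.pi - gap θ x y / 2 := by
        have := gap_add θ (cyc_self h.ne_left)
        rw [gap_self] at this
        linarith
      have e4 : Real.sin (gap θ y x / 2) = Real.sin (gap θ x y / 2) := by
        rw [e3, Real.sin_pi_sub]
      linarith
    rw [triple_spiral hθ h.ne_left h.ne_right, e]
    have p1 := mul_pos (gap_pos hθ y x) (sinc_gap_pos hθ h.ne_left.symm)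
    have p2 := mul_pos (gap_pos hθ y z) (sinc_gap_pos hθ h.ne_right)
    have p3 := gap_pos hθ y x
    generalize Real.sinc (gap θ y x / 2) = S at *
    generalize Real.sinc (gap θ y z / 2) = T at *
    have : gap θ y x * S + gap θ y z * T ≠ 0 := by linarith
    field_simp
    ring
  · refine cyclicSorted_eqOn (f := fun p => p.2.2 x y z * arcSinc p z y)
      (g := fun p => (1 - p.2.2 x y z) * (1 - arcRatio p z x y) * arcSinc p x y)
      (by fun_prop) (by fun_prop) (fun w θ hθ => ?_) hp
    rw [arcSinc_spiral hθ h.ne_left, arcSinc_spiral hθ h.ne_right.symm, arcRatio_spiral hθ h'']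
    have e : gap θ y z * Real.sinc (gap θ y z / 2) = gap θ z y * Real.sinc (gap θ z y / 2) := by
      have e1 := sin_half (gap θ y z)
      have e2 := sin_half (gap θ z y)
      have e3 : gap θ z y / 2 = Real.pi - gap θ y z / 2 := by
        have := gap_add θ (cyc_self h.ne_right)
        rw [gap_self] at this
        linarith
      have e4 : Real.sin (gap θ z y / 2) = Real.sin (gap θ y z / 2) := by
        rw [e3, Real.sin_pi_sub]
      linarith
    rw [triple_spiral hθ h.ne_left h.ne_right, e]
    have p1 := mul_pos (gap_pos hθ z y) (sinc_gap_pos hθ h.ne_right.symm)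
    have p2 := mul_pos (gap_pos hθ x y) (sinc_gap_pos hθ h.ne_left)
    have p3 := gap_pos hθ z y
    have p4 := gap_add θ h''
    generalize Real.sinc (gap θ z y / 2) = S at *
    generalize Real.sinc (gap θ x y / 2) = T at *
    have : gap θ x y * T + gap θ z y * S ≠ 0 := by linarith
    have e5 : 1 - gap θ z x / gap θ z y = gap θ x y / gap θ z y := by
      rw [eq_div_iff p3.ne', sub_mul, div_mul_cancel₀ _ p3.ne']; linarith
    rw [e5]
    field_simp
    ring

lemma ang_eq_arcRatio (p : CircleCoord n) (a b : Fin n) :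
    ang p a b = 2 * Real.pi * arcRatio p a b a := by
  rw [arcRatio, if_pos rfl]
  field_simp [Real.pi_ne_zero]

lemma arcRatio_self_swap {p : CircleCoord n} (hp : p ∈ cycloSet n) {a b : Fin n} (h : a ≠ b) :
    arcRatio p a b a = 1 - arcRatio p b a b := by
  have h1 := ang_add_ang hp h
  rw [ang_eq_arcRatio p a b, ang_eq_arcRatio p b a] at h1
  have := Real.pi_pos
  have h2 : 2 * Real.pi * (arcRatio p a b a + arcRatio p b a b) = 2 * Real.pi * 1 := by linarith
  have := mul_left_cancel₀ (by positivity) h2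
  linarith

/-- A point of the cyclohedron is determined by the position of a point and the ratios of arcs. -/
lemma cyclicSorted_ext {p q : CircleCoord n} (hp : p ∈ cyclicSorted n) (hq : q ∈ cyclicSorted n)
    (o : Fin n) (h0 : p.1 o = q.1 o)
    (h : ∀ x y z, Cyc x y z → arcRatio p x y z = arcRatio q x y z) : p = q := by
  have hp' := cyclicSorted_subset hp
  have hq' := cyclicSorted_subset hq
  have hang : ∀ a b, a ≠ b → ang p a b = ang q a b := fun a b hab => by
    rw [ang_eq_arcRatio, ang_eq_arcRatio, h _ _ _ (cyc_self hab)]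
  have hsinc : ∀ a b, a ≠ b → arcSinc p a b = arcSinc q a b := fun a b hab => by
    rw [arcSinc, arcSinc, hang a b hab]
  have h1 : p.1 = q.1 := by
    ext1 b
    by_cases hb : o = b
    · rw [← hb, h0]
    · rw [circle_eq_mul_exp_ang hp' hb, circle_eq_mul_exp_ang hq' hb, h0, hang _ _ hb]
  refine Prod.ext h1 (Prod.ext ?_ ?_)
  · ext1 a
    ext1 b
    by_cases hab : a = b
    · subst hab; rw [(cyclo_diag hp' a).1, (cyclo_diag hq' a).1]
    · rw [cyclo_pair hp' hab, cyclo_pair hq' hab, h1, hang _ _ hab]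
  · have key : ∀ x y z, Cyc x y z → x ≠ z → p.2.2 x y z = q.2.2 x y z := by
      intro x y z hc hxz
      have hr := h x y z hc
      have hadd := cyclicSorted_ang_add hq hc hxz
      have hle := ang_le q x z
      have n1 := ang_nonneg q x y
      have n2 := ang_nonneg q y z
      have t1 := (cyclicSorted_triple hp hc hxz)
      have t2 := (cyclicSorted_triple hq hc hxz)
      rw [hsinc _ _ hc.ne_left, hsinc _ _ hc.ne_right, hsinc _ _ hc.ne_left.symm,
        hsinc _ _ hc.ne_right.symm, h _ _ _ (hc.rotate hxz),
        h _ _ _ ((hc.rotate hxz).rotate hc.ne_left.symm)] at t1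
      -- The ratio of the arcs `xy` and `xz` gives the relative distance, unless one of the arcs
      -- `xy` and `yz` is a full turn. Then all three points have collided, and the relative
      -- distance is found from the ratio of arcs in another cyclic arrangement.
      rcases (ang_le q x y).eq_or_lt with hx | hx
      · have e1 : ang q y x = 0 := by linarith [ang_add_ang hq' hc.ne_left]
        have e2 := arcSinc_of_eq_zero e1
        have t1 := t1.1
        have t2 := t2.1
        rw [e2] at t1 t2
        have m := mul_nonneg (arcRatio_mem hq' y z x).1 (arcSinc_nonneg q y z)
        have : (1 + arcRatio q y z x * arcSinc q y z) * p.2.2 x y z =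
          (1 + arcRatio q y z x * arcSinc q y z) * q.2.2 x y z := by linarith
        exact mul_left_cancel₀ (by positivity) this
      · rcases (ang_le q y z).eq_or_lt with hy | hy
        · have e1 : ang q z y = 0 := by linarith [ang_add_ang hq' hc.ne_right]
          have e2 := arcSinc_of_eq_zero e1
          have t1 := t1.2
          have t2 := t2.2
          rw [e2] at t1 t2
          have m := mul_nonneg (sub_nonneg.2 (arcRatio_mem hq' z x y).2) (arcSinc_nonneg q x y)
          have : (1 + (1 - arcRatio q z x y) * arcSinc q x y) * p.2.2 x y z =
            (1 + (1 - arcRatio q z x y) * arcSinc q x y) * q.2.2 x y z := by linarith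
          exact mul_left_cancel₀ (by positivity) this
        · have s1 := arcSinc_pos hx
          have s2 := arcSinc_pos hy
          have d1 := arcRatio_denom_pos hp hc hxz
          have d2 := arcRatio_denom_pos hq hc hxz
          rw [arcRatio, arcRatio, if_neg (Ne.symm hxz), if_neg (Ne.symm hxz)] at hr
          rw [hsinc _ _ hc.ne_left, hsinc _ _ hc.ne_right] at hr d1
          rw [div_eq_div_iff d1.ne' d2.ne'] at hr
          have : arcSinc q x y * arcSinc q y z * p.2.2 x y z =
            arcSinc q x y * arcSinc q y z * q.2.2 x y z := by linarith
          exact mul_left_cancel₀ (by positivity) this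
    ext x y z
    by_cases hxy : x = y
    · subst hxy; rw [cyclo_triple_left hp', cyclo_triple_left hq']
    by_cases hyz : y = z
    · subst hyz; rw [cyclo_triple_right hp' hxy, cyclo_triple_right hq' hxy]
    by_cases hxz : x = z
    · subst hxz
      have e1 := cyclo_triple_swap hp' (c := x) hxy
      have e2 := cyclo_triple_swap hq' (c := x) hxy
      linarith
    rcases cyc_or hxy hyz with hc | hc
    · exact key x y z hc hxz
    · rw [cyclo_triple_swap hp' (Ne.symm hyz), cyclo_triple_swap hq' (Ne.symm hyz),
        key z y x hc (Ne.symm hxz)]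

end Cyclic

/-! ### The homotopy type of the cyclohedra -/

section CyclicStep

variable {n : ℕ}

lemma circlePull_spiral {k : ℕ} (w : Circle) (θ : Fin n → ℝ) (f : Fin k → Fin n) :
    circlePull (circleCoord (spiral w θ)) f = circleCoord (spiral w (θ ∘ f)) := rfl

lemma IsTurn.comp {k : ℕ} {θ : Fin n → ℝ} (hθ : IsTurn θ) {f : Fin k → Fin n} (hf : StrictMono f) :
    IsTurn (θ ∘ f) := ⟨hθ.1.comp hf, fun _ _ => hθ.2 _ _⟩

lemma circlePull_sorted {k : ℕ} {p : CircleCoord n} (hp : p ∈ cyclicSorted n) {f : Fin k → Fin n}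
    (hf : StrictMono f) : circlePull p f ∈ cyclicSorted k := by
  refine map_mem_closure (f := fun p => circlePull p f) (continuous_circlePull f) hp ?_
  rintro _ ⟨w, θ, hθ, rfl⟩
  exact ⟨w, θ ∘ f, hθ.comp hf, rfl⟩

lemma arcRatio_pull {k : ℕ} (p : CircleCoord n) {f : Fin k → Fin n} (hf : Function.Injective f)
    (x y z : Fin k) : arcRatio (circlePull p f) x y z = arcRatio p (f x) (f y) (f z) := by
  unfold arcRatio
  simp only [hf.eq_iff]
  rfl

lemma isCompact_cyclicSorted (n : ℕ) : IsCompact (cyclicSorted n) :=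
  (isCompact_cycloSet n).of_isClosed_subset isClosed_closure cyclicSorted_subset

/-- Forgetting the last point of a configuration on the circle. -/
def circleForget (n : ℕ) : C(cyclicSorted (n + 1), cyclicSorted n) where
  toFun p := ⟨circlePull p.1 Fin.castSucc, circlePull_sorted p.2 Fin.strictMono_castSucc⟩
  continuous_toFun := ((continuous_circlePull _).comp continuous_subtype_val).subtype_mk _

lemma dense_cyclicSorted : Dense {p : cyclicSorted n | ∃ (w : Circle) (θ : Fin n → ℝ),
    IsTurn θ ∧ p.1 = circleCoord (spiral w θ)} := by
  intro p
  rw [closure_subtype]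
  convert p.2 using 1
  unfold cyclicSorted
  congr 1
  ext q
  constructor
  · rintro ⟨r, hr, rfl⟩; exact hr
  · intro hq; exact ⟨⟨q, subset_closure hq⟩, hq, rfl⟩

/-- The dependence of the relative position `F` of a new point with respect to an old one on its
relative position `h` with respect to its neighbours is increasing. -/
lemma le_of_link {k h h' F F' : ℝ} (hk0 : 0 ≤ k) (hk1 : k ≤ 1) (h0 : 0 ≤ h') (hF1 : F' ≤ 1)
    (e : F * (1 - k) = (1 - F) * (h * k)) (e' : F' * (1 - k) = (1 - F') * (h' * k))
    (hlt : F < F') : h ≤ h' := by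
  by_contra hn
  push Not at hn
  rcases hk0.eq_or_lt with rfl | hk
  · simp at e e'; linarith
  · have h1 : (1 - F') * h' < (1 - F) * h := by nlinarith
    have h2 := mul_lt_mul_of_pos_right h1 hk
    nlinarith

/-- The position `F` with respect to an old point is determined by `h`, unless `h = 0`. -/
lemma eq_zero_of_link {k h F F' : ℝ} (hk0 : 0 ≤ k) (hk1 : k ≤ 1) (h0 : 0 ≤ h)
    (e : F * (1 - k) = (1 - F) * (h * k)) (e' : F' * (1 - k) = (1 - F') * (h * k))
    (hlt : F < F') : h = 0 := by
  have h1 : (F' - F) * (1 - k + h * k) = 0 := by linarith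
  have h2 : 1 - k + h * k = 0 := (mul_eq_zero.1 h1).resolve_left (by linarith)
  have h3 := mul_nonneg h0 hk0
  have h4 : k = 1 := by linarith
  rw [h4] at h2
  linarith

lemma isTurn_snoc {θ : Fin (n + 1) → ℝ} (hθ : IsTurn θ) {s : ℝ} (h1 : θ (Fin.last n) < s)
    (h2 : s < θ 0 + 2 * Real.pi) : IsTurn (Fin.snoc θ s : Fin (n + 2) → ℝ) := by
  refine ⟨strictMono_snoc hθ.1 h1, fun a b => ?_⟩
  have hpi := Real.pi_pos
  induction a using Fin.lastCases with
  | last =>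
    induction b using Fin.lastCases with
    | last => simp [hpi]
    | cast b => simpa using h2.trans_le (add_le_add_left (hθ.1.monotone (Fin.zero_le b)) _)
  | cast a =>
    induction b using Fin.lastCases with
    | last =>
      have := hθ.1.monotone (Fin.le_last a)
      simp only [Fin.snoc_castSucc, Fin.snoc_last]
      linarith
    | cast b => simpa using hθ.2 a b

lemma gap_snoc (θ : Fin (n + 1) → ℝ) (s : ℝ) (a b : Fin (n + 1)) :
    gap (Fin.snoc θ s : Fin (n + 2) → ℝ) a.castSucc b.castSucc = gap θ a b := by
  simp [gap, Fin.castSucc_lt_castSucc_iff]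

/-- The position of the last point of a configuration, as a point of the arc from its predecessor
to the first point: the relative position with respect to the two neighbours, and the ratios of
its distances from a neighbour with the distances of the neighbour from the other points. -/
def lastPos (n : ℕ) (i : Option (Fin n ⊕ Fin n)) (p : CircleCoord (n + 2)) : ℝ :=
  match i with
  | none => arcRatio p (Fin.last n).castSucc (Fin.last (n + 1)) (0 : Fin (n + 1)).castSucc
  | some (.inl a) => 1 - arcRatio p a.castSucc.castSucc (Fin.last n).castSucc (Fin.last (n + 1))
  | some (.inr b) => 1 - arcRatio p (Fin.last (n + 1)) (0 : Fin (n + 1)).castSucc b.succ.castSucc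

/-- The limits of `lastPos` as the last point approaches its predecessor. -/
def lastPosLower (n : ℕ) (i : Option (Fin n ⊕ Fin n)) (p : CircleCoord (n + 1)) : ℝ :=
  match i with
  | none => 0
  | some (.inl _) => 0
  | some (.inr b) => 1 - arcRatio p (Fin.last n) 0 b.succ

/-- The limits of `lastPos` as the last point approaches the first one. -/
def lastPosUpper (n : ℕ) (i : Option (Fin n ⊕ Fin n)) (p : CircleCoord (n + 1)) : ℝ :=
  match i with
  | none => 1
  | some (.inl a) => 1 - arcRatio p a.castSucc (Fin.last n) 0
  | some (.inr _) => 1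

lemma cyc_pred (a : Fin n) : Cyc a.castSucc.castSucc (Fin.last n).castSucc (Fin.last (n + 1)) := by
  unfold Cyc; simp only [Fin.lt_def, Fin.le_def, Fin.val_castSucc, Fin.val_last]; omega

lemma cyc_new : Cyc (Fin.last n).castSucc (Fin.last (n + 1)) (0 : Fin (n + 1)).castSucc := by
  unfold Cyc
  simp only [Fin.lt_def, Fin.le_def, Fin.val_castSucc, Fin.val_last, Fin.val_zero]; omega

lemma cyc_succ (b : Fin n) :
    Cyc (Fin.last (n + 1)) (0 : Fin (n + 1)).castSucc b.succ.castSucc := by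
  unfold Cyc
  simp only [Fin.lt_def, Fin.le_def, Fin.val_castSucc, Fin.val_last, Fin.val_zero, Fin.val_succ]
  omega

lemma cyc_last_zero (a : Fin n) : Cyc a.castSucc (Fin.last n) 0 := by
  unfold Cyc
  simp only [Fin.lt_def, Fin.le_def, Fin.val_castSucc, Fin.val_last, Fin.val_zero]; omega

lemma cyc_zero_succ (b : Fin n) : Cyc (Fin.last n) 0 b.succ := by
  unfold Cyc
  simp only [Fin.lt_def, Fin.le_def, Fin.val_last, Fin.val_zero, Fin.val_succ]; omega

lemma lastPos_mem (i : Option (Fin n ⊕ Fin n)) {p : CircleCoord (n + 2)}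
    (hp : p ∈ cycloSet (n + 2)) : lastPos n i p ∈ Icc (0 : ℝ) 1 := by
  rcases i with _ | a | b
  · exact arcRatio_mem hp _ _ _
  · have := arcRatio_mem hp a.castSucc.castSucc (Fin.last n).castSucc (Fin.last (n + 1))
    exact ⟨by linarith [this.2, show lastPos n (some (.inl a)) p = 1 - _ from rfl],
      by linarith [this.1, show lastPos n (some (.inl a)) p = 1 - _ from rfl]⟩
  · have := arcRatio_mem hp (Fin.last (n + 1)) (0 : Fin (n + 1)).castSucc b.succ.castSucc
    exact ⟨by linarith [this.2, show lastPos n (some (.inr b)) p = 1 - _ from rfl],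
      by linarith [this.1, show lastPos n (some (.inr b)) p = 1 - _ from rfl]⟩

lemma lastPosUpper_mem (i : Option (Fin n ⊕ Fin n)) {p : CircleCoord (n + 1)}
    (hp : p ∈ cycloSet (n + 1)) : lastPosUpper n i p ∈ Icc (0 : ℝ) 1 := by
  rcases i with _ | a | b
  · exact ⟨zero_le_one, le_rfl⟩
  · have := arcRatio_mem hp a.castSucc (Fin.last n) 0
    exact ⟨sub_nonneg.2 this.2, sub_le_self _ this.1⟩
  · exact ⟨zero_le_one, le_rfl⟩

lemma lastPosLower_mem (i : Option (Fin n ⊕ Fin n)) {p : CircleCoord (n + 1)}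
    (hp : p ∈ cycloSet (n + 1)) : lastPosLower n i p ∈ Icc (0 : ℝ) 1 := by
  rcases i with _ | a | b
  · exact ⟨le_rfl, zero_le_one⟩
  · exact ⟨le_rfl, zero_le_one⟩
  · have := arcRatio_mem hp (Fin.last n) 0 b.succ
    exact ⟨sub_nonneg.2 this.2, sub_le_self _ this.1⟩

lemma lastPos_left {p : CircleCoord (n + 2)} (hp : p ∈ cyclicSorted (n + 2)) (a : Fin n) :
    lastPos n (some (.inl a)) p * (1 - lastPosUpper n (some (.inl a)) (circlePull p Fin.castSucc)) =
      (1 - lastPos n (some (.inl a)) p) * (lastPos n none p *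
        lastPosUpper n (some (.inl a)) (circlePull p Fin.castSucc)) := by
  have h2 : Cyc a.castSucc.castSucc (Fin.last (n + 1)) (0 : Fin (n + 1)).castSucc := by
    unfold Cyc
    simp only [Fin.lt_def, Fin.le_def, Fin.val_castSucc, Fin.val_last, Fin.val_zero]; omega
  have := (arcRatio_quadruple hp (cyc_pred a) h2 (Fin.castSucc_lt_last _).ne).2.1
  simp only [lastPos, lastPosUpper, arcRatio_pull p (Fin.castSucc_injective (n + 1))]
  linarith

lemma lastPos_right {p : CircleCoord (n + 2)} (hp : p ∈ cyclicSorted (n + 2)) (b : Fin n) :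
    (1 - lastPos n (some (.inr b)) p) *
      (1 - (1 - lastPosLower n (some (.inr b)) (circlePull p Fin.castSucc))) =
      (1 - (1 - lastPos n (some (.inr b)) p)) * ((1 - lastPos n none p) *
        (1 - lastPosLower n (some (.inr b)) (circlePull p Fin.castSucc))) := by
  have h2 : Cyc (Fin.last n).castSucc (0 : Fin (n + 1)).castSucc b.succ.castSucc := cyc_zero_succ b
  have hne : (Fin.last n).castSucc ≠ (0 : Fin (n + 1)).castSucc := by
    have := b.2
    simp only [ne_eq, Fin.ext_iff, Fin.val_castSucc, Fin.val_last, Fin.val_zero]; omega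
  have := (arcRatio_quadruple hp cyc_new h2 hne).1
  simp only [lastPos, lastPosLower, arcRatio_pull p (Fin.castSucc_injective (n + 1))]
  linarith

/-- Configurations that agree but for the last point: its position is higher in one of them than
in the other one with respect to all coordinates. -/
lemma lastPos_mono {p p' : CircleCoord (n + 2)} (hp : p ∈ cyclicSorted (n + 2))
    (hp' : p' ∈ cyclicSorted (n + 2))
    (h : circlePull p Fin.castSucc = circlePull p' Fin.castSucc) (i j : Option (Fin n ⊕ Fin n))
    (hlt : lastPos n i p < lastPos n i p') : lastPos n j p ≤ lastPos n j p' := by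
  have hpull : ∀ {q}, q ∈ cyclicSorted (n + 2) → circlePull q Fin.castSucc ∈ cycloSet (n + 1) :=
    fun hq => circlePull_mem (cyclicSorted_subset hq) (Fin.castSucc_injective _)
  -- each coordinate is linked to the position between the neighbours; it moves alone only if this
  -- position is at the end of the arc next to the relevant neighbour
  have hF : ∀ {p p'}, p ∈ cyclicSorted (n + 2) → p' ∈ cyclicSorted (n + 2) →
      circlePull p Fin.castSucc = circlePull p' Fin.castSucc → ∀ a,
      lastPos n (some (.inl a)) p < lastPos n (some (.inl a)) p' →
      lastPos n none p ≤ lastPos n none p' ∧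
      (lastPos n none p = lastPos n none p' → lastPos n none p = 0) := by
    intro p p' hp hp' h a hlt
    have e := lastPos_left hp a
    have e' := lastPos_left hp' a
    rw [← h] at e'
    have m := lastPosUpper_mem (some (.inl a)) (hpull hp)
    refine ⟨le_of_link m.1 m.2 (lastPos_mem _ (cyclicSorted_subset hp')).1
      (lastPos_mem _ (cyclicSorted_subset hp')).2 e e' hlt, fun heq => ?_⟩
    rw [← heq] at e'
    exact eq_zero_of_link m.1 m.2 (lastPos_mem _ (cyclicSorted_subset hp)).1 e e' hlt
  have hG : ∀ {p p'}, p ∈ cyclicSorted (n + 2) → p' ∈ cyclicSorted (n + 2) →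
      circlePull p Fin.castSucc = circlePull p' Fin.castSucc → ∀ a,
      lastPos n (some (.inr a)) p < lastPos n (some (.inr a)) p' →
      lastPos n none p ≤ lastPos n none p' ∧
      (lastPos n none p = lastPos n none p' → lastPos n none p = 1) := by
    intro p p' hp hp' h a hlt
    have e := lastPos_right hp a
    have e' := lastPos_right hp' a
    rw [← h] at e'
    have m := lastPosLower_mem (some (.inr a)) (hpull hp)
    have m1 := lastPos_mem none (cyclicSorted_subset hp)
    have m2 := lastPos_mem (some (.inr a)) (cyclicSorted_subset hp)
    have hlt' : 1 - lastPos n (some (.inr a)) p' < 1 - lastPos n (some (.inr a)) p := by linarith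
    have k0 : 0 ≤ 1 - lastPosLower n (some (.inr a)) (circlePull p Fin.castSucc) := by
      linarith [m.2]
    have k1 : 1 - lastPosLower n (some (.inr a)) (circlePull p Fin.castSucc) ≤ 1 := by
      linarith [m.1]
    constructor
    · have := le_of_link k0 k1 (by linarith [m1.2]) (by linarith [m2.1]) e' e hlt'
      linarith
    · intro heq
      rw [← heq] at e'
      have := eq_zero_of_link k0 k1 (by linarith [m1.2]) e' e hlt'
      linarith
  -- coordinates belonging to the same neighbour have proportional odds
  have hFF : ∀ {p p'}, p ∈ cyclicSorted (n + 2) → p' ∈ cyclicSorted (n + 2) →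
      circlePull p Fin.castSucc = circlePull p' Fin.castSucc → ∀ a b, a < b →
      (lastPos n (some (.inl a)) p < lastPos n (some (.inl a)) p' →
        lastPos n (some (.inl b)) p ≤ lastPos n (some (.inl b)) p') := by
    intro p p' hp hp' h a b hab hlt
    have hc : Cyc a.castSucc.castSucc b.castSucc.castSucc (Fin.last n).castSucc :=
      Or.inl ⟨by simpa using hab, by simp [Fin.castSucc_lt_last b]⟩
    have hne : a.castSucc.castSucc ≠ (Fin.last n).castSucc := by
      simp [(Fin.castSucc_lt_last a).ne]
    have e := (arcRatio_quadruple hp hc (cyc_pred a) hne).1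
    have e' := (arcRatio_quadruple hp' hc (cyc_pred a) hne).1
    have hd : arcRatio p a.castSucc.castSucc b.castSucc.castSucc (Fin.last n).castSucc =
        arcRatio p' a.castSucc.castSucc b.castSucc.castSucc (Fin.last n).castSucc := by
      have := congrArg (fun q => arcRatio q a.castSucc b.castSucc (Fin.last n)) h
      simpa only [arcRatio_pull _ (Fin.castSucc_injective (n + 1))] using this
    rw [← hd] at e'
    have m := arcRatio_mem (cyclicSorted_subset hp) a.castSucc.castSucc b.castSucc.castSucc
      (Fin.last n).castSucc
    refine le_of_proportional (β := 1) (sub_nonneg.2 m.2) zero_le_one (by linarith [m.2])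
      (lastPos_mem _ (cyclicSorted_subset hp')).1 (lastPos_mem _ (cyclicSorted_subset hp)).2
      (lastPos_mem _ (cyclicSorted_subset hp)).1 (lastPos_mem _ (cyclicSorted_subset hp')).2 ?_ ?_
      hlt
    · simp only [lastPos]; linarith
    · simp only [lastPos]; linarith
  have hGG : ∀ {p p'}, p ∈ cyclicSorted (n + 2) → p' ∈ cyclicSorted (n + 2) →
      circlePull p Fin.castSucc = circlePull p' Fin.castSucc → ∀ a b, a < b →
      (lastPos n (some (.inr a)) p < lastPos n (some (.inr a)) p' →
        lastPos n (some (.inr b)) p ≤ lastPos n (some (.inr b)) p') := by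
    intro p p' hp hp' h a b hab hlt
    have hc : Cyc (Fin.last (n + 1)) a.succ.castSucc b.succ.castSucc :=
      Or.inr (Or.inl ⟨by simpa using hab, Fin.le_last _⟩)
    have hne : Fin.last (n + 1) ≠ a.succ.castSucc := (Fin.castSucc_lt_last _).ne'
    have e := (arcRatio_quadruple hp (cyc_succ a) hc hne).2.1
    have e' := (arcRatio_quadruple hp' (cyc_succ a) hc hne).2.1
    have hd : arcRatio p (0 : Fin (n + 1)).castSucc a.succ.castSucc b.succ.castSucc =
        arcRatio p' (0 : Fin (n + 1)).castSucc a.succ.castSucc b.succ.castSucc := by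
      have := congrArg (fun q => arcRatio q 0 a.succ b.succ) h
      simpa only [arcRatio_pull _ (Fin.castSucc_injective (n + 1))] using this
    rw [← hd] at e'
    have m := arcRatio_mem (cyclicSorted_subset hp) (0 : Fin (n + 1)).castSucc a.succ.castSucc
      b.succ.castSucc
    refine le_of_proportional (α := arcRatio p (0 : Fin (n + 1)).castSucc a.succ.castSucc
      b.succ.castSucc) (β := 1) m.1 zero_le_one (by linarith [m.1])
      (lastPos_mem _ (cyclicSorted_subset hp')).1 (lastPos_mem _ (cyclicSorted_subset hp)).2
      (lastPos_mem _ (cyclicSorted_subset hp)).1 (lastPos_mem _ (cyclicSorted_subset hp')).2 ?_ ?_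
      hlt
    · simp only [lastPos]; linarith
    · simp only [lastPos]; linarith
  -- coordinates belonging to different neighbours cannot move in opposite directions, since this
  -- would place the last point at both ends of the arc
  have hFG : ∀ {p p'}, p ∈ cyclicSorted (n + 2) → p' ∈ cyclicSorted (n + 2) →
      circlePull p Fin.castSucc = circlePull p' Fin.castSucc → ∀ a b,
      (lastPos n (some (.inl a)) p < lastPos n (some (.inl a)) p' →
        lastPos n (some (.inr b)) p ≤ lastPos n (some (.inr b)) p') := by
    intro p p' hp hp' h a b hlt
    by_contra hn
    push Not at hn
    have h1 := hF hp hp' h a hlt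
    have h2 := hG hp' hp h.symm b hn
    have h3 := le_antisymm h1.1 h2.1
    have h4 := h1.2 h3
    have h5 := h2.2 h3.symm
    linarith
  rcases i with _ | a | a <;> rcases j with _ | b | b
  · exact hlt.le
  · by_contra hn
    exact absurd (hF hp' hp h.symm b (not_le.1 hn)).1 (not_le.2 hlt)
  · by_contra hn
    exact absurd (hG hp' hp h.symm b (not_le.1 hn)).1 (not_le.2 hlt)
  · exact (hF hp hp' h a hlt).1
  · rcases lt_trichotomy a b with hab | rfl | hab
    · exact hFF hp hp' h a b hab hlt
    · exact hlt.le
    · by_contra hn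
      exact absurd (hFF hp' hp h.symm b a hab (not_le.1 hn)) (not_le.2 hlt)
  · exact hFG hp hp' h a b hlt
  · exact (hG hp hp' h a hlt).1
  · by_contra hn
    exact absurd (hFG hp' hp h.symm b a (not_le.1 hn)) (not_le.2 hlt)
  · rcases lt_trichotomy a b with hab | rfl | hab
    · exact hGG hp hp' h a b hab hlt
    · exact hlt.le
    · by_contra hn
      exact absurd (hGG hp' hp h.symm b a hab (not_le.1 hn)) (not_le.2 hlt)

/-- Configurations are determined by all points but the last one, and by the coordinates of the
last one. -/
lemma lastPos_ext {p p' : CircleCoord (n + 2)} (hp : p ∈ cyclicSorted (n + 2))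
    (hp' : p' ∈ cyclicSorted (n + 2))
    (h : circlePull p Fin.castSucc = circlePull p' Fin.castSucc)
    (hf : ∀ i, lastPos n i p = lastPos n i p') : p = p' := by
  have hb : ∀ x y z : Fin (n + 1), arcRatio p x.castSucc y.castSucc z.castSucc =
      arcRatio p' x.castSucc y.castSucc z.castSucc := fun x y z => by
    have := congrArg (fun q => arcRatio q x y z) h
    simpa only [arcRatio_pull _ (Fin.castSucc_injective (n + 1))] using this
  set N := Fin.last (n + 1) with hN
  set L := (Fin.last n).castSucc with hL
  set O := (0 : Fin (n + 1)).castSucc with hO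
  have hh : arcRatio p L N O = arcRatio p' L N O := hf none
  have hF : ∀ a : Fin (n + 1), a ≠ Fin.last n →
      arcRatio p a.castSucc L N = arcRatio p' a.castSucc L N := fun a ha => by
    obtain ⟨a, rfl⟩ := Fin.exists_castSucc_eq.2 ha
    have : 1 - arcRatio p a.castSucc.castSucc L N = 1 - arcRatio p' a.castSucc.castSucc L N :=
      hf (some (.inl a))
    linarith
  have hG : ∀ b : Fin (n + 1), b ≠ 0 →
      arcRatio p N O b.castSucc = arcRatio p' N O b.castSucc := fun b hb => by
    obtain ⟨b, rfl⟩ := Fin.exists_succ_eq.2 hb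
    have : 1 - arcRatio p N O b.succ.castSucc = 1 - arcRatio p' N O b.succ.castSucc :=
      hf (some (.inr b))
    linarith
  have hcF : ∀ a : Fin (n + 1), a ≠ Fin.last n → Cyc a.castSucc L N := fun a ha => by
    obtain ⟨a, rfl⟩ := Fin.exists_castSucc_eq.2 ha
    exact cyc_pred a
  -- the last point in the middle, after its predecessor
  have hmid0 : ∀ w : Fin (n + 1), Cyc L N w.castSucc →
      arcRatio p L N w.castSucc = arcRatio p' L N w.castSucc := by
    intro w hc
    by_cases hw : w = 0
    · rw [hw]; exact hh
    · have hn : L ≠ O := by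
        have := w.2
        rw [Fin.ext_iff, Fin.val_zero] at hw
        simp only [hL, hO, ne_eq, Fin.ext_iff, Fin.val_castSucc, Fin.val_last, Fin.val_zero]
        omega
      have hc2 : Cyc L O w.castSucc := by
        have := w.2
        rw [Fin.ext_iff, Fin.val_zero] at hw
        unfold Cyc
        simp only [hL, hO, Fin.lt_def, Fin.le_def, Fin.val_castSucc, Fin.val_last, Fin.val_zero]
        omega
      rw [(arcRatio_quadruple hp cyc_new hc2 hn).2.2.1,
        (arcRatio_quadruple hp' cyc_new hc2 hn).2.2.1]
      rw [hh, hb]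
  -- the last point in the middle, after any point
  have hmid : ∀ u w : Fin (n + 1), Cyc u.castSucc N w.castSucc →
      arcRatio p u.castSucc N w.castSucc = arcRatio p' u.castSucc N w.castSucc := by
    intro u w hc
    by_cases hu : u = Fin.last n
    · subst hu; exact hmid0 w hc
    · have hne : u.castSucc ≠ N := (Fin.castSucc_lt_last _).ne
      obtain ⟨h3, -, -⟩ := (hcF u hu).right hc hne
      have e := (arcRatio_quadruple hp (hcF u hu) hc hne).2.2.2
      have e' := (arcRatio_quadruple hp' (hcF u hu) hc hne).2.2.2
      rw [hmid0 w h3, hb u (Fin.last n) w] at e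
      linarith
  refine cyclicSorted_ext hp hp' O (congrArg (fun q : CircleCoord (n + 1) => q.1 0) h)
    fun u v w hc => ?_
  have hne1 := hc.ne_left
  have hne2 := hc.ne_right
  induction v using Fin.lastCases with
  | last =>
    induction u using Fin.lastCases with
    | last => exact absurd rfl hne1
    | cast u =>
      induction w using Fin.lastCases with
      | last => exact absurd rfl hne2
      | cast w => exact hmid u w hc
  | cast v =>
    induction u using Fin.lastCases with
    | last =>
      induction w using Fin.lastCases with
      | last =>
        rw [arcRatio_self_swap (cyclicSorted_subset hp) hne1,
          arcRatio_self_swap (cyclicSorted_subset hp') hne1, hmid v v (cyc_self hne1.symm)]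
      | cast w =>
        have hw : w ≠ 0 := by
          rintro rfl
          unfold Cyc at hc
          simp only [Fin.lt_def, Fin.le_def, Fin.val_castSucc, Fin.val_last, Fin.val_zero] at hc
          omega
        by_cases hv : v = 0
        · subst hv; exact hG w hw
        · obtain ⟨b, rfl⟩ := Fin.exists_succ_eq.2 hv
          have hne : N ≠ b.succ.castSucc := (Fin.castSucc_lt_last _).ne'
          have e := (arcRatio_quadruple hp (cyc_succ b) hc hne).2.2.2
          have e' := (arcRatio_quadruple hp' (cyc_succ b) hc hne).2.2.2
          rw [hG w hw, hb] at e
          linarith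
    | cast u =>
      induction w using Fin.lastCases with
      | cast w => exact hb u v w
      | last =>
        have hu : u ≠ Fin.last n := by
          rintro rfl
          have := v.2
          unfold Cyc at hc
          simp only [Fin.lt_def, Fin.le_def, Fin.val_castSucc, Fin.val_last] at hc
          omega
        by_cases hv : v = Fin.last n
        · subst hv; exact hF u hu
        · have hc1 : Cyc u.castSucc v.castSucc L := by
            have := v.2
            simp only [ne_eq, Fin.ext_iff, Fin.val_last] at hv hu
            unfold Cyc at *
            simp only [hL, Fin.lt_def, Fin.le_def, Fin.val_castSucc, Fin.val_last] at *
            omega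
          have hne : u.castSucc ≠ L := fun e => hu (Fin.castSucc_injective _ e)
          rw [(arcRatio_quadruple hp hc1 (hcF u hu) hne).2.2.1,
            (arcRatio_quadruple hp' hc1 (hcF u hu) hne).2.2.1, hF u hu, hb]

end CyclicStep

section CyclicModel

variable {n : ℕ}

lemma continuous_lastPos (i : Option (Fin n ⊕ Fin n)) :
    Continuous fun p : cyclicSorted (n + 2) => lastPos n i p.1 := by
  have key : ∀ {x y z : Fin (n + 2)}, Cyc x y z →
      Continuous fun p : cyclicSorted (n + 2) => arcRatio p.1 x y z := fun h =>
    (continuousOn_arcRatio h).comp_continuous continuous_subtype_val fun p => p.2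
  rcases i with _ | a | b
  · exact key cyc_new
  · exact continuous_const.sub (key (cyc_pred a))
  · exact continuous_const.sub (key (cyc_succ b))

lemma continuous_lastPosLower (i : Option (Fin n ⊕ Fin n)) :
    Continuous fun p : cyclicSorted (n + 1) => lastPosLower n i p.1 := by
  rcases i with _ | a | b
  · exact continuous_const
  · exact continuous_const
  · exact continuous_const.sub ((continuousOn_arcRatio (cyc_zero_succ b)).comp_continuous
      continuous_subtype_val fun p => p.2)

lemma continuous_lastPosUpper (i : Option (Fin n ⊕ Fin n)) :
    Continuous fun p : cyclicSorted (n + 1) => lastPosUpper n i p.1 := by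
  rcases i with _ | a | b
  · exact continuous_const
  · exact continuous_const.sub ((continuousOn_arcRatio (cyc_last_zero a)).comp_continuous
      continuous_subtype_val fun p => p.2)
  · exact continuous_const

lemma lastPos_bounds (i : Option (Fin n ⊕ Fin n)) {p : CircleCoord (n + 2)}
    (hp : p ∈ cyclicSorted (n + 2)) :
    lastPosLower n i (circlePull p Fin.castSucc) ≤ lastPos n i p ∧
      lastPos n i p ≤ lastPosUpper n i (circlePull p Fin.castSucc) := by
  have hp' := cyclicSorted_subset hp
  have hq := circlePull_mem hp' (Fin.castSucc_injective (n + 1))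
  have m := lastPos_mem i hp'
  have m0 := lastPos_mem none hp'
  have u := lastPosUpper_mem i hq
  have l := lastPosLower_mem i hq
  rcases i with _ | a | b
  · exact m
  · refine ⟨m.1, ?_⟩
    have e := lastPos_left hp a
    have h1 := mul_le_mul_of_nonneg_right m0.2 u.1
    have h2 := mul_le_mul_of_nonneg_left h1 (sub_nonneg.2 m.2)
    nlinarith
  · refine ⟨?_, m.2⟩
    have e := lastPos_right hp b
    have h1 := mul_le_mul_of_nonneg_right (sub_le_self 1 m0.1) (sub_nonneg.2 l.2)
    have h2 := mul_le_mul_of_nonneg_left h1 m.1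
    nlinarith

lemma gap_last_snoc (θ : Fin (n + 1) → ℝ) (s : ℝ) (a : Fin (n + 1)) :
    gap (Fin.snoc θ s : Fin (n + 2) → ℝ) a.castSucc (Fin.last (n + 1)) = s - θ a ∧
    gap (Fin.snoc θ s : Fin (n + 2) → ℝ) (Fin.last (n + 1)) a.castSucc =
      θ a - s + 2 * Real.pi := by
  unfold gap
  rw [if_pos (Fin.castSucc_lt_last a), if_neg (Fin.castSucc_lt_last a).not_gt]
  simp

/-- The position of the first point of a configuration on the circle. -/
def firstPoint (n : ℕ) : C(cyclicSorted (n + 1), Circle) where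
  toFun p := p.1.1 0
  continuous_toFun := by fun_prop

/-- The component of the cyclohedron with the natural cyclic order retracts by deformation onto a
circle: forgetting the last point is a fibration with intervals as fibres, as long as there is a
point left. -/
theorem exists_section_cyclicSorted (n : ℕ) : ∃ s : C(Circle, cyclicSorted (n + 1)),
    (s.comp (firstPoint n)).Homotopic (ContinuousMap.id _) := by
  induction n with
  | zero =>
    have hmem : ∀ w : Circle, ((fun _ => w, fun _ _ => 0, fun _ _ _ => 0) : CircleCoord 1) ∈
        cyclicSorted (0 + 1) := by
      intro w
      have hθ : IsTurn (fun _ : Fin 1 => (0 : ℝ)) :=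
        ⟨Subsingleton.strictMono _, fun _ _ => by simp [Real.pi_pos]⟩
      convert spiral_mem (w := w) hθ using 1
      refine Prod.ext ?_ (Prod.ext ?_ ?_)
      · ext a; simp [circleCoord, spiral]
      · ext a b; simp [circleCoord, pairCoord, spiral]
      · ext a b c; simp [circleCoord, tripleCoord, spiral]
    refine ⟨⟨fun w => ⟨_, hmem w⟩, by fun_prop⟩, ?_⟩
    convert ContinuousMap.Homotopic.refl _
    ext1 p
    exact Subtype.ext (cyclicSorted_ext p.2 (hmem _) 0 rfl fun x y z hc =>
      absurd (Subsingleton.elim (α := Fin 1) x y) hc.ne_left)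
  | succ n ih =>
    have : CompactSpace (cyclicSorted (n + 1 + 1)) :=
      isCompact_iff_compactSpace.1 (isCompact_cyclicSorted _)
    have hfst : firstPoint (n + 1) = (firstPoint n).comp (circleForget (n + 1)) := rfl
    rw [hfst]
    refine exists_section_of_monotone (ι := Option (Fin n ⊕ Fin n)) (circleForget (n + 1))
      (fun i p => lastPos n i p.1) continuous_lastPos (fun i p => lastPosLower n i p.1)
      (fun i p => lastPosUpper n i p.1) continuous_lastPosLower continuous_lastPosUpper
      (fun i p => (lastPos_bounds i p.2).1) (fun i p => (lastPos_bounds i p.2).2)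
      (fun _ => ⟨none, zero_lt_one' ℝ⟩) (fun i p => ?_)
      (fun p p' h i j => lastPos_mono p.2 p'.2 (congrArg Subtype.val h) i j)
      (fun p p' h hf => Subtype.ext (lastPos_ext p.2 p'.2 (congrArg Subtype.val h) hf))
      dense_cyclicSorted ?_ (firstPoint n) ih
    · have u := lastPosUpper_mem i (cyclicSorted_subset p.2)
      have l := lastPosLower_mem i (cyclicSorted_subset p.2)
      rcases i with _ | a | b
      · exact zero_le_one
      · exact u.1
      · exact l.2
    · rintro ⟨_, _⟩ ⟨w, θ, hθ, rfl⟩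
      have hτ := gap_pos hθ (Fin.last n) 0
      have eτ : gap θ (Fin.last n) 0 = θ 0 - θ (Fin.last n) + 2 * Real.pi :=
        if_neg (Fin.zero_le _).not_gt
      set τ := gap θ (Fin.last n) 0
      -- the new point divides the arc from the last point to the first one in the ratio `t : 1 - t`
      have hs : ∀ t ∈ Ioo (0 : ℝ) 1,
          IsTurn (Fin.snoc θ (θ (Fin.last n) + t * τ) : Fin (n + 1 + 1) → ℝ) := fun t ht =>
        isTurn_snoc hθ (lt_add_of_pos_right _ (mul_pos ht.1 hτ)) (by nlinarith [ht.2])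
      refine ⟨fun t => if ht : t ∈ Ioo (0 : ℝ) 1 then ⟨_, spiral_mem (w := w) (hs t ht)⟩ else
        ⟨_, spiral_mem (w := w) (hs (1 / 2) ⟨by norm_num, by norm_num⟩)⟩, fun i t => match i with
          | none => t
          | some (.inl a) => 1 - gap θ a.castSucc (Fin.last n) /
              (gap θ a.castSucc (Fin.last n) + t * τ)
          | some (.inr b) => 1 - ((1 - t) * τ) / ((1 - t) * τ + gap θ 0 b.succ),
        fun t ht => ?_, fun i => ?_⟩
      · simp only [dif_pos ht]
        constructor
        · refine Subtype.ext ?_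
          change circleCoord (spiral w ((Fin.snoc θ _ : Fin (n + 1 + 1) → ℝ) ∘ Fin.castSucc)) = _
          congr 2
          ext a
          simp
        · have e0 := fun a => (gap_last_snoc θ (θ (Fin.last n) + t * τ) a).1
          have e1 := fun a => (gap_last_snoc θ (θ (Fin.last n) + t * τ) a).2
          rintro (_ | a | b)
          · simp only [lastPos]
            rw [arcRatio_spiral (hs t ht) cyc_new, e0, gap_snoc]
            change _ / τ = _
            field_simp
            ring
          · simp only [lastPos]
            rw [arcRatio_spiral (hs t ht) (cyc_pred a), gap_snoc, ← gap_add _ (cyc_pred a),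
              gap_snoc, e0]
            congr 2
            ring
          · simp only [lastPos]
            rw [arcRatio_spiral (hs t ht) (cyc_succ b), ← gap_add _ (cyc_succ b), gap_snoc, e1]
            have : θ 0 - (θ (Fin.last n) + t * τ) + 2 * Real.pi = (1 - t) * τ := by
              rw [eτ]; ring
            rw [this]
      · rcases i with _ | a | b
        · exact ⟨continuousOn_id, rfl, rfl⟩
        · have hA := gap_pos hθ a.castSucc (Fin.last n)
          refine ⟨ContinuousOn.sub continuousOn_const
            (ContinuousOn.div (by fun_prop) (by fun_prop) fun t ht => ?_), ?_, ?_⟩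
          · have := mul_nonneg ht.1 hτ.le
            positivity
          · simp [lastPosLower, hA.ne']
          · simp only [lastPosUpper]
            rw [arcRatio_spiral hθ (cyc_last_zero a), ← gap_add _ (cyc_last_zero a), one_mul]
        · have hB := gap_pos hθ 0 b.succ
          refine ⟨ContinuousOn.sub continuousOn_const
            (ContinuousOn.div (by fun_prop) (by fun_prop) fun t ht => ?_), ?_, ?_⟩
          · have := mul_nonneg (sub_nonneg.2 ht.2) hτ.le
            positivity
          · simp only [lastPosLower]
            rw [arcRatio_spiral hθ (cyc_zero_succ b), ← gap_add _ (cyc_zero_succ b), sub_zero,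
              one_mul]
          · simp [lastPosUpper]

/-- A function which is continuous for each value of a locally constant parameter. -/
lemma continuous_of_isLocallyConstant {X Z S : Type*} [TopologicalSpace X] [TopologicalSpace Z]
    {T : X → S} (hT : IsLocallyConstant T) {F : S → X → Z} (hF : ∀ i, Continuous (F i)) :
    Continuous fun x => F (T x) x := by
  rw [continuous_iff_continuousAt]
  intro x
  refine (hF (T x)).continuousAt.congr ?_
  filter_upwards [(IsLocallyConstant.iff_eventually_eq T).1 hT x] with y hy
  rw [hy]

/-- The cyclic order of the points of a configuration: whether, starting from the base point `0`
and moving anticlockwise, one reaches the first one of two other points before the second one. -/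
def circlePattern (p : CircleCoord (n + 1)) (a b : Fin (n + 1)) : Prop :=
  0 ≠ a ∧ a ≠ b ∧ 0 ≠ b ∧ ang p 0 a + ang p a b = ang p 0 b

lemma circlePattern_iff {p : CircleCoord (n + 1)} (hp : p ∈ cycloSet (n + 1)) {a b : Fin (n + 1)}
    (ha : 0 ≠ a) (hab : a ≠ b) (hb : 0 ≠ b) :
    circlePattern p a b ↔ ang p 0 a + ang p a b < ang p 0 b + Real.pi := by
  have hpi := Real.pi_pos
  constructor
  · rintro ⟨-, -, -, h⟩
    linarith
  · intro h
    exact ⟨ha, hab, hb, (ang_cocycle hp ha hab hb).resolve_right (by linarith)⟩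

lemma not_circlePattern_iff {p : CircleCoord (n + 1)} (hp : p ∈ cycloSet (n + 1))
    {a b : Fin (n + 1)} (ha : 0 ≠ a) (hab : a ≠ b) (hb : 0 ≠ b) :
    ¬ circlePattern p a b ↔ ang p 0 b + Real.pi < ang p 0 a + ang p a b := by
  have hpi := Real.pi_pos
  rw [circlePattern_iff hp ha hab hb]
  rcases ang_cocycle hp ha hab hb with h | h <;> rw [h] <;> constructor <;> intro h' <;> linarith

lemma circlePattern_total {p : CircleCoord (n + 1)} (hp : p ∈ cycloSet (n + 1))
    {a b : Fin (n + 1)} (ha : 0 ≠ a) (hab : a ≠ b) (hb : 0 ≠ b) :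
    circlePattern p a b ∨ circlePattern p b a := by
  have h2 := ang_add_ang hp hab
  rcases ang_cocycle hp ha hab hb with h | h
  · exact Or.inl ⟨ha, hab, hb, h⟩
  · exact Or.inr ⟨hb, hab.symm, ha, by linarith⟩

lemma isLocallyConstant_circlePattern :
    IsLocallyConstant fun p : cycloSet (n + 1) => circlePattern p.1 := by
  rw [IsLocallyConstant.iff_eventually_eq]
  intro p
  have : ∀ᶠ q : cycloSet (n + 1) in 𝓝 p, ∀ a b, circlePattern q.1 a b ↔ circlePattern p.1 a b := by
    refine eventually_all.2 fun a => eventually_all.2 fun b => ?_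
    by_cases hd : 0 ≠ a ∧ a ≠ b ∧ 0 ≠ b
    · obtain ⟨ha, hab, hb⟩ := hd
      have c1 : Continuous fun q : cycloSet (n + 1) => ang q.1 0 a + ang q.1 a b :=
        ((continuous_ang 0 a).add (continuous_ang a b)).comp continuous_subtype_val
      have c2 : Continuous fun q : cycloSet (n + 1) => ang q.1 0 b + Real.pi :=
        ((continuous_ang 0 b).add continuous_const).comp continuous_subtype_val
      by_cases h : circlePattern p.1 a b
      · filter_upwards [c1.continuousAt.eventually_lt c2.continuousAt
          ((circlePattern_iff p.2 ha hab hb).1 h)] with q hq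
        exact iff_of_true ((circlePattern_iff q.2 ha hab hb).2 hq) h
      · filter_upwards [c2.continuousAt.eventually_lt c1.continuousAt
          ((not_circlePattern_iff p.2 ha hab hb).1 h)] with q hq
        exact iff_of_false ((not_circlePattern_iff q.2 ha hab hb).2 hq) h
    · exact Eventually.of_forall fun q => iff_of_false
        (fun h => hd ⟨h.1, h.2.1, h.2.2.1⟩) fun h => hd ⟨h.1, h.2.1, h.2.2.1⟩
  filter_upwards [this] with q hq
  exact funext fun a => funext fun b => propext (hq a b)

/-- The angles of the points of a configuration, starting from the base point `0`. -/
def angleFrom (z : Fin (n + 1) → Circle) (a : Fin (n + 1)) : ℝ := Circle.angleDiff (z 0) (z a)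

lemma spiral_angleFrom (z : Fin (n + 1) → Circle) : spiral (z 0) (angleFrom z) = z := by
  ext1 a
  rw [spiral, angleFrom, mul_comm, Circle.exp_angleDiff_mul]

lemma angleFrom_injective {z : Fin (n + 1) → Circle} (hz : Function.Injective z) :
    Function.Injective (angleFrom z) := fun a b hab => hz <| by
  rw [← spiral_angleFrom z, spiral, spiral, hab]

lemma angleFrom_zero (z : Fin (n + 1) → Circle) : angleFrom z 0 = 0 := by
  by_contra h
  have h0 := Circle.angleDiff_nonneg (z 0) (z 0)
  have h1 := Circle.angleDiff_lt_two_pi (z 0) (z 0)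
  refine h (Circle.exp_injOn_Ico (a := 0) (b := 2 * Real.pi) (by linarith) ⟨h0, h1⟩
    ⟨le_rfl, by linarith⟩ ?_)
  have := congrFun (spiral_angleFrom z) 0
  rw [spiral] at this
  rw [Circle.exp_zero]
  exact mul_eq_left.1 this

lemma angleFrom_nonneg (z : Fin (n + 1) → Circle) (a : Fin (n + 1)) : 0 ≤ angleFrom z a :=
  Circle.angleDiff_nonneg _ _

lemma angleFrom_lt (z : Fin (n + 1) → Circle) (a : Fin (n + 1)) : angleFrom z a < 2 * Real.pi :=
  Circle.angleDiff_lt_two_pi _ _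

lemma circlePattern_circleCoord {z : Fin (n + 1) → Circle} (hz : Function.Injective z)
    {a b : Fin (n + 1)} (ha : 0 ≠ a) (hab : a ≠ b) (hb : 0 ≠ b) :
    circlePattern (circleCoord z) a b ↔ angleFrom z a < angleFrom z b := by
  have hm : circleCoord z ∈ cycloSet (n + 1) := subset_closure ⟨z, hz, rfl⟩
  have h1 := ang_circleCoord_pos (hz.ne hab)
  have key : ∀ {a b}, circlePattern (circleCoord z) a b → angleFrom z a < angleFrom z b := by
    rintro a b ⟨h0, h1, h2, h3⟩
    have h4 := ang_circleCoord_pos (hz.ne h1)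
    rw [ang_circleCoord (hz.ne h0), ang_circleCoord (hz.ne h2)] at h3
    unfold angleFrom
    linarith
  refine ⟨key, fun h => (circlePattern_total hm ha hab hb).resolve_right fun h' => ?_⟩
  exact absurd (key h') h.not_gt

/-- Relabelling all configurations with a given cyclic order of the points into the natural
order, with the same base point. -/
lemma exists_perm_cyclicSorted {p : CircleCoord (n + 1)} (hp : p ∈ cycloSet (n + 1)) :
    ∃ σ : Equiv.Perm (Fin (n + 1)), σ 0 = 0 ∧ ∀ q ∈ cycloSet (n + 1),
      circlePattern q = circlePattern p → circlePull q σ ∈ cyclicSorted (n + 1) := by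
  -- the configurations with the given cyclic order form an open set, in which configurations of
  -- distinct points are dense
  set U : Set (CircleCoord (n + 1)) := {q | ∀ a b, circlePattern p a b →
    ang q 0 a + ang q a b < ang q 0 b + Real.pi} with hU
  have hUo : IsOpen U := by
    simp only [hU, ofPred_forall]
    exact isOpen_iInter_of_finite fun a => isOpen_iInter_of_finite fun b =>
      isOpen_iInter_of_finite fun _ => isOpen_lt ((continuous_ang 0 a).add (continuous_ang a b))
        ((continuous_ang 0 b).add continuous_const)
  have hUm : ∀ q ∈ cycloSet (n + 1), circlePattern q = circlePattern p → q ∈ U :=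
    fun q hq h a b hab => (circlePattern_iff hq hab.1 hab.2.1 hab.2.2.1).1 (by rwa [h])
  have hlt : ∀ z : Fin (n + 1) → Circle, Function.Injective z → circleCoord z ∈ U →
      ∀ a b, circlePattern p a b → angleFrom z a < angleFrom z b := by
    intro z hz hzU a b hab
    have hm : circleCoord z ∈ cycloSet (n + 1) := subset_closure ⟨z, hz, rfl⟩
    exact (circlePattern_circleCoord hz hab.1 hab.2.1 hab.2.2.1).1
      ((circlePattern_iff hm hab.1 hab.2.1 hab.2.2.1).2 (hzU a b hab))
  obtain ⟨_, hxU, x, hx, rfl⟩ := mem_closure_iff.1 hp U hUo (hUm p hp rfl)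
  have hx : Function.Injective x := hx
  -- sorting by the angle from the base point, which comes first
  have hsort : StrictMono (angleFrom x ∘ Tuple.sort (angleFrom x)) :=
    (Tuple.monotone_sort _).strictMono_of_injective
      ((angleFrom_injective hx).comp (Tuple.sort (angleFrom x)).injective)
  have hzero : Tuple.sort (angleFrom x) 0 = 0 := by
    refine angleFrom_injective hx (le_antisymm ?_ ?_)
    · have := hsort.monotone (Fin.zero_le ((Tuple.sort (angleFrom x)).symm 0))
      simpa using this
    · rw [angleFrom_zero]; exact angleFrom_nonneg _ _
  refine ⟨Tuple.sort (angleFrom x), hzero, fun q hq h => ?_⟩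
  generalize hσ : Tuple.sort (angleFrom x) = σ at *
  have hqc : q ∈ closure (U ∩ circleCoord '' {z : Fin (n + 1) → Circle | Function.Injective z}) :=
    hUo.inter_closure ⟨hUm q hq h, hq⟩
  refine map_mem_closure (f := fun p => circlePull p σ) (continuous_circlePull _) hqc ?_
  rintro _ ⟨hyU, y, hy, rfl⟩
  have hy : Function.Injective y := hy
  refine ⟨y 0, angleFrom y ∘ σ, ⟨fun a b hab => ?_, fun a b => ?_⟩, ?_⟩
  · have h1 : angleFrom x (σ a) < angleFrom x (σ b) := hsort hab
    have hb : 0 ≠ σ b := fun e => by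
      rw [← e, angleFrom_zero] at h1
      exact absurd h1 (angleFrom_nonneg x _).not_gt
    change angleFrom y (σ a) < angleFrom y (σ b)
    by_cases ha : 0 = σ a
    · rw [← ha]
      refine lt_of_le_of_ne ?_ ((angleFrom_injective hy).ne hb)
      rw [angleFrom_zero]
      exact angleFrom_nonneg _ _
    · have hne : σ a ≠ σ b := σ.injective.ne hab.ne
      refine hlt y hy hyU _ _ ?_
      refine (circlePattern_total hp ha hne hb).resolve_right fun h' => ?_
      exact absurd (hlt x hx hxU _ _ h') h1.not_gt
  · have h1 := angleFrom_lt y (σ a)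
    have h2 := angleFrom_nonneg y (σ b)
    simp only [Function.comp_apply]
    linarith
  · change circlePull (circleCoord y) σ = _
    rw [← circlePull_spiral, spiral_angleFrom]

/-- The homotopy type of the cyclohedron with at least one label: it retracts by deformation onto
finitely many circles, one for each cyclic order of the labels. -/
theorem exists_circle_model (n : ℕ) :
    ∃ (E : (Fin (n + 1) → Fin (n + 1) → Prop) → C(Circle, cycloSet (n + 1)))
      (e : C(cycloSet (n + 1), cycloSet (n + 1))),
      (∀ q, e q = E (circlePattern q.1) (q.1.1 0)) ∧ e.Homotopic (ContinuousMap.id _) := by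
  obtain ⟨s, ⟨H⟩⟩ := exists_section_cyclicSorted n
  have hσ : ∀ π : Fin (n + 1) → Fin (n + 1) → Prop, ∃ σ : Equiv.Perm (Fin (n + 1)), σ 0 = 0 ∧
      ∀ q ∈ cycloSet (n + 1), circlePattern q = π → circlePull q σ ∈ cyclicSorted (n + 1) := by
    intro π
    by_cases h : ∃ p ∈ cycloSet (n + 1), circlePattern p = π
    · obtain ⟨p, hp, rfl⟩ := h; exact exists_perm_cyclicSorted hp
    · exact ⟨1, rfl, fun q hq hqπ => absurd ⟨q, hq, hqπ⟩ h⟩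
  choose σ hσ0 hσ using hσ
  have hmem : ∀ (q : cyclicSorted (n + 1)) (τ : Equiv.Perm (Fin (n + 1))),
      circlePull q.1 τ ∈ cycloSet (n + 1) := fun q τ =>
    circlePull_mem (cyclicSorted_subset q.2) τ.injective
  have hc : ∀ τ : Equiv.Perm (Fin (n + 1)), Continuous fun q : cyclicSorted (n + 1) =>
      (⟨circlePull q.1 τ, hmem q τ⟩ : cycloSet (n + 1)) := fun τ =>
    ((continuous_circlePull _).comp continuous_subtype_val).subtype_mk _
  set E : (Fin (n + 1) → Fin (n + 1) → Prop) → C(Circle, cycloSet (n + 1)) := fun π =>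
    ⟨fun w => ⟨circlePull (s w).1 (σ π).symm, hmem _ _⟩, (hc _).comp s.continuous⟩ with hE
  have hec : Continuous fun q : cycloSet (n + 1) => E (circlePattern q.1) (q.1.1 0) :=
    continuous_of_isLocallyConstant (F := fun π (q : cycloSet (n + 1)) => E π (q.1.1 0))
      isLocallyConstant_circlePattern fun π => (E π).continuous.comp (by fun_prop)
  refine ⟨E, ⟨_, hec⟩, fun q => rfl,
    homotopic_of_isLocallyConstant isLocallyConstant_circlePattern _ _ fun π => ?_⟩
  refine ⟨fun x => ⟨circlePull (H (x.1, ⟨circlePull x.2.1.1 (σ π), hσ π _ x.2.1.2 x.2.2⟩)).1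
    (σ π).symm, hmem _ _⟩, ?_, ?_, ?_⟩
  · refine (hc _).comp (H.continuous.comp (continuous_fst.prodMk ?_))
    exact ((continuous_circlePull _).comp (by fun_prop)).subtype_mk _
  · rintro ⟨q, rfl⟩
    refine Subtype.ext ?_
    dsimp only
    rw [H.apply_zero]
    change circlePull (s (q.1.1 (σ _ 0))).1 _ = circlePull (s (q.1.1 0)).1 _
    rw [hσ0]
  · rintro ⟨q, rfl⟩
    refine Subtype.ext ?_
    simp [circlePull]

end CyclicModel

/-! ### Little intervals with given endpoints -/

section Values

variable {n : ℕ}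

/-- The linear map from the unit interval onto the interval from `x.1` to `x.1 + x.2` (truncated, in
case that the latter is not contained in the unit interval). -/
def intervalMap (x : ℝ × ℝ) : C(unitInterval, unitInterval) :=
  ⟨fun t => projIcc 0 1 zero_le_one (x.1 + x.2 * t), continuous_projIcc.comp (by fun_prop)⟩

/-- The linear map from the unit interval onto the arc of length `x.2` with the initial point at
the angle `x.1` from the point `z`. -/
def arcMap (z : Circle) (x : ℝ × ℝ) : C(unitInterval, Circle) :=
  ⟨fun t => z * Circle.exp (x.1 + x.2 * t), by fun_prop⟩

lemma continuous_intervalMap : Continuous intervalMap :=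
  ContinuousMap.continuous_of_continuous_uncurry _
    ((continuous_projIcc (h := zero_le_one)).comp
      (show Continuous fun p : (ℝ × ℝ) × unitInterval => p.1.1 + p.1.2 * (p.2 : ℝ) by fun_prop))

lemma continuous_arcMap : Continuous fun p : Circle × ℝ × ℝ => arcMap p.1 p.2 :=
  ContinuousMap.continuous_of_continuous_uncurry _ (by
    change Continuous fun q : (Circle × ℝ × ℝ) × unitInterval =>
      q.1.1 * Circle.exp (q.1.2.1 + q.1.2.2 * (q.2 : ℝ))
    fun_prop)

/-- The values describe an interval contained in the unit interval. -/
def IsUnitValue (x : ℝ × ℝ) : Prop := 0 < x.2 ∧ 0 ≤ x.1 ∧ x.1 + x.2 ≤ 1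

lemma IsUnitValue.mem {x : ℝ × ℝ} (h : IsUnitValue x) (t : unitInterval) :
    x.1 + x.2 * t ∈ Icc (0 : ℝ) 1 := by
  obtain ⟨h1, h2, h3⟩ := h
  have := mul_nonneg h1.le t.2.1
  have := mul_le_mul_of_nonneg_left t.2.2 h1.le
  exact ⟨by linarith, by linarith⟩

lemma coe_intervalMap {x : ℝ × ℝ} (h : IsUnitValue x) (t : unitInterval) :
    (intervalMap x t : ℝ) = x.1 + x.2 * t := by
  change ((projIcc 0 1 zero_le_one _ : Icc (0 : ℝ) 1) : ℝ) = _
  rw [projIcc_of_mem _ (h.mem t)]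

lemma isLinearInterval_intervalMap {x : ℝ × ℝ} (h : IsUnitValue x) :
    IsLinearInterval (intervalMap x) := ⟨x.1, x.2, h.1, coe_intervalMap h⟩

lemma IsUnitValue.vmul {x y : ℝ × ℝ} (hx : IsUnitValue x) (hy : IsUnitValue y) :
    IsUnitValue (vmul x y) := by
  obtain ⟨h1, h2, h3⟩ := hx
  obtain ⟨k1, k2, k3⟩ := hy
  have e1 := mul_nonneg h1.le k2
  have e2 := mul_le_mul_of_nonneg_left k3 h1.le
  refine ⟨mul_pos h1 k1, add_nonneg h2 e1, ?_⟩
  simp only [CycloLoop.vmul]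
  linarith

lemma intervalMap_vmul {x y : ℝ × ℝ} (hx : IsUnitValue x) (hy : IsUnitValue y) :
    intervalMap (vmul x y) = (intervalMap x).comp (intervalMap y) := by
  ext t
  rw [coe_intervalMap (hx.vmul hy), ContinuousMap.comp_apply, coe_intervalMap hx,
    coe_intervalMap hy]
  simp only [vmul]
  ring

lemma arcMap_vmul (z : Circle) (x : ℝ × ℝ) {y : ℝ × ℝ} (hy : IsUnitValue y) :
    arcMap z (vmul x y) = (arcMap z x).comp (intervalMap y) := by
  ext1 t
  change z * _ = z * Circle.exp (x.1 + x.2 * (intervalMap y t : ℝ))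
  rw [coe_intervalMap hy]
  congr 2
  simp only [vmul]
  ring

lemma intervalMap_unit : intervalMap (0, 1) = ContinuousMap.id _ := by
  ext t
  rw [coe_intervalMap ⟨one_pos, le_rfl, by norm_num⟩]
  simp

/-- The values that describe a map of the unit interval into itself. -/
def valueOf (f : C(unitInterval, unitInterval)) : ℝ × ℝ := (f 0, f 1 - f 0)

lemma continuous_valueOf : Continuous valueOf := by unfold valueOf; fun_prop

lemma IsLinearInterval.apply {f : C(unitInterval, unitInterval)} (hf : IsLinearInterval f)
    (t : unitInterval) : (f t : ℝ) = (valueOf f).1 + (valueOf f).2 * t := by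
  obtain ⟨a, s, hs, h⟩ := hf
  simp only [valueOf, h, Icc.coe_zero, Icc.coe_one]
  ring

lemma IsLinearInterval.isUnitValue {f : C(unitInterval, unitInterval)} (hf : IsLinearInterval f) :
    IsUnitValue (valueOf f) := by
  obtain ⟨a, s, hs, h⟩ := hf
  refine ⟨?_, (f 0).2.1, ?_⟩
  · simp only [valueOf, h, Icc.coe_zero, Icc.coe_one]; linarith
  · simpa [valueOf] using (f 1).2.2

lemma intervalMap_valueOf {f : C(unitInterval, unitInterval)} (hf : IsLinearInterval f) :
    intervalMap (valueOf f) = f := by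
  ext t
  rw [coe_intervalMap hf.isUnitValue, hf.apply]

lemma valueOf_comp {f g : C(unitInterval, unitInterval)} (hf : IsLinearInterval f) :
    valueOf (f.comp g) = vmul (valueOf f) (valueOf g) := by
  refine Prod.ext ?_ ?_
  · change ((f (g 0) : unitInterval) : ℝ) = _ + _ * ((g 0 : unitInterval) : ℝ)
    exact hf.apply _
  · change ((f (g 1) : unitInterval) : ℝ) - f (g 0) =
      (valueOf f).2 * (((g 1 : unitInterval) : ℝ) - g 0)
    rw [hf.apply, hf.apply]
    ring

lemma valueOf_id : valueOf (ContinuousMap.id _) = (0, 1) := by simp [valueOf]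

/-- One interval lies on the left of another one. -/
def Before (f g : C(unitInterval, unitInterval)) : Prop := f 1 ≤ g 0

lemma IsLinearInterval.monotone {f : C(unitInterval, unitInterval)} (hf : IsLinearInterval f) :
    Monotone f := by
  obtain ⟨a, s, hs, h⟩ := hf
  intro t t' htt
  have : (t : ℝ) ≤ t' := htt
  change (f t : ℝ) ≤ f t'
  rw [h, h]
  nlinarith

lemma Before.not {f g : C(unitInterval, unitInterval)} (hfg : Before f g)
    (hf : IsLinearInterval f) (hg : IsLinearInterval g) : ¬ Before g f := by
  intro hgf
  have h1 : (f 1 : ℝ) ≤ g 0 := hfg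
  have h2 : (g 1 : ℝ) ≤ f 0 := hgf
  have h3 := hf.isUnitValue.1
  have h4 := hg.isUnitValue.1
  simp only [valueOf] at h3 h4
  linarith

lemma exists_unitInterval {f : C(unitInterval, unitInterval)} (hf : IsLinearInterval f) {x : ℝ}
    (h0 : f 0 < x) (h1 : x < f 1) : ∃ t ∈ Ioo (0 : unitInterval) 1, (f t : ℝ) = x := by
  have hs := hf.isUnitValue.1
  simp only [valueOf] at hs
  have h2 : 0 < (x - f 0) / (f 1 - f 0) := div_pos (by linarith) hs
  have h3 : (x - f 0) / (f 1 - f 0) < 1 := (div_lt_one hs).2 (by linarith)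
  refine ⟨⟨_, h2.le, h3.le⟩, ⟨h2, h3⟩, ?_⟩
  rw [hf.apply]
  simp only [valueOf]
  field_simp
  ring

lemma before_or {c : Fin n → C(unitInterval, unitInterval)} (hc : c ∈ intervalSet n) {a b : Fin n}
    (hab : a ≠ b) : Before (c a) (c b) ∨ Before (c b) (c a) := by
  by_contra hn
  push Not at hn
  obtain ⟨h1, h2⟩ := hn
  have h1 : ((c b 0 : unitInterval) : ℝ) < c a 1 := not_le.1 h1
  have h2 : ((c a 0 : unitInterval) : ℝ) < c b 1 := not_le.1 h2
  have h3 := (hc.1 a).isUnitValue.1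
  have h4 := (hc.1 b).isUnitValue.1
  simp only [valueOf] at h3 h4
  -- if neither interval is on the left of the other one, the interiors have a common point
  obtain ⟨x, hx1, hx2⟩ := exists_between
    (max_lt (lt_min (sub_pos.1 h3) h2) (lt_min h1 (sub_pos.1 h4)))
  rw [max_lt_iff] at hx1
  rw [lt_min_iff] at hx2
  obtain ⟨t, ht, e1⟩ := exists_unitInterval (hc.1 a) hx1.1 hx2.1
  obtain ⟨t', ht', e2⟩ := exists_unitInterval (hc.1 b) hx1.2 hx2.2
  exact Set.disjoint_left.1 (hc.2 a b hab) ⟨t, ht, rfl⟩ ⟨t', ht', Subtype.ext (e2.trans e1.symm)⟩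

/-- Intervals with the given values are little intervals, in the order of the configuration. -/
def LineValid (q : LineCoord n) (v : Fin n → ℝ × ℝ) : Prop :=
  (∀ a, IsUnitValue (v a)) ∧ ∀ a b, a ≠ b → (v a).1 + (v a).2 ≤ 1 - q.1 a b + (v b).1

lemma lineValid_iff (q : LineCoord n) (v : Fin n → ℝ × ℝ) :
    LineValid q v ↔ lineSystem.Valid q v := by
  constructor
  · rintro ⟨h1, h2⟩
    refine ⟨fun a => (h1 a).1, fun a c => ?_, h2⟩
    have := h1 a
    fin_cases c
    · change 0 ≤ (0 : ℝ) + 1 * _ + 0 * _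
      linarith [this.2.1]
    · change 0 ≤ (1 : ℝ) + -1 * _ + -1 * _
      linarith [this.2.2]
  · rintro ⟨h1, h2, h3⟩
    refine ⟨fun a => ⟨h1 a, ?_, ?_⟩, h3⟩
    · have : 0 ≤ (0 : ℝ) + 1 * _ + 0 * _ := h2 a 0
      linarith
    · have : 0 ≤ (1 : ℝ) + -1 * _ + -1 * _ := h2 a 1
      linarith

lemma LineValid.before {q : LineCoord n} {v : Fin n → ℝ × ℝ} (h : LineValid q v) {a b : Fin n}
    (hab : a ≠ b) (hq : q.1 a b = 1) : Before (intervalMap (v a)) (intervalMap (v b)) := by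
  change (intervalMap (v a) 1 : ℝ) ≤ intervalMap (v b) 0
  rw [coe_intervalMap (h.1 a), coe_intervalMap (h.1 b), Icc.coe_one, Icc.coe_zero]
  have := h.2 a b hab
  rw [hq] at this
  linarith

lemma Before.disjoint {f g : C(unitInterval, unitInterval)} (h : Before f g)
    (hf : IsLinearInterval f) (hg : IsLinearInterval g) :
    Disjoint (f '' Ioo 0 1) (g '' Ioo 0 1) := by
  rw [Set.disjoint_left]
  rintro _ ⟨t, ht, rfl⟩ ⟨t', ht', e⟩
  have h1 : (f 1 : ℝ) ≤ g 0 := h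
  have h2 := hf.isUnitValue.1
  have h3 := hg.isUnitValue.1
  have e : (g t' : ℝ) = f t := congrArg Subtype.val e
  rw [hf.apply, hg.apply] at e
  have ht1 : (t : ℝ) < 1 := ht.2
  have ht2 : (0 : ℝ) < t' := ht'.1
  have := mul_lt_mul_of_pos_left ht1 h2
  have := mul_pos h3 ht2
  simp only [valueOf] at *
  linarith

lemma LineValid.mem {q : LineCoord n} (hq : q ∈ assocSet n) {v : Fin n → ℝ × ℝ}
    (h : LineValid q v) : (fun a => intervalMap (v a)) ∈ intervalSet n := by
  refine ⟨fun a => isLinearInterval_intervalMap (h.1 a), fun a b hab => ?_⟩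
  have ha := isLinearInterval_intervalMap (h.1 a)
  have hb := isLinearInterval_intervalMap (h.1 b)
  rcases assoc_pair hq hab with h' | h'
  · exact (h.before hab h'.1).disjoint ha hb
  · exact ((h.before hab.symm h'.2).disjoint hb ha).symm

lemma LineValid.combine {q : LineCoord n} {v w : Fin n → ℝ × ℝ} (hv : LineValid q v)
    (hw : LineValid q w) (t : unitInterval) :
    LineValid q fun a => ((1 - (t : ℝ)) * (v a).1 + t * (w a).1,
      (1 - (t : ℝ)) * (v a).2 + t * (w a).2) := by
  have h0 := t.2.1
  have h1 := sub_nonneg.2 t.2.2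
  refine ⟨fun a => ⟨?_, ?_, ?_⟩, fun a b hab => ?_⟩
  · rcases h0.eq_or_lt with h | h
    · simp only [← h]; linarith [(hv.1 a).1]
    · have := mul_pos h (hw.1 a).1
      have := mul_nonneg h1 (hv.1 a).1.le
      simp only; linarith
  · exact add_nonneg (mul_nonneg h1 (hv.1 a).2.1) (mul_nonneg h0 (hw.1 a).2.1)
  · have := mul_le_mul_of_nonneg_left (hv.1 a).2.2 h1
    have := mul_le_mul_of_nonneg_left (hw.1 a).2.2 h0
    simp only; linarith
  · have := mul_le_mul_of_nonneg_left (hv.2 a b hab) h1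
    have := mul_le_mul_of_nonneg_left (hw.2 a b hab) h0
    simp only; linarith

/-- Arcs with the given values are little intervals in the circle. -/
def CircleValid (m : CircleCoord n) (v : Fin n → ℝ × ℝ) : Prop :=
  (∀ a, 0 < (v a).2 ∧ (v a).2 < 2 * Real.pi) ∧
    ∀ a b, a ≠ b → (v a).1 + (v a).2 ≤ ang m a b + (v b).1

lemma CircleValid.of_valid {m : CircleCoord n} {v : Fin n → ℝ × ℝ} (h : circleSystem.Valid m v) :
    CircleValid m v := by
  refine ⟨fun a => ⟨h.pos a, ?_⟩, h.sep⟩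
  have : 0 ≤ Real.pi + 0 * _ + -1 * _ := h.bound a 0
  linarith [Real.pi_pos]

lemma CircleValid.combine {m : CircleCoord n} {v w : Fin n → ℝ × ℝ} (hv : CircleValid m v)
    (hw : CircleValid m w) (t : unitInterval) :
    CircleValid m fun a => ((1 - (t : ℝ)) * (v a).1 + t * (w a).1,
      (1 - (t : ℝ)) * (v a).2 + t * (w a).2) := by
  have h0 := t.2.1
  have h1 := sub_nonneg.2 t.2.2
  refine ⟨fun a => ⟨?_, ?_⟩, fun a b hab => ?_⟩
  · rcases h0.eq_or_lt with h | h
    · simp only [← h]; linarith [(hv.1 a).1]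
    · have := mul_pos h (hw.1 a).1
      have := mul_nonneg h1 (hv.1 a).1.le
      simp only; linarith
  · rcases h0.eq_or_lt with h | h
    · simp only [← h]; linarith [(hv.1 a).2]
    · have := mul_lt_mul_of_pos_left (hw.1 a).2 h
      have := mul_le_mul_of_nonneg_left (hv.1 a).2.le h1
      simp only; linarith
  · have := mul_le_mul_of_nonneg_left (hv.2 a b hab) h1
    have := mul_le_mul_of_nonneg_left (hw.2 a b hab) h0
    simp only; linarith

lemma exp_ne_exp {x y : ℝ} (h1 : x < y) (h2 : y < x + 2 * Real.pi) : Circle.exp x ≠ Circle.exp y :=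
  fun h => h1.ne (Circle.exp_injOn_Ico (a := x) (b := x + 2 * Real.pi) (by linarith)
    ⟨le_rfl, by linarith⟩ ⟨h1.le, h2⟩ h)

lemma isLinearArc_arcMap (z : Circle) {x : ℝ × ℝ} (h0 : 0 < x.2) (h1 : x.2 < 2 * Real.pi) :
    IsLinearArc (arcMap z x) := by
  obtain ⟨r, rfl⟩ := Circle.exp_surjective z
  refine ⟨fun t t' htt => ?_, r + x.1, x.2, h0, fun t => ?_⟩
  · by_contra hne
    wlog hlt : t < t' generalizing t t'
    · exact this _ _ htt.symm (Ne.symm hne) (lt_of_le_of_ne (not_lt.1 hlt) (Ne.symm hne))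
    have hlt' : (t : ℝ) < t' := hlt
    have a1 := mul_lt_mul_of_pos_left hlt' h0
    have a2 := mul_le_mul_of_nonneg_left t'.2.2 h0.le
    have a3 := mul_nonneg h0.le t.2.1
    exact exp_ne_exp (x := x.1 + x.2 * t) (y := x.1 + x.2 * t') (by linarith) (by linarith)
      (mul_left_cancel htt)
  · change Circle.exp r * Circle.exp _ = _
    rw [← Circle.exp_add, add_assoc]

lemma CircleValid.ne {m : CircleCoord n} (hm : m ∈ cycloSet n) {v : Fin n → ℝ × ℝ}
    (h : CircleValid m v) {a b : Fin n} (hab : a ≠ b) {t t' : unitInterval}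
    (ht : t ∈ Ioo (0 : unitInterval) 1) (ht' : t' ∈ Ioo (0 : unitInterval) 1) :
    arcMap (m.1 a) (v a) t ≠ arcMap (m.1 b) (v b) t' := by
  change m.1 a * Circle.exp _ ≠ m.1 b * Circle.exp _
  rw [circle_eq_mul_exp_ang hm hab, mul_assoc, ← Circle.exp_add]
  refine fun e => exp_ne_exp ?_ ?_ (mul_left_cancel e)
  · have h1 := h.2 a b hab
    have h2 := mul_lt_mul_of_pos_left (show (t : ℝ) < 1 from ht.2) (h.1 a).1
    have h3 := mul_pos (h.1 b).1 (show (0 : ℝ) < t' from ht'.1)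
    linarith
  · have h1 := h.2 b a hab.symm
    have h2 := mul_lt_mul_of_pos_left (show (t' : ℝ) < 1 from ht'.2) (h.1 b).1
    have h3 := mul_pos (h.1 a).1 (show (0 : ℝ) < t from ht.1)
    have h4 := ang_add_ang hm hab
    linarith

lemma CircleValid.mem {m : CircleCoord n} (hm : m ∈ cycloSet n) {v : Fin n → ℝ × ℝ}
    (h : CircleValid m v) : (fun a => arcMap (m.1 a) (v a)) ∈ arcSet n := by
  refine ⟨fun a => isLinearArc_arcMap _ (h.1 a).1 (h.1 a).2, fun a b hab => ?_⟩
  rw [Set.disjoint_left]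
  rintro _ ⟨t, ht, rfl⟩ ⟨t', ht', e⟩
  exact h.ne hm hab ht ht' e.symm

end Values

/-! ### The centers of little intervals -/

section Centers

variable {n : ℕ} {X E : Type*} [TopologicalSpace X] [NormedAddCommGroup E]

lemma continuous_pairCoord [NormedSpace ℝ E] {z : X → Fin n → E} (hz : Continuous z)
    (h : ∀ x, Function.Injective (z x)) : Continuous fun x => pairCoord (z x) := by
  have hc : ∀ a, Continuous fun x => z x a := fun a => (continuous_apply a).comp hz
  refine continuous_pi fun a => continuous_pi fun b => ?_
  by_cases hab : a = b
  · subst hab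
    simp only [pairCoord, sub_self, smul_zero]
    exact continuous_const
  · exact (((hc b).sub (hc a)).norm.inv₀ fun x => norm_ne_zero_iff.2 (sub_ne_zero.2
      ((h x).ne (Ne.symm hab)))).smul ((hc b).sub (hc a))

lemma continuous_tripleCoord {z : X → Fin n → E} (hz : Continuous z)
    (h : ∀ x, Function.Injective (z x)) : Continuous fun x => tripleCoord (z x) := by
  have hc : ∀ a, Continuous fun x => z x a := fun a => (continuous_apply a).comp hz
  refine continuous_pi fun a => continuous_pi fun b => continuous_pi fun c => ?_
  by_cases hab : a = b
  · subst hab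
    simp only [tripleCoord_left]
    exact continuous_const
  · refine ((hc b).sub (hc a)).norm.div (((hc b).sub (hc a)).norm.add ((hc c).sub (hc b)).norm)
      fun x => (add_pos_of_pos_of_nonneg (norm_pos_iff.2 (sub_ne_zero.2
        ((h x).ne (Ne.symm hab)))) (norm_nonneg _)).ne'

lemma continuous_lineCoord {z : X → Fin n → ℝ} (hz : Continuous z)
    (h : ∀ x, Function.Injective (z x)) : Continuous fun x => lineCoord (z x) :=
  (continuous_pairCoord hz h).prodMk (continuous_tripleCoord hz h)

lemma continuous_circleCoord {z : X → Fin n → Circle} (hz : Continuous z)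
    (h : ∀ x, Function.Injective (z x)) : Continuous fun x => circleCoord (z x) := by
  have hc : Continuous fun x a => (z x a : ℂ) := by fun_prop
  exact hz.prodMk ((continuous_pairCoord hc fun x => circleCoe_injective (h x)).prodMk
    (continuous_tripleCoord hc fun x => circleCoe_injective (h x)))

lemma half_mem : half ∈ Ioo (0 : unitInterval) 1 := by
  constructor
  · change (0 : ℝ) < 1 / 2
    norm_num
  · change (1 / 2 : ℝ) < 1
    norm_num

lemma half_injective {Y : Type*} [TopologicalSpace Y] {c : Fin n → C(unitInterval, Y)}
    (hc : DisjointInteriors c) : Function.Injective fun a => c a half := by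
  intro a b hab
  by_contra hne
  exact Set.disjoint_left.1 (hc a b hne) ⟨half, half_mem, rfl⟩ ⟨half, half_mem, hab.symm⟩

lemma continuous_combine {t : X → ℝ} {f g : X → ℝ × ℝ} (ht : Continuous t) (hf : Continuous f)
    (hg : Continuous g) : Continuous fun x => ((1 - t x) * (f x).1 + t x * (g x).1,
      (1 - t x) * (f x).2 + t x * (g x).2) := by
  fun_prop

/-- The configuration of the centers of little intervals in the interval. -/
def lineCenters (hn : 0 < n) : C(intervalSet n, assocSet n) where
  toFun c := ⟨lineCoord fun a => (c.1 a half : ℝ), hn, subset_closure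
    ⟨_, Subtype.val_injective.comp (half_injective c.2.2), rfl⟩⟩
  continuous_toFun := (continuous_lineCoord
    (z := fun c : intervalSet n => fun a => (c.1 a half : ℝ))
    (continuous_pi fun a => continuous_subtype_val.comp ((continuous_eval_const half).comp
      ((continuous_apply a).comp continuous_subtype_val)))
    fun c => Subtype.val_injective.comp (half_injective c.2.2)).subtype_mk _

lemma Before.half_lt {f g : C(unitInterval, unitInterval)} (h : Before f g)
    (hf : IsLinearInterval f) (hg : IsLinearInterval g) : (f half : ℝ) < g half := by
  have h1 : (f 1 : ℝ) ≤ g 0 := h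
  have h2 := hf.isUnitValue.1
  have h3 := hg.isUnitValue.1
  have h4 : (half : ℝ) = 1 / 2 := rfl
  rw [hf.apply, hg.apply, h4]
  simp only [valueOf] at *
  linarith

lemma lineCoord_eq_one {x : Fin n → ℝ} {a b : Fin n} (h : (lineCoord x).1 a b = 1) : x a < x b := by
  by_contra hn
  rcases (not_lt.1 hn).eq_or_lt with e | e
  · simp [lineCoord, pairCoord, e] at h
  · have : (lineCoord x).1 a b = -1 := (pairCoord_line e).2
    linarith

lemma lineValid_centers (hn : 0 < n) (c : intervalSet n) :
    LineValid (lineCenters hn c).1 fun a => valueOf (c.1 a) := by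
  refine ⟨fun a => (c.2.1 a).isUnitValue, fun a b hab => ?_⟩
  rcases assoc_pair (lineCenters hn c).2 hab with ⟨h, -⟩ | ⟨h, -⟩
  · have hlt : (c.1 a half : ℝ) < c.1 b half := lineCoord_eq_one h
    rw [h]
    rcases before_or c.2 hab with h' | h'
    · have : (c.1 a 1 : ℝ) ≤ c.1 b 0 := h'
      simp only [valueOf]
      linarith
    · exact absurd hlt (h'.half_lt (c.2.1 b) (c.2.1 a)).not_gt
  · rw [h]
    have h1 := (c.2.1 a).isUnitValue.2.2
    have h2 := (c.2.1 b).isUnitValue.2.1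
    linarith

/-- The map from the associahedron to the little intervals with the given values. -/
def lineMap {v : LineCoord n → Fin n → ℝ × ℝ} (hc : ContinuousOn v (assocSet n))
    (hv : ∀ q ∈ assocSet n, LineValid q (v q)) : C(assocSet n, intervalSet n) where
  toFun q := ⟨fun a => intervalMap (v q.1 a), (hv q.1 q.2).mem q.2⟩
  continuous_toFun := (continuous_pi fun a => continuous_intervalMap.comp ((continuous_apply a).comp
    (hc.comp_continuous continuous_subtype_val fun q => q.2))).subtype_mk _

variable {v : LineCoord n → Fin n → ℝ × ℝ} (hc : ContinuousOn v (assocSet n))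
  (hv : ∀ q ∈ assocSet n, LineValid q (v q))

lemma linePattern_centers (hn : 0 < n) (q : assocSet n) :
    linePattern (lineCenters hn (lineMap hc hv q)).1 = linePattern q.1 := by
  have key : ∀ a b, a ≠ b → q.1.1 a b = 1 →
      (lineCenters hn (lineMap hc hv q)).1.1 a b = 1 ∧
        (lineCenters hn (lineMap hc hv q)).1.1 b a = -1 := fun a b hab h =>
    pairCoord_line (x := fun a => ((lineMap hc hv q).1 a half : ℝ))
      (((hv q.1 q.2).before hab h).half_lt ((lineMap hc hv q).2.1 a) ((lineMap hc hv q).2.1 b))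
  ext a b
  unfold linePattern
  by_cases hab : a = b
  · subst hab
    rw [(assoc_diag q.2 a).1, (assoc_diag (Subtype.prop _) a).1]
  · rcases assoc_pair q.2 hab with ⟨h, -⟩ | ⟨h, h'⟩
    · rw [h, (key a b hab h).1]
    · rw [h, (key b a (Ne.symm hab) h').2]

/-- Maps from the associahedron to the little intervals that preserve the order are homotopy
equivalences. The inverse is given by the centers: a family of intervals may be deformed linearly,
and the order of the points determines the component of the associahedron, which is contractible. -/
theorem lineCenters_homotopyInverse (hn : 0 < n) :
    ((lineCenters hn).comp (lineMap hc hv)).Homotopic (ContinuousMap.id _) ∧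
      ((lineMap hc hv).comp (lineCenters hn)).Homotopic (ContinuousMap.id _) := by
  constructor
  · obtain ⟨E, e, he, hid⟩ := exists_line_model hn
    have h : e.comp ((lineCenters hn).comp (lineMap hc hv)) = e := by
      ext1 q
      rw [ContinuousMap.comp_apply, he, he]
      exact congrArg E (linePattern_centers hc hv hn q)
    have h1 := hid.comp (ContinuousMap.Homotopic.refl ((lineCenters hn).comp (lineMap hc hv)))
    rw [h, ContinuousMap.id_comp] at h1
    exact h1.symm.trans hid
  · refine ⟨⟨⟨fun x => ⟨fun a => intervalMap
      ((1 - (x.1 : ℝ)) * (v (lineCenters hn x.2).1 a).1 + x.1 * (valueOf (x.2.1 a)).1,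
        (1 - (x.1 : ℝ)) * (v (lineCenters hn x.2).1 a).2 + x.1 * (valueOf (x.2.1 a)).2),
      ((hv _ (lineCenters hn x.2).2).combine (lineValid_centers hn x.2) x.1).mem
        (lineCenters hn x.2).2⟩, ?_⟩, fun c => ?_, fun c => ?_⟩⟩
    · refine (continuous_pi fun a => continuous_intervalMap.comp ?_).subtype_mk _
      have h1 : Continuous fun x : unitInterval × intervalSet n => v (lineCenters hn x.2).1 a :=
        (continuous_apply a).comp (hc.comp_continuous (continuous_subtype_val.comp
          ((lineCenters hn).continuous.comp continuous_snd)) fun x => (lineCenters hn x.2).2)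
      have h2 : Continuous fun x : unitInterval × intervalSet n => valueOf (x.2.1 a) :=
        continuous_valueOf.comp ((continuous_apply a).comp
          (continuous_subtype_val.comp continuous_snd))
      exact continuous_combine (by fun_prop) h1 h2
    · refine Subtype.ext (funext fun a => ?_)
      simp [lineMap]
    · refine Subtype.ext (funext fun a => ?_)
      simpa using intervalMap_valueOf (c.2.1 a)

end Centers

section ArcCenters

variable {n : ℕ}

/-- The length of a linear arc, computed from its center and its endpoint. -/
def arcLength (f : C(unitInterval, Circle)) : ℝ := 2 * Real.arccos ((f 1 / f half : Circle) : ℂ).re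

lemma continuous_arcLength : Continuous arcLength := by
  unfold arcLength
  have h : Continuous fun f : C(unitInterval, Circle) => ((f 1 / f half : Circle) : ℂ).re :=
    Complex.continuous_re.comp ((show Continuous fun z : Circle => (z : ℂ) by fun_prop).comp
      ((continuous_eval_const 1).div' (continuous_eval_const half)))
  exact continuous_const.mul (Real.continuous_arccos.comp h)

lemma IsLinearArc.spec {f : C(unitInterval, Circle)} (hf : IsLinearArc f) :
    0 < arcLength f ∧ arcLength f < 2 * Real.pi ∧
      arcMap (f half) (-(arcLength f / 2), arcLength f) = f := by
  obtain ⟨hi, a, s, hs, h⟩ := hf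
  have h2 := IsLinearArc.lt_two_pi hi hs h
  have e : arcLength f = s := by
    have e1 : f 1 / f half = Circle.exp (s / 2) := by
      rw [h, h, ← Circle.exp_sub]; congr 1; simp only [Icc.coe_one, half]; ring
    have e2 : ((Circle.exp (s / 2) : Circle) : ℂ).re = Real.cos (s / 2) := by
      rw [Circle.coe_exp, Complex.exp_ofReal_mul_I_re]
    rw [arcLength, e1, e2, Real.arccos_cos (by linarith) (by linarith)]
    ring
  rw [e]
  refine ⟨hs, h2, ContinuousMap.ext fun t => ?_⟩
  change f half * Circle.exp (-(s / 2) + s * t) = f t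
  rw [h, h, ← Circle.exp_add]
  congr 1
  simp only [half]
  ring

/-- The configuration of the centers of little intervals in the circle. -/
def circleCenters (n : ℕ) : C(arcSet n, cycloSet n) where
  toFun d := ⟨circleCoord fun a => d.1 a half, subset_closure ⟨_, half_injective d.2.2, rfl⟩⟩
  continuous_toFun := (continuous_circleCoord (z := fun d : arcSet n => fun a => d.1 a half)
    (continuous_pi fun a => (continuous_eval_const half).comp
      ((continuous_apply a).comp continuous_subtype_val))
    fun d => half_injective d.2.2).subtype_mk _

lemma circleValid_centers (d : arcSet n) :
    CircleValid (circleCenters n d).1 fun a => (-(arcLength (d.1 a) / 2), arcLength (d.1 a)) := by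
  refine ⟨fun a => ⟨(d.2.1 a).spec.1, (d.2.1 a).spec.2.1⟩, fun a b hab => ?_⟩
  obtain ⟨ha, -, ea⟩ := (d.2.1 a).spec
  obtain ⟨hb, -, eb⟩ := (d.2.1 b).spec
  have hne : d.1 a half ≠ d.1 b half := (half_injective d.2.2).ne hab
  have hpos : 0 < ang (circleCenters n d).1 a b := ang_circleCoord_pos hne
  have hexp : d.1 b half = d.1 a half * Circle.exp (ang (circleCenters n d).1 a b) :=
    circle_eq_mul_exp_ang (circleCenters n d).2 hab
  by_contra hlt
  simp only at hlt
  generalize ang (circleCenters n d).1 a b = θ at *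
  generalize arcLength (d.1 a) = s at *
  generalize arcLength (d.1 b) = r at *
  -- The point dividing the arc between the centers in the ratio `s : r` lies in both intervals.
  have h0 : 0 < θ / (s + r) := by positivity
  have h1 : θ / (s + r) < 1 / 2 := by rw [div_lt_iff₀ (by positivity)]; linarith
  refine Set.disjoint_left.1 (d.2.2 a b hab)
    ⟨⟨1 / 2 + θ / (s + r), by linarith, by linarith⟩, ⟨?_, ?_⟩, rfl⟩
    ⟨⟨1 / 2 - θ / (s + r), by linarith, by linarith⟩, ⟨?_, ?_⟩, ?_⟩
  · change (0 : ℝ) < 1 / 2 + θ / (s + r)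
    linarith
  · change 1 / 2 + θ / (s + r) < (1 : ℝ)
    linarith
  · change (0 : ℝ) < 1 / 2 - θ / (s + r)
    linarith
  · change 1 / 2 - θ / (s + r) < (1 : ℝ)
    linarith
  · rw [← ea, ← eb]
    change d.1 b half * Circle.exp (-(r / 2) + r * (1 / 2 - θ / (s + r))) =
      d.1 a half * Circle.exp (-(s / 2) + s * (1 / 2 + θ / (s + r)))
    rw [hexp, mul_assoc, ← Circle.exp_add]
    congr 2
    field_simp
    ring

/-- The map from the cyclohedron to the little intervals in the circle with the given values. -/
def circleMap {v : CircleCoord n → Fin n → ℝ × ℝ} (hc : ContinuousOn v (cycloSet n))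
    (hv : ∀ m ∈ cycloSet n, CircleValid m (v m)) : C(cycloSet n, arcSet n) where
  toFun m := ⟨fun a => arcMap (m.1.1 a) (v m.1 a), (hv m.1 m.2).mem m.2⟩
  continuous_toFun := (continuous_pi fun a => continuous_arcMap.comp
    (Continuous.prodMk (by fun_prop) ((continuous_apply a).comp
      (hc.comp_continuous continuous_subtype_val fun m => m.2)))).subtype_mk _

/-- The angle from the point of the configuration to the center of the interval at that point. -/
def centerAngle (v : Fin n → ℝ × ℝ) (a : Fin n) : ℝ := (v a).1 + (v a).2 * (half : ℝ)

/-- Passing to the centers of the intervals changes the angles between the points by the angles from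
the points to the centers, without any jump by a full turn. -/
lemma ang_centers {m : CircleCoord n} (hm : m ∈ cycloSet n) {v : Fin n → ℝ × ℝ}
    (hv : CircleValid m v) {a b : Fin n} (hab : a ≠ b) :
    ang (circleCoord fun a => m.1 a * Circle.exp (centerAngle v a)) a b =
      ang m a b + centerAngle v b - centerAngle v a := by
  have h1 := hv.2 a b hab
  have h2 := hv.2 b a (Ne.symm hab)
  have h3 := ang_add_ang hm hab
  have h4 := (hv.1 a).1
  have h5 := (hv.1 b).1
  have e : (half : ℝ) = 1 / 2 := rfl
  have hne : m.1 a * Circle.exp (centerAngle v a) ≠ m.1 b * Circle.exp (centerAngle v b) :=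
    hv.ne hm hab half_mem half_mem
  rw [ang_circleCoord (z := fun a => m.1 a * Circle.exp (centerAngle v a)) hne]
  refine Circle.exp_injOn_Ico (a := 0) (b := 2 * Real.pi) (by linarith)
    ⟨Circle.angleDiff_nonneg _ _, Circle.angleDiff_lt_two_pi _ _⟩ ⟨?_, ?_⟩ ?_
  · simp only [centerAngle, e]; linarith
  · simp only [centerAngle, e]; linarith
  · refine mul_right_cancel (b := m.1 a * Circle.exp (centerAngle v a)) ?_
    rw [Circle.exp_angleDiff_mul, circle_eq_mul_exp_ang hm hab, mul_left_comm, mul_assoc,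
      ← Circle.exp_add, ← Circle.exp_add]
    congr 2
    ring

lemma circlePattern_centers {m : CircleCoord (n + 1)} (hm : m ∈ cycloSet (n + 1))
    {v : Fin (n + 1) → ℝ × ℝ} (hv : CircleValid m v) :
    circlePattern (circleCoord fun a => m.1 a * Circle.exp (centerAngle v a)) =
      circlePattern m := by
  ext a b
  refine and_congr_right fun ha => and_congr_right fun hab => and_congr_right fun hb => ?_
  rw [ang_centers hm hv ha, ang_centers hm hv hab, ang_centers hm hv hb]
  constructor <;> intro h <;> linarith

variable {v : CircleCoord n → Fin n → ℝ × ℝ} (hc : ContinuousOn v (cycloSet n))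
  (hv : ∀ m ∈ cycloSet n, CircleValid m (v m))

/-- A family of arcs is deformed linearly, with fixed centers, into the family assigned to the
configuration of its centers. -/
lemma circleMap_centers_homotopic :
    ((circleMap hc hv).comp (circleCenters n)).Homotopic (ContinuousMap.id _) := by
  refine ⟨⟨⟨fun x => ⟨fun a => arcMap (x.2.1 a half)
    ((1 - (x.1 : ℝ)) * (v (circleCenters n x.2).1 a).1 + x.1 * -(arcLength (x.2.1 a) / 2),
      (1 - (x.1 : ℝ)) * (v (circleCenters n x.2).1 a).2 + x.1 * arcLength (x.2.1 a)),
    ((hv _ (circleCenters n x.2).2).combine (circleValid_centers x.2) x.1).mem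
      (circleCenters n x.2).2⟩, ?_⟩, fun d => ?_, fun d => ?_⟩⟩
  · have h0 (a : Fin n) : Continuous fun x : unitInterval × arcSet n => x.2.1 a :=
      (continuous_apply a).comp (continuous_subtype_val.comp continuous_snd)
    have h1 (a : Fin n) :
        Continuous fun x : unitInterval × arcSet n => v (circleCenters n x.2).1 a :=
      (continuous_apply a).comp (hc.comp_continuous (continuous_subtype_val.comp
        ((circleCenters n).continuous.comp continuous_snd)) fun x => (circleCenters n x.2).2)
    have h2 (a : Fin n) : Continuous fun x : unitInterval × arcSet n =>
        (-(arcLength (x.2.1 a) / 2), arcLength (x.2.1 a)) :=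
      ((continuous_arcLength.comp (h0 a)).div_const 2).neg.prodMk (continuous_arcLength.comp (h0 a))
    exact (continuous_pi fun a => continuous_arcMap.comp
      (((continuous_eval_const half).comp (h0 a)).prodMk
        (continuous_combine (by fun_prop) (h1 a) (h2 a)))).subtype_mk _
  · refine Subtype.ext (funext fun a => ?_)
    simp [circleMap, circleCenters, circleCoord]
  · refine Subtype.ext (funext fun a => ?_)
    simpa using (d.2.1 a).spec.2.2

/-- The centers of the arcs assigned to a configuration have the same cyclic order, and the base
point is moved continuously. So the claim follows from the homotopy type of the cyclohedron. -/
lemma centers_circleMap_homotopic :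
    ((circleCenters n).comp (circleMap hc hv)).Homotopic (ContinuousMap.id _) := by
  rcases n with - | n
  · have : Subsingleton (cycloSet 0) := ⟨fun x y => Subtype.ext (Prod.ext (funext fun a => a.elim0)
      (Prod.ext (funext fun a => a.elim0) (funext fun a => a.elim0)))⟩
    rw [Subsingleton.elim ((circleCenters 0).comp (circleMap hc hv)) (ContinuousMap.id _)]
  · obtain ⟨E, e, he, hid⟩ := exists_circle_model n
    have h : (e.comp ((circleCenters (n + 1)).comp (circleMap hc hv))).Homotopic e := by
      have hT : IsLocallyConstant fun x : unitInterval × cycloSet (n + 1) => circlePattern x.2.1 :=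
        isLocallyConstant_circlePattern.comp_continuous continuous_snd
      have hv0 : Continuous fun x : unitInterval × cycloSet (n + 1) => v x.2.1 0 :=
        (continuous_apply 0).comp (hc.comp_continuous (continuous_subtype_val.comp continuous_snd)
          fun x => x.2.2)
      -- The base point moves back from the center of its interval to its position in `m`.
      refine ⟨⟨⟨fun x => E (circlePattern x.2.1) (x.2.1.1 0 *
        Circle.exp ((1 - (x.1 : ℝ)) * centerAngle (v x.2.1) 0)),
        continuous_of_isLocallyConstant hT (F := fun i x => E i (x.2.1.1 0 *
          Circle.exp ((1 - (x.1 : ℝ)) * centerAngle (v x.2.1) 0))) fun i => ?_⟩,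
        fun m => ?_, fun m => ?_⟩⟩
      · unfold centerAngle
        have h0 : Continuous fun x : unitInterval × cycloSet (n + 1) => x.2.1.1 0 := by fun_prop
        exact (E i).continuous.comp (h0.mul (Circle.exp.continuous.comp
          ((continuous_const.sub (continuous_subtype_val.comp continuous_fst)).mul
            (hv0.fst.add (hv0.snd.mul continuous_const)))))
      · change _ = e (circleCenters (n + 1) (circleMap hc hv m))
        rw [he]
        have h1 : circlePattern (circleCenters (n + 1) (circleMap hc hv m)).1 =
          circlePattern m.1 := circlePattern_centers m.2 (hv m.1 m.2)
        rw [h1]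
        simp only [Icc.coe_zero, sub_zero, one_mul]
        rfl
      · simp [he]
    have h1 := hid.comp (ContinuousMap.Homotopic.refl
      ((circleCenters (n + 1)).comp (circleMap hc hv)))
    rw [ContinuousMap.id_comp] at h1
    exact h1.symm.trans (h.trans hid)

end ArcCenters

section Homs

variable {R : ∀ n, LineCoord n → Fin n → ℝ × ℝ} {L : ∀ n, CircleCoord n → Fin n → ℝ × ℝ}

/-- The homomorphism of operads given by a family of values. -/
def lineHom (hR : ∀ n, lineSystem.GoodAt R R n) (hR1 : ∀ p ∈ assocSet 1, ∀ a, R 1 p a = (0, 1)) :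
    OperadHom associahedra littleIntervals where
  map {n} := lineMap (hR n).continuousOn fun q hq => (lineValid_iff q _).2 ((hR n).valid q hq)
  continuous_map n := ContinuousMap.continuous _
  map_act {n} q σ := Subtype.ext (funext fun a =>
    congrArg intervalMap ((hR n).perm q.1 q.2 σ a))
  map_unit := Subtype.ext (funext fun a =>
    (congrArg intervalMap (hR1 _ associahedra.unit.2 a)).trans intervalMap_unit)
  map_comp {k l n} i h p q := by
    refine Subtype.ext (funext fun j => ?_)
    refine (congrArg intervalMap ((hR n).comp i h p.1 p.2 q.1 q.2 j)).trans ?_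
    change _ = insMaps i h _ _ j
    unfold insMaps
    split_ifs with hb
    · exact intervalMap_vmul (((lineValid_iff p.1 _).2 ((hR k).valid p.1 p.2)).1 i)
        (((lineValid_iff q.1 _).2 ((hR l).valid q.1 q.2)).1 (sub hb))
    · rfl

/-- The homomorphism of right modules given by a family of values. -/
def circleHom (ρ : OperadHom associahedra littleIntervals)
    (hρ : ∀ n (q : assocSet n) a, R n q.1 a = valueOf ((ρ.map (n := n) q).1 a))
    (hL : ∀ n, circleSystem.GoodAt L R n) :
    ModuleHom ρ cyclohedra circleIntervals where
  map {n} := circleMap (hL n).continuousOn fun m hm => CircleValid.of_valid ((hL n).valid m hm)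
  continuous_map n := ContinuousMap.continuous _
  map_act {n} m σ := Subtype.ext (funext fun a =>
    congrArg (arcMap _) ((hL n).perm m.1 m.2 σ a))
  map_comp {k l n} i h m p := by
    refine Subtype.ext (funext fun j => ?_)
    refine (congrArg (arcMap _) ((hL n).comp i h m.1 m.2 p.1 p.2 j)).trans ?_
    change arcMap (m.1.1 (outer i h j)) _ = insMaps i h _ _ j
    unfold insMaps
    split_ifs with hb
    · have hlin := (ρ.map (n := l) p).2.1 (sub hb)
      rw [hρ l p, arcMap_vmul _ _ hlin.isUnitValue, intervalMap_valueOf hlin,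
        (outer_eq_iff i h j).2 hb]
      rfl
    · rfl

end Homs

/-! ### Homomorphisms into the little intervals operad and the order of the inputs -/

section Order

variable {n : ℕ}

lemma mem_lineSorted {q : LineCoord n} (hq : q ∈ assocSet n) (h : ∀ a b, a < b → q.1 a b = 1) :
    q ∈ lineSorted n := by
  have hUo : IsOpen {q : LineCoord n | ∀ a b, a < b → 0 < q.1 a b} := by
    simp only [ofPred_forall]
    exact isOpen_iInter_of_finite fun a => isOpen_iInter_of_finite fun b =>
      isOpen_iInter_of_finite fun _ => isOpen_lt (by fun_prop) (by fun_prop)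
  refine closure_mono ?_ (hUo.inter_closure
    ⟨fun a b hab => by rw [h a b hab]; exact one_pos, hq.2⟩)
  rintro _ ⟨hxU, x, -, rfl⟩
  refine ⟨x, fun a b hab => lineCoord_eq_one ?_, rfl⟩
  have h1 := hxU a b hab
  by_contra hne
  rcases lt_trichotomy (x a) (x b) with h2 | h2 | h2
  · exact hne (pairCoord_line h2).1
  · simp [lineCoord, pairCoord, h2] at h1
  · have h3 : (lineCoord x).1 a b = -1 := (pairCoord_line h2).2
    linarith

lemma isPreconnected_lineSorted (n : ℕ) : IsPreconnected (lineSorted n) := by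
  refine IsPreconnected.closure (IsPreconnected.image ?_ _ ?_)
  · refine Convex.isPreconnected fun x hx y hy s t hs ht hst a b hab => ?_
    have h1 := hx hab
    have h2 := hy hab
    change s * x a + t * y a < s * x b + t * y b
    rcases hs.eq_or_lt with h | h
    · subst h
      have : t = 1 := by linarith
      subst this
      linarith
    · have h3 := mul_lt_mul_of_pos_left h1 h
      have h4 := mul_le_mul_of_nonneg_left h2.le ht
      linarith
  · rw [continuousOn_iff_continuous_domRestrict]
    exact continuous_lineCoord (z := fun x : {x : Fin n → ℝ | StrictMono x} => x.1)
      continuous_subtype_val fun x => StrictMono.injective x.2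

/-- The generator of arity two of the operad of associahedra. -/
def lineMul : assocSet 2 := ⟨lineCoord ![0, 1], two_pos, subset_closure
  ⟨![0, 1], fun a b h => by fin_cases a <;> fin_cases b <;> simp_all, rfl⟩⟩

lemma lineMul_zero_one : lineMul.1.1 0 1 = 1 :=
  (pairCoord_line (x := ![(0 : ℝ), 1]) (by simp)).1

/-- The little intervals in the image of `ρ` have the same order as the points on the line. -/
def OrderPreserving (ρ : OperadHom associahedra littleIntervals) : Prop :=
  ∀ (n : ℕ) (q : assocSet n) (a b : Fin n), q.1.1 a b = 1 →
    Before ((ρ.map (n := n) q).1 a) ((ρ.map (n := n) q).1 b)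

variable {ρ : OperadHom associahedra littleIntervals}

lemma isClosed_before (a b : Fin n) : IsClosed {c : intervalSet n | Before (c.1 a) (c.1 b)} :=
  isClosed_le ((continuous_eval_const 1).comp ((continuous_apply a).comp continuous_subtype_val))
    ((continuous_eval_const 0).comp ((continuous_apply b).comp continuous_subtype_val))

/-- Iterated compositions of the operation of arity two represent the component of the associahedron
with the natural order of the labels. -/
lemma exists_before (h : Before ((ρ.map (n := 2) lineMul).1 0) ((ρ.map (n := 2) lineMul).1 1))
    (hn : 0 < n) : ∃ q : assocSet n, ∀ a b, a < b → q.1.1 a b = 1 ∧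
      Before ((ρ.map (n := n) q).1 a) ((ρ.map (n := n) q).1 b) := by
  induction n, hn using Nat.le_induction with
  | base => exact ⟨associahedra.unit, fun a b hab => absurd hab (by omega)⟩
  | succ n hn ih =>
    obtain ⟨q, hq⟩ := ih
    have e : n + 1 + 1 = 2 + n := by omega
    obtain ⟨r, hr1, hr2⟩ : ∃ r : assocSet (n + 1), r.1.1 = ins2 (0 : Fin 2) e lineMul.1.1 q.1.1 ∧
        (ρ.map (n := n + 1) r).1 =
          insMaps (0 : Fin 2) e (ρ.map (n := 2) lineMul).1 (ρ.map (n := n) q).1 :=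
      ⟨associahedra.comp (k := 2) (l := n) 0 e lineMul q, rfl,
        congrArg Subtype.val (ρ.map_comp (k := 2) (l := n) 0 e lineMul q)⟩
    refine ⟨r, fun a b hab => ?_⟩
    rw [hr1, hr2]
    rw [Fin.lt_def] at hab
    have ha : InBlock ((0 : Fin 2) : ℕ) n a := ⟨Nat.zero_le _, by simp; omega⟩
    have ea : outer (0 : Fin 2) e a = 0 := (outer_eq_iff _ e a).2 ha
    by_cases hb : InBlock ((0 : Fin 2) : ℕ) n b
    · have hlt : sub ha < sub hb := by
        rw [Fin.lt_def]
        simp only [sub]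
        simpa using hab
      obtain ⟨h1, h2⟩ := hq _ _ hlt
      simp only [ins2, insMaps, dif_pos ha, dif_pos hb]
      rw [dif_pos ⟨ha, hb⟩]
      exact ⟨h1, ((ρ.map (n := 2) lineMul).2.1 0).monotone h2⟩
    · have eb : outer (0 : Fin 2) e b = 1 := by
        have hne : outer (0 : Fin 2) e b ≠ 0 := fun h => hb ((outer_eq_iff _ e b).1 h)
        omega
      simp only [ins2, insMaps, dif_pos ha, dif_neg hb, eb, ea]
      rw [dif_neg fun h => hb h.2]
      exact ⟨lineMul_zero_one, ((ρ.map (n := 2) lineMul).2.1 0).monotone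
        unitInterval.le_one' |>.trans h⟩

/-- The order of the intervals is determined in arity two, since the associahedron with a given
order of the labels is connected. -/
theorem orderPreserving_of_before
    (h : Before ((ρ.map (n := 2) lineMul).1 0) ((ρ.map (n := 2) lineMul).1 1)) :
    OrderPreserving ρ := by
  have sorted : ∀ (n : ℕ) (q : assocSet n), q.1 ∈ lineSorted n → ∀ a b : Fin n, a < b →
      Before ((ρ.map (n := n) q).1 a) ((ρ.map (n := n) q).1 b) := by
    intro n q hq a b hab
    have hn : 0 < n := q.2.1
    obtain ⟨q₀, hq₀⟩ := exists_before h hn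
    have : PreconnectedSpace (lineSorted n) :=
      Subtype.preconnectedSpace (isPreconnected_lineSorted n)
    let g : lineSorted n → intervalSet n := fun p => ρ.map (n := n) ⟨p.1, lineSorted_subset hn p.2⟩
    have hg : Continuous g := (ρ.continuous_map n).comp (continuous_subtype_val.subtype_mk _)
    -- one of two little intervals lies on the left of the other one, so the condition and its
    -- negation are both closed
    have hclopen : IsClopen {p | Before ((g p).1 a) ((g p).1 b)} := by
      refine ⟨(isClosed_before a b).preimage hg, ?_⟩
      rw [← isClosed_compl_iff]
      have : {p | Before ((g p).1 a) ((g p).1 b)}ᶜ = {p | Before ((g p).1 b) ((g p).1 a)} := by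
        ext p
        exact ⟨fun hp => (before_or (g p).2 hab.ne).resolve_left hp,
          fun hp => hp.not ((g p).2.1 b) ((g p).2.1 a)⟩
      rw [this]
      exact (isClosed_before b a).preimage hg
    have huniv := hclopen.eq_univ
      ⟨⟨q₀.1, mem_lineSorted q₀.2 fun a b hab => (hq₀ a b hab).1⟩, (hq₀ a b hab).2⟩
    have hmem : (⟨q.1, hq⟩ : lineSorted n) ∈ {p | Before ((g p).1 a) ((g p).1 b)} :=
      huniv ▸ mem_univ _
    exact hmem
  intro n q a b hab
  -- in general, the labels are sorted by a permutation
  obtain ⟨σ, hσ⟩ := exists_perm_lineSorted q.2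
  have hs := hσ q.1 q.2 rfl
  have hact := ρ.map_act (n := n) q σ
  obtain ⟨a, rfl⟩ := σ.surjective a
  obtain ⟨b, rfl⟩ := σ.surjective b
  rcases lt_trichotomy a b with hlt | rfl | hlt
  · have := sorted n (associahedra.act (n := n) q σ) hs a b hlt
    rw [hact] at this
    exact this
  · rw [(assoc_diag q.2 _).1] at hab
    norm_num at hab
  · have h1 : q.1.1 (σ a) (σ b) = -1 := (lineSorted_pair hs hlt).2
    rw [h1] at hab
    norm_num at hab

end Order

section Values

variable (ρ : OperadHom associahedra littleIntervals)

/-- The values that describe the little intervals in the image of an operad homomorphism. -/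
def homValue (n : ℕ) (q : LineCoord n) (a : Fin n) : ℝ × ℝ :=
  open Classical in if h : q ∈ assocSet n then valueOf ((ρ.map (n := n) ⟨q, h⟩).1 a) else (0, 1)

variable {ρ}

lemma homValue_of_mem {n : ℕ} (q : assocSet n) (a : Fin n) :
    homValue ρ n q.1 a = valueOf ((ρ.map (n := n) q).1 a) := dif_pos q.2

lemma homValue_one {p : LineCoord 1} (hp : p ∈ assocSet 1) (a : Fin 1) :
    homValue ρ 1 p a = (0, 1) := by
  have key : ∀ q ∈ assocSet 1, ∀ q' ∈ assocSet 1, q = q' := fun q hq q' hq' =>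
    Prod.ext (funext fun a => funext fun b => by
      rw [Subsingleton.elim b a, (assoc_diag hq a).1, (assoc_diag hq' a).1])
      (funext fun a => funext fun b => funext fun c => by
        rw [Subsingleton.elim b a, Subsingleton.elim c a, (assoc_diag hq a).2,
          (assoc_diag hq' a).2])
  obtain rfl := key p hp _ (Subtype.prop (associahedra.unit : assocSet 1))
  have h : valueOf ((ρ.map (n := 1) associahedra.unit).1 a) = valueOf (ContinuousMap.id _) :=
    congrArg (fun c : intervalSet 1 => valueOf (c.1 a)) ρ.map_unit
  exact (homValue_of_mem (associahedra.unit : assocSet 1) a).trans (h.trans valueOf_id)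

lemma continuousOn_homValue (n : ℕ) : ContinuousOn (homValue ρ n) (assocSet n) := by
  rw [continuousOn_iff_continuous_domRestrict]
  have h : (assocSet n).domRestrict (homValue ρ n) =
      fun q a => valueOf ((ρ.map (n := n) q).1 a) := funext fun q => funext (homValue_of_mem q)
  exact h ▸ continuous_pi fun a => continuous_valueOf.comp ((continuous_apply a).comp
    (continuous_subtype_val.comp (ρ.continuous_map n)))

lemma OrderPreserving.lineValid (hρ : OrderPreserving ρ) {n : ℕ} (q : assocSet n) :
    LineValid q.1 (homValue ρ n q.1) := by
  rw [show homValue ρ n q.1 = fun a => valueOf ((ρ.map (n := n) q).1 a) from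
    funext (homValue_of_mem q)]
  have hc := (ρ.map (n := n) q).2.1
  refine ⟨fun a => (hc a).isUnitValue, fun a b hab => ?_⟩
  rcases assoc_pair q.2 hab with ⟨h, -⟩ | ⟨h, -⟩
  · have h1 : (((ρ.map (n := n) q).1 a 1 : unitInterval) : ℝ) ≤ (ρ.map (n := n) q).1 b 0 :=
      hρ n q a b h
    rw [h]
    simp only [valueOf]
    linarith
  · rw [h]
    have h1 := (hc a).isUnitValue.2.2
    have h2 := (hc b).isUnitValue.2.1
    linarith

lemma OrderPreserving.goodAt (hρ : OrderPreserving ρ) (n : ℕ) :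
    lineSystem.GoodAt (homValue ρ) (homValue ρ) n where
  continuousOn := continuousOn_homValue n
  valid q hq := (lineValid_iff q _).1 (hρ.lineValid ⟨q, hq⟩)
  perm q hq σ a := by
    have h := congrArg (fun c : intervalSet n => valueOf (c.1 a)) (ρ.map_act (n := n) ⟨q, hq⟩ σ)
    exact (homValue_of_mem (associahedra.act (n := n) ⟨q, hq⟩ σ) a).trans
      (h.trans (homValue_of_mem ⟨q, hq⟩ (σ a)).symm)
  comp {k l} i h p hp q hq j := by
    have h1 := congrArg (fun c : intervalSet n => valueOf (c.1 j))
      (ρ.map_comp (k := k) (l := l) i h ⟨p, hp⟩ ⟨q, hq⟩)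
    refine (homValue_of_mem (associahedra.comp (k := k) (l := l) i h ⟨p, hp⟩ ⟨q, hq⟩) j).trans
      (h1.trans ?_)
    change valueOf (insMaps i h _ _ j) = _
    unfold insMaps
    split_ifs with hb
    · rw [valueOf_comp ((ρ.map (n := k) ⟨p, hp⟩).2.1 i)]
      exact congrArg₂ vmul (homValue_of_mem ⟨p, hp⟩ i).symm (homValue_of_mem ⟨q, hq⟩ _).symm
    · exact (homValue_of_mem ⟨p, hp⟩ _).symm

end Values

/-! ### Reversing the orientation -/

section Reverse

variable {n : ℕ}

/-- The reflection of the unit interval. -/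
def flip : C(unitInterval, unitInterval) := ⟨unitInterval.symm, unitInterval.continuous_symm⟩

/-- The reflection of the circle. -/
def circleFlip : C(Circle, Circle) := ⟨fun z => z⁻¹, continuous_inv⟩

lemma flip_flip : flip.comp flip = ContinuousMap.id _ :=
  ContinuousMap.ext fun t => unitInterval.symm_symm t

lemma comp_flip_flip {Y : Type*} [TopologicalSpace Y] (f : C(unitInterval, Y)) :
    (f.comp flip).comp flip = f := by
  rw [ContinuousMap.comp_assoc, flip_flip, ContinuousMap.comp_id]

lemma continuous_comp_flip {Y : Type*} [TopologicalSpace Y] (g : C(Y, Y)) :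
    Continuous fun (c : Fin n → C(unitInterval, Y)) (a : Fin n) => (g.comp (c a)).comp flip :=
  continuous_pi fun a => ((ContinuousMap.continuous_precomp flip).comp
    (ContinuousMap.continuous_postcomp g)).comp (continuous_apply a)

lemma flip_image_Ioo : flip '' Ioo 0 1 = Ioo 0 1 := by
  have h : flip '' Ioo 0 1 ⊆ Ioo 0 1 := by
    rintro _ ⟨t, ⟨h0, h1⟩, rfl⟩
    exact ⟨unitInterval.pos_iff_ne_zero.2 fun h => h1.ne (by
      simpa [flip] using congrArg unitInterval.symm h), unitInterval.lt_one_iff_ne_one.2 fun h =>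
      h0.ne' (by simpa [flip] using congrArg unitInterval.symm h)⟩
  exact h.antisymm fun t ht => ⟨flip t, h ⟨t, ht, rfl⟩, unitInterval.symm_symm t⟩

lemma DisjointInteriors.flip {Y : Type*} [TopologicalSpace Y] {c : Fin n → C(unitInterval, Y)}
    (hc : DisjointInteriors c) {g : C(Y, Y)} (hg : Function.Injective g) :
    DisjointInteriors fun a => (g.comp (c a)).comp flip := by
  intro a b hab
  simp only [ContinuousMap.coe_comp, image_comp, flip_image_Ioo]
  exact (disjoint_image_iff hg).2 (hc a b hab)

lemma IsLinearInterval.flip {f : C(unitInterval, unitInterval)} (hf : IsLinearInterval f) :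
    IsLinearInterval ((CycloLoop.flip.comp f).comp CycloLoop.flip) := by
  obtain ⟨a, s, hs, h⟩ := hf
  refine ⟨1 - (a + s), s, hs, fun t => ?_⟩
  change 1 - (f (unitInterval.symm t) : ℝ) = _
  rw [h, unitInterval.coe_symm_eq]
  ring

lemma IsLinearArc.flip {f : C(unitInterval, Circle)} (hf : IsLinearArc f) :
    IsLinearArc ((circleFlip.comp f).comp CycloLoop.flip) := by
  obtain ⟨hi, a, s, hs, h⟩ := hf
  refine ⟨inv_injective.comp (hi.comp unitInterval.symm_involutive.injective), -(a + s), s, hs,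
    fun t => ?_⟩
  change (f (unitInterval.symm t))⁻¹ = _
  rw [h, ← Circle.exp_neg, unitInterval.coe_symm_eq]
  congr 1
  ring

/-- The composition of a homomorphism into the little intervals operad with the reflection. -/
def OperadHom.flip (ρ : OperadHom associahedra littleIntervals) :
    OperadHom associahedra littleIntervals where
  map {n} p := ⟨fun a => (CycloLoop.flip.comp ((ρ.map (n := n) p).1 a)).comp CycloLoop.flip,
    fun a => ((ρ.map (n := n) p).2.1 a).flip,
    (ρ.map (n := n) p).2.2.flip unitInterval.symm_involutive.injective⟩
  continuous_map n := ((continuous_comp_flip CycloLoop.flip).comp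
    (continuous_subtype_val.comp (ρ.continuous_map n))).subtype_mk _
  map_act {n} p σ := by
    refine Subtype.ext (funext fun a => ?_)
    simp only [ρ.map_act]
    rfl
  map_unit := by
    refine Subtype.ext (funext fun a => ?_)
    simp only [ρ.map_unit]
    change (CycloLoop.flip.comp (ContinuousMap.id _)).comp CycloLoop.flip = ContinuousMap.id _
    rw [ContinuousMap.comp_id, flip_flip]
  map_comp {k l n} i h p q := by
    refine Subtype.ext (funext fun j => ?_)
    simp only [ρ.map_comp]
    change (CycloLoop.flip.comp (insMaps i h _ _ j)).comp CycloLoop.flip = insMaps i h _ _ j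
    unfold insMaps
    split_ifs with hb
    · simp only [← ContinuousMap.comp_assoc, comp_flip_flip]
    · rfl

/-- The involution of the space of little intervals in the circle induced by the reflections of the
circle and of the interval. -/
def arcFlip (n : ℕ) : C(arcSet n, arcSet n) where
  toFun d := ⟨fun a => (circleFlip.comp (d.1 a)).comp flip, fun a => (d.2.1 a).flip,
    d.2.2.flip inv_injective⟩
  continuous_toFun := ((continuous_comp_flip circleFlip).comp continuous_subtype_val).subtype_mk _

lemma arcFlip_arcFlip (n : ℕ) : (arcFlip n).comp (arcFlip n) = ContinuousMap.id _ := by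
  ext d a t
  simp [arcFlip, circleFlip, flip]

/-- A homomorphism of modules over the reflected homomorphism of operads, composed with the
reflection. -/
def ModuleHom.flip {ρ : OperadHom associahedra littleIntervals}
    (lam : ModuleHom ρ.flip cyclohedra circleIntervals) :
    ModuleHom ρ cyclohedra circleIntervals where
  map {n} m := arcFlip n (lam.map m)
  continuous_map n := (arcFlip n).continuous.comp (lam.continuous_map n)
  map_act {n} m σ := by
    simp only [lam.map_act]
    rfl
  map_comp {k l n} i h m p := by
    refine Subtype.ext (funext fun j => ?_)
    simp only [lam.map_comp]
    change (circleFlip.comp (insMaps i h _ _ j)).comp CycloLoop.flip = insMaps i h _ _ j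
    unfold insMaps
    split_ifs with hb
    · change (circleFlip.comp (((lam.map m).1 i).comp ((CycloLoop.flip.comp
        ((ρ.map (n := l) p).1 (sub hb))).comp CycloLoop.flip))).comp CycloLoop.flip =
          ((circleFlip.comp ((lam.map m).1 i)).comp CycloLoop.flip).comp
            ((ρ.map (n := l) p).1 (sub hb))
      simp only [← ContinuousMap.comp_assoc, comp_flip_flip]
    · rfl

end Reverse

/-! ### The homotopy equivalences -/

lemma isWeakHomotopyEquiv_lineHom {R : ∀ n, LineCoord n → Fin n → ℝ × ℝ}
    (hR : ∀ n, lineSystem.GoodAt R R n) (hR1 : ∀ p ∈ assocSet 1, ∀ a, R 1 p a = (0, 1)) {n : ℕ}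
    (hn : 1 ≤ n) : IsWeakHomotopyEquiv
      ((lineHom hR hR1).map : associahedra.obj n → littleIntervals.obj n) :=
  isWeakHomotopyEquiv_of_homotopic
    (lineMap (hR n).continuousOn fun q hq => (lineValid_iff q _).2 ((hR n).valid q hq))
    (lineCenters hn) (lineCenters_homotopyInverse _ _ hn).1 (lineCenters_homotopyInverse _ _ hn).2

lemma OrderPreserving.exists_moduleHom {ρ : OperadHom associahedra littleIntervals}
    (hρ : OrderPreserving ρ) : ∃ lam : ModuleHom ρ cyclohedra circleIntervals,
      ∀ n, ∃ (f : C(cycloSet n, arcSet n)) (g : C(arcSet n, cycloSet n)),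
        (∀ m, f m = lam.map (n := n) m) ∧ (g.comp f).Homotopic (ContinuousMap.id _) ∧
          (f.comp g).Homotopic (ContinuousMap.id _) := by
  obtain ⟨L, hL⟩ := exists_circle_family hρ.goodAt fun p hp a => homValue_one hp a
  exact ⟨circleHom ρ (fun n q a => homValue_of_mem q a) hL, fun n =>
    ⟨circleMap (hL n).continuousOn fun m hm => CircleValid.of_valid ((hL n).valid m hm),
      circleCenters n, fun m => rfl, centers_circleMap_homotopic _ _,
      circleMap_centers_homotopic _ _⟩⟩

/-- Over every homomorphism from the associahedra to the little intervals there is a homomorphism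
from the cyclohedra to the little intervals in the circle that is a homotopy equivalence. -/
theorem exists_moduleHom (ρ : OperadHom associahedra littleIntervals) :
    ∃ lam : ModuleHom ρ cyclohedra circleIntervals, ∀ n,
      IsWeakHomotopyEquiv (lam.map : cyclohedra.obj n → circleIntervals.obj n) := by
  rcases before_or (ρ.map (n := 2) lineMul).2 (show (0 : Fin 2) ≠ 1 by decide) with h | h
  · obtain ⟨lam, hlam⟩ := (orderPreserving_of_before h).exists_moduleHom
    refine ⟨lam, fun n => ?_⟩
    obtain ⟨f, g, hf, h1, h2⟩ := hlam n
    have e : (lam.map : cyclohedra.obj n → circleIntervals.obj n) = f :=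
      funext fun m => (hf m).symm
    exact e ▸ isWeakHomotopyEquiv_of_homotopic f g h1 h2
  · have h' : Before ((ρ.flip.map (n := 2) lineMul).1 0) ((ρ.flip.map (n := 2) lineMul).1 1) := by
      have h1 : (ρ.map (n := 2) lineMul).1 1 1 ≤ (ρ.map (n := 2) lineMul).1 0 0 := h
      change unitInterval.symm ((ρ.map (n := 2) lineMul).1 0 (unitInterval.symm 1)) ≤
        unitInterval.symm ((ρ.map (n := 2) lineMul).1 1 (unitInterval.symm 0))
      rw [unitInterval.symm_one, unitInterval.symm_zero]
      exact unitInterval.symm_le_symm.2 h1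
    obtain ⟨lam, hlam⟩ := (orderPreserving_of_before h').exists_moduleHom
    refine ⟨lam.flip, fun n => ?_⟩
    obtain ⟨f, g, hf, h1, h2⟩ := hlam n
    have e : (lam.flip.map : cyclohedra.obj n → circleIntervals.obj n) = (arcFlip n).comp f :=
      funext fun m => congrArg (arcFlip n) (hf m).symm
    refine e ▸ isWeakHomotopyEquiv_of_homotopic ((arcFlip n).comp f) (g.comp (arcFlip n)) ?_ ?_
    · have : (g.comp (arcFlip n)).comp ((arcFlip n).comp f) = g.comp f := by
        rw [ContinuousMap.comp_assoc, ← ContinuousMap.comp_assoc (arcFlip n), arcFlip_arcFlip,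
          ContinuousMap.id_comp]
      rwa [this]
    · have h3 := ((ContinuousMap.Homotopic.refl (arcFlip n)).comp h2).comp
        (ContinuousMap.Homotopic.refl (arcFlip n))
      rw [ContinuousMap.comp_id, arcFlip_arcFlip] at h3
      exact h3

end CycloLoop

end

theorem mainTheorem2 :
    (∃ ρ : CycloLoop.OperadHom CycloLoop.associahedra CycloLoop.littleIntervals,
      ∀ n : ℕ, 1 ≤ n → CycloLoop.IsWeakHomotopyEquiv
        (ρ.map : CycloLoop.associahedra.obj n → CycloLoop.littleIntervals.obj n)) ∧
    ∀ ρ : CycloLoop.OperadHom CycloLoop.associahedra CycloLoop.littleIntervals,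
      (∀ n : ℕ, 1 ≤ n → CycloLoop.IsWeakHomotopyEquiv
        (ρ.map : CycloLoop.associahedra.obj n → CycloLoop.littleIntervals.obj n)) →
      ∃ lam : CycloLoop.ModuleHom ρ CycloLoop.cyclohedra CycloLoop.circleIntervals,
        (∀ n : ℕ, CycloLoop.IsWeakHomotopyEquiv
          (lam.map : CycloLoop.cyclohedra.obj n → CycloLoop.circleIntervals.obj n)) ∧
        ∀ (X : Type*) [TopologicalSpace X] (b : X),
          ∃ (A : CycloLoop.OperadAlgebra CycloLoop.littleIntervals (CycloLoop.BasedLoopSpace X b))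
            (T : CycloLoop.Trace CycloLoop.circleIntervals A (CycloLoop.FreeLoopSpace X))
            (S : CycloLoop.Trace CycloLoop.cyclohedra (A.restrict ρ) (CycloLoop.FreeLoopSpace X)),
            CycloLoop.IsClassicalAction A ∧ CycloLoop.IsLoopTrace T ∧
              ∀ (n : ℕ) (m : CycloLoop.cyclohedra.obj n)
                (φ : Fin n → CycloLoop.BasedLoopSpace X b), S.map m φ = T.map (lam.map m) φ := by
  obtain ⟨R, hR, hR1⟩ := CycloLoop.exists_line_family
  refine ⟨⟨CycloLoop.lineHom hR fun p _ a => hR1 p a, fun n hn =>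
    CycloLoop.isWeakHomotopyEquiv_lineHom hR _ hn⟩, fun ρ _ => ?_⟩
  obtain ⟨lam, hlam⟩ := CycloLoop.exists_moduleHom ρ
  exact ⟨lam, hlam, fun X _ b => ⟨CycloLoop.loopAlgebra X b, CycloLoop.loopTrace X b,
    (CycloLoop.loopTrace X b).restrict lam, CycloLoop.isClassicalAction_loopAlgebra X b,
    CycloLoop.isLoopTrace_loopTrace X b, fun _ _ _ => rfl⟩⟩
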